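/- Work over $\mathbb{C}$ and let $n\ge 0$. The Yangian $Y_n=Y(\mathfrak{gl}_n)$ is the associative algebra with generators $T_{i,j}^{(r)}$ ($1\le i,j\le n$, $r\ge 1$) subject to the RTT relation $$R^{[1,2]}(u-v)\,T^{[1,3]}(u)\,T^{[2,3]}(v)=T^{[2,3]}(v)\,T^{[1,3]}(u)\,R^{[1,2]}(u-v),\qquad R(u)=u-\sum_{i,j}e_{i,j}\otimes e_{j,i},$$ where $T(u)=(T_{i,j}(u))$ with $T_{i,j}(u)=\sum_{r\ge0}T_{i,j}^{(r)}u^{-r}$ and $T_{i,j}^{(0)}=\delta_{i,j}$. Let $\nu=(\nu_1,\dots,\nu_m)$ be a tuple of positive integers summing to $n$. Then there are unique $n\times n$ matrices over $Y_n[[u^{-1}]]$, partitioned into blocks of sizes $\nu_a\times\nu_b$, such that $T(u)=F(u)D(u)E(u)$, where $D(u)=\operatorname{diag}(D_1(u),\dots,D_m(u))$ is block diagonal, $E(u)$ is block upper triangular and $F(u)$ is block lower triangular, both with identity matrices as diagonal blocks. Moreover each $D_a(u)$ is invertible. Put $\widetilde D_a(u)=-D_a(u)^{-1}$, let $E_a(u)$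 be the block of $E(u)$ in position $(a,a+1)$ and $F_a(u)$ the block of $F(u)$ in position $(a+1,a)$, and denote the coefficient of $u^{-r}$ in the $(i,j)$-entry of these blocks by $D_{a;i,j}^{(r)},\widetilde D_{a;i,j}^{(r)},E_{a;i,j}^{(r)},F_{a;i,j}^{(r)}$. **Theorem A.** The algebra $Y_n$ is generated by the elements $D_{a;i,j}^{(r)},\widetilde D_{a;i,j}^{(r)}$ ($1\le a\le m$, $1\le i,j\le\nu_a$, $r\ge0$), $E_{a;i,j}^{(r)}$ ($1\le a<m$, $1\le i\le\nu_a$, $1\le j\le\nu_{a+1}$, $r\ge1$) and $F_{a;i,j}^{(r)}$ ($1\le a<m$, $1\le i\le\nu_{a+1}$, $1\le j\le\nu_a$, $r\ge1$) subject only to the relations \begin{align*} D_{a;i,j}^{(0)}&=\delta_{i,j},\\ \sum_{t=0}^{r}\sum_p D_{a;i,p}^{(t)}\widetilde D_{a;p,j}^{(r-t)}&=-\delta_{r,0}\delta_{i,j},\\ [D_{a;i,j}^{(r)},D_{b;h,k}^{(s)}]&=\delta_{a,b}\sum_{t=0}^{\min(r,s)-1}\left(D_{a;i,k}^{(r+s-1-t)}D_{a;h,j}^{(t)}-D_{a;i,k}^{(t)}D_{a;h,j}^{(r+s-1-t)}\right),\\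 [E_{a;i,j}^{(r)},F_{b;h,k}^{(s)}]&=\delta_{a,b}\sum_{t=0}^{r+s-1}\widetilde D_{a;i,k}^{(t)}D_{a+1;h,j}^{(r+s-1-t)},\\ [D_{a;i,j}^{(r)},E_{b;h,k}^{(s)}]&=\delta_{a,b}\delta_{h,j}\sum_{t=0}^{r-1}\sum_p D_{a;i,p}^{(t)}E_{a;p,k}^{(r+s-1-t)}-\delta_{a,b+1}\sum_{t=0}^{r-1}D_{b+1;i,k}^{(t)}E_{b;h,j}^{(r+s-1-t)},\\ [D_{a;i,j}^{(r)},F_{b;h,k}^{(s)}]&=\delta_{a,b+1}\sum_{t=0}^{r-1}F_{b;i,k}^{(r+s-1-t)}D_{b+1;h,j}^{(t)}-\delta_{a,b}\delta_{i,k}\sum_{t=0}^{r-1}\sum_p F_{a;h,p}^{(r+s-1-t)}D_{a;p,j}^{(t)},\\ [E_{a;i,j}^{(r)},E_{a;h,k}^{(s)}]&=\sum_{t=1}^{s-1}E_{a;i,k}^{(t)}E_{a;h,j}^{(r+s-1-t)}-\sum_{t=1}^{r-1}E_{a;i,k}^{(t)}E_{a;h,j}^{(r+s-1-t)},\\ [F_{a;i,j}^{(r)},F_{a;h,k}^{(s)}]&=\sum_{t=1}^{r-1}F_{a;i,k}^{(r+s-1-t)}F_{a;h,j}^{(t)}-\sum_{t=1}^{s-1}F_{a;i,k}^{(r+s-1-t)}F_{a;h,j}^{(t)},\\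 [E_{a;i,j}^{(r)},E_{a+1;h,k}^{(s+1)}]-[E_{a;i,j}^{(r+1)},E_{a+1;h,k}^{(s)}]&=-\delta_{h,j}\sum_q E_{a;i,q}^{(r)}E_{a+1;q,k}^{(s)},\\ [F_{a;i,j}^{(r+1)},F_{a+1;h,k}^{(s)}]-[F_{a;i,j}^{(r)},F_{a+1;h,k}^{(s+1)}]&=-\delta_{i,k}\sum_q F_{a+1;h,q}^{(s)}F_{a;q,j}^{(r)},\\ [E_{a;i,j}^{(r)},E_{b;h,k}^{(s)}]&=0\quad\text{if } b>a+1,\text{ or } b=a+1 \text{ and } h\ne j,\\ [F_{a;i,j}^{(r)},F_{b;h,k}^{(s)}]&=0\quad\text{if } b>a+1,\text{ or } b=a+1 \text{ and } i\ne k,\\ [E_{a;i,j}^{(r)},[E_{a;h,k}^{(s)},E_{b;f,g}^{(t)}]]+[E_{a;i,j}^{(s)},[E_{a;h,k}^{(r)},E_{b;f,g}^{(t)}]]&=0\quad\text{if } |a-b|=1,\\ [F_{a;i,j}^{(r)},[F_{a;h,k}^{(s)},F_{b;f,g}^{(t)}]]+[F_{a;i,j}^{(s)},[F_{a;h,k}^{(r)},F_{b;f,g}^{(t)}]]&=0\quad\text{if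 } |a-b|=1, \end{align*} for all admissible $a,b,f,g,h,i,j,k,r,s,t$, where $p$ is summed over $1,\dots,\nu_a$ and $q$ over $1,\dots,\nu_{a+1}$. If $n\ge1$ and $\nu=(n)$, then $D_1(u)=T(u)$, and the presentation is the RTT presentation: $Y_n$ is generated by the $T_{i,j}^{(r)}$ ($r\ge1$) subject only to $$[T_{i,j}^{(r)},T_{h,k}^{(s)}]=\sum_{t=0}^{\min(r,s)-1}\left(T_{i,k}^{(r+s-1-t)}T_{h,j}^{(t)}-T_{i,k}^{(t)}T_{h,j}^{(r+s-1-t)}\right)\qquad(r,s\ge0).$$ If $\nu=(1^n)$, write $D_i^{(r)}=D_{i;1,1}^{(r)}$, and similarly $\widetilde D_i^{(r)},E_i^{(r)},F_i^{(r)}$. Then the presentation is of Drinfeld type: $Y_n$ is generated by $D_i^{(r)},\widetilde D_i^{(r)}$ ($1\le i\le n$, $r\ge0$) and $E_i^{(r)},F_i^{(r)}$ ($1\le i<n$, $r\ge1$) subject only to \begin{align*} D_i^{(0)}&=1,\qquad \sum_{t=0}^{r}D_i^{(t)}\widetilde D_i^{(r-t)}=-\delta_{r,0},\qquad [D_i^{(r)},D_j^{(s)}]=0,\\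 [E_i^{(r)},F_j^{(s)}]&=\delta_{i,j}\sum_{t=0}^{r+s-1}\widetilde D_i^{(t)}D_{i+1}^{(r+s-1-t)},\\ [D_i^{(r)},E_j^{(s)}]&=(\delta_{i,j}-\delta_{i,j+1})\sum_{t=0}^{r-1}D_i^{(t)}E_j^{(r+s-1-t)},\\ [D_i^{(r)},F_j^{(s)}]&=(\delta_{i,j+1}-\delta_{i,j})\sum_{t=0}^{r-1}F_j^{(r+s-1-t)}D_i^{(t)},\\ [E_i^{(r)},E_i^{(s)}]&=\sum_{t=1}^{s-1}E_i^{(t)}E_i^{(r+s-1-t)}-\sum_{t=1}^{r-1}E_i^{(t)}E_i^{(r+s-1-t)},\\ [F_i^{(r)},F_i^{(s)}]&=\sum_{t=1}^{r-1}F_i^{(r+s-1-t)}F_i^{(t)}-\sum_{t=1}^{s-1}F_i^{(r+s-1-t)}F_i^{(t)},\\ [E_i^{(r)},E_{i+1}^{(s+1)}]-[E_i^{(r+1)},E_{i+1}^{(s)}]&=-E_i^{(r)}E_{i+1}^{(s)},\\ [F_i^{(r+1)},F_{i+1}^{(s)}]-[F_i^{(r)},F_{i+1}^{(s+1)}]&=-F_{i+1}^{(s)}F_i^{(r)},\\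 [E_i^{(r)},E_j^{(s)}]&=0,\qquad [F_i^{(r)},F_j^{(s)}]=0\quad\text{if }|i-j|>1,\\ [E_i^{(r)},[E_i^{(s)},E_j^{(t)}]]+[E_i^{(s)},[E_i^{(r)},E_j^{(t)}]]&=0\quad\text{if }|i-j|=1,\\ [F_i^{(r)},[F_i^{(s)},F_j^{(t)}]]+[F_i^{(s)},[F_i^{(r)},F_j^{(t)}]]&=0\quad\text{if }|i-j|=1. \end{align*} -/

import Mathlib

namespace ParabolicYangian

/-- The elements `x g` generate the `ℂ`-algebra `A` subject only to the relations `rel`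
(pairs of noncommutative polynomials in the generators): the algebra with generators `G` and
relations `rel` is isomorphic to `A` through the map that sends each generator `g` to `x g`. -/
def IsPresentation {G A : Type} [Ring A] [Algebra ℂ A] (x : G → A)
    (rel : FreeAlgebra ℂ G → FreeAlgebra ℂ G → Prop) : Prop :=
  ∃ e : RingQuot rel ≃ₐ[ℂ] A,
    ∀ g : G, e (RingQuot.mkAlgHom ℂ rel (FreeAlgebra.ι ℂ g)) = x g

/-! ### The Yangian of `gl_n` -/

/-- The generators `T_{i,j}^{(r)}` with `r ≥ 1`: `YangianGen.T i j r` stands for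
`T_{i,j}^{(r+1)}`. -/
inductive YangianGen (n : ℕ) : Type
  | T (i j : Fin n) (r : ℕ) : YangianGen n

/-- The matrix `T^{(r)}` with entries `T_{i,j}^{(r)}`, where `T_{i,j}^{(0)} = δ_{i,j}`,
in the free algebra. -/
noncomputable def freeT (n : ℕ) : ℕ → Matrix (Fin n) (Fin n) (FreeAlgebra ℂ (YangianGen n))
  | 0 => 1
  | r + 1 => Matrix.of fun i j => FreeAlgebra.ι ℂ (YangianGen.T i j r)

/-- `T ⊗ 1` on the tensor square: the matrix acts in the first tensor position. -/
def leg₁ {n : ℕ} {A : Type} [Ring A] (M : Matrix (Fin n) (Fin n) A) :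
    Matrix (Fin n × Fin n) (Fin n × Fin n) A :=
  Matrix.of fun x y => if x.2 = y.2 then M x.1 y.1 else 0

/-- `1 ⊗ T` on the tensor square: the matrix acts in the second tensor position. -/
def leg₂ {n : ℕ} {A : Type} [Ring A] (M : Matrix (Fin n) (Fin n) A) :
    Matrix (Fin n × Fin n) (Fin n × Fin n) A :=
  Matrix.of fun x y => if x.1 = y.1 then M x.2 y.2 else 0

/-- The matrix of `∑ e_{i,j} ⊗ e_{j,i}`. Yang's `R`-matrix is `R(u) = u - swapMatrix`. -/
def swapMatrix (n : ℕ) (A : Type) [Ring A] : Matrix (Fin n × Fin n) (Fin n × Fin n) A :=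
  ∑ i : Fin n, ∑ j : Fin n, Matrix.single (i, j) (j, i) 1

/-- The coefficient of `u^{-r} v^{-s}` in `R(u-v) T₁(u) T₂(v)`. -/
noncomputable def rttLeft (n r s : ℕ) :
    Matrix (Fin n × Fin n) (Fin n × Fin n) (FreeAlgebra ℂ (YangianGen n)) :=
  leg₁ (freeT n (r + 1)) * leg₂ (freeT n s) - leg₁ (freeT n r) * leg₂ (freeT n (s + 1))
    - swapMatrix n _ * (leg₁ (freeT n r) * leg₂ (freeT n s))

/-- The coefficient of `u^{-r} v^{-s}` in `T₂(v) T₁(u) R(u-v)`. -/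
noncomputable def rttRight (n r s : ℕ) :
    Matrix (Fin n × Fin n) (Fin n × Fin n) (FreeAlgebra ℂ (YangianGen n)) :=
  leg₂ (freeT n s) * leg₁ (freeT n (r + 1)) - leg₂ (freeT n (s + 1)) * leg₁ (freeT n r)
    - (leg₂ (freeT n s) * leg₁ (freeT n r)) * swapMatrix n _

/-- The RTT relation `R(u-v) T₁(u) T₂(v) = T₂(v) T₁(u) R(u-v)`, coefficient by coefficient and
entry by entry. (The coefficients of `u v^{-s}` and of `u^{-r} v` on the two sides agree
automatically because `T^{(0)} = 1`.) -/
inductive YangianRel (n : ℕ) :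
    FreeAlgebra ℂ (YangianGen n) → FreeAlgebra ℂ (YangianGen n) → Prop
  | rtt (r s : ℕ) (x y : Fin n × Fin n) : YangianRel n (rttLeft n r s x y) (rttRight n r s x y)

/-- The Yangian `Y_n = Y(gl_n)` over `ℂ`. -/
abbrev Yangian (n : ℕ) : Type := RingQuot (YangianRel n)

/-- The element `T_{i,j}^{(r)}` of `Y_n`, for `r ≥ 0`. -/
noncomputable def T (n : ℕ) (i j : Fin n) (r : ℕ) : Yangian n :=
  RingQuot.mkAlgHom ℂ (YangianRel n) (freeT n r i j)

/-- The matrix `T(u)` of power series `T_{i,j}(u) = ∑_{r ≥ 0} T_{i,j}^{(r)} u^{-r}`; the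
variable of the power series is `u⁻¹`. -/
noncomputable def Tseries (n : ℕ) : Matrix (Fin n) (Fin n) (PowerSeries (Yangian n)) :=
  Matrix.of fun i j => PowerSeries.mk (T n i j)

/-! ### Blocks and the block Gauss factorization

A tuple of positive integers summing to `n` is a `Composition n`. Blocks are numbered from `0`. -/

/-- The size `ν_a` of block `a`, with the value `0` when there is no block `a`. -/
def size {n : ℕ} (ν : Composition n) (a : ℕ) : ℕ := ν.blocks.getD a 0

theorem sizeUpTo_add_lt {n : ℕ} (ν : Composition n) (a : ℕ) (i : Fin (size ν a)) :
    ν.sizeUpTo a + i < n := by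
  obtain ⟨i, hi⟩ := i
  unfold size at hi
  by_cases h : a < ν.length
  · have h1 := ν.sizeUpTo_succ h
    have h2 := ν.sizeUpTo_le (a + 1)
    have h3 : ν.blocks.getD a 0 = ν.blocks[a]'h := by
      simp [List.getD, List.getElem?_eq_getElem h]
    simp only
    omega
  · rw [List.getD_eq_default _ _ (not_lt.mp h)] at hi
    omega

/-- The position in `{0, …, n-1}` of the `i`-th index of block `a`. -/
def pos {n : ℕ} (ν : Composition n) (a : ℕ) (i : Fin (size ν a)) : Fin n :=
  ⟨ν.sizeUpTo a + i, sizeUpTo_add_lt ν a i⟩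

/-- A block Gauss factorization `T(u) = F(u) D(u) E(u)` of shape `ν`, together with
`D̃(u) = -D(u)⁻¹`. Here `ν.index i` is the block in which the index `i` lies. -/
structure BlockGauss {n : ℕ} (ν : Composition n) where
  F : Matrix (Fin n) (Fin n) (PowerSeries (Yangian n))
  D : Matrix (Fin n) (Fin n) (PowerSeries (Yangian n))
  Dt : Matrix (Fin n) (Fin n) (PowerSeries (Yangian n))
  E : Matrix (Fin n) (Fin n) (PowerSeries (Yangian n))
  /-- `F` is block lower triangular with identity matrices as diagonal blocks. -/
  F_above : ∀ i j, ν.index i < ν.index j → F i j = 0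
  F_diag : ∀ i j, ν.index i = ν.index j → F i j = if i = j then 1 else 0
  /-- `D` is block diagonal. -/
  D_off : ∀ i j, ν.index i ≠ ν.index j → D i j = 0
  /-- `E` is block upper triangular with identity matrices as diagonal blocks. -/
  E_below : ∀ i j, ν.index j < ν.index i → E i j = 0
  E_diag : ∀ i j, ν.index i = ν.index j → E i j = if i = j then 1 else 0
  D_mul_Dt : D * Dt = -1
  Dt_mul_D : Dt * D = -1
  factor : Tseries n = F * D * E

/-! ### The parabolic presentation -/

/-- The generators: `D a i j r` and `Dt a i j r` stand for `D_{a;i,j}^{(r)}` and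
`D̃_{a;i,j}^{(r)}` with `r ≥ 0`, while `E a i j r` and `F a i j r` stand for
`E_{a;i,j}^{(r+1)}` and `F_{a;i,j}^{(r+1)}`. As `size ν a = 0` when there is no block `a`, there
are no generators `D`, `Dt` unless `a` is a block and no generators `E`, `F` unless `a` and
`a + 1` are blocks. -/
inductive ParGen {n : ℕ} (ν : Composition n) : Type
  | D (a : ℕ) (i j : Fin (size ν a)) (r : ℕ) : ParGen ν
  | Dt (a : ℕ) (i j : Fin (size ν a)) (r : ℕ) : ParGen ν
  | E (a : ℕ) (i : Fin (size ν a)) (j : Fin (size ν (a + 1))) (r : ℕ) : ParGen ν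
  | F (a : ℕ) (i : Fin (size ν (a + 1))) (j : Fin (size ν a)) (r : ℕ) : ParGen ν

/-- The elements of `Y_n` given by a block Gauss factorization: the blocks `D_a(u)`, `D̃_a(u)` on
the diagonal, `E_a(u) = E_{a,a+1}(u)` just above it and `F_a(u) = F_{a,a+1}(u)` just below it. -/
noncomputable def BlockGauss.elem {n : ℕ} {ν : Composition n} (G : BlockGauss ν) :
    ParGen ν → Yangian n
  | .D a i j r => PowerSeries.coeff r (G.D (pos ν a i) (pos ν a j))
  | .Dt a i j r => PowerSeries.coeff r (G.Dt (pos ν a i) (pos ν a j))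
  | .E a i j r => PowerSeries.coeff (r + 1) (G.E (pos ν a i) (pos ν (a + 1) j))
  | .F a i j r => PowerSeries.coeff (r + 1) (G.F (pos ν (a + 1) i) (pos ν a j))

section Letters

variable {n : ℕ} {ν : Composition n}

/-- `D_{a;i,j}^{(r)}` in the free algebra. -/
noncomputable def pD (a : ℕ) (i j : Fin (size ν a)) (r : ℕ) : FreeAlgebra ℂ (ParGen ν) :=
  FreeAlgebra.ι ℂ (ParGen.D a i j r)

/-- `D̃_{a;i,j}^{(r)}` in the free algebra. -/
noncomputable def pDt (a : ℕ) (i j : Fin (size ν a)) (r : ℕ) : FreeAlgebra ℂ (ParGen ν) :=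
  FreeAlgebra.ι ℂ (ParGen.Dt a i j r)

/-- `E_{a;i,j}^{(r)}` in the free algebra, for `r ≥ 1` (the value at `0` is never used). -/
noncomputable def pE (a : ℕ) (i : Fin (size ν a)) (j : Fin (size ν (a + 1))) :
    ℕ → FreeAlgebra ℂ (ParGen ν)
  | 0 => 0
  | r + 1 => FreeAlgebra.ι ℂ (ParGen.E a i j r)

/-- `F_{a;i,j}^{(r)}` in the free algebra, for `r ≥ 1` (the value at `0` is never used). -/
noncomputable def pF (a : ℕ) (i : Fin (size ν (a + 1))) (j : Fin (size ν a)) :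
    ℕ → FreeAlgebra ℂ (ParGen ν)
  | 0 => 0
  | r + 1 => FreeAlgebra.ι ℂ (ParGen.F a i j r)

end Letters

open Finset in
/-- The defining relations of the parabolic presentation of shape `ν`. A relation with a factor
`δ_{a,b}` or `δ_{a,b+1}` is split into the cases where that factor is `1` and the case where all
such factors are `0`. -/
inductive ParRel {n : ℕ} (ν : Composition n) :
    FreeAlgebra ℂ (ParGen ν) → FreeAlgebra ℂ (ParGen ν) → Prop
  | D_zero (a : ℕ) (i j : Fin (size ν a)) :
      ParRel ν (pD a i j 0) (if i = j then 1 else 0)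
  | D_Dt (a : ℕ) (i j : Fin (size ν a)) (r : ℕ) :
      ParRel ν (∑ t ∈ range (r + 1), ∑ p, pD a i p t * pDt a p j (r - t))
        (if r = 0 ∧ i = j then -1 else 0)
  | D_D_same (a : ℕ) (i j h k : Fin (size ν a)) (r s : ℕ) :
      ParRel ν ⁅pD a i j r, pD a h k s⁆
        (∑ t ∈ range (min r s),
          (pD a i k (r + s - 1 - t) * pD a h j t - pD a i k t * pD a h j (r + s - 1 - t)))
  | D_D_ne (a b : ℕ) (hab : a ≠ b) (i j : Fin (size ν a)) (h k : Fin (size ν b)) (r s : ℕ) :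
      ParRel ν ⁅pD a i j r, pD b h k s⁆ 0
  | E_F_same (a : ℕ) (i : Fin (size ν a)) (j : Fin (size ν (a + 1)))
      (h : Fin (size ν (a + 1))) (k : Fin (size ν a)) (r s : ℕ) (hr : 1 ≤ r) (hs : 1 ≤ s) :
      ParRel ν ⁅pE a i j r, pF a h k s⁆
        (∑ t ∈ range (r + s), pDt a i k t * pD (a + 1) h j (r + s - 1 - t))
  | E_F_ne (a b : ℕ) (hab : a ≠ b) (i : Fin (size ν a)) (j : Fin (size ν (a + 1)))
      (h : Fin (size ν (b + 1))) (k : Fin (size ν b)) (r s : ℕ) (hr : 1 ≤ r) (hs : 1 ≤ s) :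
      ParRel ν ⁅pE a i j r, pF b h k s⁆ 0
  | D_E_same (a : ℕ) (i j : Fin (size ν a)) (h : Fin (size ν a)) (k : Fin (size ν (a + 1)))
      (r s : ℕ) (hs : 1 ≤ s) :
      ParRel ν ⁅pD a i j r, pE a h k s⁆
        (if h = j then ∑ t ∈ range r, ∑ p, pD a i p t * pE a p k (r + s - 1 - t) else 0)
  | D_E_succ (b : ℕ) (i j : Fin (size ν (b + 1))) (h : Fin (size ν b))
      (k : Fin (size ν (b + 1))) (r s : ℕ) (hs : 1 ≤ s) :
      ParRel ν ⁅pD (b + 1) i j r, pE b h k s⁆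
        (-∑ t ∈ range r, pD (b + 1) i k t * pE b h j (r + s - 1 - t))
  | D_E_ne (a b : ℕ) (hab : a ≠ b) (hab' : a ≠ b + 1) (i j : Fin (size ν a))
      (h : Fin (size ν b)) (k : Fin (size ν (b + 1))) (r s : ℕ) (hs : 1 ≤ s) :
      ParRel ν ⁅pD a i j r, pE b h k s⁆ 0
  | D_F_succ (b : ℕ) (i j : Fin (size ν (b + 1))) (h : Fin (size ν (b + 1)))
      (k : Fin (size ν b)) (r s : ℕ) (hs : 1 ≤ s) :
      ParRel ν ⁅pD (b + 1) i j r, pF b h k s⁆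
        (∑ t ∈ range r, pF b i k (r + s - 1 - t) * pD (b + 1) h j t)
  | D_F_same (a : ℕ) (i j : Fin (size ν a)) (h : Fin (size ν (a + 1))) (k : Fin (size ν a))
      (r s : ℕ) (hs : 1 ≤ s) :
      ParRel ν ⁅pD a i j r, pF a h k s⁆
        (if i = k then -∑ t ∈ range r, ∑ p, pF a h p (r + s - 1 - t) * pD a p j t else 0)
  | D_F_ne (a b : ℕ) (hab : a ≠ b) (hab' : a ≠ b + 1) (i j : Fin (size ν a))
      (h : Fin (size ν (b + 1))) (k : Fin (size ν b)) (r s : ℕ) (hs : 1 ≤ s) :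
      ParRel ν ⁅pD a i j r, pF b h k s⁆ 0
  | E_E_same (a : ℕ) (i h : Fin (size ν a)) (j k : Fin (size ν (a + 1))) (r s : ℕ)
      (hr : 1 ≤ r) (hs : 1 ≤ s) :
      ParRel ν ⁅pE a i j r, pE a h k s⁆
        (∑ t ∈ Ico 1 s, pE a i k t * pE a h j (r + s - 1 - t)
          - ∑ t ∈ Ico 1 r, pE a i k t * pE a h j (r + s - 1 - t))
  | F_F_same (a : ℕ) (i h : Fin (size ν (a + 1))) (j k : Fin (size ν a)) (r s : ℕ)
      (hr : 1 ≤ r) (hs : 1 ≤ s) :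
      ParRel ν ⁅pF a i j r, pF a h k s⁆
        (∑ t ∈ Ico 1 r, pF a i k (r + s - 1 - t) * pF a h j t
          - ∑ t ∈ Ico 1 s, pF a i k (r + s - 1 - t) * pF a h j t)
  | E_E_succ (a : ℕ) (i : Fin (size ν a)) (j h : Fin (size ν (a + 1)))
      (k : Fin (size ν (a + 1 + 1))) (r s : ℕ) (hr : 1 ≤ r) (hs : 1 ≤ s) :
      ParRel ν (⁅pE a i j r, pE (a + 1) h k (s + 1)⁆ - ⁅pE a i j (r + 1), pE (a + 1) h k s⁆)
        (if h = j then -∑ q, pE a i q r * pE (a + 1) q k s else 0)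
  | F_F_succ (a : ℕ) (i k : Fin (size ν (a + 1))) (j : Fin (size ν a))
      (h : Fin (size ν (a + 1 + 1))) (r s : ℕ) (hr : 1 ≤ r) (hs : 1 ≤ s) :
      ParRel ν (⁅pF a i j (r + 1), pF (a + 1) h k s⁆ - ⁅pF a i j r, pF (a + 1) h k (s + 1)⁆)
        (if i = k then -∑ q, pF (a + 1) h q s * pF a q j r else 0)
  | E_E_far (a b : ℕ) (hab : a + 1 < b) (i : Fin (size ν a)) (j : Fin (size ν (a + 1)))
      (h : Fin (size ν b)) (k : Fin (size ν (b + 1))) (r s : ℕ) (hr : 1 ≤ r) (hs : 1 ≤ s) :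
      ParRel ν ⁅pE a i j r, pE b h k s⁆ 0
  | E_E_succ_ne (a : ℕ) (i : Fin (size ν a)) (j h : Fin (size ν (a + 1))) (hhj : h ≠ j)
      (k : Fin (size ν (a + 1 + 1))) (r s : ℕ) (hr : 1 ≤ r) (hs : 1 ≤ s) :
      ParRel ν ⁅pE a i j r, pE (a + 1) h k s⁆ 0
  | F_F_far (a b : ℕ) (hab : a + 1 < b) (i : Fin (size ν (a + 1))) (j : Fin (size ν a))
      (h : Fin (size ν (b + 1))) (k : Fin (size ν b)) (r s : ℕ) (hr : 1 ≤ r) (hs : 1 ≤ s) :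
      ParRel ν ⁅pF a i j r, pF b h k s⁆ 0
  | F_F_succ_ne (a : ℕ) (i k : Fin (size ν (a + 1))) (hik : i ≠ k) (j : Fin (size ν a))
      (h : Fin (size ν (a + 1 + 1))) (r s : ℕ) (hr : 1 ≤ r) (hs : 1 ≤ s) :
      ParRel ν ⁅pF a i j r, pF (a + 1) h k s⁆ 0
  | E_serre (a b : ℕ) (hab : a = b + 1 ∨ b = a + 1) (i h : Fin (size ν a))
      (j k : Fin (size ν (a + 1))) (f : Fin (size ν b)) (g : Fin (size ν (b + 1)))
      (r s t : ℕ) (hr : 1 ≤ r) (hs : 1 ≤ s) (ht : 1 ≤ t) :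
      ParRel ν (⁅pE a i j r, ⁅pE a h k s, pE b f g t⁆⁆ + ⁅pE a i j s, ⁅pE a h k r, pE b f g t⁆⁆) 0
  | F_serre (a b : ℕ) (hab : a = b + 1 ∨ b = a + 1) (i h : Fin (size ν (a + 1)))
      (j k : Fin (size ν a)) (f : Fin (size ν (b + 1))) (g : Fin (size ν b))
      (r s t : ℕ) (hr : 1 ≤ r) (hs : 1 ≤ s) (ht : 1 ≤ t) :
      ParRel ν (⁅pF a i j r, ⁅pF a h k s, pF b f g t⁆⁆ + ⁅pF a i j s, ⁅pF a h k r, pF b f g t⁆⁆) 0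

/-! ### The RTT presentation (one block) -/

open Finset in
/-- The RTT relations in the form of commutator formulas for the generators `T_{i,j}^{(r)}`. -/
inductive RTTRel (n : ℕ) :
    FreeAlgebra ℂ (YangianGen n) → FreeAlgebra ℂ (YangianGen n) → Prop
  | comm (i j h k : Fin n) (r s : ℕ) :
      RTTRel n ⁅freeT n r i j, freeT n s h k⁆
        (∑ t ∈ range (min r s),
          (freeT n (r + s - 1 - t) i k * freeT n t h j
            - freeT n t i k * freeT n (r + s - 1 - t) h j))

/-- The generators `T_{i,j}^{(r)}`, `r ≥ 1`, as elements of `Y_n`. -/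
noncomputable def YangianGen.elem {n : ℕ} : YangianGen n → Yangian n
  | .T i j r => ParabolicYangian.T n i j (r + 1)

/-! ### The presentation of Drinfeld type (all blocks of size one) -/

/-- The generators `D_i^{(r)}`, `D̃_i^{(r)}` (`0 ≤ i < n`, `r ≥ 0`) and `E_i^{(r+1)}`,
`F_i^{(r+1)}` (`0 ≤ i < n - 1`, `r ≥ 0`). -/
inductive DrinGen (n : ℕ) : Type
  | D (i : ℕ) (hi : i < n) (r : ℕ) : DrinGen n
  | Dt (i : ℕ) (hi : i < n) (r : ℕ) : DrinGen n
  | E (i : ℕ) (hi : i + 1 < n) (r : ℕ) : DrinGen n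
  | F (i : ℕ) (hi : i + 1 < n) (r : ℕ) : DrinGen n

/-- The elements of `Y_n` given by the Gauss factorization with blocks of size one. -/
noncomputable def BlockGauss.drinElem {n : ℕ} (G : BlockGauss (Composition.ones n)) :
    DrinGen n → Yangian n
  | .D i hi r => PowerSeries.coeff r (G.D ⟨i, hi⟩ ⟨i, hi⟩)
  | .Dt i hi r => PowerSeries.coeff r (G.Dt ⟨i, hi⟩ ⟨i, hi⟩)
  | .E i hi r => PowerSeries.coeff (r + 1) (G.E ⟨i, Nat.lt_of_succ_lt hi⟩ ⟨i + 1, hi⟩)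
  | .F i hi r => PowerSeries.coeff (r + 1) (G.F ⟨i + 1, hi⟩ ⟨i, Nat.lt_of_succ_lt hi⟩)

section DrinLetters

variable {n : ℕ}

/-- `D_i^{(r)}` in the free algebra. -/
noncomputable def dD (i : ℕ) (hi : i < n) (r : ℕ) : FreeAlgebra ℂ (DrinGen n) :=
  FreeAlgebra.ι ℂ (DrinGen.D i hi r)

/-- `D̃_i^{(r)}` in the free algebra. -/
noncomputable def dDt (i : ℕ) (hi : i < n) (r : ℕ) : FreeAlgebra ℂ (DrinGen n) :=
  FreeAlgebra.ι ℂ (DrinGen.Dt i hi r)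

/-- `E_i^{(r)}` in the free algebra, for `r ≥ 1` (the value at `0` is never used). -/
noncomputable def dE (i : ℕ) (hi : i + 1 < n) : ℕ → FreeAlgebra ℂ (DrinGen n)
  | 0 => 0
  | r + 1 => FreeAlgebra.ι ℂ (DrinGen.E i hi r)

/-- `F_i^{(r)}` in the free algebra, for `r ≥ 1` (the value at `0` is never used). -/
noncomputable def dF (i : ℕ) (hi : i + 1 < n) : ℕ → FreeAlgebra ℂ (DrinGen n)
  | 0 => 0
  | r + 1 => FreeAlgebra.ι ℂ (DrinGen.F i hi r)

end DrinLetters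

open Finset in
/-- The defining relations of the presentation of Drinfeld type. -/
inductive DrinRel (n : ℕ) : FreeAlgebra ℂ (DrinGen n) → FreeAlgebra ℂ (DrinGen n) → Prop
  | D_zero (i : ℕ) (hi : i < n) : DrinRel n (dD i hi 0) 1
  | D_Dt (i : ℕ) (hi : i < n) (r : ℕ) :
      DrinRel n (∑ t ∈ range (r + 1), dD i hi t * dDt i hi (r - t)) (if r = 0 then -1 else 0)
  | D_D (i j : ℕ) (hi : i < n) (hj : j < n) (r s : ℕ) :
      DrinRel n ⁅dD i hi r, dD j hj s⁆ 0
  | E_F (i j : ℕ) (hi : i + 1 < n) (hj : j + 1 < n) (r s : ℕ) (hr : 1 ≤ r) (hs : 1 ≤ s) :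
      DrinRel n ⁅dE i hi r, dF j hj s⁆
        (if i = j then
          ∑ t ∈ range (r + s), dDt i (Nat.lt_of_succ_lt hi) t * dD (i + 1) hi (r + s - 1 - t)
        else 0)
  | D_E (i j : ℕ) (hi : i < n) (hj : j + 1 < n) (r s : ℕ) (hs : 1 ≤ s) :
      DrinRel n ⁅dD i hi r, dE j hj s⁆
        (((if i = j then 1 else 0) - (if i = j + 1 then 1 else 0)) *
          ∑ t ∈ range r, dD i hi t * dE j hj (r + s - 1 - t))
  | D_F (i j : ℕ) (hi : i < n) (hj : j + 1 < n) (r s : ℕ) (hs : 1 ≤ s) :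
      DrinRel n ⁅dD i hi r, dF j hj s⁆
        (((if i = j + 1 then 1 else 0) - (if i = j then 1 else 0)) *
          ∑ t ∈ range r, dF j hj (r + s - 1 - t) * dD i hi t)
  | E_E_same (i : ℕ) (hi : i + 1 < n) (r s : ℕ) (hr : 1 ≤ r) (hs : 1 ≤ s) :
      DrinRel n ⁅dE i hi r, dE i hi s⁆
        (∑ t ∈ Ico 1 s, dE i hi t * dE i hi (r + s - 1 - t)
          - ∑ t ∈ Ico 1 r, dE i hi t * dE i hi (r + s - 1 - t))
  | F_F_same (i : ℕ) (hi : i + 1 < n) (r s : ℕ) (hr : 1 ≤ r) (hs : 1 ≤ s) :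
      DrinRel n ⁅dF i hi r, dF i hi s⁆
        (∑ t ∈ Ico 1 r, dF i hi (r + s - 1 - t) * dF i hi t
          - ∑ t ∈ Ico 1 s, dF i hi (r + s - 1 - t) * dF i hi t)
  | E_E_succ (i : ℕ) (hi : i + 1 < n) (hi' : i + 1 + 1 < n) (r s : ℕ) (hr : 1 ≤ r)
      (hs : 1 ≤ s) :
      DrinRel n (⁅dE i hi r, dE (i + 1) hi' (s + 1)⁆ - ⁅dE i hi (r + 1), dE (i + 1) hi' s⁆)
        (-(dE i hi r * dE (i + 1) hi' s))
  | F_F_succ (i : ℕ) (hi : i + 1 < n) (hi' : i + 1 + 1 < n) (r s : ℕ) (hr : 1 ≤ r)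
      (hs : 1 ≤ s) :
      DrinRel n (⁅dF i hi (r + 1), dF (i + 1) hi' s⁆ - ⁅dF i hi r, dF (i + 1) hi' (s + 1)⁆)
        (-(dF (i + 1) hi' s * dF i hi r))
  | E_E_far (i j : ℕ) (hij : i + 1 < j ∨ j + 1 < i) (hi : i + 1 < n) (hj : j + 1 < n)
      (r s : ℕ) (hr : 1 ≤ r) (hs : 1 ≤ s) :
      DrinRel n ⁅dE i hi r, dE j hj s⁆ 0
  | F_F_far (i j : ℕ) (hij : i + 1 < j ∨ j + 1 < i) (hi : i + 1 < n) (hj : j + 1 < n)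
      (r s : ℕ) (hr : 1 ≤ r) (hs : 1 ≤ s) :
      DrinRel n ⁅dF i hi r, dF j hj s⁆ 0
  | E_serre (i j : ℕ) (hij : i = j + 1 ∨ j = i + 1) (hi : i + 1 < n) (hj : j + 1 < n)
      (r s t : ℕ) (hr : 1 ≤ r) (hs : 1 ≤ s) (ht : 1 ≤ t) :
      DrinRel n (⁅dE i hi r, ⁅dE i hi s, dE j hj t⁆⁆ + ⁅dE i hi s, ⁅dE i hi r, dE j hj t⁆⁆) 0
  | F_serre (i j : ℕ) (hij : i = j + 1 ∨ j = i + 1) (hi : i + 1 < n) (hj : j + 1 < n)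
      (r s t : ℕ) (hr : 1 ≤ r) (hs : 1 ≤ s) (ht : 1 ≤ t) :
      DrinRel n (⁅dF i hi r, ⁅dF i hi s, dF j hj t⁆⁆ + ⁅dF i hi s, ⁅dF i hi r, dF j hj t⁆⁆) 0

end ParabolicYangian

/-! The presentation is proved through a universal property, so no basis of `Yangian n` is needed.
By `isPresentation_of_universal` it is enough that the Gauss entries satisfy the parabolic
relations, that they generate, and that any elements of an algebra satisfying these relations are
the images of the Gauss entries under some homomorphism. A homomorphism from the Yangian is the same
as a matrix of series with constant term one that satisfies the RTT relation. So the last point asks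
to rebuild such a matrix from elements that satisfy the parabolic relations.

All relations are equations between series in `u⁻¹` and `v⁻¹`. An equation `(u - v) x = ε y`,
multiplied by `u⁻¹ v⁻¹`, becomes `kap * x = lam ε * y`, where `kap` is central and not a zero
divisor.

From RTT to the relations. Blocks are peeled off one at a time: `T = (p + F) A (p + E) + G` with
orthogonal idempotents `p`, `q`. Since `kap` times a commutator is a derivation, RTT for the entries
of the corner `A` splits into the relations of `A` with `A`, `E`, `F` and `G`
(`TwoBlock.derivation_iff`). Passing to the inverse of `T` changes the sign of `ε` and exchanges the
two blocks; this gives RTT for the Schur complement `G` and the relations of `G` with `E`. The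
commutators `[E, E]` and `[E, F]` are computed on the tensor square (`offdiagonal_commutator`,
`mixed_commutator`). Transposition over the opposite ring turns statements about `E` into statements
about `F`. Iteration gives a `Tower`, and neighbouring levels are related because `E a` acts on the
next remainder by right multiplication (`Tower.dk_E`). For the Serre relations, the sum of `[E^(r),
E^(s)]` and `[E^(s), E^(r)]` vanishes in every two-block factorization. This is applied to a more
distant entry of the same row, or after merging two blocks, and the degree is then raised by
commutators with `D`.

From the relations to RTT, by descending induction on the block `k`. Let `T₁` satisfy RTT on the
blocks beyond `k`. The row `E k` is extended to all later columns by `X_{hj}(u) = [E_{hp}(u),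
E_{pj}^{(1)}]` with `p` in block `k + 1`, the column `F k` symmetrically, and `T` is the two-block
product of `D k`, `T₁` and these factors. The entries of `D k` satisfy RTT with all entries of `T`
by the same criterion as above, read backwards. The degree-one coefficients of the extended factors
act on the entries of `T` by matrix units (`CrossData.actsAs`). The failure of RTT transforms under
this action like `T ⊗ T`, so its vanishing on the first block spreads to all entries
(`rtt_of_actsAs`). By uniqueness of the factorization, the Gauss factors of this matrix are the
given elements.

The formula for `X` also shows that the neighbouring blocks generate. The two special cases are RTT
in coefficient form and a translation of indices for blocks of size one. -/

namespace ParabolicYangian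

set_option linter.unusedSectionVars false
set_option linter.unusedSimpArgs false

open PowerSeries

/-! ### Power series in two central variables

The outer variable is `u⁻¹` and the inner variable is `v⁻¹`. -/

section Bi

variable {A : Type*} [Ring A]

/-- Power series in two central variables `u⁻¹` (outer) and `v⁻¹` (inner). -/
abbrev BiSeries (A : Type*) [Ring A] : Type _ := PowerSeries (PowerSeries A)

/-- A series regarded as a series in `u⁻¹`. -/
noncomputable def iu : PowerSeries A →+* BiSeries A := PowerSeries.map PowerSeries.C

/-- A series regarded as a series in `v⁻¹`. -/
noncomputable def iv : PowerSeries A →+* BiSeries A := PowerSeries.C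

/-- The coefficient of `u^{-r} v^{-s}`. -/
noncomputable def cf (r s : ℕ) : BiSeries A →+ A :=
  (PowerSeries.coeff (R := A) s).toAddMonoidHom.comp
    (PowerSeries.coeff (R := PowerSeries A) r).toAddMonoidHom

theorem cf_apply (r s : ℕ) (w : BiSeries A) :
    cf r s w = PowerSeries.coeff s (PowerSeries.coeff r w) := rfl

theorem bi_ext {w w' : BiSeries A} (h : ∀ r s, cf r s w = cf r s w') : w = w' := by
  ext r s; exact h r s

theorem cf_iu_mul_iv (r s : ℕ) (f g : PowerSeries A) :
    cf r s (iu f * iv g) = coeff r f * coeff s g := by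
  simp [cf_apply, iu, iv, PowerSeries.coeff_mul_C]

theorem cf_iv_mul_iu (r s : ℕ) (f g : PowerSeries A) :
    cf r s (iv g * iu f) = coeff s g * coeff r f := by
  simp [cf_apply, iu, iv, PowerSeries.coeff_mul_C]

theorem cf_iu (r s : ℕ) (f : PowerSeries A) :
    cf r s (iu f) = if s = 0 then coeff r f else 0 := by
  simp [cf_apply, iu, PowerSeries.coeff_C]

theorem cf_iv (r s : ℕ) (f : PowerSeries A) :
    cf r s (iv f) = if r = 0 then coeff s f else 0 := by
  simp only [cf_apply, iv, PowerSeries.coeff_C]; split_ifs <;> simp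

/-- The product `u⁻¹ v⁻¹ (u - v)`, that is `v⁻¹ - u⁻¹`. -/
noncomputable def kap : BiSeries A := PowerSeries.C PowerSeries.X - PowerSeries.X

/-- An integer multiple of `u⁻¹ v⁻¹`. -/
noncomputable def lam (ε : ℤ) : BiSeries A := ε • (PowerSeries.X * PowerSeries.C PowerSeries.X)

theorem C_X_commute (w : BiSeries A) :
    PowerSeries.C PowerSeries.X * w = w * PowerSeries.C PowerSeries.X := by
  ext r : 1
  rw [PowerSeries.coeff_C_mul, PowerSeries.coeff_mul_C]
  exact (PowerSeries.commute_X _).symm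

theorem X_commute (w : BiSeries A) : PowerSeries.X * w = w * PowerSeries.X :=
  (PowerSeries.commute_X w).symm

theorem kap_comm (w : BiSeries A) : kap * w = w * kap := by
  simp only [kap, sub_mul, mul_sub, C_X_commute w, X_commute w]

theorem lam_comm (ε : ℤ) (w : BiSeries A) : lam ε * w = w * lam ε := by
  simp only [lam, smul_mul_assoc, mul_smul_comm]
  rw [mul_assoc, C_X_commute, ← mul_assoc, X_commute, mul_assoc]

theorem lam_neg (ε : ℤ) : (lam (-ε) : BiSeries A) = -lam ε := by simp [lam]

theorem cf_X_mul_succ (r s : ℕ) (w : BiSeries A) : cf (r + 1) s (PowerSeries.X * w) = cf r s w := by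
  simp [cf_apply]

theorem cf_X_mul_zero (s : ℕ) (w : BiSeries A) : cf 0 s (PowerSeries.X * w) = 0 := by
  simp [cf_apply]

theorem cf_Y_mul_succ (r s : ℕ) (w : BiSeries A) :
    cf r (s + 1) (PowerSeries.C PowerSeries.X * w) = cf r s w := by
  simp only [cf_apply, PowerSeries.coeff_C_mul, PowerSeries.coeff_succ_X_mul]

theorem cf_Y_mul_zero (r : ℕ) (w : BiSeries A) :
    cf r 0 (PowerSeries.C PowerSeries.X * w) = 0 := by
  simp only [cf_apply, PowerSeries.coeff_C_mul, PowerSeries.coeff_zero_X_mul]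

theorem cf_kap_mul_succ (r s : ℕ) (w : BiSeries A) :
    cf (r + 1) (s + 1) (kap * w) = cf (r + 1) s w - cf r (s + 1) w := by
  rw [kap, sub_mul, map_sub, cf_Y_mul_succ, cf_X_mul_succ]

theorem cf_kap_mul_zero_left (s : ℕ) (w : BiSeries A) :
    cf 0 (s + 1) (kap * w) = cf 0 s w := by
  rw [kap, sub_mul, map_sub, cf_Y_mul_succ, cf_X_mul_zero, sub_zero]

theorem cf_kap_mul_zero_right (r : ℕ) (w : BiSeries A) :
    cf (r + 1) 0 (kap * w) = -cf r 0 w := by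
  rw [kap, sub_mul, map_sub, cf_Y_mul_zero, cf_X_mul_succ, zero_sub]

theorem cf_kap_mul_zero_zero (w : BiSeries A) : cf 0 0 (kap * w) = 0 := by
  rw [kap, sub_mul, map_sub, cf_Y_mul_zero, cf_X_mul_zero, zero_sub, neg_zero]

theorem cf_lam_mul_succ (ε : ℤ) (r s : ℕ) (w : BiSeries A) :
    cf (r + 1) (s + 1) (lam ε * w) = ε • cf r s w := by
  rw [lam, smul_mul_assoc, map_zsmul, mul_assoc, cf_X_mul_succ, cf_Y_mul_succ]

theorem cf_lam_mul_zero_left (ε : ℤ) (s : ℕ) (w : BiSeries A) : cf 0 s (lam ε * w) = 0 := by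
  rw [lam, smul_mul_assoc, map_zsmul, mul_assoc, cf_X_mul_zero, smul_zero]

theorem cf_lam_mul_zero_right (ε : ℤ) (r : ℕ) (w : BiSeries A) : cf r 0 (lam ε * w) = 0 := by
  rw [lam, smul_mul_assoc, map_zsmul, mul_assoc]
  cases r with
  | zero => rw [cf_X_mul_zero, smul_zero]
  | succ r => rw [cf_X_mul_succ, cf_Y_mul_zero, smul_zero]

/-- An equation `(u - v) a = ε f`, coefficient by coefficient. -/
theorem kap_mul_eq_lam_mul_iff (ε : ℤ) (a f : BiSeries A) :
    kap * a = lam ε * f ↔ (∀ s, cf 0 s a = 0) ∧ (∀ r, cf r 0 a = 0) ∧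
      ∀ r s, cf (r + 1) s a - cf r (s + 1) a = ε • cf r s f := by
  constructor
  · intro h
    have h' : ∀ r s, cf r s (kap * a) = cf r s (lam ε * f) := fun r s => by rw [h]
    refine ⟨fun s => ?_, fun r => ?_, fun r s => ?_⟩
    · rw [← cf_kap_mul_zero_left, h', cf_lam_mul_zero_left]
    · rw [← neg_eq_zero, ← cf_kap_mul_zero_right, h', cf_lam_mul_zero_right]
    · rw [← cf_kap_mul_succ, h', cf_lam_mul_succ]
  · rintro ⟨h1, h2, h3⟩
    apply bi_ext
    rintro (_ | r) (_ | s)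
    · rw [cf_kap_mul_zero_zero, cf_lam_mul_zero_left]
    · rw [cf_kap_mul_zero_left, cf_lam_mul_zero_left, h1]
    · rw [cf_kap_mul_zero_right, cf_lam_mul_zero_right, h2, neg_zero]
    · rw [cf_kap_mul_succ, cf_lam_mul_succ, h3]

/-- The equation makes the row `u⁰` of `w` vanish and makes each further row a shift of the previous
one. Hence factors `u - v` can be cancelled everywhere below. -/
theorem kap_regular {w : BiSeries A} (h : kap * w = 0) : w = 0 := by
  have h' := (kap_mul_eq_lam_mul_iff 0 w 0).1 (by simpa using h)
  obtain ⟨h1, -, h3⟩ := h'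
  apply bi_ext
  intro r
  induction r with
  | zero => intro s; simpa using h1 s
  | succ r ih =>
    intro s
    have := h3 r s
    rw [ih (s + 1)] at this
    simpa using this

theorem kap_mul_cancel {w w' : BiSeries A} (h : kap * w = kap * w') : w = w' :=
  sub_eq_zero.1 (kap_regular (by rw [mul_sub, h, sub_self]))

/-- The exchange of the two variables. -/
noncomputable def swapVar : BiSeries A →+* BiSeries A where
  toFun w := PowerSeries.mk fun r => PowerSeries.mk fun s => cf s r w
  map_zero' := by apply bi_ext; intro r s; simp [cf_apply]
  map_one' := by
    apply bi_ext; intro r s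
    simp only [cf_apply, PowerSeries.coeff_mk, PowerSeries.coeff_one]
    split_ifs <;> simp_all [PowerSeries.coeff_one]
  map_add' w w' := by apply bi_ext; intro r s; simp [cf_apply]
  map_mul' w w' := by
    apply bi_ext; intro r s
    simp only [cf_apply, PowerSeries.coeff_mk, PowerSeries.coeff_mul, map_sum]
    exact Finset.sum_comm

theorem cf_swapVar (r s : ℕ) (w : BiSeries A) : cf r s (swapVar w) = cf s r w := by
  simp [swapVar, cf_apply]

theorem swapVar_iu (f : PowerSeries A) : swapVar (iu f) = iv f := by
  apply bi_ext; intro r s; rw [cf_swapVar, cf_iu, cf_iv]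

theorem swapVar_iv (f : PowerSeries A) : swapVar (iv f) = iu f := by
  apply bi_ext; intro r s; rw [cf_swapVar, cf_iu, cf_iv]

theorem X_eq_iu : (PowerSeries.X : BiSeries A) = iu PowerSeries.X := by simp [iu]

theorem Y_eq_iv : (PowerSeries.C PowerSeries.X : BiSeries A) = iv PowerSeries.X := rfl

theorem swapVar_kap : swapVar (kap : BiSeries A) = -kap := by
  rw [kap, map_sub, Y_eq_iv, X_eq_iu, swapVar_iu, swapVar_iv, neg_sub]

theorem swapVar_lam (ε : ℤ) : swapVar (lam ε : BiSeries A) = lam ε := by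
  rw [lam, map_zsmul, map_mul, Y_eq_iv, X_eq_iu, swapVar_iu, swapVar_iv, ← Y_eq_iv, C_X_commute]

/-- The divided difference `(f(u) - f(v)) / (v⁻¹ - u⁻¹)`. -/
theorem exists_divided_difference (f : PowerSeries A) : ∃ g, iu f - iv f = kap * g := by
  refine ⟨PowerSeries.mk fun r => PowerSeries.mk fun s => -coeff (r + s + 1) f, ?_⟩
  apply bi_ext
  rintro (_ | r) (_ | s)
  · rw [cf_kap_mul_zero_zero, map_sub, cf_iu, cf_iv]; simp
  · rw [cf_kap_mul_zero_left, map_sub, cf_iu, cf_iv]; simp [cf_apply]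
  · rw [cf_kap_mul_zero_right, map_sub, cf_iu, cf_iv]; simp [cf_apply]
  · rw [cf_kap_mul_succ, map_sub, cf_iu, cf_iv]
    have : r + 1 + s + 1 = r + (s + 1) + 1 := by ring
    simp [cf_apply, this]

end Bi

/-! ### Two-block factorizations in a ring -/

section Ring

variable {R : Type*} [Ring R]

theorem mul_eq_assoc {a b c : R} (h : a * b = c) (x : R) : a * (b * x) = c * x := by
  rw [← mul_assoc, h]

theorem mul_eq_zero_assoc {a b : R} (h : a * b = 0) (x : R) : a * (b * x) = 0 := by
  rw [← mul_assoc, h, zero_mul]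

/-- The supports of the factors of `(p + F) A (p + E) + G`, where `p` and `q` are orthogonal
idempotents and `A'` is the inverse of `A` in the corner of `p`. -/
structure TwoBlock (p q A A' G E F : R) : Prop where
  pp : p * p = p
  qq : q * q = q
  pq : p * q = 0
  qp : q * p = 0
  pA : p * A = A
  Ap : A * p = A
  pA' : p * A' = A'
  A'p : A' * p = A'
  AA' : A * A' = p
  A'A : A' * A = p
  pE : p * E = E
  Eq : E * q = E
  qF : q * F = F
  Fp : F * p = F
  qG : q * G = G
  Gq : G * q = G

/-- The element `(p + F) A (p + E) + G`. -/
def gaussProd (A G E F : R) : R := A + A * E + F * A + F * A * E + G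

namespace TwoBlock

variable {p q A A' G E F : R}

theorem qA (t : TwoBlock p q A A' G E F) : q * A = 0 := by rw [← t.pA, ← mul_assoc, t.qp, zero_mul]
theorem Aq (t : TwoBlock p q A A' G E F) : A * q = 0 := by rw [← t.Ap, mul_assoc, t.pq, mul_zero]
theorem Ep (t : TwoBlock p q A A' G E F) : E * p = 0 := by rw [← t.Eq, mul_assoc, t.qp, mul_zero]
theorem pF (t : TwoBlock p q A A' G E F) : p * F = 0 := by rw [← t.qF, ← mul_assoc, t.pq, zero_mul]
theorem pG (t : TwoBlock p q A A' G E F) : p * G = 0 := by rw [← t.qG, ← mul_assoc, t.pq, zero_mul]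
theorem Gp (t : TwoBlock p q A A' G E F) : G * p = 0 := by rw [← t.Gq, mul_assoc, t.qp, mul_zero]

theorem p_gauss_p (t : TwoBlock p q A A' G E F) : p * gaussProd A G E F * p = A := by
  simp [gaussProd, mul_add, add_mul, mul_assoc, t.pA, t.Ap, t.Ep, mul_eq_zero_assoc t.pF, t.Gp]

theorem p_gauss_q (t : TwoBlock p q A A' G E F) : p * gaussProd A G E F * q = A * E := by
  simp [gaussProd, mul_add, add_mul, mul_assoc, t.Aq, t.Eq, mul_eq_assoc t.pA,
    mul_eq_zero_assoc t.pF, mul_eq_zero_assoc t.pG]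

theorem q_gauss_p (t : TwoBlock p q A A' G E F) : q * gaussProd A G E F * p = F * A := by
  simp [gaussProd, mul_add, add_mul, mul_assoc, t.Ap, t.Ep, mul_eq_assoc t.qF, t.qA, t.Gp]

theorem q_gauss_q (t : TwoBlock p q A A' G E F) : q * gaussProd A G E F * q = F * A * E + G := by
  simp [gaussProd, mul_add, add_mul, mul_assoc, t.Aq, t.Eq, mul_eq_assoc t.qF,
    mul_eq_zero_assoc t.qA, t.qG, t.Gq]

theorem p_gauss (t : TwoBlock p q A A' G E F) : p * gaussProd A G E F = A + A * E := by
  simp [gaussProd, mul_add, mul_assoc, t.pA, mul_eq_assoc t.pA, mul_eq_zero_assoc t.pF, t.pG]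

theorem gauss_p (t : TwoBlock p q A A' G E F) : gaussProd A G E F * p = A + F * A := by
  simp [gaussProd, add_mul, mul_assoc, t.Ap, t.Ep, t.Gp]

theorem gauss_supp_left (t : TwoBlock p q A A' G E F) : (p + q) * gaussProd A G E F = gaussProd A G E F := by
  simp [gaussProd, mul_add, add_mul, ← mul_assoc, t.pA, t.pF, t.pG, t.qA, t.qF, t.qG]

theorem gauss_supp_right (t : TwoBlock p q A A' G E F) : gaussProd A G E F * (p + q) = gaussProd A G E F := by
  simp [gaussProd, mul_add, add_mul, mul_assoc, t.Ap, t.Ep, t.Gp, t.Aq, t.Eq, t.Gq]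
  abel

/-- The effect of a derivation that acts on a two-block product as the commutator with an entry
of the upper left block does. -/
theorem derivation_iff (t : TwoBlock p q A A' G E F) (d : R →+ R)
    (hd : ∀ x y, d (x * y) = d x * y + x * d y) {Av Ev Fv e : R} (hp : d p = 0) (hq : d q = 0) (pe : p * e = e)
    (ep : e * p = e) (qFv : q * Fv = Fv) (pAv : p * Av = Av) (Avp : Av * p = Av)
    (Evq : Ev * q = Ev) :
    d (gaussProd A G E F) = (Av + Fv * Av) * e * (A + A * E) - (A + F * A) * e * (Av + Av * Ev) ↔
      d A = Av * e * A - A * e * Av ∧ d E = e * Av * (E - Ev) ∧ d F = (Fv - F) * Av * e ∧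
        d G = 0 := by
  have pEv0 : Ev * p = 0 := by rw [← Evq, mul_assoc, t.qp, mul_zero]
  have pFv0 : p * Fv = 0 := by rw [← qFv, ← mul_assoc, t.pq, zero_mul]
  have qAv : q * Av = 0 := by rw [← pAv, ← mul_assoc, t.qp, zero_mul]
  have Avq : Av * q = 0 := by rw [← Avp, mul_assoc, t.pq, mul_zero]
  have dpp : ∀ x y z, d x = 0 → d z = 0 → d (x * y * z) = x * d y * z := by
    intro x y z hx hz
    rw [hd, hd, hx, hz]; simp
  have expand : d (gaussProd A G E F) = d A + d A * E + A * d E + d F * A + F * d A + d F * A * E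
      + F * d A * E + F * A * d E + d G := by
    simp only [gaussProd, map_add, hd]; noncomm_ring
  constructor
  · intro h
    -- As `d` kills `p` and `q`, it commutes with cutting out a corner. The corners `pp`, `pq` and
    -- `qp` of the equation give `d A`, `d (A E)` and `d (F A)`.
    have dA : d A = Av * e * A - A * e * Av := by
      have := dpp p (gaussProd A G E F) p hp hp
      rw [t.p_gauss_p, h] at this
      rw [this]
      simp [mul_add, add_mul, mul_sub, sub_mul, mul_assoc, t.Ap, t.Ep, mul_eq_zero_assoc t.pF,
        mul_eq_assoc t.pA, mul_eq_assoc pAv, Avp, pEv0, mul_eq_zero_assoc pFv0]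
    have dAE : d (A * E) = Av * e * A * E - A * e * Av * Ev := by
      have := dpp p (gaussProd A G E F) q hp hq
      rw [t.p_gauss_q, h] at this
      rw [this]
      simp [mul_add, add_mul, mul_sub, sub_mul, mul_assoc, t.Aq, t.Eq, mul_eq_zero_assoc t.pF,
        mul_eq_assoc t.pA, mul_eq_assoc pAv, Avq, Evq, mul_eq_zero_assoc pFv0]
    have dFA : d (F * A) = Fv * Av * e * A - F * A * e * Av := by
      have := dpp q (gaussProd A G E F) p hq hp
      rw [t.q_gauss_p, h] at this
      rw [this]
      simp [mul_add, add_mul, mul_sub, sub_mul, mul_assoc, t.Ap, t.Ep, mul_eq_assoc t.qF,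
        mul_eq_zero_assoc t.qA, mul_eq_zero_assoc qAv, Avp, pEv0, mul_eq_assoc qFv]
    have dE : d E = e * Av * (E - Ev) := by
      have h1 : d E = p * d E := by
        have := hd p E
        rw [t.pE, hp] at this; simpa using this
      rw [h1, ← t.A'A]
      have h2 := hd A E
      rw [dAE, dA] at h2
      -- By the Leibniz rule `d A` can be removed from `d (A E)`. The remaining factor `A` is
      -- cancelled on the left by `A'`, which is possible because `d E` lies in the range of `p`.
      have h3 : A * d E = A * (e * Av * (E - Ev)) := by
        linear_combination (norm := noncomm_ring) -h2
      rw [mul_assoc, h3, ← mul_assoc, t.A'A]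
      simp only [← mul_assoc, pe]
    have dF : d F = (Fv - F) * Av * e := by
      have h1 : d F = d F * p := by
        have := hd F p
        rw [t.Fp, hp] at this; simpa using this
      rw [h1, ← t.AA']
      have h2 := hd F A
      rw [dFA, dA] at h2
      have h3 : d F * A = ((Fv - F) * Av * e) * A := by
        linear_combination (norm := noncomm_ring) -h2
      rw [← mul_assoc, h3, mul_assoc, t.AA']
      simp only [mul_assoc, ep]
    refine ⟨dA, dE, dF, ?_⟩
    rw [expand, dA, dE, dF] at h
    linear_combination (norm := noncomm_ring) h
  · rintro ⟨dA, dE, dF, dG⟩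
    rw [expand, dA, dE, dF, dG]
    noncomm_ring

/-- The effect of a derivation `d` with `d T = T K`, where `K` is supported on rows in the first
block. -/
theorem log_derivation_iff (t : TwoBlock p q A A' G E F) (d : R →+ R)
    (hd : ∀ x y, d (x * y) = d x * y + x * d y) {K : R} (hp : d p = 0) (hq : d q = 0) (pK : p * K = K)
    (Kpq : K * (p + q) = K) :
    d (gaussProd A G E F) = gaussProd A G E F * K ↔
      d A = A * K * p ∧ d E = K * q - K * p * E ∧ d F = 0 ∧ d G = 0 := by
  have dpp : ∀ x y z, d x = 0 → d z = 0 → d (x * y * z) = x * d y * z := by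
    intro x y z hx hz
    rw [hd, hd, hx, hz]; simp
  -- Only the block column of `p` in the product meets `K`. So neither `E` nor `G` occurs on the
  -- right-hand side, and `d G = d F = 0` results.
  have hTK : gaussProd A G E F * K = (A + F * A) * K := by
    rw [← t.gauss_p, mul_assoc, pK]
  have expand : d (gaussProd A G E F) = d A + d A * E + A * d E + d F * A + F * d A + d F * A * E
      + F * d A * E + F * A * d E + d G := by
    simp only [gaussProd, map_add, hd]; noncomm_ring
  rw [hTK]
  constructor
  · intro h
    have dA : d A = A * K * p := by
      have := dpp p (gaussProd A G E F) p hp hp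
      rw [t.p_gauss_p, h] at this
      rw [this]
      simp [mul_add, add_mul, mul_assoc, mul_eq_zero_assoc t.pF, mul_eq_assoc t.pA]
    have dAE : d (A * E) = A * K * q := by
      have := dpp p (gaussProd A G E F) q hp hq
      rw [t.p_gauss_q, h] at this
      rw [this]
      simp [mul_add, add_mul, mul_assoc, mul_eq_zero_assoc t.pF, mul_eq_assoc t.pA]
    have dFA : d (F * A) = F * A * K * p := by
      have := dpp q (gaussProd A G E F) p hq hp
      rw [t.q_gauss_p, h] at this
      rw [this]
      simp [mul_add, add_mul, mul_assoc, mul_eq_assoc t.qF, mul_eq_zero_assoc t.qA]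
    have dE : d E = K * q - K * p * E := by
      have h1 : d E = p * d E := by
        have := hd p E
        rw [t.pE, hp] at this; simpa using this
      rw [h1, ← t.A'A]
      have h2 := hd A E
      rw [dAE, dA] at h2
      have h3 : A * d E = A * (K * q - K * p * E) := by
        linear_combination (norm := noncomm_ring) -h2
      rw [mul_assoc, h3, ← mul_assoc, t.A'A]
      simp only [← mul_assoc, pK, mul_sub]
    have dF : d F = 0 := by
      have h1 : d F = d F * p := by
        have := hd F p
        rw [t.Fp, hp] at this; simpa using this
      rw [h1, ← t.AA']
      have h2 := hd F A
      rw [dFA, dA] at h2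
      have h3 : d F * A = 0 := by
        linear_combination (norm := noncomm_ring) -h2
      rw [← mul_assoc, h3, zero_mul]
    refine ⟨dA, dE, dF, ?_⟩
    rw [expand, dA, dE, dF] at h
    linear_combination (norm := noncomm_ring) h - (A + F * A) * Kpq
  · rintro ⟨dA, dE, dF, dG⟩
    rw [expand, dA, dE, dF, dG]
    linear_combination (norm := noncomm_ring) (A + F * A) * Kpq

end TwoBlock

/-- The inverse of a two-block product is a two-block product with the blocks exchanged. -/
theorem TwoBlock.inverse {p q A A' G G' E F : R} (t : TwoBlock p q A A' G E F)
    (qG' : q * G' = G') (G'q : G' * q = G') (GG' : G * G' = q) (G'G : G' * G = q) :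
    TwoBlock q p G' G A' (-F) (-E) where
  pp := t.qq
  qq := t.pp
  pq := t.qp
  qp := t.pq
  pA := qG'
  Ap := G'q
  pA' := t.qG
  A'p := t.Gq
  AA' := G'G
  A'A := GG'
  pE := by rw [mul_neg, t.qF]
  Eq := by rw [neg_mul, t.Fp]
  qF := by rw [mul_neg, t.pE]
  Fp := by rw [neg_mul, t.Eq]
  qG := t.pA'
  Gq := t.A'p

/-- The product sends `A'` to `p + F` and `G' - E G'` to `G G' = q`, and the claimed inverse is `A'
+ (G' - E G') (q - F)`. The unit obtained is `p + q`, which need not be `1`. -/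
theorem TwoBlock.gauss_mul_inverse {p q A A' G G' E F : R} (t : TwoBlock p q A A' G E F)
    (qG' : q * G' = G') (GG' : G * G' = q) :
    gaussProd A G E F * gaussProd G' A' (-F) (-E) = p + q := by
  have h1 : (p + F) * A * (p + E) + G = gaussProd A G E F := by
    simp [gaussProd, mul_add, add_mul, mul_assoc, t.Ap, t.pA]; abel
  have h3 : gaussProd A G E F * (G' - E * G') = G * G' := by
    rw [← h1]
    have : (p + E) * (G' - E * G') = 0 := by
      have e1 : E * E = 0 := by rw [← mul_eq_zero_assoc t.Ep E, t.pE]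
      have e2 : p * G' = 0 := by rw [← qG', ← mul_assoc, t.pq, zero_mul]
      simp [mul_sub, add_mul, ← mul_assoc, e1, e2, t.pE]
    have e3 : G * E = 0 := by rw [← t.pE, ← mul_assoc, t.Gp, zero_mul]
    rw [add_mul, mul_assoc, this, mul_zero, mul_sub, ← mul_assoc, e3]; simp
  have h4 : gaussProd A G E F * A' = p + F := by
    have e3 : E * A' = 0 := by rw [← t.pA', ← mul_assoc, t.Ep, zero_mul]
    have e4 : G * A' = 0 := by rw [← t.pA', ← mul_assoc, t.Gp, zero_mul]
    simp [gaussProd, add_mul, mul_assoc, t.AA', e3, e4, t.Fp]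
  have h5 : gaussProd G' A' (-F) (-E) = (G' - E * G') - (G' - E * G') * F + A' := by
    rw [gaussProd]; noncomm_ring
  rw [h5, mul_add, mul_sub, ← mul_assoc, h3, h4, GG', t.qF]; abel

end Ring

/-! ### Matrices of series: projections, commutator derivations and the RTT relation -/

section Mat

variable {A : Type*} [Ring A] {I : Type*} [Fintype I] [DecidableEq I]

/-- The diagonal idempotent of the index set `P`. -/
def proj (R : Type*) [Ring R] (P : I → Prop) [DecidablePred P] : Matrix I I R :=
  Matrix.diagonal fun i => if P i then 1 else 0

section proj

variable {R : Type*} [Ring R] {P Q : I → Prop} [DecidablePred P] [DecidablePred Q]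

theorem proj_mul_apply (M : Matrix I I R) (i j : I) :
    (proj R P * M) i j = if P i then M i j else 0 := by
  simp [proj, Matrix.diagonal_mul]

theorem mul_proj_apply (M : Matrix I I R) (i j : I) :
    (M * proj R P) i j = if P j then M i j else 0 := by
  simp [proj, Matrix.mul_diagonal]

theorem proj_mul_eq_iff {M : Matrix I I R} :
    proj R P * M = M ↔ ∀ i j, ¬P i → M i j = 0 := by
  rw [← Matrix.ext_iff]
  simp only [proj_mul_apply]
  exact ⟨fun h i j hi => by rw [← h i j, if_neg hi], fun h i j => by
    split_ifs with hi
    · rfl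
    · exact (h i j hi).symm⟩

theorem mul_proj_eq_iff {M : Matrix I I R} :
    M * proj R P = M ↔ ∀ i j, ¬P j → M i j = 0 := by
  rw [← Matrix.ext_iff]
  simp only [mul_proj_apply]
  exact ⟨fun h i j hi => by rw [← h i j, if_neg hi], fun h i j => by
    split_ifs with hi
    · rfl
    · exact (h i j hi).symm⟩

theorem proj_apply (i j : I) : proj R P i j = if i = j ∧ P i then 1 else 0 := by
  by_cases h : i = j
  · subst h; simp [proj]
  · simp [proj, h]

theorem map_proj {S : Type*} [Ring S] (f : R →+* S) : f.mapMatrix (proj R P) = proj S P := by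
  ext i j; simp [proj_apply]

theorem proj_idem : proj R P * proj R P = proj R P :=
  proj_mul_eq_iff.2 fun i j hi => by simp [proj_apply, hi]

theorem proj_disjoint (h : ∀ i, P i → ¬Q i) : proj R P * proj R Q = 0 := by
  ext i j
  rw [proj_mul_apply, proj_apply]
  have := h i
  simp; tauto

end proj

/-- The derivation `M ↦ (v⁻¹ - u⁻¹) [M, s]` on matrices. -/
noncomputable def dk (s : BiSeries A) : Matrix I I (BiSeries A) →+ Matrix I I (BiSeries A) where
  toFun M := Matrix.of fun i j => kap * (M i j * s - s * M i j)
  map_zero' := by ext i j : 1; simp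
  map_add' M N := by ext i j : 1; simp only [Matrix.of_apply, Matrix.add_apply]; noncomm_ring

theorem dk_apply (s : BiSeries A) (M : Matrix I I (BiSeries A)) (i j : I) :
    dk s M i j = kap * (M i j * s - s * M i j) := rfl

theorem dk_mul (s : BiSeries A) (M N : Matrix I I (BiSeries A)) :
    dk s (M * N) = dk s M * N + M * dk s N := by
  ext i j : 1
  simp only [dk_apply, Matrix.add_apply, Matrix.mul_apply, Finset.sum_mul, Finset.mul_sum,
    ← Finset.sum_sub_distrib, ← Finset.sum_add_distrib]
  refine Finset.sum_congr rfl fun k _ => ?_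
  rw [← mul_assoc (M i k), ← kap_comm (M i k)]
  noncomm_ring

theorem dk_proj (s : BiSeries A) (P : I → Prop) [DecidablePred P] :
    dk s (proj (BiSeries A) P) = 0 := by
  ext i j : 1
  rw [dk_apply, proj_apply]
  split_ifs <;> simp

/-- The series matrix `M(u)`. -/
noncomputable def matU : Matrix I I (PowerSeries A) →+* Matrix I I (BiSeries A) := iu.mapMatrix

/-- The series matrix `M(v)`. -/
noncomputable def matV : Matrix I I (PowerSeries A) →+* Matrix I I (BiSeries A) := iv.mapMatrix

theorem matU_apply (M : Matrix I I (PowerSeries A)) (i j : I) : matU M i j = iu (M i j) := rfl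
theorem matV_apply (M : Matrix I I (PowerSeries A)) (i j : I) : matV M i j = iv (M i j) := rfl

theorem matU_proj (P : I → Prop) [DecidablePred P] :
    matU (proj (PowerSeries A) P) = proj (BiSeries A) P := map_proj _

theorem matV_proj (P : I → Prop) [DecidablePred P] :
    matV (proj (PowerSeries A) P) = proj (BiSeries A) P := map_proj _

/-- The relation `(u - v) [T_{ij}(u), T_{hk}(v)] = ε (T_{hj}(u) T_{ik}(v) - T_{hj}(v) T_{ik}(u))`. -/
def RTT (ε : ℤ) (T : Matrix I I (PowerSeries A)) : Prop :=
  ∀ i j h k, kap * (iu (T i j) * iv (T h k) - iv (T h k) * iu (T i j)) =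
    lam ε * (iu (T h j) * iv (T i k) - iv (T h j) * iu (T i k))

/-- Exchanging the variables together with the two entries changes the sign of `kap` and fixes
`lam`. In this form the right-hand side is an entry of a matrix product `T(v) e T(u) - T(u) e T(v)`.
-/
theorem RTT.swapped {ε : ℤ} {T : Matrix I I (PowerSeries A)} (hT : RTT ε T) (i j h k : I) :
    kap * (iu (T i j) * iv (T h k) - iv (T h k) * iu (T i j)) =
      lam ε * (iv (T i k) * iu (T h j) - iu (T i k) * iv (T h j)) := by
  have := congrArg swapVar (hT h k i j)
  simp only [map_mul, map_sub, swapVar_kap, swapVar_lam, swapVar_iu, swapVar_iv] at this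
  rw [← this]; noncomm_ring

theorem rtt_of_swapped {ε : ℤ} {T : Matrix I I (PowerSeries A)}
    (hT : ∀ i j h k, kap * (iu (T i j) * iv (T h k) - iv (T h k) * iu (T i j)) =
      lam ε * (iv (T i k) * iu (T h j) - iu (T i k) * iv (T h j))) : RTT ε T := by
  intro i j h k
  have := congrArg swapVar (hT h k i j)
  simp only [map_mul, map_sub, swapVar_kap, swapVar_lam, swapVar_iu, swapVar_iv] at this
  rw [← this]; noncomm_ring

theorem mul_single_mul_apply {R : Type*} [Ring R] (M N : Matrix I I R) (k h i j : I) (c : R) :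
    (M * Matrix.single k h c * N) i j = M i k * c * N h j := by
  rw [Matrix.mul_apply, Finset.sum_eq_single h]
  · rw [Matrix.mul_single_apply_same]
  · intro b _ hb
    rw [Matrix.mul_single_apply_of_ne _ _ _ _ _ hb, zero_mul]
  · simp

theorem single_mul_apply' {R : Type*} [Ring R] (N : Matrix I I R) (k h i j : I) (c : R) :
    (Matrix.single k h c * N) i j = if i = k then c * N h j else 0 := by
  rw [← one_mul (Matrix.single k h c), mul_single_mul_apply, Matrix.one_apply]
  split_ifs <;> simp

theorem mul_single_apply' {R : Type*} [Ring R] (M : Matrix I I R) (k h i j : I) (c : R) :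
    (M * Matrix.single k h c) i j = if h = j then M i k * c else 0 := by
  rw [← mul_one (M * Matrix.single k h c), mul_single_mul_apply, Matrix.one_apply]
  split_ifs <;> simp

/-- The relation `RTT` says that the commutators with the entries of `T(v)` act on `T(u)` by
`T(v) e T(u) - T(u) e T(v)`. -/
theorem RTT.dk_eq {ε : ℤ} {T : Matrix I I (PowerSeries A)} (hT : RTT ε T) (h k : I) :
    dk (iv (T h k)) (matU T) = matV T * Matrix.single k h (lam ε) * matU T
      - matU T * Matrix.single k h (lam ε) * matV T := by
  ext i j : 1
  rw [dk_apply, Matrix.sub_apply, mul_single_mul_apply, mul_single_mul_apply]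
  simp only [matU_apply, matV_apply]
  rw [hT.swapped, ← lam_comm, ← lam_comm, mul_sub, mul_assoc, mul_assoc]

theorem rtt_of_dk_eq {ε : ℤ} {T : Matrix I I (PowerSeries A)}
    (hT : ∀ h k, dk (iv (T h k)) (matU T) = matV T * Matrix.single k h (lam ε) * matU T
      - matU T * Matrix.single k h (lam ε) * matV T) : RTT ε T := by
  refine rtt_of_swapped fun i j h k => ?_
  have := congrFun (congrFun (hT h k) i) j
  rw [dk_apply, Matrix.sub_apply, mul_single_mul_apply, mul_single_mul_apply] at this
  simp only [matU_apply, matV_apply] at this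
  rw [this, ← lam_comm, ← lam_comm, mul_sub, mul_assoc, mul_assoc]

theorem TwoBlock.map {R S : Type*} [Ring R] [Ring S] {p q A A' G E F : R}
    (t : TwoBlock p q A A' G E F) (f : R →+* S) :
    TwoBlock (f p) (f q) (f A) (f A') (f G) (f E) (f F) where
  pp := by rw [← map_mul, t.pp]
  qq := by rw [← map_mul, t.qq]
  pq := by rw [← map_mul, t.pq, map_zero]
  qp := by rw [← map_mul, t.qp, map_zero]
  pA := by rw [← map_mul, t.pA]
  Ap := by rw [← map_mul, t.Ap]
  pA' := by rw [← map_mul, t.pA']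
  A'p := by rw [← map_mul, t.A'p]
  AA' := by rw [← map_mul, t.AA']
  A'A := by rw [← map_mul, t.A'A]
  pE := by rw [← map_mul, t.pE]
  Eq := by rw [← map_mul, t.Eq]
  qF := by rw [← map_mul, t.qF]
  Fp := by rw [← map_mul, t.Fp]
  qG := by rw [← map_mul, t.qG]
  Gq := by rw [← map_mul, t.Gq]

theorem map_gaussProd {R S : Type*} [Ring R] [Ring S] (A G E F : R) (f : R →+* S) :
    f (gaussProd A G E F) = gaussProd (f A) (f G) (f E) (f F) := by
  simp [gaussProd]

variable {P Q : I → Prop} [DecidablePred P] [DecidablePred Q]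

/-- Matrices of series with the supports of a two-block factorization. -/
abbrev Blocks (P Q : I → Prop) [DecidablePred P] [DecidablePred Q]
    (M M' G E F : Matrix I I (PowerSeries A)) : Prop :=
  TwoBlock (proj (PowerSeries A) P) (proj (PowerSeries A) Q) M M' G E F

variable {M M' G G' E F : Matrix I I (PowerSeries A)}

theorem Blocks.toU (t : Blocks P Q M M' G E F) :
    TwoBlock (proj (BiSeries A) P) (proj (BiSeries A) Q) (matU M) (matU M') (matU G) (matU E) (matU F) := by
  have := TwoBlock.map t matU
  rwa [matU_proj, matU_proj] at this

theorem Blocks.toV (t : Blocks P Q M M' G E F) :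
    TwoBlock (proj (BiSeries A) P) (proj (BiSeries A) Q) (matV M) (matV M') (matV G) (matV E) (matV F) := by
  have := TwoBlock.map t matV
  rwa [matV_proj, matV_proj] at this

theorem Blocks.gauss_apply (t : Blocks P Q M M' G E F) {i j : I} (hi : P i) (hj : P j) :
    gaussProd M G E F i j = M i j := by
  rw [← congrFun (congrFun t.p_gauss_p i) j, mul_proj_apply, if_pos hj, proj_mul_apply, if_pos hi]

/-- The commutation relations of the entries of the upper left block with the other factors are
equivalent to those of its entries with the entries of the product. -/
theorem Blocks.corner_iff (t : Blocks P Q M M' G E F) (ε : ℤ) {h k : I} (hh : P h) (hk : P k) :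
    dk (iv (M h k)) (matU (gaussProd M G E F)) =
        matV (gaussProd M G E F) * Matrix.single k h (lam ε)
            * matU (gaussProd M G E F)
          - matU (gaussProd M G E F) * Matrix.single k h (lam ε)
            * matV (gaussProd M G E F) ↔
      (dk (iv (M h k)) (matU M) =
          matV M * Matrix.single k h (lam ε) * matU M
          - matU M * Matrix.single k h (lam ε) * matV M) ∧
      (dk (iv (M h k)) (matU E) = Matrix.single k h (lam ε) *
        matV M * (matU E - matV E)) ∧
      (dk (iv (M h k)) (matU F) = (matV F - matU F)
        * matV M * Matrix.single k h (lam ε)) ∧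
      dk (iv (M h k)) (matU G) = 0 := by
  have pe : proj (BiSeries A) P * Matrix.single k h (lam ε) = Matrix.single k h (lam ε) :=
    proj_mul_eq_iff.2 fun i j hi => by
      rw [Matrix.single_apply, if_neg]; rintro ⟨rfl, -⟩; exact hi hk
  have ep : Matrix.single k h (lam ε) * proj (BiSeries A) P = Matrix.single k h (lam ε) :=
    mul_proj_eq_iff.2 fun i j hj => by
      rw [Matrix.single_apply, if_neg]; rintro ⟨-, rfl⟩; exact hj hh
  have tu := Blocks.toU t
  have tv := Blocks.toV t
  -- The matrix unit `e` lies in the corner of `P`, so of each product only the first block column,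
  -- to the left of `e`, and the first block row, to its right, contribute.
  rw [← tu.derivation_iff (dk (iv (M h k))) (dk_mul _) (dk_proj _ _) (dk_proj _ _) pe ep
    tv.qF tv.pA tv.Ap tv.Eq, ← tu.gauss_p, ← tu.p_gauss, ← tv.gauss_p, ← tv.p_gauss]
  simp only [map_gaussProd, mul_assoc, mul_eq_assoc pe, mul_eq_assoc ep]

end Mat

/-! ### Matrices on the tensor square -/

section Legs

variable {R : Type*} [Ring R] {I : Type*} [Fintype I] [DecidableEq I]

/-- A matrix acting in the first tensor position. -/
def lg₁ : Matrix I I R →+* Matrix (I × I) (I × I) R where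
  toFun M := Matrix.of fun x y => if x.2 = y.2 then M x.1 y.1 else 0
  map_zero' := by ext; simp
  map_one' := by
    ext ⟨i, h⟩ ⟨j, k⟩
    simp only [Matrix.of_apply, Matrix.one_apply, Prod.mk.injEq]
    split_ifs <;> simp_all
  map_add' M N := by ext x y; simp only [Matrix.of_apply, Matrix.add_apply]; split_ifs <;> simp
  map_mul' M N := by
    ext ⟨i, h⟩ ⟨j, k⟩
    simp only [Matrix.of_apply, Matrix.mul_apply, Fintype.sum_prod_type]
    by_cases hk : h = k <;> simp [hk]

/-- A matrix acting in the second tensor position. -/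
def lg₂ : Matrix I I R →+* Matrix (I × I) (I × I) R where
  toFun M := Matrix.of fun x y => if x.1 = y.1 then M x.2 y.2 else 0
  map_zero' := by ext; simp
  map_one' := by
    ext ⟨i, h⟩ ⟨j, k⟩
    simp only [Matrix.of_apply, Matrix.one_apply, Prod.mk.injEq]
    split_ifs <;> simp_all
  map_add' M N := by ext x y; simp only [Matrix.of_apply, Matrix.add_apply]; split_ifs <;> simp
  map_mul' M N := by
    ext ⟨i, h⟩ ⟨j, k⟩
    simp only [Matrix.of_apply, Matrix.mul_apply, Fintype.sum_prod_type]
    by_cases hk : i = j <;> simp [hk]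

theorem lg₁_apply (M : Matrix I I R) (i h j k : I) :
    lg₁ M (i, h) (j, k) = if h = k then M i j else 0 := rfl

theorem lg₂_apply (M : Matrix I I R) (i h j k : I) :
    lg₂ M (i, h) (j, k) = if i = j then M h k else 0 := rfl

theorem lg₁_mul_lg₂ (M N : Matrix I I R) (i h j k : I) :
    (lg₁ M * lg₂ N) (i, h) (j, k) = M i j * N h k := by
  simp [Matrix.mul_apply, Fintype.sum_prod_type, lg₁_apply, lg₂_apply]

theorem lg₂_mul_lg₁ (M N : Matrix I I R) (i h j k : I) :
    (lg₂ N * lg₁ M) (i, h) (j, k) = N h k * M i j := by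
  simp [Matrix.mul_apply, Fintype.sum_prod_type, lg₁_apply, lg₂_apply]

/-- A multiple of the matrix that exchanges the tensor positions. -/
def tensorSwap (c : R) : Matrix (I × I) (I × I) R :=
  Matrix.of fun x y => if x.1 = y.2 ∧ x.2 = y.1 then c else 0

theorem tensorSwap_mul_apply (c : R) (M : Matrix (I × I) (I × I) R) (i h : I) (y : I × I) :
    (tensorSwap c * M : Matrix (I × I) (I × I) R) (i, h) y = c * M (h, i) y := by
  simp [Matrix.mul_apply, Fintype.sum_prod_type, tensorSwap, ite_and]

theorem mul_tensorSwap_apply (c : R) (M : Matrix (I × I) (I × I) R) (j k : I) (x : I × I) :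
    (M * tensorSwap c : Matrix (I × I) (I × I) R) x (j, k) = M x (k, j) * c := by
  simp [Matrix.mul_apply, Fintype.sum_prod_type, tensorSwap, ite_and]

theorem tensorSwap_lg₁ {c : R} (hc : ∀ w, c * w = w * c) (M : Matrix I I R) :
    tensorSwap c * lg₁ M = lg₂ M * tensorSwap c := by
  ext ⟨i, h⟩ ⟨j, k⟩
  rw [tensorSwap_mul_apply, mul_tensorSwap_apply, lg₁_apply, lg₂_apply, hc]

theorem tensorSwap_lg₂ {c : R} (hc : ∀ w, c * w = w * c) (M : Matrix I I R) :
    tensorSwap c * lg₂ M = lg₁ M * tensorSwap c := by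
  ext ⟨i, h⟩ ⟨j, k⟩
  rw [tensorSwap_mul_apply, mul_tensorSwap_apply, lg₁_apply, lg₂_apply, hc]

theorem scalar_comm {J : Type*} [Fintype J] [DecidableEq J] {c : R} (hc : ∀ w, c * w = w * c)
    (M : Matrix J J R) : Matrix.scalar J c * M = M * Matrix.scalar J c := by
  ext x y; simp [Matrix.scalar_apply, Matrix.diagonal_mul, Matrix.mul_diagonal, hc]

theorem scalar_mul_apply {J : Type*} [Fintype J] [DecidableEq J] (c : R)
    (M : Matrix J J R) (x y : J) : (Matrix.scalar J c * M) x y = c * M x y := by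
  simp [Matrix.scalar_apply, Matrix.diagonal_mul]

theorem lg_proj_comm (P : I → Prop) [DecidablePred P] (M : Matrix I I R) :
    lg₂ (proj R P) * lg₁ M = lg₁ M * lg₂ (proj R P) := by
  ext ⟨i, h⟩ ⟨j, k⟩
  rw [lg₂_mul_lg₁, lg₁_mul_lg₂, proj_apply]; split_ifs <;> simp

theorem lg_proj_comm' (P : I → Prop) [DecidablePred P] (M : Matrix I I R) :
    lg₁ (proj R P) * lg₂ M = lg₂ M * lg₁ (proj R P) := by
  ext ⟨i, h⟩ ⟨j, k⟩
  rw [lg₂_mul_lg₁, lg₁_mul_lg₂, proj_apply]; split_ifs <;> simp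

end Legs

/-! ### Commutators of off-diagonal factors as identities in a ring -/

section Algebra

variable {R : Type*} [Ring R]

/-- The commutator of the off-diagonal factors of `B = A E`, from the exchange relations of `A` and
`B` and the commutators of `A` and `E`. The subscripts are tensor positions; `E₁` and `E₂u` have the
variable `u`, and `E₂` and `E₁v` have the variable `v`. -/
theorem offdiagonal_commutator {K P A₁ A₂ A₁' A₂' p₁ p₂ E₁ E₂ E₁v E₂u : R}
    (hK : ∀ x, K * x = x * K)
    (hA : K * (A₁ * A₂ - A₂ * A₁) = P * A₁ * A₂ - A₂ * A₁ * P)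
    (hB : K * (A₁ * E₁ * (A₂ * E₂) - A₂ * E₂ * (A₁ * E₁)) =
      P * (A₁ * E₁) * (A₂ * E₂) - A₂ * E₂ * (A₁ * E₁) * P)
    (h₁₂ : K * (A₁ * E₁ * A₂) = K * (A₁ * A₂ * E₁) + A₁ * A₂ * (E₂u - E₂) * P)
    (h₂₁ : K * (A₂ * E₂ * A₁) = K * (A₂ * A₁ * E₂) + A₂ * A₁ * (E₁ - E₁v) * P)
    (hPE₁ : P * E₁ = E₂u * P) (hPE₂ : P * E₂ = E₁v * P) (hPE₁v : P * E₁v = E₂ * P)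
    (hPE₂u : P * E₂u = E₁ * P)
    (hA₁ : A₁' * A₁ = p₁) (hA₂ : A₂' * A₂ = p₂) (hp₂A₁ : p₂ * A₁ = A₁ * p₂)
    (hPp : P * (p₂ * p₁) = p₂ * p₁ * P) (hp : p₂ * p₁ = p₁ * p₂)
    (hE₁ : p₁ * E₁ = E₁) (hE₂ : p₂ * E₂ = E₂) (hE₁v : p₁ * E₁v = E₁v) (hE₂u : p₂ * E₂u = E₂u)
    (h1 : p₂ * E₁ = E₁ * p₂) (h2 : p₁ * E₂ = E₂ * p₁) (h1v : p₂ * E₁v = E₁v * p₂)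
    (h2u : p₁ * E₂u = E₂u * p₁) :
    K * (K * (E₁ * E₂ - E₂ * E₁)) = K * ((E₁ - E₁v) * E₂u - E₂ * (E₁ - E₁v)) * P
      - (E₁ - E₁v) * (E₂u - E₂) * P * P := by
  -- `X` and `Y` are what remains of `K B₁ B₂` and `K B₂ B₁` once `A₁ A₂`, respectively `A₂ A₁`, is
  -- pulled to the left.
  set X := K * (E₁ * E₂) + (E₂u - E₂) * E₁v * P with hX
  set Y := K * (E₂ * E₁) + (E₁ - E₁v) * E₂u * P with hY
  have e1 : K * (A₁ * E₁ * (A₂ * E₂)) = A₁ * A₂ * X := by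
    have := congrArg (· * E₂) h₁₂
    linear_combination (norm := (rw [hX]; noncomm_ring)) this + A₁ * A₂ * (E₂u - E₂) * hPE₂
      + hK (A₁ * A₂) * E₁ * E₂
  have e2 : K * (A₂ * E₂ * (A₁ * E₁)) = A₂ * A₁ * Y := by
    have := congrArg (· * E₁) h₂₁
    linear_combination (norm := (rw [hY]; noncomm_ring)) this + A₂ * A₁ * (E₁ - E₁v) * hPE₁
      + hK (A₂ * A₁) * E₂ * E₁
  -- The hypotheses `hA` and `hB` say `(K - P) A₁ A₂ = A₂ A₁ (K - P)` and the same for `B`. Using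
  -- the first to pass `K - P` through `A₁ A₂` leaves `A₂ A₁` as a common left factor.
  have e3 : A₂ * A₁ * ((K - P) * X - Y * (K - P)) = 0 := by
    linear_combination (norm := noncomm_ring) -hA * X + K * hB - K * e1 + e2 * K + P * e1 - e2 * P
      - hK (A₂ * A₁) * X + K * hK (A₂ * E₂ * (A₁ * E₁)) + hK P * (A₁ * E₁ * (A₂ * E₂))
  have pX : p₂ * p₁ * X = X := by
    rw [hX]
    linear_combination (norm := noncomm_ring) -hK (p₂ * p₁) * E₁ * E₂ + K * p₂ * hE₁ * E₂
      + K * h1 * E₂ + K * E₁ * hE₂ + p₂ * h2u * E₁v * P - p₂ * h2 * E₁v * P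
      + p₂ * (E₂u - E₂) * hE₁v * P + (hE₂u - hE₂) * E₁v * P
  have pY : p₂ * p₁ * Y = Y := by
    rw [hY]
    linear_combination (norm := noncomm_ring) -hK (p₂ * p₁) * E₂ * E₁ + K * p₂ * h2 * E₁
      + K * hE₂ * p₁ * E₁ + K * E₂ * hE₁ + p₂ * (hE₁ - hE₁v) * E₂u * P + (h1 - h1v) * E₂u * P
      + (E₁ - E₁v) * hE₂u * P
  -- Cancellation of `A₂ A₁` by the inverses produces `p₂ p₁`, which acts as the identity on `X` and
  -- `Y`.
  have e4 : (K - P) * X = Y * (K - P) := by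
    linear_combination (norm := noncomm_ring) A₁' * A₂' * e3
      - A₁' * hA₂ * A₁ * ((K - P) * X - Y * (K - P)) - A₁' * hp₂A₁ * ((K - P) * X - Y * (K - P))
      - hA₁ * p₂ * ((K - P) * X - Y * (K - P)) + hp * ((K - P) * X - Y * (K - P))
      + hK (p₂ * p₁) * X - hPp * X - (K - P) * pX + pY * (K - P)
  rw [hX, hY] at e4
  linear_combination (norm := noncomm_ring) e4 - K * hK (E₂ * E₁)
    - hK ((E₁ - E₁v) * E₂u * P) - hK P * (E₁ * E₂) + K * hPE₁ * E₂ + K * E₂u * hPE₂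
    + hPE₂u * E₁v * P + E₁ * hPE₁v * P - hPE₂ * E₁v * P - E₁v * hPE₁v * P

/-- The commutator of `E(u)` and `F(v)` from the relations of `A`, of `A` with `E` and `F`, and of
`B = A E` with `C = F A`. -/
theorem mixed_commutator {K P A₁ A₂ A₁v E₁ E₂ E₂u F₁ F₁v F₂ G₁ G₂ G₂u p₁ E₁v : R}
    (hK : ∀ x, K * x = x * K) (hKc : ∀ x, K * x = 0 → x = 0)
    (hA : K * (A₁ * A₂ - A₂ * A₁) = P * A₁ * A₂ - A₂ * A₁ * P)
    (hBC : K * (A₁ * E₁ * (F₂ * A₂) - F₂ * A₂ * (A₁ * E₁)) =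
      P * (F₁ * A₁ * E₁ + G₁) * A₂ - (F₂ * A₂ * E₂ + G₂) * A₁ * P)
    (h₁₂ : K * (A₁ * E₁ * A₂) = K * (A₁ * A₂ * E₁) + A₁ * A₂ * (E₂u - E₂) * P)
    (h₂₁ : K * (A₂ * E₂ * A₁) = K * (A₂ * A₁ * E₂) + A₂ * A₁ * (E₁ - E₁v) * P)
    (hF : K * (A₁ * F₂) = K * (F₂ * A₁) + p₁ * P * (F₁ - F₁v) * A₁)
    (hpF : p₁ * P * (F₁ - F₁v) * A₁ * A₂ = P * (F₁ - F₁v) * A₁ * A₂)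
    (hPE₁ : P * E₁ = E₂u * P) (hPE₂ : P * E₂ = E₁v * P) (hPE₂u : P * E₂u = E₁ * P)
    (hPF : P * F₁v = F₂ * P)
    (hPG : P * G₁ = G₂u * P) (hPA : P * A₂ = A₁v * P) (hAG : A₁ * G₂ = G₂ * A₁) :
    K * (A₁ * (E₁ * F₂ - F₂ * E₁) * A₂) = (G₂u * A₁v - A₁ * G₂) * P := by
  have e1 : K * (K * (A₁ * F₂ * E₁ * A₂)) =
      K * F₂ * (K * (A₁ * A₂ * E₁) + A₁ * A₂ * (E₂u - E₂) * P)
        + K * (P * (F₁ - F₁v) * A₁ * A₂ * E₁) + P * (F₁ - F₁v) * A₁ * A₂ * (E₂u - E₂) * P := by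
    linear_combination (norm := noncomm_ring) K * hF * E₁ * A₂ + K * F₂ * h₁₂
      + hK (p₁ * P * (F₁ - F₁v)) * A₁ * E₁ * A₂ + p₁ * P * (F₁ - F₁v) * h₁₂
      - hK (p₁ * P * (F₁ - F₁v)) * A₁ * A₂ * E₁ + K * hpF * E₁ + hpF * (E₂u - E₂) * P
      + K * hK F₂ * (A₁ * E₁ * A₂)
  -- The rearrangement `e1` uses two exchange relations and so carries `K` twice. The identity is
  -- therefore checked after one more multiplication by `K`.
  refine sub_eq_zero.1 (hKc _ ?_)
  linear_combination (norm := noncomm_ring) K * hBC - e1 + K * hPG * A₂ + K * G₂u * hPA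
    + K * hAG * P + P * F₁ * h₁₂ + hK (P * F₁) * A₁ * E₁ * A₂ - hK (P * F₁) * A₁ * A₂ * E₁
    - F₂ * h₂₁ * P - hK F₂ * A₂ * E₂ * A₁ * P - K * F₂ * hA * E₁ + K * hK F₂ * A₂ * A₁ * E₁
    + K * hPF * A₁ * A₂ * E₁ + K * F₂ * A₂ * A₁ * hPE₁ + hPF * A₁ * A₂ * (E₂u - E₂) * P
    + F₂ * A₂ * A₁ * (hPE₂u - hPE₂) * P - F₂ * hA * (E₂u - E₂) * P
    - hK F₂ * (A₁ * A₂ - A₂ * A₁) * (E₂u - E₂) * P + hK F₂ * A₂ * A₁ * E₂ * P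

end Algebra

/-! ### Consequences of the `RTT` relation for the factors of a two-block factorization -/

section TwoBlockRelations

variable {A : Type*} [Ring A] {I : Type*} [Fintype I] [DecidableEq I]

/-- The central matrix `v⁻¹ - u⁻¹` on the tensor square. -/
noncomputable def kapMat : Matrix (I × I) (I × I) (BiSeries A) := Matrix.scalar (I × I) kap

theorem kapMat_comm (M : Matrix (I × I) (I × I) (BiSeries A)) : kapMat * M = M * kapMat :=
  scalar_comm kap_comm M

theorem kapMat_mul_apply (M : Matrix (I × I) (I × I) (BiSeries A)) (x y : I × I) :
    (kapMat * M : Matrix (I × I) (I × I) (BiSeries A)) x y = kap * M x y := scalar_mul_apply _ _ _ _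

theorem kapMat_regular (M : Matrix (I × I) (I × I) (BiSeries A)) (h : kapMat * M = 0) : M = 0 := by
  ext x y : 1
  refine kap_regular ?_
  rw [← kapMat_mul_apply, h]; rfl

/-- The swap on the left exchanges the two row indices and on the right the two column indices, so
each entry of this equation is one instance of the relation. -/
theorem RTT.legs {ε : ℤ} {T : Matrix I I (PowerSeries A)} (hT : RTT ε T) :
    kapMat * (lg₁ (matU T) * lg₂ (matV T) - lg₂ (matV T) * lg₁ (matU T)) =
      tensorSwap (lam ε) * lg₁ (matU T) * lg₂ (matV T)
        - lg₂ (matV T) * lg₁ (matU T) * tensorSwap (lam ε) := by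
  ext ⟨i, h⟩ ⟨j, k⟩ : 1
  rw [kapMat_mul_apply, Matrix.sub_apply, Matrix.sub_apply, lg₁_mul_lg₂, lg₂_mul_lg₁,
    mul_assoc (tensorSwap _), tensorSwap_mul_apply, mul_tensorSwap_apply, lg₁_mul_lg₂, lg₂_mul_lg₁,
    ← lam_comm, ← mul_sub]
  exact hT i j h k

/-- Multiply the tensor form by `S₁ S₂` on the left and by `S₂ S₁` on the right. This leaves `S₁ S₂
P₀ - P₀ S₂ S₁`, with the swap on the opposite sides, which is the swapped form with the sign of `ε`
reversed. Inverses are taken in the corner of an idempotent, since the remainders of a factorization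
are supported on part of the indices. -/
theorem RTT.inverse {ε : ℤ} {P : I → Prop} [DecidablePred P] {T S : Matrix I I (PowerSeries A)}
    (hT : RTT ε T) (hTS : T * S = proj _ P) (hST : S * T = proj _ P) (hS : proj _ P * S = S)
    (hS' : S * proj _ P = S) : RTT (-ε) S := by
  have h := hT.legs
  set P₀ : Matrix (I × I) (I × I) (BiSeries A) := tensorSwap (lam ε) with hP₀
  set p₁ := lg₁ (proj (BiSeries A) P) with hp₁
  set p₂ := lg₂ (proj (BiSeries A) P) with hp₂
  have a1 : lg₁ (matU T) * lg₁ (matU S) = p₁ := by rw [← map_mul, ← map_mul, hTS, matU_proj]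
  have a2 : lg₁ (matU S) * lg₁ (matU T) = p₁ := by rw [← map_mul, ← map_mul, hST, matU_proj]
  have b1 : lg₂ (matV T) * lg₂ (matV S) = p₂ := by rw [← map_mul, ← map_mul, hTS, matV_proj]
  have b2 : lg₂ (matV S) * lg₂ (matV T) = p₂ := by rw [← map_mul, ← map_mul, hST, matV_proj]
  have a3 : p₁ * lg₁ (matU S) = lg₁ (matU S) := by
    rw [hp₁, ← matU_proj, ← map_mul, ← map_mul, hS]
  have a4 : lg₁ (matU S) * p₁ = lg₁ (matU S) := by
    rw [hp₁, ← matU_proj, ← map_mul, ← map_mul, hS']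
  have b3 : p₂ * lg₂ (matV S) = lg₂ (matV S) := by
    rw [hp₂, ← matV_proj, ← map_mul, ← map_mul, hS]
  have b4 : lg₂ (matV S) * p₂ = lg₂ (matV S) := by
    rw [hp₂, ← matV_proj, ← map_mul, ← map_mul, hS']
  have c1 := lg_proj_comm P (matU T)
  have c1' := lg_proj_comm P (matU S)
  have c2 := lg_proj_comm' P (matV T)
  have c2' := lg_proj_comm' P (matV S)
  have f1 : P₀ * p₁ = p₂ * P₀ := tensorSwap_lg₁ (lam_comm ε) _
  have f2 : P₀ * p₂ = p₁ * P₀ := tensorSwap_lg₂ (lam_comm ε) _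
  rw [← hp₂] at c1 c1'
  rw [← hp₁] at c2 c2'
  generalize lg₁ (matU T) = T₁ at *
  generalize hS₁ : lg₁ (matU S) = S₁ at *
  generalize lg₂ (matV T) = T₂ at *
  generalize hS₂ : lg₂ (matV S) = S₂ at *
  -- Matrices in different tensor positions do not commute when their entries do not, but a
  -- projection in one position commutes with everything in the other.
  have r1 : T₁ * T₂ * S₂ * S₁ = p₁ * p₂ := by
    linear_combination (norm := noncomm_ring) T₁ * b1 * S₁ + T₁ * c1' + a1 * p₂
  have r2 : S₁ * S₂ * T₂ * T₁ = p₁ * p₂ := by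
    linear_combination (norm := noncomm_ring) S₁ * b2 * T₁ + S₁ * c1 + a2 * p₂
  have r3 : p₁ * p₂ * S₂ * S₁ = S₂ * S₁ := by
    linear_combination (norm := noncomm_ring) p₁ * b3 * S₁ + c2' * S₁ + S₂ * a3
  have r4 : S₁ * S₂ * (p₁ * p₂) = S₁ * S₂ := by
    linear_combination (norm := noncomm_ring) -S₁ * c2' * p₂ + a4 * S₂ * p₂ + S₁ * b4
  have r5 : P₀ * (p₁ * p₂) = p₁ * p₂ * P₀ := by
    have : p₂ * p₁ = p₁ * p₂ := lg_proj_comm P _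
    linear_combination (norm := noncomm_ring) f1 * p₂ + p₂ * f2 + this * P₀
  have key : kapMat * (S₁ * S₂ - S₂ * S₁) = S₁ * S₂ * P₀ - P₀ * (S₂ * S₁) := by
    linear_combination (norm := noncomm_ring) S₁ * S₂ * h * S₂ * S₁
      + kapMat_comm (S₁ * S₂) * (T₁ * T₂ - T₂ * T₁) * S₂ * S₁
      + kapMat * S₁ * S₂ * (-r1) + kapMat * r2 * S₂ * S₁ - kapMat * r4 + kapMat * r3
      + S₁ * S₂ * P₀ * r1 - r2 * P₀ * S₂ * S₁ + S₁ * S₂ * r5 + r4 * P₀ + r5 * S₂ * S₁ - P₀ * r3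
  refine rtt_of_swapped fun i j h k => ?_
  have := congrFun (congrFun key (i, h)) (j, k)
  rw [← hS₁, ← hS₂, hP₀, kapMat_mul_apply, Matrix.sub_apply, Matrix.sub_apply, lg₁_mul_lg₂,
    lg₂_mul_lg₁, tensorSwap_mul_apply, mul_tensorSwap_apply, lg₁_mul_lg₂, lg₂_mul_lg₁, ← lam_comm,
    ← mul_sub] at this
  simp only [matU_apply, matV_apply] at this
  rw [this, lam_neg]; noncomm_ring

variable {P Q : I → Prop} [DecidablePred P] [DecidablePred Q]
  {M M' G G' E F : Matrix I I (PowerSeries A)} {ε : ℤ}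

theorem Blocks.row_eq_zero_of_proj {R : Type*} [Ring R] {N : Matrix I I R}
    (h : proj R P * N = N) {i j : I} (hi : ¬P i) : N i j = 0 := proj_mul_eq_iff.1 h i j hi

theorem Blocks.col_eq_zero_of_proj {R : Type*} [Ring R] {N : Matrix I I R}
    (h : N * proj R P = N) {i j : I} (hi : ¬P j) : N i j = 0 := mul_proj_eq_iff.1 h i j hi

theorem Blocks.corner (t : Blocks P Q M M' G E F) (hT : RTT ε (gaussProd M G E F)) {h k : I}
    (hh : P h) (hk : P k) :
      (dk (iv (M h k)) (matU M) = matV M * Matrix.single k h (lam ε) * matU M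
          - matU M * Matrix.single k h (lam ε) * matV M) ∧
      (dk (iv (M h k)) (matU E) = Matrix.single k h (lam ε) * matV M * (matU E - matV E)) ∧
      (dk (iv (M h k)) (matU F) = (matV F - matU F) * matV M * Matrix.single k h (lam ε)) ∧
      dk (iv (M h k)) (matU G) = 0 := by
  rw [← Blocks.corner_iff t ε hh hk, ← Blocks.gauss_apply t hh hk]
  exact hT.dk_eq h k

/-- For indices in `P` this is the first component of `Blocks.corner`. For other indices both sides
vanish because of the support of `M`. -/
theorem Blocks.rtt_corner (t : Blocks P Q M M' G E F) (hT : RTT ε (gaussProd M G E F)) :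
    RTT ε M := by
  refine rtt_of_dk_eq fun h k => ?_
  by_cases hh : P h
  · by_cases hk : P k
    · exact (Blocks.corner t hT hh hk).1
    · have pe : Matrix.single k h (lam ε) = Matrix.single k h (lam ε) * proj (BiSeries A) P := by
        refine (mul_proj_eq_iff.2 fun i j hj => ?_).symm
        rw [Matrix.single_apply, if_neg]; rintro ⟨-, rfl⟩; exact hj hh
      have e1 : ∀ N : Matrix I I (BiSeries A), N * proj _ P = N →
          N * Matrix.single k h (lam ε) = 0 := fun N hN => by
        ext i j : 1
        rw [mul_single_apply', Blocks.col_eq_zero_of_proj hN hk]; simp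
      rw [e1 _ (Blocks.toU t).Ap, e1 _ (Blocks.toV t).Ap, Blocks.col_eq_zero_of_proj t.Ap hk]
      ext i j : 1
      simp [dk_apply]
  · have e1 : ∀ N : Matrix I I (BiSeries A), proj _ P * N = N →
        Matrix.single k h (lam ε) * N = 0 := fun N hN => by
      ext i j : 1
      rw [single_mul_apply', Blocks.row_eq_zero_of_proj hN hh]; simp
    rw [mul_assoc, mul_assoc, e1 _ (Blocks.toU t).pA, e1 _ (Blocks.toV t).pA,
      Blocks.row_eq_zero_of_proj t.pA hh]
    ext i j : 1
    simp [dk_apply]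

/-- `(u - v) [E_{ij}(u), A_{hk}(v)]` -/
theorem Blocks.E_M (t : Blocks P Q M M' G E F) (hT : RTT ε (gaussProd M G E F)) (i j h : I) {k : I}
    (hk : P k) : kap * (iu (E i j) * iv (M h k) - iv (M h k) * iu (E i j)) =
      if i = k then lam ε * (matV M * (matU E - matV E)) h j else 0 := by
  by_cases hh : P h
  · have := congrFun (congrFun (Blocks.corner t hT hh hk).2.1 i) j
    rw [dk_apply, mul_assoc, single_mul_apply'] at this
    exact this
  · have e1 : (matV M * (matU E - matV E)) h j = 0 :=
      Blocks.row_eq_zero_of_proj (P := P) (by rw [← mul_assoc, (Blocks.toV t).pA]) hh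
    rw [e1, Blocks.row_eq_zero_of_proj t.pA hh]; simp

/-- `(u - v) [F_{ij}(u), A_{hk}(v)]` -/
theorem Blocks.F_M (t : Blocks P Q M M' G E F) (hT : RTT ε (gaussProd M G E F)) (i j k : I) {h : I}
    (hh : P h) : kap * (iu (F i j) * iv (M h k) - iv (M h k) * iu (F i j)) =
      if h = j then lam ε * ((matV F - matU F) * matV M) i k else 0 := by
  by_cases hk : P k
  · have := congrFun (congrFun (Blocks.corner t hT hh hk).2.2.1 i) j
    rw [dk_apply, mul_single_apply', ← lam_comm] at this
    exact this
  · have e1 : ((matV F - matU F) * matV M) i k = 0 :=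
      Blocks.col_eq_zero_of_proj (P := P) (by rw [mul_assoc, (Blocks.toV t).Ap]) hk
    rw [e1, Blocks.col_eq_zero_of_proj t.Ap hk]; simp

theorem Blocks.G_M (t : Blocks P Q M M' G E F) (hT : RTT ε (gaussProd M G E F)) (i j h k : I) :
    iu (G i j) * iv (M h k) = iv (M h k) * iu (G i j) := by
  by_cases hh : P h
  · by_cases hk : P k
    · have := congrFun (congrFun (Blocks.corner t hT hh hk).2.2.2 i) j
      rw [dk_apply] at this
      exact sub_eq_zero.1 (kap_regular this)
    · rw [Blocks.col_eq_zero_of_proj t.Ap hk]; simp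
  · rw [Blocks.row_eq_zero_of_proj t.pA hh]; simp

theorem matU_sub_matV_swap (N N' : Matrix I I (PowerSeries A)) (i j : I) :
    swapVar ((matV N * (matU N' - matV N')) i j) = (matU N * (matV N' - matU N')) i j := by
  simp [Matrix.mul_apply, matU_apply, matV_apply, swapVar_iu, swapVar_iv]

theorem matU_sub_matV_swap' (N N' : Matrix I I (PowerSeries A)) (i j : I) :
    swapVar (((matV N' - matU N') * matV N) i j) = ((matU N' - matV N') * matU N) i j := by
  simp [Matrix.mul_apply, matU_apply, matV_apply, swapVar_iu, swapVar_iv]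

/-- `(u - v) [A_{ij}(u), E_{hk}(v)]` -/
theorem Blocks.M_E (t : Blocks P Q M M' G E F) (hT : RTT ε (gaussProd M G E F)) (i h k : I) {j : I}
    (hj : P j) : kap * (iu (M i j) * iv (E h k) - iv (E h k) * iu (M i j)) =
      if h = j then lam ε * (matU M * (matV E - matU E)) i k else 0 := by
  have := congrArg swapVar (Blocks.E_M t hT h k i hj)
  rw [apply_ite swapVar, map_mul, map_mul, matU_sub_matV_swap, swapVar_kap, swapVar_lam] at this
  simp only [map_sub, map_mul, swapVar_iu, swapVar_iv, map_zero] at this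
  rw [← this]; noncomm_ring

/-- `(u - v) [A_{ij}(u), F_{hk}(v)]` -/
theorem Blocks.M_F (t : Blocks P Q M M' G E F) (hT : RTT ε (gaussProd M G E F)) (j h k : I) {i : I}
    (hi : P i) : kap * (iu (M i j) * iv (F h k) - iv (F h k) * iu (M i j)) =
      if i = k then lam ε * ((matU F - matV F) * matU M) h j else 0 := by
  have := congrArg swapVar (Blocks.F_M t hT h k j hi)
  rw [apply_ite swapVar, map_mul, map_mul, matU_sub_matV_swap', swapVar_kap, swapVar_lam] at this
  simp only [map_sub, map_mul, swapVar_iu, swapVar_iv, map_zero] at this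
  rw [← this]; noncomm_ring

end TwoBlockRelations

/-! ### The Schur complement and relations on the tensor square -/

section TwoBlockRelations

variable {A : Type*} [Ring A] {I : Type*} [Fintype I] [DecidableEq I]

/-- `G'` is the inverse of `G` in the corner of the idempotent `p`. -/
structure CornerInverse {R : Type*} [Ring R] (p G G' : R) : Prop where
  left : p * G' = G'
  right : G' * p = G'
  mul : G * G' = p
  mul' : G' * G = p

variable {P Q : I → Prop} [DecidablePred P] [DecidablePred Q]
  {M M' G G' E F : Matrix I I (PowerSeries A)} {ε : ℤ}

theorem proj_add_proj {R : Type*} [Ring R] (h : ∀ i, P i → ¬Q i) :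
    proj R P + proj R Q = proj R fun i => P i ∨ Q i := by
  ext i j
  have := h i
  rw [Matrix.add_apply, proj_apply, proj_apply, proj_apply]
  by_cases hij : i = j <;> by_cases hP : P i <;> by_cases hQ : Q i <;> simp_all

theorem Blocks.inverse (t : Blocks P Q M M' G E F) (g : CornerInverse (proj _ Q) G G') :
    Blocks Q P G' G M' (-F) (-E) :=
  TwoBlock.inverse t g.left g.right g.mul g.mul'

theorem Blocks.rtt_inverse (t : Blocks P Q M M' G E F) (g : CornerInverse (proj _ Q) G G')
    (hPQ : ∀ i, P i → ¬Q i) (hT : RTT ε (gaussProd M G E F)) :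
    RTT (-ε) (gaussProd G' M' (-F) (-E)) := by
  have t' := Blocks.inverse t g
  have h1 := TwoBlock.gauss_mul_inverse t g.left g.mul
  have h2 := TwoBlock.gauss_mul_inverse t' t.pA t.A'A
  rw [neg_neg, neg_neg, add_comm] at h2
  have h3 := t'.gauss_supp_left
  have h4 := t'.gauss_supp_right
  rw [add_comm] at h3 h4
  rw [proj_add_proj hPQ] at h1 h2 h3 h4
  exact hT.inverse h1 h2 h3 h4

/-- In the inverse product the corner is `G'`, so `G'` satisfies RTT with `-ε`. A second inversion
restores the sign. -/
theorem Blocks.rtt_schur (t : Blocks P Q M M' G E F) (g : CornerInverse (proj _ Q) G G')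
    (hPQ : ∀ i, P i → ¬Q i) (hT : RTT ε (gaussProd M G E F)) : RTT ε G := by
  have h1 := Blocks.rtt_corner (Blocks.inverse t g) (Blocks.rtt_inverse t g hPQ hT)
  have h2 := h1.inverse g.mul' g.mul t.qG t.Gq
  rwa [neg_neg] at h2

/-- The derivative of an inverse, inside the corner of `p`. -/
theorem dk_of_inverse {p N N' : Matrix I I (BiSeries A)} (s : BiSeries A) (hp : dk s p = 0)
    (hN : N * p = N) (h : N * N' = p) (hN' : N' * N = p) : dk s N = -(N * dk s N' * N) := by
  have h1 := dk_mul s N N'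
  rw [h, hp] at h1
  have h2 := dk_mul s N p
  rw [hN, hp] at h2
  linear_combination (norm := noncomm_ring) -h1 * N + dk s N * (-hN') + h2

/-- `(u - v) [G_{ij}(u), E_{hk}(v)]` -/
theorem Blocks.G_E (t : Blocks P Q M M' G E F) (g : CornerInverse (proj _ Q) G G')
    (hPQ : ∀ i, P i → ¬Q i) (hT : RTT ε (gaussProd M G E F)) (i j h k : I) :
    kap * (iu (G i j) * iv (E h k) - iv (E h k) * iu (G i j)) =
      lam ε * (iu (G i k) * (iu (E h j) - iv (E h j))) := by
  have t' := Blocks.inverse t g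
  have hS := Blocks.rtt_inverse t g hPQ hT
  by_cases hk : Q k
  -- In the inverse product `G'` is the first corner and `-E` the lower left factor, so `Blocks.M_F`
  -- with parameter `-ε` gives the commutators of `G'` with `E`. They are carried over to `G` by
  -- differentiating the inverse.
  · have h1 : dk (iv (E h k)) (matU G') =
        Matrix.single k h (lam ε) * ((matV E - matU E) * matU G') := by
      ext i j : 1
      rw [dk_apply, single_mul_apply']
      by_cases hi : Q i
      · have := Blocks.M_F t' hS j h k hi
        rw [Matrix.neg_apply, map_neg, lam_neg, map_neg, map_neg, neg_sub_neg] at this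
        rw [matU_apply]
        split_ifs at this ⊢ with hik
        · linear_combination (norm := noncomm_ring) -this
        · linear_combination (norm := noncomm_ring) -this
      · rw [matU_apply, Blocks.row_eq_zero_of_proj t'.pA hi, if_neg (by rintro rfl; exact hi hk)]
        simp
    have h2 := dk_of_inverse (iv (E h k)) (dk_proj _ Q) (Blocks.toU t).Gq (Blocks.toU t').A'A
      (Blocks.toU t').AA'
    rw [h1] at h2
    have h3 : matU G * (Matrix.single k h (lam ε) * ((matV E - matU E) * matU G')) * matU G =
        matU G * Matrix.single k h (lam ε) * (matV E - matU E) := by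
      simp only [mul_assoc, (Blocks.toU t').AA', sub_mul, (Blocks.toU t).Eq, (Blocks.toV t).Eq]
    rw [h3] at h2
    have := congrFun (congrFun h2 i) j
    rw [dk_apply, Matrix.neg_apply, mul_single_mul_apply, ← lam_comm] at this
    simp only [matU_apply, matV_apply, Matrix.sub_apply] at this
    rw [this]; noncomm_ring
  · rw [Blocks.col_eq_zero_of_proj t.Eq hk, Blocks.col_eq_zero_of_proj t.Gq hk]; simp

theorem mul_lg₁_proj_apply {R : Type*} [Ring R] (N : Matrix (I × I) (I × I) R) (x : I × I)
    (j k : I) : (N * lg₁ (proj R P)) x (j, k) = if P j then N x (j, k) else 0 := by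
  rw [Matrix.mul_apply, Finset.sum_eq_single (j, k)]
  · rw [lg₁_apply, proj_apply]; simp
  · rintro ⟨a, b⟩ - hab
    rw [lg₁_apply, proj_apply]
    split_ifs <;> simp_all
  · simp

theorem mul_lg₂_proj_apply {R : Type*} [Ring R] (N : Matrix (I × I) (I × I) R) (x : I × I)
    (j k : I) : (N * lg₂ (proj R P)) x (j, k) = if P k then N x (j, k) else 0 := by
  rw [Matrix.mul_apply, Finset.sum_eq_single (j, k)]
  · rw [lg₂_apply, proj_apply]; simp
  · rintro ⟨a, b⟩ - hab
    rw [lg₂_apply, proj_apply]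
    split_ifs <;> simp_all
  · simp

theorem lg₁_proj_mul_apply {R : Type*} [Ring R] (N : Matrix (I × I) (I × I) R) (y : I × I)
    (i h : I) : (lg₁ (proj R P) * N) (i, h) y = if P i then N (i, h) y else 0 := by
  rw [Matrix.mul_apply, Finset.sum_eq_single (i, h)]
  · rw [lg₁_apply, proj_apply]; simp
  · rintro ⟨a, b⟩ - hab
    rw [lg₁_apply, proj_apply]
    split_ifs <;> simp_all
  · simp

/-- The projection at the end is needed because the relation holds with this right-hand side only
for `k` in `P`; for other `k` the left-hand side is zero since `M` has no such column. -/
theorem Blocks.E_M_legs (t : Blocks P Q M M' G E F) (hT : RTT ε (gaussProd M G E F)) :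
    kapMat * (lg₁ (matU E) * lg₂ (matV M) - lg₂ (matV M) * lg₁ (matU E)) =
      lg₂ (matV M) * (lg₂ (matU E) - lg₂ (matV E)) * tensorSwap (lam ε) *
        lg₂ (proj (BiSeries A) P) := by
  ext ⟨i, h⟩ ⟨j, k⟩ : 1
  rw [kapMat_mul_apply, Matrix.sub_apply, lg₁_mul_lg₂, lg₂_mul_lg₁, mul_lg₂_proj_apply,
    mul_tensorSwap_apply, ← map_sub, ← map_mul, lg₂_apply, ← lam_comm, mul_ite, mul_zero]
  by_cases hk : P k
  · rw [if_pos hk]; exact Blocks.E_M t hT i j h hk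
  · rw [if_neg hk, matV_apply, Blocks.col_eq_zero_of_proj t.Ap hk]; simp

theorem Blocks.M_E_legs (t : Blocks P Q M M' G E F) (hT : RTT ε (gaussProd M G E F)) :
    kapMat * (lg₂ (matV E) * lg₁ (matU M) - lg₁ (matU M) * lg₂ (matV E)) =
      lg₁ (matU M) * (lg₁ (matU E) - lg₁ (matV E)) * tensorSwap (lam ε) *
        lg₁ (proj (BiSeries A) P) := by
  ext ⟨i, h⟩ ⟨j, k⟩ : 1
  rw [kapMat_mul_apply, Matrix.sub_apply, lg₁_mul_lg₂, lg₂_mul_lg₁, mul_lg₁_proj_apply,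
    mul_tensorSwap_apply, ← map_sub, ← map_mul, lg₁_apply, ← lam_comm, mul_ite, mul_zero]
  by_cases hk : P j
  · have := Blocks.M_E t hT i h k hk
    rw [if_pos hk, matU_apply, matV_apply, ← neg_sub, mul_neg, this, ← neg_sub (matV E), mul_neg]
    split_ifs <;> simp
  · rw [if_neg hk, matU_apply, Blocks.col_eq_zero_of_proj t.Ap hk]; simp

theorem Blocks.M_F_legs (t : Blocks P Q M M' G E F) (hT : RTT ε (gaussProd M G E F)) :
    kapMat * (lg₁ (matU M) * lg₂ (matV F) - lg₂ (matV F) * lg₁ (matU M)) =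
      lg₁ (proj (BiSeries A) P) * tensorSwap (lam ε) *
        ((lg₁ (matU F) - lg₁ (matV F)) * lg₁ (matU M)) := by
  ext ⟨i, h⟩ ⟨j, k⟩ : 1
  rw [kapMat_mul_apply, Matrix.sub_apply, lg₁_mul_lg₂, lg₂_mul_lg₁, mul_assoc, lg₁_proj_mul_apply,
    tensorSwap_mul_apply, ← map_sub, ← map_mul, lg₁_apply, mul_ite, mul_zero]
  by_cases hi : P i
  · rw [if_pos hi]; exact Blocks.M_F t hT j h k hi
  · rw [if_neg hi, matU_apply, Blocks.row_eq_zero_of_proj t.pA hi]; simp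

/-- Multiplication by `M(u)` on the left removes the trailing projection. The swap turns it into a
projection in the other tensor position, which passes to the left and is absorbed by `M(u)`. -/
theorem Blocks.E_M_dressed (t : Blocks P Q M M' G E F) (hT : RTT ε (gaussProd M G E F)) :
    kapMat * (lg₁ (matU M) * lg₁ (matU E) * lg₂ (matV M)) =
      kapMat * (lg₁ (matU M) * lg₂ (matV M) * lg₁ (matU E)) +
        lg₁ (matU M) * lg₂ (matV M) * (lg₂ (matU E) - lg₂ (matV E)) * tensorSwap (lam ε) := by
  have h := Blocks.E_M_legs t hT
  have h1 : lg₁ (matU M) * lg₁ (proj (BiSeries A) P) = lg₁ (matU M) := by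
    rw [← map_mul, (Blocks.toU t).Ap]
  have h2 := lg_proj_comm' P (matV M)
  have h3 := lg_proj_comm' P (matU E)
  have h4 := lg_proj_comm' P (matV E)
  have h5 := tensorSwap_lg₂ (lam_comm ε) (proj (BiSeries A) P)
  linear_combination (norm := noncomm_ring) lg₁ (matU M) * h
    + kapMat_comm (lg₁ (matU M)) * (lg₁ (matU E) * lg₂ (matV M) - lg₂ (matV M) * lg₁ (matU E))
    + lg₁ (matU M) * lg₂ (matV M) * (lg₂ (matU E) - lg₂ (matV E)) * h5
    - lg₁ (matU M) * lg₂ (matV M) * (h3 - h4) * tensorSwap (lam ε)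
    - lg₁ (matU M) * h2 * (lg₂ (matU E) - lg₂ (matV E)) * tensorSwap (lam ε)
    + h1 * lg₂ (matV M) * (lg₂ (matU E) - lg₂ (matV E)) * tensorSwap (lam ε)

theorem Blocks.M_E_dressed (t : Blocks P Q M M' G E F) (hT : RTT ε (gaussProd M G E F)) :
    kapMat * (lg₂ (matV M) * lg₂ (matV E) * lg₁ (matU M)) =
      kapMat * (lg₂ (matV M) * lg₁ (matU M) * lg₂ (matV E)) +
        lg₂ (matV M) * lg₁ (matU M) * (lg₁ (matU E) - lg₁ (matV E)) * tensorSwap (lam ε) := by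
  have h := Blocks.M_E_legs t hT
  have h1 : lg₂ (matV M) * lg₂ (proj (BiSeries A) P) = lg₂ (matV M) := by
    rw [← map_mul, (Blocks.toV t).Ap]
  have h2 := lg_proj_comm P (matU M)
  have h3 := lg_proj_comm P (matU E)
  have h4 := lg_proj_comm P (matV E)
  have h5 := tensorSwap_lg₁ (lam_comm ε) (proj (BiSeries A) P)
  linear_combination (norm := noncomm_ring) lg₂ (matV M) * h
    + kapMat_comm (lg₂ (matV M)) * (lg₂ (matV E) * lg₁ (matU M) - lg₁ (matU M) * lg₂ (matV E))
    + lg₂ (matV M) * lg₁ (matU M) * (lg₁ (matU E) - lg₁ (matV E)) * h5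
    - lg₂ (matV M) * lg₁ (matU M) * (h3 - h4) * tensorSwap (lam ε)
    - lg₂ (matV M) * h2 * (lg₁ (matU E) - lg₁ (matV E)) * tensorSwap (lam ε)
    + h1 * lg₁ (matU M) * (lg₁ (matU E) - lg₁ (matV E)) * tensorSwap (lam ε)

end TwoBlockRelations

/-! ### The commutators of E with E and of E with F -/

section TwoBlockRelations

variable {A : Type*} [Ring A] {I : Type*} [Fintype I] [DecidableEq I]

/-- A family of two-variable series with `(v⁻¹ - u⁻¹) z = u⁻¹ v⁻¹ (z' - c'(v))`, where the prime
is a permutation of the indices, vanishes. -/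
theorem eq_zero_of_kap_mul_eq {ι : Type*} (τ : ι → ι) {ε : ℤ} (hε : ε * ε = 1)
    (z : ι → BiSeries A) (c : ι → PowerSeries A) (hτ : ∀ a, τ (τ a) = a)
    (h : ∀ a, kap * z a = lam ε * (z (τ a) - iv (c (τ a)))) (a : ι) : z a = 0 := by
  have h' := fun a => (kap_mul_eq_lam_mul_iff ε _ _).1 (h a)
  have hε' : ∀ x : A, ε • x = 0 → x = 0 := fun x hx => by
    rw [← one_smul ℤ x, ← hε, mul_smul, hx, smul_zero]
  have h1 : ∀ a s, cf 1 s (z a) = -(ε • coeff s (c (τ a))) := fun a s => by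
    have := (h' a).2.2 0 s
    rw [(h' a).1, map_sub, (h' (τ a)).1, cf_iv, if_pos rfl] at this
    simpa using this
  have h2 : ∀ a r s, cf (r + 2) s (z a) = cf (r + 1) (s + 1) (z a) + ε • cf (r + 1) s (z (τ a)) :=
    fun a r s => by
      have := (h' a).2.2 (r + 1) s
      rw [map_sub, cf_iv, if_neg (by omega), sub_zero] at this
      rw [← this]; abel
  have hc : ∀ N a, coeff N (c a) = 0 := by
    intro N
    induction N using Nat.strong_induction_on with
    | _ N ih =>
      -- If the coefficients of all `c` below `N` vanish, the recursion moves the value in row `1`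
      -- along antidiagonals unchanged. The column `v⁰` of `z` is zero, which forces the coefficient
      -- `N` of `c` to vanish as well.
      have h3 : ∀ r a s, r + s ≤ N → cf (r + 1) s (z a) = -(ε • coeff (r + s) (c (τ a))) := by
        intro r
        induction r with
        | zero => intro a s _; rw [h1, zero_add]
        | succ r ihr =>
          intro a s hrs
          rw [h2, ihr _ _ (by omega), ihr _ _ (by omega), ih (r + s) (by omega)]
          simp [add_right_comm, add_assoc]
      intro a
      have := h3 N (τ a) 0 le_rfl
      rw [(h' _).2.1, hτ, add_zero] at this
      exact hε' _ (neg_eq_zero.1 this.symm)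
  apply bi_ext
  intro r
  suffices ∀ a s, cf r s (z a) = 0 by intro s; rw [map_zero]; exact this a s
  induction r using Nat.strong_induction_on with
  | _ r ih =>
    intro a s
    match r with
    | 0 => exact (h' a).1 s
    | 1 => rw [h1, hc]; simp
    | r + 2 => rw [h2, ih _ (by omega), ih _ (by omega)]; simp

/-- In each instance both sides involve the same two rows and the same two columns, so the relation
passes to any rectangular part. Here it is used for `M * E`, the upper right part of the product. -/
theorem RTT.restrict {ε : ℤ} {T : Matrix I I (PowerSeries A)} (hT : RTT ε T) (P Q : I → Prop)
    [DecidablePred P] [DecidablePred Q] : RTT ε (proj _ P * T * proj _ Q) := by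
  intro i j h k
  simp only [mul_proj_apply, proj_mul_apply]
  by_cases hi : P i <;> by_cases hj : Q j <;> by_cases hh : P h <;> by_cases hk : Q k <;>
    simp [hi, hj, hh, hk, hT i j h k]

variable {P Q : I → Prop} [DecidablePred P] [DecidablePred Q]
  {M M' G G' E F : Matrix I I (PowerSeries A)} {ε : ℤ}

/-- `(u - v) [E_{ij}(u), E_{hk}(v)]` -/
theorem Blocks.E_E (t : Blocks P Q M M' G E F) (hε : ε * ε = 1) (hT : RTT ε (gaussProd M G E F))
    (i j h k : I) : kap * (iu (E i j) * iv (E h k) - iv (E h k) * iu (E i j)) =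
      lam ε * ((iu (E i k) - iv (E i k)) * (iu (E h j) - iv (E h j))) := by
  have tu := Blocks.toU t
  have tv := Blocks.toV t
  have hB := (hT.restrict P Q).legs
  rw [TwoBlock.p_gauss_q t] at hB
  simp only [map_mul] at hB
  have key := offdiagonal_commutator (K := kapMat) (P := tensorSwap (lam ε))
    (A₁' := lg₁ (matU M')) (A₂' := lg₂ (matV M'))
    (p₁ := lg₁ (proj _ P)) (p₂ := lg₂ (proj _ P)) (E₁v := lg₁ (matV E)) (E₂u := lg₂ (matU E))
    kapMat_comm (Blocks.rtt_corner t hT).legs hB (Blocks.E_M_dressed t hT) (Blocks.M_E_dressed t hT)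
    (tensorSwap_lg₁ (lam_comm ε) _) (tensorSwap_lg₂ (lam_comm ε) _)
    (tensorSwap_lg₁ (lam_comm ε) _) (tensorSwap_lg₂ (lam_comm ε) _)
    (by rw [← map_mul, tu.A'A]) (by rw [← map_mul, tv.A'A]) (lg_proj_comm P _)
    (by rw [← mul_assoc, tensorSwap_lg₂ (lam_comm ε), mul_assoc, tensorSwap_lg₁ (lam_comm ε),
      ← mul_assoc, lg_proj_comm]) (lg_proj_comm P _)
    (by rw [← map_mul, tu.pE]) (by rw [← map_mul, tv.pE]) (by rw [← map_mul, tv.pE])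
    (by rw [← map_mul, tu.pE]) (lg_proj_comm P _) (lg_proj_comm' P _) (lg_proj_comm P _)
    (lg_proj_comm' P _)
  -- The tensor identity determines the commutator after two factors `kap`. Dividing the differences
  -- `E(u) - E(v)` by `kap` allows one of these factors to be cancelled.
  choose g hg using fun i j => exists_divided_difference (E i j)
  have ent : ∀ i j h k, kap * (kap * (iu (E i j) * iv (E h k) - iv (E h k) * iu (E i j))) =
      kap * (lam ε * ((iu (E i k) - iv (E i k)) * iu (E h j) - iv (E h j) * (iu (E i k) - iv (E i k))))
      - lam ε * (lam ε * ((iu (E i j) - iv (E i j)) * (iu (E h k) - iv (E h k)))) := by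
    intro i j h k
    have := congrFun (congrFun key (i, h)) (j, k)
    simp only [← map_sub, Matrix.sub_apply, kapMat_mul_apply, lg₁_mul_lg₂, lg₂_mul_lg₁,
      mul_tensorSwap_apply] at this
    simp only [matU_apply, matV_apply, ← lam_comm, mul_assoc] at this
    linear_combination (norm := noncomm_ring) this
      + (lam_comm ε (iu (E i j) - iv (E i j))) * lam ε * (iu (E h k) - iv (E h k))
      + lam ε * (lam_comm ε (iu (E i j) - iv (E i j))) * (iu (E h k) - iv (E h k))
  -- The family consists of the defects of the claim. The permutation exchanges the two columns, and
  -- `c` collects the commutators of two entries at the same variable `v`; that these vanish is not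
  -- known in advance but is part of the conclusion of `eq_zero_of_kap_mul_eq`.
  have hz := eq_zero_of_kap_mul_eq (ι := I × I × I × I) (fun a => (a.1, a.2.2.2, a.2.2.1, a.2.1))
    hε (fun a => iu (E a.1 a.2.1) * iv (E a.2.2.1 a.2.2.2) - iv (E a.2.2.1 a.2.2.2) * iu (E a.1 a.2.1)
      - lam ε * (g a.1 a.2.2.2 * (iu (E a.2.2.1 a.2.1) - iv (E a.2.2.1 a.2.1))))
    (fun a => E a.1 a.2.1 * E a.2.2.1 a.2.2.2 - E a.2.2.1 a.2.2.2 * E a.1 a.2.1) (fun a => rfl) ?_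
    (i, j, h, k)
  · simp only at hz
    rw [hg i k]
    have lc := lam_comm ε (kap : BiSeries A)
    linear_combination (norm := noncomm_ring) kap * hz - lc * g i k * (iu (E h j) - iv (E h j))
  · rintro ⟨i, j, h, k⟩
    apply kap_mul_cancel
    simp only [map_sub, map_mul]
    have lc := lam_comm ε (kap : BiSeries A)
    have e1 := ent i j h k
    have e2 := hg i k
    have e3 := hg i j
    linear_combination (norm := noncomm_ring) e1 + kap * lam ε * (e2 * (iu (E h j) - iv (E h j)))
      - lam ε * lam ε * e3 * (iu (E h k) - iv (E h k))
      + kap * lc * g i k * (iu (E h j) - iv (E h j))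
      - lam ε * lc * g i j * (iu (E h k) - iv (E h k))
      - lc * lam ε * g i j * (iu (E h k) - iv (E h k))

/-- RTT with the first entry in the upper right part and the second in the lower left part. The
exchange of rows then leads to the lower right part `F M E + G` and the corner `M`. -/
theorem RTT.mixed_legs (t : Blocks P Q M M' G E F) (hT : RTT ε (gaussProd M G E F)) :
    kapMat * (lg₁ (matU (M * E)) * lg₂ (matV (F * M)) - lg₂ (matV (F * M)) * lg₁ (matU (M * E))) =
      tensorSwap (lam ε) * lg₁ (matU (F * M * E + G)) * lg₂ (matV M)
        - lg₂ (matV (F * M * E + G)) * lg₁ (matU M) * tensorSwap (lam ε) := by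
  have e1 := fun i j => congrFun (congrFun (TwoBlock.p_gauss_q t).symm i) j
  have e2 := fun i j => congrFun (congrFun (TwoBlock.q_gauss_p t).symm i) j
  have e3 := fun i j => congrFun (congrFun (TwoBlock.q_gauss_q t).symm i) j
  have e4 := fun i j => congrFun (congrFun (TwoBlock.p_gauss_p t).symm i) j
  simp only [mul_proj_apply, proj_mul_apply] at e1 e2 e3 e4
  ext ⟨i, h⟩ ⟨j, k⟩ : 1
  rw [kapMat_mul_apply, Matrix.sub_apply, Matrix.sub_apply, lg₁_mul_lg₂, lg₂_mul_lg₁,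
    mul_assoc (tensorSwap _), tensorSwap_mul_apply, mul_tensorSwap_apply, lg₁_mul_lg₂, lg₂_mul_lg₁,
    ← lam_comm, ← mul_sub]
  have := hT i j h k
  simp only [matU_apply, matV_apply]
  rw [e1, e2, e3, e4]
  by_cases hi : P i <;> by_cases hj : Q j <;> by_cases hh : Q h <;> by_cases hk : P k <;>
    simp [hi, hj, hh, hk, this]

/-- `(u - v) [E_{ij}(u), F_{hk}(v)]` -/
theorem Blocks.E_F (t : Blocks P Q M M' G E F) (hT : RTT ε (gaussProd M G E F))
    (i j h k : I) : kap * (iu (E i j) * iv (F h k) - iv (F h k) * iu (E i j)) =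
      lam ε * (iu (M' i k) * iu (G h j) - iv (G h j) * iv (M' i k)) := by
  have tu := Blocks.toU t
  have tv := Blocks.toV t
  have hBC := RTT.mixed_legs t hT
  simp only [map_mul, map_add] at hBC
  have a1 : lg₁ (matU M') * lg₁ (matU M) = lg₁ (proj (BiSeries A) P) := by rw [← map_mul, tu.A'A]
  have a1v : lg₁ (matV M) * lg₁ (matV M') = lg₁ (proj (BiSeries A) P) := by rw [← map_mul, tv.AA']
  have a2 : lg₂ (matV M) * lg₂ (matV M') = lg₂ (proj (BiSeries A) P) := by rw [← map_mul, tv.AA']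
  have a3 : lg₁ (matU M') * lg₁ (proj (BiSeries A) P) = lg₁ (matU M') := by rw [← map_mul, tu.A'p]
  have a4 : lg₁ (proj (BiSeries A) P) * lg₁ (matV M') = lg₁ (matV M') := by rw [← map_mul, tv.pA']
  have a5 : lg₁ (proj (BiSeries A) P) * lg₁ (matU E) = lg₁ (matU E) := by rw [← map_mul, tu.pE]
  have a6 : lg₂ (matV F) * lg₂ (proj (BiSeries A) P) = lg₂ (matV F) := by rw [← map_mul, tv.Fp]
  have b1 := lg_proj_comm' P (matV F)
  have b2 := lg_proj_comm P (matU E)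
  have b3 := lg_proj_comm' P (matU G)
  have b4 := lg_proj_comm' P (matV G)
  have b5 := lg_proj_comm' P (matV M)
  have b6 := tensorSwap_lg₂ (lam_comm ε) (matV M')
  have b7 : lg₁ (proj (BiSeries A) P) * lg₁ (matU M) = lg₁ (matU M) := by rw [← map_mul, tu.pA]
  have b8 := tensorSwap_lg₁ (lam_comm ε) (proj (BiSeries A) P)
  have b9 : lg₂ (proj (BiSeries A) P) * lg₂ (matV M) = lg₂ (matV M) := by rw [← map_mul, tv.pA]
  have b10 := lg_proj_comm P (matU M)
  have b11 := tensorSwap_lg₂ (lam_comm ε) (proj (BiSeries A) P)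
  have b12 := lg_proj_comm P (matU F)
  have b13 := lg_proj_comm P (matV F)
  have key := mixed_commutator (K := kapMat) (P := tensorSwap (lam ε))
    (A₁v := lg₁ (matV M)) (E₁v := lg₁ (matV E)) (E₂u := lg₂ (matU E)) (F₁v := lg₁ (matV F))
    (G₂u := lg₂ (matU G)) (p₁ := lg₁ (proj _ P))
    kapMat_comm kapMat_regular (Blocks.rtt_corner t hT).legs hBC
    (Blocks.E_M_dressed t hT) (Blocks.M_E_dressed t hT)
    (by linear_combination (norm := noncomm_ring) Blocks.M_F_legs t hT)
    (by
      linear_combination (norm := noncomm_ring)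
        -b11 * (lg₁ (matU F) - lg₁ (matV F)) * lg₁ (matU M) * lg₂ (matV M)
        + tensorSwap (lam ε) * (b12 - b13) * lg₁ (matU M) * lg₂ (matV M)
        + tensorSwap (lam ε) * (lg₁ (matU F) - lg₁ (matV F)) * b10 * lg₂ (matV M)
        + tensorSwap (lam ε) * (lg₁ (matU F) - lg₁ (matV F)) * lg₁ (matU M) * b9)
    (tensorSwap_lg₁ (lam_comm ε) _) (tensorSwap_lg₂ (lam_comm ε) _)
    (tensorSwap_lg₂ (lam_comm ε) _) (tensorSwap_lg₁ (lam_comm ε) _)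
    (tensorSwap_lg₁ (lam_comm ε) _) (tensorSwap_lg₂ (lam_comm ε) _)
    (by
      ext ⟨i, h⟩ ⟨j, k⟩ : 1
      rw [lg₁_mul_lg₂, lg₂_mul_lg₁]
      have := congrArg swapVar (Blocks.G_M t hT h k i j)
      simp only [map_mul, swapVar_iu, swapVar_iv] at this
      exact this.symm)
  -- The factors `M(u)` on the left and `M(v)` on the right of the commutator are removed by their
  -- inverses. Moving `M'(v)` past the swap puts it into the first tensor position.
  have fin : kapMat * (lg₁ (matU E) * lg₂ (matV F) - lg₂ (matV F) * lg₁ (matU E)) =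
      (lg₁ (matU M') * lg₂ (matU G) - lg₂ (matV G) * lg₁ (matV M')) * tensorSwap (lam ε) := by
    linear_combination (norm := noncomm_ring) lg₁ (matU M') * key * lg₂ (matV M')
      + kapMat_comm (lg₁ (matU M')) * lg₁ (matU M) *
          (lg₁ (matU E) * lg₂ (matV F) - lg₂ (matV F) * lg₁ (matU E)) * lg₂ (matV M) * lg₂ (matV M')
      - kapMat * a1 * (lg₁ (matU E) * lg₂ (matV F) - lg₂ (matV F) * lg₁ (matU E)) *
          lg₂ (matV M) * lg₂ (matV M')
      - kapMat * lg₁ (proj (BiSeries A) P) *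
          (lg₁ (matU E) * lg₂ (matV F) - lg₂ (matV F) * lg₁ (matU E)) * a2
      - kapMat * a5 * lg₂ (matV F) * lg₂ (proj (BiSeries A) P)
      - kapMat * lg₁ (matU E) * a6
      + kapMat * b1 * lg₁ (matU E) * lg₂ (proj (BiSeries A) P)
      + kapMat * lg₂ (matV F) * a5 * lg₂ (proj (BiSeries A) P)
      - kapMat * lg₂ (matV F) * b2 + kapMat * a6 * lg₁ (matU E)
      + lg₁ (matU M') * (lg₂ (matU G) * lg₁ (matV M) - lg₁ (matU M) * lg₂ (matV G)) * b6
      + lg₁ (matU M') * lg₂ (matU G) * a1v * tensorSwap (lam ε)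
      - lg₁ (matU M') * b3 * tensorSwap (lam ε) + a3 * lg₂ (matU G) * tensorSwap (lam ε)
      - a1 * lg₂ (matV G) * lg₁ (matV M') * tensorSwap (lam ε)
      - b4 * lg₁ (matV M') * tensorSwap (lam ε) - lg₂ (matV G) * a4 * tensorSwap (lam ε)
  have := congrFun (congrFun fin (i, h)) (j, k)
  rw [kapMat_mul_apply, Matrix.sub_apply, lg₁_mul_lg₂, lg₂_mul_lg₁, mul_tensorSwap_apply,
    Matrix.sub_apply, lg₁_mul_lg₂, lg₂_mul_lg₁, ← lam_comm] at this
  exact this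

end TwoBlockRelations

open PowerSeries MulOpposite

/-! ### The opposite algebra -/

section Opposite

variable {A : Type*} [Ring A] {I : Type*} [Fintype I] [DecidableEq I]

/-- A series regarded as a series over the opposite ring. -/
noncomputable def opS : PowerSeries A →+ PowerSeries Aᵐᵒᵖ where
  toFun f := PowerSeries.mk fun r => op (coeff r f)
  map_zero' := by ext; simp
  map_add' f g := by ext; simp

theorem coeff_opS (r : ℕ) (f : PowerSeries A) : coeff r (opS f) = op (coeff r f) := by simp [opS]

theorem opS_injective {f g : PowerSeries A} (h : opS f = opS g) : f = g := by
  ext r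
  have := congrArg (coeff r) h
  rwa [coeff_opS, coeff_opS, op_inj] at this

theorem opS_mul (f g : PowerSeries A) : opS (f * g) = opS g * opS f := by
  ext r
  rw [coeff_opS, coeff_mul, coeff_mul, ← Finset.Nat.sum_antidiagonal_swap, Finset.op_sum]
  exact Finset.sum_congr rfl fun p _ => by simp [coeff_opS]

theorem opS_one : opS (1 : PowerSeries A) = 1 := by
  ext r
  rw [coeff_opS, coeff_one, coeff_one]; split_ifs <;> simp

/-- A two-variable series regarded as a series over the opposite ring. -/
noncomputable def opB : BiSeries A →+ BiSeries Aᵐᵒᵖ where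
  toFun w := PowerSeries.mk fun r => opS (coeff r w)
  map_zero' := by ext; simp
  map_add' f g := by ext; simp

theorem cf_opB (r s : ℕ) (w : BiSeries A) : cf r s (opB w) = op (cf r s w) := by
  simp [cf_apply, opB, coeff_opS]

theorem opB_injective {w w' : BiSeries A} (h : opB w = opB w') : w = w' := by
  apply bi_ext; intro r s
  have := congrArg (cf r s) h
  rwa [cf_opB, cf_opB, op_inj] at this

theorem opB_mul (w w' : BiSeries A) : opB (w * w') = opB w' * opB w := by
  ext r : 1
  rw [coeff_mul, ← Finset.Nat.sum_antidiagonal_swap]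
  simp [opB, coeff_mul, map_sum, opS_mul]

theorem opB_iu (f : PowerSeries A) : opB (iu f) = iu (opS f) := by
  apply bi_ext; intro r s
  rw [cf_opB, cf_iu, cf_iu]; split_ifs <;> simp [coeff_opS]

theorem opB_iv (f : PowerSeries A) : opB (iv f) = iv (opS f) := by
  apply bi_ext; intro r s
  rw [cf_opB, cf_iv, cf_iv]; split_ifs <;> simp [coeff_opS]

theorem opS_X : opS (PowerSeries.X : PowerSeries A) = PowerSeries.X := by
  ext r
  rw [coeff_opS, coeff_X, coeff_X]; split_ifs <;> simp

theorem opB_kap : opB (kap : BiSeries A) = kap := by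
  rw [kap, kap, Y_eq_iv, X_eq_iu, map_sub, opB_iu, opB_iv, opS_X, ← Y_eq_iv, ← X_eq_iu]

theorem opB_lam (ε : ℤ) : opB (lam ε : BiSeries A) = lam ε := by
  rw [lam, lam, map_zsmul, opB_mul, Y_eq_iv, X_eq_iu, opB_iu, opB_iv, opS_X, ← Y_eq_iv,
    ← X_eq_iu, ← X_commute]

/-- The transpose of a matrix of series, over the opposite ring. -/
noncomputable def opM (M : Matrix I I (PowerSeries A)) : Matrix I I (PowerSeries Aᵐᵒᵖ) :=
  Matrix.of fun i j => opS (M j i)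

theorem opM_apply (M : Matrix I I (PowerSeries A)) (i j : I) : opM M i j = opS (M j i) := rfl

theorem opM_mul (M N : Matrix I I (PowerSeries A)) : opM (M * N) = opM N * opM M := by
  ext i j : 1
  simp [opM_apply, Matrix.mul_apply, opS_mul, map_sum]

theorem opM_add (M N : Matrix I I (PowerSeries A)) : opM (M + N) = opM M + opM N := by
  ext i j : 1
  simp [opM_apply]

theorem opM_zero : opM (0 : Matrix I I (PowerSeries A)) = 0 := by
  ext i j : 1
  simp [opM_apply]

theorem opM_proj (P : I → Prop) [DecidablePred P] :
    opM (proj (PowerSeries A) P) = proj _ P := by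
  ext i j : 1
  rw [opM_apply, proj_apply, proj_apply]
  by_cases h : i = j
  · subst h; split_ifs <;> simp [opS_one]
  · rw [if_neg (by tauto), if_neg (by tauto), map_zero]

theorem opM_gaussProd (M G E F : Matrix I I (PowerSeries A)) :
    opM (gaussProd M G E F) = gaussProd (opM M) (opM G) (opM F) (opM E) := by
  simp only [gaussProd, opM_add, opM_mul, mul_assoc]; abel

/-- Transposition exchanges row and column indices and the opposite ring reverses the products; RTT
is invariant under the two together. Since `E` and `F` change places, statements about `E` yield
statements about `F`. -/
theorem RTT.op {ε : ℤ} {T : Matrix I I (PowerSeries A)} (hT : RTT ε T) : RTT ε (opM T) := by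
  refine rtt_of_swapped fun i j h k => ?_
  have := congrArg opB (hT.swapped j i k h)
  simp only [opB_mul, map_sub, opB_iu, opB_iv, opB_kap, opB_lam] at this
  simp only [opM_apply]
  rw [kap_comm, lam_comm]
  linear_combination (norm := noncomm_ring) -this

variable {P Q : I → Prop} [DecidablePred P] [DecidablePred Q]
  {M M' G G' E F : Matrix I I (PowerSeries A)} {ε : ℤ}

theorem Blocks.op (t : Blocks P Q M M' G E F) :
    Blocks P Q (opM M) (opM M') (opM G) (opM F) (opM E) where
  pp := proj_idem
  qq := proj_idem
  pq := by rw [← opM_proj, ← opM_proj, ← opM_mul, t.qp, opM_zero]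
  qp := by rw [← opM_proj, ← opM_proj, ← opM_mul, t.pq, opM_zero]
  pA := by rw [← opM_proj, ← opM_mul, t.Ap]
  Ap := by rw [← opM_proj, ← opM_mul, t.pA]
  pA' := by rw [← opM_proj, ← opM_mul, t.A'p]
  A'p := by rw [← opM_proj, ← opM_mul, t.pA']
  AA' := by rw [← opM_proj, ← opM_mul, t.A'A]
  A'A := by rw [← opM_proj, ← opM_mul, t.AA']
  pE := by rw [← opM_proj, ← opM_mul, t.Fp]
  Eq := by rw [← opM_proj, ← opM_mul, t.qF]
  qF := by rw [← opM_proj, ← opM_mul, t.Eq]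
  Fp := by rw [← opM_proj, ← opM_mul, t.pE]
  qG := by rw [← opM_proj, ← opM_mul, t.Gq]
  Gq := by rw [← opM_proj, ← opM_mul, t.qG]

end Opposite

open PowerSeries

/-! ### Iterated factorizations -/

section Tower

variable {A : Type*} [Ring A] {I : Type*} [Fintype I] [DecidableEq I]

/-- The matrix of constant terms. -/
noncomputable def c0 : Matrix I I (PowerSeries A) →+* Matrix I I A :=
  (PowerSeries.constantCoeff (R := A)).mapMatrix

theorem c0_apply (M : Matrix I I (PowerSeries A)) (i j : I) : c0 M i j = coeff 0 (M i j) := by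
  simp [c0]

theorem c0_proj (P : I → Prop) [DecidablePred P] : c0 (proj (PowerSeries A) P) = proj A P :=
  map_proj _

/-- A power series of matrices as a matrix of power series. -/
noncomputable def matOfSeries : PowerSeries (Matrix I I A) →+* Matrix I I (PowerSeries A) where
  toFun f := Matrix.of fun i j => PowerSeries.mk fun r => coeff r f i j
  map_zero' := by ext; simp
  map_one' := by
    ext i j r
    simp only [Matrix.of_apply, coeff_mk, coeff_one, Matrix.one_apply]
    split_ifs <;> simp_all [coeff_one, Matrix.one_apply]
  map_add' f g := by ext; simp
  map_mul' f g := by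
    ext i j r
    simp only [Matrix.of_apply, coeff_mk, coeff_mul, Matrix.sum_apply, Matrix.mul_apply, map_sum]
    exact Finset.sum_comm

/-- A matrix of series is a series of matrices, and a series with invertible constant term is
invertible on both sides. -/
theorem exists_inverse_of_c0_eq_one {N : Matrix I I (PowerSeries A)} (h : c0 N = 1) :
    ∃ S, N * S = 1 ∧ S * N = 1 := by
  let f : PowerSeries (Matrix I I A) := PowerSeries.mk fun r => Matrix.of fun i j => coeff r (N i j)
  have hf : matOfSeries f = N := by ext i j r; simp [matOfSeries, f]
  have hc : constantCoeff f = ((1 : (Matrix I I A)ˣ) : Matrix I I A) := by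
    rw [Units.val_one, ← h]
    ext i j
    simp [f, c0]
  refine ⟨matOfSeries (invOfUnit f 1), ?_, ?_⟩
  · rw [← hf, ← map_mul, mul_invOfUnit _ _ hc, map_one]
  · rw [← hf, ← map_mul, invOfUnit_mul _ _ hc, map_one]

/-- Adding `1 - p` completes `M` to a matrix with constant term `1`. The inverse of that matrix is
cut down to the corner. -/
theorem exists_cornerInverse {P : I → Prop} [DecidablePred P] {M : Matrix I I (PowerSeries A)}
    (hl : proj _ P * M = M) (hr : M * proj _ P = M) (h0 : c0 M = proj A P) :
    ∃ M', CornerInverse (proj _ P) M M' := by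
  obtain ⟨S, h1, h2⟩ := exists_inverse_of_c0_eq_one (N := M + (1 - proj _ P))
    (by rw [map_add, map_sub, map_one, c0_proj, h0]; abel)
  have pp : proj (PowerSeries A) P * proj _ P = proj _ P := proj_idem
  set p := proj (PowerSeries A) P
  refine ⟨p * S * p, ?_, ?_, ?_, ?_⟩
  · rw [← mul_assoc, ← mul_assoc, pp]
  · rw [mul_assoc, pp]
  · linear_combination (norm := noncomm_ring) hr * S * p + p * h1 * p - hl * S * p + pp * S * p + pp
  · linear_combination (norm := noncomm_ring) p * S * hl + p * h2 * p - p * S * hr + p * S * pp + pp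

theorem CornerInverse.unique {R : Type*} [Ring R] {p G G' G'' : R} (h : CornerInverse p G G')
    (hG : CornerInverse p G G'') : G' = G'' := by
  rw [← h.right, ← hG.mul, ← mul_assoc, h.mul', hG.left]

/-- The matrices of a factorization into blocks, block by block: `D k`, `E k` and `F k` are the
rows and columns of the block `k`, and `T k` is what is left when the blocks before `k` are
removed. -/
structure Tower (β : I → ℕ) (T D D' E F : ℕ → Matrix I I (PowerSeries A)) : Prop where
  blocks : ∀ k, Blocks (fun i => β i = k) (fun i => k < β i) (D k) (D' k) (T (k + 1)) (E k) (F k)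
  eq : ∀ k, T k = gaussProd (D k) (T (k + 1)) (E k) (F k)

variable {β : I → ℕ}

theorem proj_block_add (k : ℕ) :
    proj A (fun i => β i = k) + proj A (fun i => k < β i) = proj A fun i => k ≤ β i := by
  rw [proj_add_proj (fun i hi => by omega)]
  congr 1
  ext i
  exact ⟨fun h => by omega, fun h => by omega⟩

section TwoBlockConst

variable {R : Type*} [Ring R] {p q M M' G E F : R}

theorem TwoBlock.of_gauss_eq (t : TwoBlock p q M M' G E F) (h : gaussProd M G E F = p + q) :
    M = p ∧ E = 0 ∧ F = 0 ∧ G = q := by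
  have h1 := t.p_gauss_p
  have h2 := t.p_gauss_q
  have h3 := t.q_gauss_p
  have h4 := t.q_gauss_q
  rw [h] at h1 h2 h3 h4
  simp only [mul_add, t.pp, t.pq, t.qp, t.qq, add_zero, zero_add] at h1 h2 h3 h4
  have hE : E = 0 := by rw [← t.pE, ← t.A'A, mul_assoc, ← h2, mul_zero]
  have hF : F = 0 := by rw [← t.Fp, ← t.AA', ← mul_assoc, ← h3, zero_mul]
  exact ⟨h1.symm, hE, hF, by rw [h4, hF]; simp⟩

/-- The factors are determined by the product. -/
theorem TwoBlock.unique {M₂ M₂' G₂ E₂ F₂ : R} (t : TwoBlock p q M M' G E F)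
    (t₂ : TwoBlock p q M₂ M₂' G₂ E₂ F₂) (h : gaussProd M G E F = gaussProd M₂ G₂ E₂ F₂) :
    M = M₂ ∧ M' = M₂' ∧ G = G₂ ∧ E = E₂ ∧ F = F₂ := by
  have hM : M = M₂ := by rw [← t.p_gauss_p, h, t₂.p_gauss_p]
  subst hM
  have hM' : M' = M₂' := CornerInverse.unique (p := p) (G := M) ⟨t.pA', t.A'p, t.AA', t.A'A⟩
    ⟨t₂.pA', t₂.A'p, t₂.AA', t₂.A'A⟩
  subst hM'
  have hE : E = E₂ := by
    rw [← t.pE, ← t.A'A, mul_assoc, ← t.p_gauss_q, h, t₂.p_gauss_q, ← mul_assoc, t.A'A, t₂.pE]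
  have hF : F = F₂ := by
    rw [← t.Fp, ← t.AA', ← mul_assoc, ← t.q_gauss_p, h, t₂.q_gauss_p, mul_assoc, t.AA', t₂.Fp]
  subst hE hF
  have h4 := t.q_gauss_q
  rw [h, t₂.q_gauss_q] at h4
  exact ⟨rfl, rfl, (add_left_cancel h4).symm, rfl, rfl⟩

end TwoBlockConst

theorem Blocks.c0_gauss {P Q : I → Prop} [DecidablePred P] [DecidablePred Q]
    {M M' G E F : Matrix I I (PowerSeries A)} (t : Blocks P Q M M' G E F)
    (h : c0 (gaussProd M G E F) = proj A P + proj A Q) :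
    c0 M = proj A P ∧ c0 E = 0 ∧ c0 F = 0 ∧ c0 G = proj A Q := by
  have t' := TwoBlock.map t c0
  rw [c0_proj, c0_proj] at t'
  rw [map_gaussProd] at h
  exact t'.of_gauss_eq h

theorem exists_blocks {P Q : I → Prop} [DecidablePred P] [DecidablePred Q]
    (hPQ : ∀ i, P i → ¬Q i) {T : Matrix I I (PowerSeries A)}
    (hl : (proj _ P + proj _ Q) * T = T) (hr : T * (proj _ P + proj _ Q) = T)
    (h0 : c0 T = proj A P + proj A Q) :
    ∃ M M' G E F, Blocks P Q M M' G E F ∧ T = gaussProd M G E F := by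
  have pp : proj (PowerSeries A) P * proj _ P = proj _ P := proj_idem
  have qq : proj (PowerSeries A) Q * proj _ Q = proj _ Q := proj_idem
  have pq : proj (PowerSeries A) P * proj _ Q = 0 := proj_disjoint hPQ
  have qp : proj (PowerSeries A) Q * proj _ P = 0 := proj_disjoint fun i h h' => hPQ i h' h
  have hc : c0 (proj _ P * T * proj _ P) = proj A P := by
    rw [map_mul, map_mul, h0, c0_proj]
    have pp : proj A P * proj _ P = proj _ P := proj_idem
    have qp : proj A Q * proj _ P = 0 := proj_disjoint fun i h h' => hPQ i h' h
    rw [mul_assoc, add_mul, pp, qp, add_zero, pp]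
  obtain ⟨M', c⟩ := exists_cornerInverse (P := P) (M := proj _ P * T * proj _ P)
    (by rw [← mul_assoc, ← mul_assoc, pp]) (by rw [mul_assoc, pp]) hc
  set p := proj (PowerSeries A) P
  set q := proj (PowerSeries A) Q
  -- The usual Gauss elimination; the lower right factor is the Schur complement.
  refine ⟨p * T * p, M', q * T * q - q * T * M' * T * q, M' * T * q, q * T * M', ⟨pp, qq, pq, qp, ?_, ?_,
    c.left, c.right, c.mul, c.mul', ?_, ?_, ?_, ?_, ?_, ?_⟩, ?_⟩
  · rw [← mul_assoc, ← mul_assoc, pp]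
  · rw [mul_assoc, pp]
  · rw [← mul_assoc, ← mul_assoc, c.left]
  · rw [mul_assoc, qq]
  · rw [← mul_assoc, ← mul_assoc, qq]
  · rw [mul_assoc, c.right]
  · change q * _ = _
    simp only [mul_sub, ← mul_assoc, qq]
  · change _ * q = _
    simp only [sub_mul, mul_assoc, qq]
  · rw [gaussProd]
    have e1 := c.mul
    have e2 := c.mul'
    have e3 := c.left
    linear_combination (norm := noncomm_ring) -hr - hl * (p + q)
      - e1 * T * q - q * T * e2 - q * T * e2 * M' * T * q - q * T * e3 * T * q

/-- The properties of the matrix that is left when the blocks before `k` are removed. -/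
structure Remainder (β : I → ℕ) (k : ℕ) (T : Matrix I I (PowerSeries A)) : Prop where
  left : proj _ (fun i => k ≤ β i) * T = T
  right : T * proj _ (fun i => k ≤ β i) = T
  const : c0 T = proj A fun i => k ≤ β i

theorem Remainder.of_blocks {k : ℕ} {D D' T' E F : Matrix I I (PowerSeries A)}
    (t : Blocks (fun i => β i = k) (fun i => k < β i) D D' T' E F)
    (h : Remainder β k (gaussProd D T' E F)) : Remainder β (k + 1) T' where
  left := t.qG
  right := t.Gq
  const := (Blocks.c0_gauss t (by rw [h.const, proj_block_add])).2.2.2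

theorem Remainder.exists_blocks {k : ℕ} {T : Matrix I I (PowerSeries A)} (h : Remainder β k T) :
    ∃ D D' T' E F, Blocks (fun i => β i = k) (fun i => k < β i) D D' T' E F ∧
      T = gaussProd D T' E F :=
  ParabolicYangian.exists_blocks (fun i hi => by omega) (by rw [proj_block_add, h.left])
    (by rw [proj_block_add, h.right]) (by rw [proj_block_add, h.const])

/-- Elimination repeats because each Schur complement again has the projection to the remaining
blocks as its constant term. The levels run over all of `ℕ`; beyond the last block everything is
zero. -/
theorem exists_tower (β : I → ℕ) {T₀ : Matrix I I (PowerSeries A)} (h0 : c0 T₀ = 1) :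
    ∃ T D D' E F, Tower β T D D' E F ∧ T 0 = T₀ := by
  choose! D D' T' E F hB hT using
    fun (k : ℕ) (T : Matrix I I (PowerSeries A)) (h : Remainder β k T) => h.exists_blocks
  have h1 : proj (PowerSeries A) (fun i => 0 ≤ β i) = 1 := by
    ext i j; simp [proj, Matrix.one_apply]
  let S : ∀ k, {T : Matrix I I (PowerSeries A) // Remainder β k T} := fun k =>
    Nat.rec ⟨T₀, by rw [h1, one_mul], by rw [h1, mul_one], by
      rw [h0, ← c0_proj, h1, map_one]⟩
      (fun k T => ⟨T' k T.1, Remainder.of_blocks (hB k T.1 T.2) (hT k T.1 T.2 ▸ T.2)⟩) k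
  exact ⟨fun k => (S k).1, fun k => D k (S k).1, fun k => D' k (S k).1, fun k => E k (S k).1,
    fun k => F k (S k).1, ⟨fun k => hB k _ (S k).2, fun k => hT k _ (S k).2⟩, rfl⟩

variable {T D D' E F : ℕ → Matrix I I (PowerSeries A)}

theorem Tower.unique {T₂ D₂ D₂' E₂ F₂ : ℕ → Matrix I I (PowerSeries A)} (t : Tower β T D D' E F)
    (t₂ : Tower β T₂ D₂ D₂' E₂ F₂) (h : T 0 = T₂ 0) :
    D = D₂ ∧ D' = D₂' ∧ T = T₂ ∧ E = E₂ ∧ F = F₂ := by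
  have hT : ∀ k, T k = T₂ k := fun k => by
    induction k with
    | zero => exact h
    | succ k ih =>
      exact (TwoBlock.unique (t.blocks k) (t₂.blocks k) (by rw [← t.eq, ← t₂.eq, ih])).2.2.1
  have hk := fun k =>
    TwoBlock.unique (t.blocks k) (t₂.blocks k) (by rw [← t.eq, ← t₂.eq, hT])
  exact ⟨funext fun k => (hk k).1, funext fun k => (hk k).2.1, funext hT,
    funext fun k => (hk k).2.2.2.1, funext fun k => (hk k).2.2.2.2⟩

theorem Tower.remainder (t : Tower β T D D' E F) (h0 : c0 (T 0) = 1) (k : ℕ) :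
    Remainder β k (T k) := by
  induction k with
  | zero =>
    have h1 : proj (PowerSeries A) (fun i => 0 ≤ β i) = 1 := by
      ext i j; simp [proj, Matrix.one_apply]
    exact ⟨by rw [h1, one_mul], by rw [h1, mul_one], by rw [h0, ← c0_proj, h1, map_one]⟩
  | succ k ih => exact Remainder.of_blocks (t.blocks k) (t.eq k ▸ ih)

theorem Tower.const (t : Tower β T D D' E F) (h0 : c0 (T 0) = 1) (k : ℕ) :
    c0 (D k) = proj A (fun i => β i = k) ∧ c0 (E k) = 0 ∧ c0 (F k) = 0 := by
  have := Blocks.c0_gauss (t.blocks k)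
    (by rw [← t.eq, (t.remainder h0 k).const, proj_block_add])
  exact ⟨this.1, this.2.1, this.2.2.1⟩

theorem Remainder.exists_inverse {k : ℕ} {T : Matrix I I (PowerSeries A)} (h : Remainder β k T) :
    ∃ T', CornerInverse (proj _ fun i => k ≤ β i) T T' :=
  exists_cornerInverse h.left h.right h.const

theorem Tower.rtt (t : Tower β T D D' E F) (h0 : c0 (T 0) = 1) {ε : ℤ} (hT : RTT ε (T 0)) (k : ℕ) :
    RTT ε (T k) := by
  induction k with
  | zero => exact hT
  | succ k ih =>
    obtain ⟨G', g⟩ := (t.remainder h0 (k + 1)).exists_inverse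
    exact Blocks.rtt_schur (t.blocks k) g (fun i hi => by omega) (t.eq k ▸ ih)

theorem Tower.op (t : Tower β T D D' E F) : Tower β (fun k => opM (T k)) (fun k => opM (D k))
    (fun k => opM (D' k)) (fun k => opM (F k)) (fun k => opM (E k)) where
  blocks k := Blocks.op (t.blocks k)
  eq k := by rw [t.eq k, opM_gaussProd]

theorem c0_opM {M : Matrix I I (PowerSeries A)} (h : c0 M = 1) : c0 (opM M) = 1 := by
  ext i j
  rw [c0_apply, opM_apply, coeff_opS, ← c0_apply, h]
  by_cases hij : i = j
  · subst hij; simp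
  · simp [hij, Ne.symm hij]

/-- The coefficients of the entries of `M` commute with `x`. -/
def MComm (x : A) (M : Matrix I I (PowerSeries A)) : Prop :=
  Matrix.scalar I (C x) * M = M * Matrix.scalar I (C x)

theorem mComm_iff {x : A} {M : Matrix I I (PowerSeries A)} :
    MComm x M ↔ ∀ i j r, x * coeff r (M i j) = coeff r (M i j) * x := by
  rw [MComm, ← Matrix.ext_iff]
  simp only [Matrix.scalar_apply, Matrix.diagonal_mul, Matrix.mul_diagonal, PowerSeries.ext_iff,
    coeff_C_mul, coeff_mul_C]

theorem MComm.mul {x : A} {M N : Matrix I I (PowerSeries A)} (h : MComm x M) (h' : MComm x N) :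
    MComm x (M * N) := by
  unfold MComm at *
  rw [← mul_assoc, h, mul_assoc, h', mul_assoc]

theorem MComm.add {x : A} {M N : Matrix I I (PowerSeries A)} (h : MComm x M) (h' : MComm x N) :
    MComm x (M + N) := by
  unfold MComm at *
  rw [mul_add, add_mul, h, h']

theorem MComm.sub {x : A} {M N : Matrix I I (PowerSeries A)} (h : MComm x M) (h' : MComm x N) :
    MComm x (M - N) := by
  unfold MComm at *
  rw [mul_sub, sub_mul, h, h']

theorem mComm_proj (x : A) (P : I → Prop) [DecidablePred P] : MComm x (proj _ P) := by
  rw [mComm_iff]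
  intro i j r
  rw [proj_apply]
  split_ifs
  · rw [coeff_one]; split_ifs <;> simp
  · simp

theorem MComm.gaussProd {x : A} {M G E F : Matrix I I (PowerSeries A)} (hM : MComm x M)
    (hG : MComm x G) (hE : MComm x E) (hF : MComm x F) : MComm x (gaussProd M G E F) :=
  (((hM.add (hM.mul hE)).add (hF.mul hM)).add ((hF.mul hM).mul hE)).add hG

theorem MComm.inverse {x : A} {P : I → Prop} [DecidablePred P] {M M' : Matrix I I (PowerSeries A)}
    (c : CornerInverse (proj _ P) M M') (h : MComm x M) : MComm x M' := by
  have hp := mComm_proj x P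
  unfold MComm at *
  have e1 := c.left
  have e2 := c.right
  have e3 := c.mul
  have e4 := c.mul'
  generalize Matrix.scalar I (C x) = X at *
  linear_combination (norm := noncomm_ring) -X * e1 + hp * M' - e4 * X * M' - M' * h * M'
    + M' * X * e3 + M' * hp + e2 * X

/-- The factors arise from the product by cutting out corners, multiplying and inverting, so an
element that commutes with all entries of the product commutes with all entries of the factors. -/
theorem Blocks.mComm {P Q : I → Prop} [DecidablePred P] [DecidablePred Q]
    {M M' G E F : Matrix I I (PowerSeries A)} (t : Blocks P Q M M' G E F) {x : A}
    (h : MComm x (gaussProd M G E F)) :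
    MComm x M ∧ MComm x M' ∧ MComm x G ∧ MComm x E ∧ MComm x F := by
  have hp := mComm_proj x P
  have hq := mComm_proj x Q
  have hM : MComm x M := by rw [← t.p_gauss_p]; exact (hp.mul h).mul hp
  have hM' : MComm x M' := MComm.inverse ⟨t.pA', t.A'p, t.AA', t.A'A⟩ hM
  have hE : MComm x E := by
    rw [← t.pE, ← t.A'A, mul_assoc, ← t.p_gauss_q]; exact hM'.mul ((hp.mul h).mul hq)
  have hF : MComm x F := by
    rw [← t.Fp, ← t.AA', ← mul_assoc, ← t.q_gauss_p]; exact ((hq.mul h).mul hp).mul hM'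
  have hG : MComm x G := by
    have := (TwoBlock.q_gauss_q t)
    rw [← add_sub_cancel_left (F * M * E) G, ← this]
    exact ((hq.mul h).mul hq).sub ((hF.mul hM).mul hE)
  exact ⟨hM, hM', hG, hE, hF⟩

theorem Tower.mComm (t : Tower β T D D' E F) {x : A} {k : ℕ} (h : MComm x (T k)) (l : ℕ)
    (hl : k ≤ l) : MComm x (T l) ∧ MComm x (D l) ∧ MComm x (D' l) ∧ MComm x (E l) ∧
      MComm x (F l) := by
  have hT : MComm x (T l) := by
    induction l, hl using Nat.le_induction with
    | base => exact h
    | succ l _ ih => exact (Blocks.mComm (t.blocks l) (t.eq l ▸ ih)).2.2.1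
  have := Blocks.mComm (t.blocks l) (t.eq l ▸ hT)
  exact ⟨hT, this.1, this.2.1, this.2.2.2.1, this.2.2.2.2⟩

end Tower

/-! ### Merging two blocks -/

section Regroup

variable {R : Type*} [Ring R] {p q A A' G E F p₁ q₁ B B' H E₁ F₁ : R}

/-- The factors of a three-block product, when the first two blocks are merged. -/
theorem TwoBlock.regroup (t : TwoBlock p q A A' G E F) (t₁ : TwoBlock p₁ q₁ B B' H E₁ F₁)
    (hG : G = gaussProd B H E₁ F₁) (hq : q = p₁ + q₁) :
    ∃ M M' F₂, TwoBlock (p + p₁) q₁ M M' H (E * q₁ + E₁ - E * p₁ * E₁) F₂ ∧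
      gaussProd M H (E * q₁ + E₁ - E * p₁ * E₁) F₂ = gaussProd A G E F := by
  have qp₁ : q * p₁ = p₁ := by rw [hq, add_mul, t₁.pp, t₁.qp, add_zero]
  have p₁q : p₁ * q = p₁ := by rw [hq, mul_add, t₁.pp, t₁.pq, add_zero]
  have qq₁ : q * q₁ = q₁ := by rw [hq, add_mul, t₁.qq, t₁.pq, zero_add]
  have q₁q : q₁ * q = q₁ := by rw [hq, mul_add, t₁.qq, t₁.qp, zero_add]
  have pp₁ : p * p₁ = 0 := by rw [← qp₁, ← mul_assoc, t.pq, zero_mul]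
  have p₁p : p₁ * p = 0 := by rw [← p₁q, mul_assoc, t.qp, mul_zero]
  have pq₁ : p * q₁ = 0 := by rw [← qq₁, ← mul_assoc, t.pq, zero_mul]
  have q₁p : q₁ * p = 0 := by rw [← q₁q, mul_assoc, t.qp, mul_zero]
  have t₂ : TwoBlock p p₁ A A' B (E * p₁) (p₁ * F) :=
    ⟨t.pp, t₁.pp, pp₁, p₁p, t.pA, t.Ap, t.pA', t.A'p, t.AA', t.A'A, by rw [← mul_assoc, t.pE],
      by rw [mul_assoc, t₁.pp], by rw [← mul_assoc, t₁.pp], by rw [mul_assoc, t.Fp], t₁.pA, t₁.Ap⟩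
  have t₃ := t₂.inverse t₁.pA' t₁.A'p t₁.AA' t₁.A'A
  have h1 := t₂.gauss_mul_inverse t₁.pA' t₁.AA'
  have h2 := t₃.gauss_mul_inverse t.pA t.A'A
  rw [neg_neg, neg_neg, add_comm] at h2
  have h3 := t₃.gauss_supp_left
  have h4 := t₃.gauss_supp_right
  rw [add_comm] at h3 h4
  have p₁E : p₁ * E = 0 := by rw [← t.pE, ← mul_assoc, p₁p, zero_mul]
  have Fp₁ : F * p₁ = 0 := by rw [← t.Fp, mul_assoc, pp₁, mul_zero]
  have pE₁ : p * E₁ = 0 := by rw [← t₁.pE, ← mul_assoc, pp₁, zero_mul]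
  have F₁p : F₁ * p = 0 := by rw [← t₁.Fp, mul_assoc, p₁p, mul_zero]
  have AE₁ : A * E₁ = 0 := by rw [← t.Ap, mul_assoc, pE₁, mul_zero]
  have F₁A : F₁ * A = 0 := by rw [← t.pA, ← mul_assoc, F₁p, zero_mul]
  have BE : B * E = 0 := by rw [← t₁.Ap, mul_assoc, p₁E, mul_zero]
  have FB : F * B = 0 := by rw [← t₁.pA, ← mul_assoc, Fp₁, zero_mul]
  have E_eq : E = E * p₁ + E * q₁ := by rw [← mul_add, ← hq, t.Eq]
  have F_eq : F = p₁ * F + q₁ * F := by rw [← add_mul, ← hq, t.qF]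
  refine ⟨gaussProd A B (E * p₁) (p₁ * F), gaussProd B' A' (-(p₁ * F)) (-(E * p₁)),
    q₁ * F + F₁ - F₁ * p₁ * F, ⟨?_, t₁.qq, ?_, ?_, t₂.gauss_supp_left, t₂.gauss_supp_right,
      h3, h4, h1, h2, ?_, ?_, ?_, ?_, t₁.qG, t₁.Gq⟩, ?_⟩
  · simp [mul_add, add_mul, t.pp, t₁.pp, pp₁, p₁p]
  · simp [add_mul, pq₁, t₁.pq]
  · simp [mul_add, q₁p, t₁.qp]
  · simp [mul_add, add_mul, mul_sub, ← mul_assoc, t.pE, pE₁, p₁E, t₁.pE]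
  · simp [add_mul, sub_mul, mul_assoc, t₁.qq, t₁.Eq]
  · simp [mul_add, mul_sub, ← mul_assoc, t₁.qq, t₁.qF]
  · simp [mul_add, add_mul, sub_mul, mul_assoc, t.Fp, F₁p, Fp₁, t₁.Fp]
    abel
  · have hU : gaussProd A B (E * p₁) (p₁ * F) * (E * q₁ + E₁ - E * p₁ * E₁) =
        A * E * q₁ + p₁ * F * A * E * q₁ + B * E₁ := by
      rw [gaussProd]
      linear_combination (norm := noncomm_ring) AE₁ + A * E * p₁E * q₁
        - A * E * p₁E * p₁ * E₁ + p₁ * F * AE₁ + p₁ * F * A * E * p₁E * q₁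
        - p₁ * F * A * E * p₁E * p₁ * E₁ + BE * q₁ - BE * p₁ * E₁
    have hV : (q₁ * F + F₁ - F₁ * p₁ * F) * gaussProd A B (E * p₁) (p₁ * F) =
        q₁ * F * A + q₁ * F * A * E * p₁ + F₁ * B := by
      rw [gaussProd]
      linear_combination (norm := noncomm_ring) q₁ * Fp₁ * F * A + q₁ * Fp₁ * F * A * E * p₁
        + q₁ * FB + F₁A + F₁A * E * p₁ - F₁ * p₁ * Fp₁ * F * A - F₁ * p₁ * Fp₁ * F * A * E * p₁
        - F₁ * p₁ * FB
    have hW : (q₁ * F + F₁ - F₁ * p₁ * F) * (A * E * q₁ + p₁ * F * A * E * q₁ + B * E₁) =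
        q₁ * F * A * E * q₁ + F₁ * B * E₁ := by
      linear_combination (norm := noncomm_ring) q₁ * Fp₁ * F * A * E * q₁ + q₁ * FB * E₁
        + F₁A * E * q₁ - F₁ * p₁ * Fp₁ * F * A * E * q₁ - F₁ * p₁ * FB * E₁
    rw [gaussProd, mul_assoc (q₁ * F + F₁ - F₁ * p₁ * F), hV, hU, hW, hG, gaussProd, gaussProd,
      gaussProd]
    linear_combination (norm := noncomm_ring) -A * E_eq - F_eq * A - F_eq * A * E
      - p₁ * F * A * E_eq - q₁ * F * A * E_eq

end Regroup

/-! ### The relations of the entries of a factorization -/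

/-! ### Neighbouring levels of a tower -/

section Forward

variable {A : Type*} [Ring A] {I : Type*} [Fintype I] [DecidableEq I]

/-- The coefficients of two series commute. -/
def SComm (f g : PowerSeries A) : Prop := ∀ r s, coeff r f * coeff s g = coeff s g * coeff r f

theorem SComm.symm {f g : PowerSeries A} (h : SComm f g) : SComm g f := fun r s => (h s r).symm

theorem sComm_iff {f g : PowerSeries A} : SComm f g ↔ iu f * iv g = iv g * iu f := by
  constructor
  · intro h
    apply bi_ext; intro r s
    rw [cf_iu_mul_iv, cf_iv_mul_iu, h]
  · intro h r s
    rw [← cf_iu_mul_iv, h, cf_iv_mul_iu]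

theorem sComm_zero_left (g : PowerSeries A) : SComm 0 g := fun r s => by simp

theorem sComm_zero_right (f : PowerSeries A) : SComm f 0 := fun r s => by simp

/-- The relations of the diagonal blocks `D a` and the blocks `E a` above the diagonal. -/
structure HalfSystem (β : I → ℕ) (D E : ℕ → Matrix I I (PowerSeries A)) : Prop where
  D_E_same : ∀ a i j h k, β j = a →
    kap * (iu (D a i j) * iv (E a h k) - iv (E a h k) * iu (D a i j)) =
      if h = j then lam 1 * (matU (D a) * (matV (E a) - matU (E a))) i k else 0
  D_E_succ : ∀ a i j h k,
    kap * (iu (D (a + 1) i j) * iv (E a h k) - iv (E a h k) * iu (D (a + 1) i j)) =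
      lam 1 * (iu (D (a + 1) i k) * (iu (E a h j) - iv (E a h j)))
  D_E_ne : ∀ a b i j h k, a ≠ b → a ≠ b + 1 → SComm (D a i j) (E b h k)
  E_E_same : ∀ a i j h k, kap * (iu (E a i j) * iv (E a h k) - iv (E a h k) * iu (E a i j)) =
      lam 1 * ((iu (E a i k) - iv (E a i k)) * (iu (E a h j) - iv (E a h j)))
  E_E_succ : ∀ a i j h k, β j = a + 1 → ∀ r s, 1 ≤ r → 1 ≤ s →
    ⁅coeff r (E a i j), coeff (s + 1) (E (a + 1) h k)⁆
        - ⁅coeff (r + 1) (E a i j), coeff s (E (a + 1) h k)⁆ =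
      if h = j then -∑ q, coeff r (E a i q) * coeff s (E (a + 1) q k) else 0
  E_E_succ_ne : ∀ a i j h k, h ≠ j → SComm (E a i j) (E (a + 1) h k)
  E_E_far : ∀ a b i j h k, a + 1 < b → SComm (E a i j) (E b h k)
  serre : ∀ a b i j h k f g, a = b + 1 ∨ b = a + 1 → ∀ r s t,
    ⁅coeff r (E a i j), ⁅coeff s (E a h k), coeff t (E b f g)⁆⁆
      + ⁅coeff s (E a i j), ⁅coeff r (E a h k), coeff t (E b f g)⁆⁆ = 0

variable {β : I → ℕ} {T D D' E F : ℕ → Matrix I I (PowerSeries A)}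

/-- The part of `E a` just above the diagonal. -/
noncomputable def nextBlock (β : I → ℕ) (E : ℕ → Matrix I I (PowerSeries A)) (a : ℕ) :
    Matrix I I (PowerSeries A) := E a * proj _ fun i => β i = a + 1

theorem nextBlock_apply (a : ℕ) (i j : I) :
    nextBlock β E a i j = if β j = a + 1 then E a i j else 0 := mul_proj_apply _ _ _

theorem Tower.G_E (t : Tower β T D D' E F) (h0 : c0 (T 0) = 1) (hT : RTT 1 (T 0)) (a : ℕ)
    (i j h k : I) :
    kap * (iu (T (a + 1) i j) * iv (E a h k) - iv (E a h k) * iu (T (a + 1) i j)) =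
      lam 1 * (iu (T (a + 1) i k) * (iu (E a h j) - iv (E a h j))) := by
  obtain ⟨G', g⟩ := (t.remainder h0 (a + 1)).exists_inverse
  exact Blocks.G_E (t.blocks a) g (fun i hi => by omega) (t.eq a ▸ t.rtt h0 hT a) i j h k

/-- By `Tower.G_E`, commutation with an entry of `E a` in column `k` multiplies the remainder `T (a
+ 1)` on the right by a matrix with the single nonzero row `k`. As `k` lies in the first block of
that remainder, `TwoBlock.log_derivation_iff` distributes the action over its factors. -/
theorem Tower.dk_E (t : Tower β T D D' E F) (h0 : c0 (T 0) = 1) (hT : RTT 1 (T 0)) (a : ℕ)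
    (h k : I) (hk : β k = a + 1) (K : Matrix I I (BiSeries A))
    (hK : K = Matrix.of fun l j => if l = k then lam 1 * (iu (E a h j) - iv (E a h j)) else 0) :
    dk (iv (E a h k)) (matU (D (a + 1))) = matU (D (a + 1)) * K * proj _ (fun i => β i = a + 1) ∧
    dk (iv (E a h k)) (matU (E (a + 1))) = K * proj _ (fun i => a + 1 < β i)
      - K * proj _ (fun i => β i = a + 1) * matU (E (a + 1)) ∧
    dk (iv (E a h k)) (matU (F (a + 1))) = 0 ∧ dk (iv (E a h k)) (matU (T (a + 2))) = 0 := by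
  rw [← (Blocks.toU (t.blocks (a + 1))).log_derivation_iff (dk (iv (E a h k))) (dk_mul _)
    (dk_proj _ _) (dk_proj _ _), ← map_gaussProd, ← t.eq]
  · ext i j : 1
    rw [dk_apply, matU_apply, t.G_E h0 hT, Matrix.mul_apply, Finset.sum_eq_single k]
    · rw [hK, Matrix.of_apply, if_pos rfl, matU_apply, ← mul_assoc, lam_comm, mul_assoc]
    · intro b _ hb
      rw [hK, Matrix.of_apply, if_neg hb, mul_zero]
    · simp
  · refine proj_mul_eq_iff.2 fun i j hi => ?_
    rw [hK, Matrix.of_apply, if_neg (by rintro rfl; exact hi hk)]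
  · rw [proj_block_add]
    refine mul_proj_eq_iff.2 fun i j hj => ?_
    rw [hK, Matrix.of_apply, Blocks.col_eq_zero_of_proj (t.blocks a).Eq hj]
    simp

theorem iu_coeff_commute {x : A} {M : Matrix I I (PowerSeries A)} (h : ∀ i j, ∀ r,
    coeff r (M i j) * x = x * coeff r (M i j)) : MComm x M :=
  mComm_iff.2 fun i j r => (h i j r).symm

/-- The entries of `E a` in the block `a + 1` commute with all that comes after it. -/
theorem Tower.mComm_E (t : Tower β T D D' E F) (h0 : c0 (T 0) = 1) (hT : RTT 1 (T 0)) (a : ℕ)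
    (h k : I) (s : ℕ) : MComm (coeff s (nextBlock β E a h k)) (F (a + 1)) ∧
      MComm (coeff s (nextBlock β E a h k)) (T (a + 2)) := by
  rw [nextBlock_apply]
  split_ifs with hk
  · have := (t.dk_E h0 hT a h k hk _ rfl).2.2
    refine ⟨iu_coeff_commute fun i j r => ?_, iu_coeff_commute fun i j r => ?_⟩
    · have := congrFun (congrFun this.1 i) j
      rw [dk_apply] at this
      exact sComm_iff.2 (sub_eq_zero.1 (kap_regular this)) r s
    · have := congrFun (congrFun this.2 i) j
      rw [dk_apply] at this
      exact sComm_iff.2 (sub_eq_zero.1 (kap_regular this)) r s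
  · simp [mComm_iff]

theorem Tower.mComm_D (t : Tower β T D D' E F) (h0 : c0 (T 0) = 1) (hT : RTT 1 (T 0)) (a : ℕ)
    (h k : I) (s : ℕ) : MComm (coeff s (D a h k)) (T (a + 1)) :=
  iu_coeff_commute fun i j r => sComm_iff.2
    (Blocks.G_M (t.blocks a) (t.eq a ▸ t.rtt h0 hT a) i j h k) r s

/-- `(u - v) [E_{a + 1; xy}(u), E_{a; hk}(v)]` -/
theorem Tower.E_E_succ_series (t : Tower β T D D' E F) (h0 : c0 (T 0) = 1) (hT : RTT 1 (T 0))
    (a : ℕ) (x y h k : I) (hk : β k = a + 1) (hy : a + 1 < β y) :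
    kap * (iu (E (a + 1) x y) * iv (E a h k) - iv (E a h k) * iu (E (a + 1) x y)) =
      if x = k then lam 1 * (iu (E a h y) - iv (E a h y)
        - (iu ((nextBlock β E a * E (a + 1)) h y)
          - ∑ p, iv (nextBlock β E a h p) * iu (E (a + 1) p y))) else 0 := by
  have := congrFun (congrFun (t.dk_E h0 hT a h k hk _ rfl).2.1 x) y
  rw [dk_apply, matU_apply, Matrix.sub_apply, mul_proj_apply, if_pos hy, Matrix.mul_apply] at this
  simp only [mul_proj_apply, Matrix.of_apply] at this
  rw [this]
  split_ifs with hx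
  · rw [mul_sub (lam 1) (iu (E a h y) - iv (E a h y)), Matrix.mul_apply, map_sum, ← Finset.sum_sub_distrib, Finset.mul_sum]
    refine congrArg₂ _ rfl (Finset.sum_congr rfl fun p _ => ?_)
    rw [nextBlock_apply, matU_apply]
    split_ifs
    · rw [map_mul]; noncomm_ring
    · simp
  · simp

/-- The right-hand side of `Blocks.E_E` is symmetric in `u` and `v` while `kap` is antisymmetric.
This vanishing is the source of the Serre relations. -/
theorem Blocks.E_E_symm {P Q : I → Prop} [DecidablePred P] [DecidablePred Q]
    {M M' G E F : Matrix I I (PowerSeries A)} (t : Blocks P Q M M' G E F)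
    (hT : RTT 1 (gaussProd M G E F)) (i j h k : I) (r s : ℕ) :
    ⁅coeff r (E i j), coeff s (E h k)⁆ + ⁅coeff s (E i j), coeff r (E h k)⁆ = 0 := by
  have h1 := Blocks.E_E t (by norm_num) hT i j h k
  have h2 := congrArg swapVar h1
  simp only [map_mul, map_sub, swapVar_kap, swapVar_lam, swapVar_iu, swapVar_iv] at h2
  have h3 : kap * ((iu (E i j) * iv (E h k) - iv (E h k) * iu (E i j))
      + (iv (E i j) * iu (E h k) - iu (E h k) * iv (E i j))) = 0 := by
    linear_combination (norm := noncomm_ring) h1 - h2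
  have := congrArg (cf r s) (kap_regular h3)
  rw [map_add, map_sub, map_sub, cf_iu_mul_iv, cf_iv_mul_iu, cf_iv_mul_iu, cf_iu_mul_iv,
    map_zero] at this
  exact this

/-- The coefficients of an equation `(u - v) a = f`. -/
theorem cf_eq_of_kap {a f : BiSeries A} (h : kap * a = lam 1 * f) (r s : ℕ) :
    cf (r + 1) s a - cf r (s + 1) a = cf r s f := by
  rw [((kap_mul_eq_lam_mul_iff 1 a f).1 h).2.2, one_smul]

theorem cf_iu_succ (r s : ℕ) (f : PowerSeries A) : cf r (s + 1) (iu f) = 0 := by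
  rw [cf_iu, if_neg (Nat.succ_ne_zero s)]

theorem cf_iv_succ (r s : ℕ) (f : PowerSeries A) : cf (r + 1) s (iv f) = 0 := by
  rw [cf_iv, if_neg (Nat.succ_ne_zero r)]

theorem Tower.coeff_zero_E (t : Tower β T D D' E F) (h0 : c0 (T 0) = 1) (a : ℕ) (i j : I) :
    coeff 0 (E a i j) = 0 := by
  rw [← c0_apply, (t.const h0 a).2.1]; rfl

theorem coeff_zero_nextBlock {a : ℕ} (hE : ∀ i j, coeff 0 (E a i j) = 0) (i j : I) :
    coeff 0 (nextBlock β E a i j) = 0 := by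
  rw [nextBlock_apply]; split_ifs
  · exact hE i j
  · simp

theorem Tower.E_E_succ (t : Tower β T D D' E F) (h0 : c0 (T 0) = 1) (hT : RTT 1 (T 0))
    (a : ℕ) (x y h k : I) (hk : β k = a + 1) (hy : a + 1 < β y) (r s : ℕ) :
    ⁅coeff (r + 2) (E (a + 1) x y), coeff (s + 1) (E a h k)⁆
        - ⁅coeff (r + 1) (E (a + 1) x y), coeff (s + 2) (E a h k)⁆ =
      if x = k then ∑ p, coeff (s + 1) (nextBlock β E a h p) * coeff (r + 1) (E (a + 1) p y)
      else 0 := by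
  have h1 := t.E_E_succ_series h0 hT a x y h k hk hy
  split_ifs at h1 ⊢ with hx
  · have := cf_eq_of_kap h1 (r + 1) (s + 1)
    simp only [map_sub, cf_iu_mul_iv, cf_iv_mul_iu, cf_iu_succ, cf_iv_succ, map_sum] at this
    simpa [Ring.lie_def] using this
  · have h2 := sComm_iff.2 (sub_eq_zero.1 (kap_regular h1))
    rw [Ring.lie_def, Ring.lie_def, h2, h2]; simp

/-- The degree-one coefficients of `E (a + 1)` carry a column of `E a` in block `a + 1` to any later
column. This serves for the Serre relations and for generation. -/
theorem Tower.lie_E_one_left (t : Tower β T D D' E F) (h0 : c0 (T 0) = 1) (hT : RTT 1 (T 0))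
    (a : ℕ) (x y h k : I) (hk : β k = a + 1) (hy : a + 1 < β y) (s : ℕ) :
    ⁅coeff s (E a h k), coeff 1 (E (a + 1) x y)⁆ = if x = k then coeff s (E a h y) else 0 := by
  have h1 := t.E_E_succ_series h0 hT a x y h k hk hy
  have e0 := t.coeff_zero_E h0
  have n0 := coeff_zero_nextBlock (β := β) (e0 a)
  rw [Ring.lie_def, ← neg_sub, neg_eq_iff_eq_neg]
  split_ifs at h1 ⊢ with hx
  · have := cf_eq_of_kap h1 0 s
    simp only [map_sub, cf_iu_mul_iv, cf_iv_mul_iu, map_sum, e0, cf_iu, cf_iv] at this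
    cases s with
    | zero => simp [e0]
    | succ s => simpa [coeff_mul, n0, e0] using this
  · have h2 := sComm_iff.2 (sub_eq_zero.1 (kap_regular h1))
    rw [h2]; simp

/-- With the degree-one factor on the other side a quadratic term appears. Up to sign, the result is
an entry of the off-diagonal factor after the blocks `a` and `a + 1` are merged. -/
theorem Tower.lie_E_one_right (t : Tower β T D D' E F) (h0 : c0 (T 0) = 1) (hT : RTT 1 (T 0))
    (a : ℕ) (x y h k : I) (hk : β k = a + 1) (hy : a + 1 < β y) (s : ℕ) :
    ⁅coeff s (E (a + 1) x y), coeff 1 (E a h k)⁆ =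
      if x = k then coeff s ((nextBlock β E a * E (a + 1)) h y - E a h y) else 0 := by
  have h1 := t.E_E_succ_series h0 hT a x y h k hk hy
  have e0 := t.coeff_zero_E h0
  have n0 := coeff_zero_nextBlock (β := β) (e0 a)
  split_ifs at h1 ⊢ with hx
  · have := cf_eq_of_kap h1 s 0
    simp only [map_sub, cf_iu_mul_iv, cf_iv_mul_iu, map_sum, e0, cf_iu, cf_iv, n0] at this
    rw [map_sub, Ring.lie_def]
    simp only [mul_zero, zero_mul, sub_zero, Finset.sum_const_zero, if_true, ite_self] at this
    linear_combination (norm := skip) -this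
    abel
  · have h2 := sComm_iff.2 (sub_eq_zero.1 (kap_regular h1))
    rw [Ring.lie_def, h2]; simp

end Forward

/-! ### The relations of D with E and of E with E, except Serre -/

section Forward

variable {A : Type*} [Ring A] {I : Type*} [Fintype I] [DecidableEq I]
  {β : I → ℕ} {T D D' E F : ℕ → Matrix I I (PowerSeries A)}

theorem Tower.T_apply (t : Tower β T D D' E F) {a : ℕ} {i j : I} (hi : β i = a) (hj : β j = a) :
    T a i j = D a i j := by
  rw [t.eq a]; exact Blocks.gauss_apply (t.blocks a) hi hj

theorem Tower.D_zero_left (t : Tower β T D D' E F) {a : ℕ} {i j : I} (hi : β i ≠ a) :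
    D a i j = 0 := Blocks.row_eq_zero_of_proj (t.blocks a).pA hi

theorem Tower.D_zero_right (t : Tower β T D D' E F) {a : ℕ} {i j : I} (hi : β j ≠ a) :
    D a i j = 0 := Blocks.col_eq_zero_of_proj (t.blocks a).Ap hi

theorem Tower.E_zero_left (t : Tower β T D D' E F) {a : ℕ} {i j : I} (hi : β i ≠ a) :
    E a i j = 0 := Blocks.row_eq_zero_of_proj (t.blocks a).pE hi

theorem nextBlock_zero_right {a : ℕ} {i j : I} (hj : β j ≠ a + 1) : nextBlock β E a i j = 0 := by
  rw [nextBlock_apply, if_neg hj]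

theorem Tower.nextBlock_zero_left (t : Tower β T D D' E F) {a : ℕ} {i j : I} (hi : β i ≠ a) :
    nextBlock β E a i j = 0 := by
  rw [nextBlock_apply, t.E_zero_left hi, ite_self]

theorem Tower.D_E_same (t : Tower β T D D' E F) (h0 : c0 (T 0) = 1) (hT : RTT 1 (T 0))
    (a : ℕ) (i j h k : I) (hj : β j = a) :
    kap * (iu (D a i j) * iv (nextBlock β E a h k) - iv (nextBlock β E a h k) * iu (D a i j)) =
      if h = j then
        lam 1 * (matU (D a) * (matV (nextBlock β E a) - matU (nextBlock β E a))) i k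
      else 0 := by
  have h1 := Blocks.M_E (t.blocks a) (t.eq a ▸ t.rtt h0 hT a) i h k hj
  have h2 : (matU (D a) * (matV (nextBlock β E a) - matU (nextBlock β E a))) i k =
      if β k = a + 1 then (matU (D a) * (matV (E a) - matU (E a))) i k else 0 := by
    rw [nextBlock, map_mul, map_mul, matU_proj, matV_proj, ← sub_mul, ← mul_assoc, mul_proj_apply]
  rw [h2, nextBlock_apply]
  by_cases hk : β k = a + 1
  · simp only [if_pos hk]; exact h1
  · simp only [if_neg hk]; simp

theorem Tower.D_E_succ (t : Tower β T D D' E F) (h0 : c0 (T 0) = 1) (hT : RTT 1 (T 0))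
    (a : ℕ) (i j h k : I) :
    kap * (iu (D (a + 1) i j) * iv (nextBlock β E a h k)
        - iv (nextBlock β E a h k) * iu (D (a + 1) i j)) =
      lam 1 * (iu (D (a + 1) i k) * (iu (nextBlock β E a h j) - iv (nextBlock β E a h j))) := by
  have h1 := t.G_E h0 hT a i j h k
  by_cases hi : β i = a + 1
  · by_cases hk : β k = a + 1
    · by_cases hj : β j = a + 1
      · rwa [nextBlock_apply, nextBlock_apply, if_pos hk, if_pos hj, ← t.T_apply hi hj,
          ← t.T_apply hi hk]
      · rw [nextBlock_zero_right hj, t.D_zero_right hj]; simp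
    · rw [nextBlock_zero_right hk, t.D_zero_right hk]; simp
  · rw [t.D_zero_left hi, t.D_zero_left hi]; simp

/-- For `a < b` the entries of `D a` commute with `T (a + 1)`, hence with all its factors. For `a >
b + 1` the part of `E b` next to the diagonal commutes with `T (b + 2)`. -/
theorem Tower.D_E_ne (t : Tower β T D D' E F) (h0 : c0 (T 0) = 1) (hT : RTT 1 (T 0))
    (a b : ℕ) (i j h k : I) (hab : a ≠ b) (hab' : a ≠ b + 1) :
    SComm (D a i j) (nextBlock β E b h k) := by
  intro r s
  rcases lt_or_gt_of_ne hab with hlt | hgt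
  · rw [nextBlock_apply]
    split_ifs
    · exact mComm_iff.1 ((t.mComm (t.mComm_D h0 hT a i j r) b hlt).2.2.2.1) h k s
    · simp
  · exact (mComm_iff.1 ((t.mComm (t.mComm_E h0 hT b h k s).2 a (by omega)).2.1) i j r).symm

theorem Tower.E_E_same (t : Tower β T D D' E F) (h0 : c0 (T 0) = 1) (hT : RTT 1 (T 0))
    (a : ℕ) (i j h k : I) :
    kap * (iu (nextBlock β E a i j) * iv (nextBlock β E a h k)
        - iv (nextBlock β E a h k) * iu (nextBlock β E a i j)) =
      lam 1 * ((iu (nextBlock β E a i k) - iv (nextBlock β E a i k))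
        * (iu (nextBlock β E a h j) - iv (nextBlock β E a h j))) := by
  have := Blocks.E_E (t.blocks a) (by norm_num) (t.eq a ▸ t.rtt h0 hT a) i j h k
  by_cases hk : β k = a + 1
  · by_cases hj : β j = a + 1
    · simpa only [nextBlock_apply, if_pos hk, if_pos hj] using this
    · rw [nextBlock_zero_right hj, nextBlock_zero_right hj]; simp
  · rw [nextBlock_zero_right hk, nextBlock_zero_right hk]; simp

theorem Tower.E_E_far (t : Tower β T D D' E F) (h0 : c0 (T 0) = 1) (hT : RTT 1 (T 0))
    (a b : ℕ) (i j h k : I) (hab : a + 1 < b) :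
    SComm (nextBlock β E a i j) (nextBlock β E b h k) := by
  intro r s
  have := t.mComm (t.mComm_E h0 hT a i j r).2 b hab
  rw [nextBlock_apply (a := b)]
  split_ifs
  · exact mComm_iff.1 this.2.2.2.1 h k s
  · simp

theorem Tower.E_E_succ_ne (t : Tower β T D D' E F) (h0 : c0 (T 0) = 1) (hT : RTT 1 (T 0))
    (a : ℕ) (i j h k : I) (hj : h ≠ j) :
    SComm (nextBlock β E a i j) (nextBlock β E (a + 1) h k) := by
  rw [nextBlock_apply, nextBlock_apply]
  split_ifs with h1 h2
  · have := t.E_E_succ_series h0 hT a h k i j h1 (by omega)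
    rw [if_neg hj] at this
    exact (sComm_iff.2 (sub_eq_zero.1 (kap_regular this))).symm
  · exact sComm_zero_right _
  · exact sComm_zero_left _
  · exact sComm_zero_left _

theorem Tower.E_E_succ' (t : Tower β T D D' E F) (h0 : c0 (T 0) = 1) (hT : RTT 1 (T 0))
    (a : ℕ) (i j h k : I) (hj : β j = a + 1) (r s : ℕ) (hr : 1 ≤ r) (hs : 1 ≤ s) :
    ⁅coeff r (nextBlock β E a i j), coeff (s + 1) (nextBlock β E (a + 1) h k)⁆
        - ⁅coeff (r + 1) (nextBlock β E a i j), coeff s (nextBlock β E (a + 1) h k)⁆ =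
      if h = j then
        -∑ q, coeff r (nextBlock β E a i q) * coeff s (nextBlock β E (a + 1) q k)
      else 0 := by
  by_cases hk : β k = a + 1 + 1
  · obtain ⟨r, rfl⟩ := Nat.exists_eq_add_of_le' hr
    obtain ⟨s, rfl⟩ := Nat.exists_eq_add_of_le' hs
    have := t.E_E_succ h0 hT a h k i j hj (by omega) s r
    simp only [nextBlock_apply (a := a + 1), if_pos hk]
    rw [nextBlock_apply (j := j), if_pos hj]
    simp only [Ring.lie_def] at this ⊢
    split_ifs at this ⊢
    · linear_combination (norm := noncomm_ring) -this
    · linear_combination (norm := noncomm_ring) -this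
  · simp [nextBlock_zero_right hk, Ring.lie_def]

/-- The Serre expression is linear over the elements that commute with the outer letters. -/
theorem serre_mul_left {x x' y y' X Z : A} (hx : Z * x = x * Z) (hx' : Z * x' = x' * Z)
    (hy : Z * y = y * Z) (hy' : Z * y' = y' * Z) :
    ⁅x, ⁅y, Z * X⁆⁆ + ⁅x', ⁅y', Z * X⁆⁆ = Z * (⁅x, ⁅y, X⁆⁆ + ⁅x', ⁅y', X⁆⁆) := by
  simp only [Ring.lie_def]
  linear_combination (norm := noncomm_ring) -x * hy * X - hx * y * X + hx * X * y + hy * X * x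
    - x' * hy' * X - hx' * y' * X + hx' * X * y' + hy' * X * x'

theorem serre_mul_right {x x' y y' X Z : A} (hx : Z * x = x * Z) (hx' : Z * x' = x' * Z)
    (hy : Z * y = y * Z) (hy' : Z * y' = y' * Z) :
    ⁅x, ⁅y, X * Z⁆⁆ + ⁅x', ⁅y', X * Z⁆⁆ = (⁅x, ⁅y, X⁆⁆ + ⁅x', ⁅y', X⁆⁆) * Z := by
  simp only [Ring.lie_def]
  linear_combination (norm := noncomm_ring) -x * X * hy - y * X * hx + X * hy * x + X * y * hx
    - x' * X * hy' - y' * X * hx' + X * hy' * x' + X * y' * hx'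

theorem serre_add {x x' y y' X Y : A} : ⁅x, ⁅y, X + Y⁆⁆ + ⁅x', ⁅y', X + Y⁆⁆ =
    (⁅x, ⁅y, X⁆⁆ + ⁅x', ⁅y', X⁆⁆) + (⁅x, ⁅y, Y⁆⁆ + ⁅x', ⁅y', Y⁆⁆) := by
  simp only [Ring.lie_def]; noncomm_ring

theorem serre_sub {x x' y y' X Y : A} : ⁅x, ⁅y, X - Y⁆⁆ + ⁅x', ⁅y', X - Y⁆⁆ =
    (⁅x, ⁅y, X⁆⁆ + ⁅x', ⁅y', X⁆⁆) - (⁅x, ⁅y, Y⁆⁆ + ⁅x', ⁅y', Y⁆⁆) := by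
  simp only [Ring.lie_def]; noncomm_ring

theorem serre_sum {ι : Type*} (s : Finset ι) {x x' y y' : A} (X : ι → A)
    (h : ∀ p, ⁅x, ⁅y, X p⁆⁆ + ⁅x', ⁅y', X p⁆⁆ = 0) :
    ⁅x, ⁅y, ∑ p ∈ s, X p⁆⁆ + ⁅x', ⁅y', ∑ p ∈ s, X p⁆⁆ = 0 := by
  classical
  induction s using Finset.induction_on with
  | empty => simp [Ring.lie_def]
  | insert a s ha ih => rw [Finset.sum_insert ha, serre_add, h, ih, add_zero]

theorem Tower.coeff_zero_D (t : Tower β T D D' E F) (h0 : c0 (T 0) = 1) (a : ℕ) (i j : I) :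
    coeff 0 (D a i j) = if i = j ∧ β i = a then 1 else 0 := by
  rw [← c0_apply, (t.const h0 a).1, proj_apply]

/-- The second coefficient of `D (a + 1)` raises the degree of `E a` by one, up to a product with
the first coefficient. The induction on the degree in `Tower.serre_succ` rests on this. -/
theorem Tower.coeff_succ_of_D_succ (t : Tower β T D D' E F) (h0 : c0 (T 0) = 1) (hT : RTT 1 (T 0))
    (a : ℕ) (h j : I) (hj : β j = a + 1) (s : ℕ) :
    coeff (s + 2) (nextBlock β E a h j) =
      coeff (s + 1) (nextBlock β E a h j) * coeff 2 (D (a + 1) j j)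
      - coeff 2 (D (a + 1) j j) * coeff (s + 1) (nextBlock β E a h j)
      - coeff 1 (D (a + 1) j j) * coeff (s + 1) (nextBlock β E a h j) := by
  have h1 := t.D_E_succ h0 hT a j j h j
  have e1 := cf_eq_of_kap h1 1 (s + 1)
  have e2 := cf_eq_of_kap h1 0 (s + 1 + 1)
  have d0 := t.coeff_zero_D h0 (a + 1) j j
  rw [if_pos ⟨rfl, hj⟩] at d0
  rw [mul_sub, ← map_mul] at e1 e2
  simp only [map_sub, cf_iu_mul_iv, cf_iv_mul_iu, cf_iu_succ, d0, one_mul, mul_one, zero_add,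
    one_add_one_eq_two, show s + 1 + 1 = s + 2 from rfl] at e1 e2
  linear_combination (norm := skip) e1 + e2
  abel

/-- The same raising of the degree by `D a` from the left, for use in `Tower.serre_pred`. The
correction mixes the rows of the block, so the induction there runs over all rows. -/
theorem Tower.coeff_succ_of_D_same (t : Tower β T D D' E F) (h0 : c0 (T 0) = 1) (hT : RTT 1 (T 0))
    (a : ℕ) (i k : I) (hi : β i = a) (s : ℕ) :
    coeff (s + 2) (nextBlock β E a i k) =
      coeff 2 (D a i i) * coeff (s + 1) (nextBlock β E a i k)
      - coeff (s + 1) (nextBlock β E a i k) * coeff 2 (D a i i)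
      - ∑ p, coeff 1 (D a i p) * coeff (s + 1) (nextBlock β E a p k) := by
  have h1 := t.D_E_same h0 hT a i i i k hi
  rw [if_pos rfl, mul_sub (matU (D a)), ← map_mul, Matrix.sub_apply, matU_apply, Matrix.mul_apply] at h1
  simp only [matU_apply, matV_apply] at h1
  have e1 := cf_eq_of_kap h1 1 (s + 1)
  have e2 := cf_eq_of_kap h1 0 (s + 1 + 1)
  simp only [map_sub, map_sum, cf_iu_mul_iv, cf_iv_mul_iu, cf_iu_succ, t.coeff_zero_D h0,
    ite_mul, one_mul, zero_mul, ite_and, Finset.sum_ite_eq, Finset.mem_univ, if_true, if_pos hi,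
    mul_one, zero_add, one_add_one_eq_two,
    show s + 1 + 1 = s + 2 from rfl] at e1 e2
  linear_combination (norm := skip) -e1 - e2
  abel

end Forward

open PowerSeries MulOpposite

/-! ### The Serre relations and the full system of relations -/

section Forward

variable {A : Type*} [Ring A] {I : Type*} [Fintype I] [DecidableEq I]
  {β : I → ℕ} {T D D' E F : ℕ → Matrix I I (PowerSeries A)}

/-- In degree one the inner commutator is an entry of the same row factor `E a` in a later column,
so `Blocks.E_E_symm` applies. Higher degrees follow because `D (a + 2)` commutes with `E a` and
raises the degree of `E (a + 1)`. -/
theorem Tower.serre_succ (t : Tower β T D D' E F) (h0 : c0 (T 0) = 1) (hT : RTT 1 (T 0))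
    (a : ℕ) (i j h k f g : I) (r s l : ℕ) :
    ⁅coeff r (nextBlock β E a i j), ⁅coeff s (nextBlock β E a h k),
        coeff l (nextBlock β E (a + 1) f g)⁆⁆
      + ⁅coeff s (nextBlock β E a i j), ⁅coeff r (nextBlock β E a h k),
        coeff l (nextBlock β E (a + 1) f g)⁆⁆ = 0 := by
  by_cases hg : β g = a + 1 + 1
  swap
  · simp [nextBlock_zero_right hg, Ring.lie_def]
  induction l with
  | zero =>
    rw [coeff_zero_nextBlock (t.coeff_zero_E h0 _)]; simp [Ring.lie_def]
  | succ l ih =>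
    cases l with
    | zero =>
      by_cases hk : β k = a + 1
      swap
      · simp [nextBlock_zero_right hk, Ring.lie_def]
      by_cases hj : β j = a + 1
      swap
      · simp [nextBlock_zero_right hj, Ring.lie_def]
      simp only [nextBlock_apply, if_pos hk, if_pos hj, if_pos hg]
      rw [zero_add, t.lie_E_one_left h0 hT a f g h k hk (by omega),
        t.lie_E_one_left h0 hT a f g h k hk (by omega)]
      split_ifs
      · exact Blocks.E_E_symm (t.blocks a) (t.eq a ▸ t.rtt h0 hT a) i j h g r s
      · simp [Ring.lie_def]
    | succ l =>
      have hc : ∀ x y m n, coeff n (D (a + 1 + 1) g g) * coeff m (nextBlock β E a x y) =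
          coeff m (nextBlock β E a x y) * coeff n (D (a + 1 + 1) g g) := fun x y m n =>
        t.D_E_ne h0 hT _ _ g g x y (by omega) (by omega) n m
      rw [show l + 1 + 1 = l + 2 from rfl, t.coeff_succ_of_D_succ h0 hT (a + 1) f g hg l, serre_sub,
        serre_sub, serre_mul_left (hc _ _ _ _) (hc _ _ _ _) (hc _ _ _ _) (hc _ _ _ _),
        serre_mul_left (hc _ _ _ _) (hc _ _ _ _) (hc _ _ _ _) (hc _ _ _ _),
        serre_mul_right (hc _ _ _ _) (hc _ _ _ _) (hc _ _ _ _) (hc _ _ _ _), ih]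
      simp

/-- When blocks `b` and `b + 1` are merged, both elements become entries of one off-diagonal factor,
and `Blocks.E_E_symm` applies to the merged factorization. -/
theorem Tower.serre_pred_one (t : Tower β T D D' E F) (h0 : c0 (T 0) = 1) (hT : RTT 1 (T 0))
    (b : ℕ) (i j f k : I) (hi : β i = b + 1) (hf : β f = b) (hk : b + 1 < β k)
    (r s : ℕ) :
    ⁅coeff r (E (b + 1) i j), coeff s ((nextBlock β E b * E (b + 1)) f k - E b f k)⁆
      + ⁅coeff s (E (b + 1) i j), coeff r ((nextBlock β E b * E (b + 1)) f k - E b f k)⁆ = 0 := by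
  obtain ⟨M, M', F₂, t₂, hM⟩ := TwoBlock.regroup (t.blocks b) (t.blocks (b + 1)) (t.eq (b + 1))
    (proj_block_add (b + 1)).symm
  rw [← t.eq b] at hM
  have hR := t.rtt h0 hT b
  rw [← hM] at hR
  rw [proj_add_proj (fun i hi => by omega)] at t₂
  have h1 := Blocks.E_E_symm t₂ hR i j f k r s
  set X := E b * proj (PowerSeries A) (fun i => b + 1 < β i) + E (b + 1)
    - E b * proj (PowerSeries A) (fun i => β i = b + 1) * E (b + 1) with hX
  have e1 : X i j = E (b + 1) i j := by
    rw [hX, Matrix.sub_apply, Matrix.add_apply, mul_proj_apply, t.E_zero_left (by omega), mul_assoc,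
      Matrix.mul_apply, Finset.sum_eq_zero]
    · simp
    · intro p _
      rw [t.E_zero_left (by omega), zero_mul]
  have e2 : X f k = -((nextBlock β E b * E (b + 1)) f k - E b f k) := by
    rw [hX, Matrix.sub_apply, Matrix.add_apply, mul_proj_apply, if_pos hk,
      t.E_zero_left (a := b + 1) (i := f) (by omega), ← nextBlock]
    abel
  rw [e1, e2] at h1
  simp only [Ring.lie_def, map_neg] at h1 ⊢
  linear_combination (norm := noncomm_ring) -h1

theorem Tower.serre_pred (t : Tower β T D D' E F) (h0 : c0 (T 0) = 1) (hT : RTT 1 (T 0))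
    (b : ℕ) (i j h k f g : I) (r s l : ℕ) :
    ⁅coeff r (nextBlock β E (b + 1) i j), ⁅coeff s (nextBlock β E (b + 1) h k),
        coeff l (nextBlock β E b f g)⁆⁆
      + ⁅coeff s (nextBlock β E (b + 1) i j), ⁅coeff r (nextBlock β E (b + 1) h k),
        coeff l (nextBlock β E b f g)⁆⁆ = 0 := by
  induction l generalizing f with
  | zero =>
    rw [coeff_zero_nextBlock (t.coeff_zero_E h0 _)]; simp [Ring.lie_def]
  | succ l ih =>
    by_cases hf : β f = b
    swap
    · simp [t.nextBlock_zero_left hf, Ring.lie_def]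
    cases l with
    | zero =>
      by_cases hk : β k = b + 1 + 1
      swap
      · simp [nextBlock_zero_right hk, Ring.lie_def]
      by_cases hj : β j = b + 1 + 1
      swap
      · simp [nextBlock_zero_right hj, Ring.lie_def]
      by_cases hg : β g = b + 1
      swap
      · simp [nextBlock_zero_right hg, Ring.lie_def]
      by_cases hi : β i = b + 1
      swap
      · simp [t.nextBlock_zero_left hi, Ring.lie_def]
      simp only [nextBlock_apply, if_pos hk, if_pos hj, if_pos hg]
      rw [zero_add, t.lie_E_one_right h0 hT b h k f g hg (by omega),
        t.lie_E_one_right h0 hT b h k f g hg (by omega)]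
      split_ifs
      · exact t.serre_pred_one h0 hT b i j f k hi hf (by omega) r s
      · simp [Ring.lie_def]
    | succ l =>
      have hc : ∀ x y p m n, coeff n (D b f p) * coeff m (nextBlock β E (b + 1) x y) =
          coeff m (nextBlock β E (b + 1) x y) * coeff n (D b f p) := fun x y p m n =>
        t.D_E_ne h0 hT _ _ f p x y (by omega) (by omega) n m
      rw [show l + 1 + 1 = l + 2 from rfl, t.coeff_succ_of_D_same h0 hT b f g hf l, serre_sub,
        serre_sub, serre_sum, serre_mul_left (hc _ _ _ _ _) (hc _ _ _ _ _) (hc _ _ _ _ _) (hc _ _ _ _ _),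
        serre_mul_right (hc _ _ _ _ _) (hc _ _ _ _ _) (hc _ _ _ _ _) (hc _ _ _ _ _), ih]
      · simp
      · intro p
        rw [serre_mul_left (hc _ _ _ _ _) (hc _ _ _ _ _) (hc _ _ _ _ _) (hc _ _ _ _ _), ih, mul_zero]

theorem Tower.halfSystem (t : Tower β T D D' E F) (h0 : c0 (T 0) = 1) (hT : RTT 1 (T 0)) :
    HalfSystem β D (nextBlock β E) where
  D_E_same := t.D_E_same h0 hT
  D_E_succ := t.D_E_succ h0 hT
  D_E_ne := t.D_E_ne h0 hT
  E_E_same := t.E_E_same h0 hT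
  E_E_succ a i j h k hj r s hr hs := t.E_E_succ' h0 hT a i j h k hj r s hr hs
  E_E_succ_ne := t.E_E_succ_ne h0 hT
  E_E_far := t.E_E_far h0 hT
  serre a b i j h k f g hab r s l := by
    rcases hab with rfl | rfl
    · exact t.serre_pred h0 hT b i j h k f g r s l
    · exact t.serre_succ h0 hT a i j h k f g r s l

/-- The relations of the parabolic presentation for matrices of series: `D a` is the diagonal
block `a`, `D' a` its inverse, `E a` is the block `(a, a + 1)` and `F a` the block `(a + 1, a)`. -/
structure ParSystem (β : I → ℕ) (D D' E F : ℕ → Matrix I I (PowerSeries A)) : Prop where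
  D_left : ∀ {a i j}, β i ≠ a → D a i j = 0
  D_right : ∀ {a i j}, β j ≠ a → D a i j = 0
  E_left : ∀ {a i j}, β i ≠ a → E a i j = 0
  E_right : ∀ {a i j}, β j ≠ a + 1 → E a i j = 0
  F_left : ∀ {a i j}, β i ≠ a + 1 → F a i j = 0
  F_right : ∀ {a i j}, β j ≠ a → F a i j = 0
  D_const : ∀ a i j, coeff 0 (D a i j) = if i = j ∧ β i = a then 1 else 0
  E_const : ∀ a i j, coeff 0 (E a i j) = 0
  F_const : ∀ a i j, coeff 0 (F a i j) = 0
  D_inv : ∀ a, CornerInverse (proj _ fun i => β i = a) (D a) (D' a)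
  D_D : ∀ a, RTT 1 (D a)
  D_D_ne : ∀ a b i j h k, a ≠ b → SComm (D a i j) (D b h k)
  E_F_same : ∀ a i j h k, kap * (iu (E a i j) * iv (F a h k) - iv (F a h k) * iu (E a i j)) =
    lam 1 * (iu (D' a i k) * iu (D (a + 1) h j) - iv (D (a + 1) h j) * iv (D' a i k))
  E_F_ne : ∀ a b i j h k, a ≠ b → SComm (E a i j) (F b h k)
  half : HalfSystem β D E
  half_op : HalfSystem β (fun a => opM (D a)) (fun a => opM (F a))

theorem sComm_opS {f g : PowerSeries A} : SComm (opS f) (opS g) ↔ SComm f g := by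
  unfold SComm
  simp only [coeff_opS, ← op_mul, op_inj]
  exact ⟨fun h r s => (h r s).symm, fun h r s => (h r s).symm⟩

/-- The part of `F a` just below the diagonal. -/
noncomputable def lowBlock (β : I → ℕ) (F : ℕ → Matrix I I (PowerSeries A)) (a : ℕ) :
    Matrix I I (PowerSeries A) := proj _ (fun i => β i = a + 1) * F a

theorem lowBlock_apply (a : ℕ) (i j : I) :
    lowBlock β F a i j = if β i = a + 1 then F a i j else 0 := proj_mul_apply _ _ _

theorem opM_lowBlock (a : ℕ) : opM (lowBlock β F a) = nextBlock β (fun a => opM (F a)) a := by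
  rw [lowBlock, nextBlock, opM_mul, opM_proj]

theorem Tower.mComm_E_F (t : Tower β T D D' E F) (h0 : c0 (T 0) = 1) (hT : RTT 1 (T 0)) (a b : ℕ)
    (hab : a < b) (i j h k : I) : SComm (nextBlock β E a i j) (F b h k) := by
  intro r s
  rcases Nat.lt_or_eq_of_le hab with hlt | heq
  · exact mComm_iff.1 (t.mComm (t.mComm_E h0 hT a i j r).2 b hlt).2.2.2.2 h k s
  · rw [← heq]
    exact mComm_iff.1 (t.mComm_E h0 hT a i j r).1 h k s

theorem Tower.parSystem (t : Tower β T D D' E F) (h0 : c0 (T 0) = 1) (hT : RTT 1 (T 0)) :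
    ParSystem β D D' (nextBlock β E) (lowBlock β F) where
  D_left := t.D_zero_left
  D_right := t.D_zero_right
  E_left := t.nextBlock_zero_left
  E_right := nextBlock_zero_right
  F_left hi := by rw [lowBlock_apply, if_neg hi]
  F_right {a i j} hj := by
    rw [lowBlock_apply, Blocks.col_eq_zero_of_proj (t.blocks a).Fp hj, ite_self]
  D_const := t.coeff_zero_D h0
  E_const a := coeff_zero_nextBlock (t.coeff_zero_E h0 a)
  F_const a i j := by
    rw [lowBlock_apply]
    split_ifs
    · rw [← c0_apply, (t.const h0 a).2.2]; rfl
    · simp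
  D_inv a := ⟨(t.blocks a).pA', (t.blocks a).A'p, (t.blocks a).AA', (t.blocks a).A'A⟩
  D_D a := Blocks.rtt_corner (t.blocks a) (t.eq a ▸ t.rtt h0 hT a)
  D_D_ne a b i j h k hab r s := by
    rcases lt_or_gt_of_ne hab with hlt | hgt
    · exact mComm_iff.1 (t.mComm (t.mComm_D h0 hT a i j r) b hlt).2.1 h k s
    · exact (mComm_iff.1 (t.mComm (t.mComm_D h0 hT b h k s) a hgt).2.1 i j r).symm
  E_F_same a i j h k := by
    have := Blocks.E_F (t.blocks a) (t.eq a ▸ t.rtt h0 hT a) i j h k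
    rw [nextBlock_apply, lowBlock_apply]
    by_cases hj : β j = a + 1
    · by_cases hh : β h = a + 1
      · rwa [if_pos hj, if_pos hh, ← t.T_apply hh hj]
      · rw [if_neg hh, t.D_zero_left hh]; simp
    · rw [if_neg hj, t.D_zero_right hj]; simp
  E_F_ne a b i j h k hab := by
    rcases lt_or_gt_of_ne hab with hlt | hgt
    · rw [lowBlock_apply]
      split_ifs
      · exact t.mComm_E_F h0 hT a b hlt i j h k
      · exact sComm_zero_right _
    · rw [nextBlock_apply]
      split_ifs
      -- For `b < a` the claim is the previous case for the transposed tower, in which `E` and `F`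
      -- have changed places.
      · have := t.op.mComm_E_F (c0_opM h0) hT.op b a hgt k h j i
        rw [← opM_lowBlock] at this
        exact (sComm_opS.1 this).symm
      · exact sComm_zero_left _
  half := t.halfSystem h0 hT
  half_op := by
    have := t.op.halfSystem (c0_opM h0) hT.op
    convert this using 1
    ext a : 1
    exact opM_lowBlock a

end Forward

/-! ### From the relations of the factors back to the `RTT` relation -/

section Backward

/-- The four formulas are the infinitesimal effect on the Gauss factors of conjugating the product
by a strictly lower triangular matrix; put together they give the commutator with `X`. -/
theorem TwoBlock.inner_action {R : Type*} [Ring R] {p q A A' G E F X : R}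
    (t : TwoBlock p q A A' G E F) (d : R →+ R) (hd : ∀ x y, d (x * y) = d x * y + x * d y)
    (qX : q * X = X) (Xp : X * p = X) (hA : d A = -(A * E * X)) (hE : d E = E * X * E)
    (hG : d G = G * X * E) (hF : d F = X - G * X * A') :
    d (gaussProd A G E F) = X * gaussProd A G E F - gaussProd A G E F * X := by
  simp only [gaussProd, map_add, hd, hA, hE, hG, hF]
  have hXE : p * E = E := t.pE
  have XF : X * F = 0 := by rw [← Xp, mul_assoc, t.pF, mul_zero]
  have XG : X * G = 0 := by rw [← Xp, mul_assoc, t.pG, mul_zero]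
  have AX : A * X = 0 := by rw [← qX, ← mul_assoc, t.Aq, zero_mul]
  have hA'A := t.A'A
  linear_combination (norm := noncomm_ring) -G * X * hA'A - G * Xp - G * X * hA'A * E - G * X * hXE
    - XF * A - XF * A * E - XG + AX + F * AX

variable {A : Type*} [Ring A] {I : Type*} [Fintype I] [DecidableEq I]

/-- The commutator with an element of `A`, on series. -/
noncomputable def adC (x : A) : PowerSeries A →+ PowerSeries A where
  toFun f := C x * f - f * C x
  map_zero' := by simp
  map_add' f g := by noncomm_ring

theorem adC_apply (x : A) (f : PowerSeries A) : adC x f = C x * f - f * C x := rfl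

theorem coeff_adC (x : A) (f : PowerSeries A) (r : ℕ) :
    coeff r (adC x f) = x * coeff r f - coeff r f * x := by
  rw [adC_apply, map_sub, coeff_C_mul, coeff_mul_C]

theorem adC_mul (x : A) (f g : PowerSeries A) : adC x (f * g) = adC x f * g + f * adC x g := by
  simp only [adC_apply]; noncomm_ring

theorem adC_one (x : A) : adC x 1 = 0 := by simp [adC_apply]

theorem adC_lie (x y : A) (f : PowerSeries A) :
    adC (x * y - y * x) f = adC x (adC y f) - adC y (adC x f) := by
  simp only [adC_apply, map_sub, map_mul]; noncomm_ring

theorem adC_neg (x : A) (f : PowerSeries A) : adC (-x) f = -adC x f := by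
  simp only [adC_apply, map_neg]; noncomm_ring

theorem adC_zero (f : PowerSeries A) : adC 0 f = 0 := by simp [adC_apply]

theorem adC_sub (x y : A) (f : PowerSeries A) : adC (x - y) f = adC x f - adC y f := by
  simp only [adC_apply, map_sub]; noncomm_ring

theorem adC_eq_zero {x : A} {f : PowerSeries A} (h : ∀ r, x * coeff r f = coeff r f * x) :
    adC x f = 0 := by
  ext r; rw [coeff_adC, h, sub_self, map_zero]

/-- The commutator with an element of `A`, on matrices of series. -/
noncomputable def adM (x : A) : Matrix I I (PowerSeries A) →+ Matrix I I (PowerSeries A) where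
  toFun M := M.map (adC x)
  map_zero' := by ext i j : 1; simp
  map_add' M N := by ext i j : 1; simp

theorem adM_apply (x : A) (M : Matrix I I (PowerSeries A)) (i j : I) :
    adM x M i j = adC x (M i j) := rfl

theorem adM_mul (x : A) (M N : Matrix I I (PowerSeries A)) :
    adM x (M * N) = adM x M * N + M * adM x N := by
  ext i j : 1
  simp only [adM_apply, Matrix.mul_apply, Matrix.add_apply, map_sum, adC_mul,
    Finset.sum_add_distrib]

theorem adM_proj (x : A) (P : I → Prop) [DecidablePred P] : adM x (proj _ P) = 0 := by
  ext i j : 1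
  rw [adM_apply, proj_apply]
  split_ifs
  · exact adC_one x
  · exact map_zero _

theorem adM_eq_zero_iff {x : A} {M : Matrix I I (PowerSeries A)} : adM x M = 0 ↔ MComm x M := by
  rw [mComm_iff, ← Matrix.ext_iff]
  simp only [adM_apply, PowerSeries.ext_iff, Matrix.zero_apply, coeff_adC, map_zero, sub_eq_zero]

/-- The element `t` acts on the entries of `T` by the matrix unit in position `(b, a)`. -/
def ActsAs (t : A) (a b : I) (T : Matrix I I (PowerSeries A)) : Prop :=
  ∀ i j, adC t (T i j) = (if i = b then T a j else 0) - (if a = j then T i b else 0)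

theorem actsAs_of_adM {t : A} {a b : I} {T : Matrix I I (PowerSeries A)}
    (h : adM t T = Matrix.single b a 1 * T - T * Matrix.single b a 1) : ActsAs t a b T := by
  intro i j
  rw [← adM_apply, h, Matrix.sub_apply, single_mul_apply', mul_single_apply', one_mul, mul_one]

/-- The defect of the `RTT` relation. -/
noncomputable def defect (T : Matrix I I (PowerSeries A)) (i j h k : I) : BiSeries A :=
  kap * (iu (T i j) * iv (T h k) - iv (T h k) * iu (T i j))
    - lam 1 * (iu (T h j) * iv (T i k) - iv (T h j) * iu (T i k))

theorem iv_C (x : A) : iv (C x) = iu (C x) := by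
  apply bi_ext; intro r s
  rw [cf_iu, cf_iv, coeff_C, coeff_C]
  split_ifs <;> simp_all

/-- Both sides of RTT are built from `T(u) ⊗ T(v)` in a way that is compatible with matrix units
acting on both tensor positions, so each of the four indices of the defect is moved in turn. -/
theorem ActsAs.defect {t : A} {a b : I} {T : Matrix I I (PowerSeries A)} (h : ActsAs t a b T)
    (i j k l : I) : iu (C t) * defect T i j k l - defect T i j k l * iu (C t) =
      (if i = b then defect T a j k l else 0) - (if a = j then defect T i b k l else 0)
      + (if k = b then defect T i j a l else 0) - (if a = l then defect T i j k b else 0) := by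
  have hu : ∀ i j, iu (C t) * iu (T i j) - iu (T i j) * iu (C t) =
      (if i = b then iu (T a j) else 0) - (if a = j then iu (T i b) else 0) := fun i j => by
    have := congrArg iu (h i j)
    rw [adC_apply, map_sub, map_sub, map_mul, map_mul] at this
    rw [this]; split_ifs <;> simp
  have hv : ∀ i j, iu (C t) * iv (T i j) - iv (T i j) * iu (C t) =
      (if i = b then iv (T a j) else 0) - (if a = j then iv (T i b) else 0) := fun i j => by
    have := congrArg iv (h i j)
    rw [adC_apply, map_sub, map_sub, map_mul, map_mul, iv_C] at this
    rw [this]; split_ifs <;> simp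
  have e1 := hu i j
  have e2 := hv k l
  have e3 := hu k j
  have e4 := hv i l
  have e5 := hv k j
  have e6 := hu i l
  have k1 := kap_comm (iu (C t))
  have l1 := lam_comm 1 (iu (C t))
  unfold ParabolicYangian.defect
  split_ifs at * <;>
  linear_combination (norm := noncomm_ring)
    -k1 * (iu (T i j) * iv (T k l) - iv (T k l) * iu (T i j))
    + kap * (e1 * iv (T k l) + iu (T i j) * e2 - e2 * iu (T i j) - iv (T k l) * e1)
    + l1 * (iu (T k j) * iv (T i l) - iv (T k j) * iu (T i l))
    - lam 1 * (e3 * iv (T i l) + iu (T k j) * e4 - e5 * iu (T i l) - iv (T k j) * e6)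

/-- The `RTT` relation follows from its instances with entries of the upper left block and from
the action of the elements that connect the two blocks. -/
theorem rtt_of_actsAs {P Q : I → Prop} (hPQ : ∀ i, P i → ¬Q i) (hP : ∃ i, P i)
    {T : Matrix I I (PowerSeries A)} (hl : ∀ i j, ¬(P i ∨ Q i) → T i j = 0)
    (hr : ∀ i j, ¬(P j ∨ Q j) → T i j = 0) (h₀ : ∀ i j h k, P h → P k → defect T h k i j = 0)
    (hE : ∀ a b, P a → Q b → ∃ t, ActsAs t a b T) (hF : ∀ a b, Q a → P b → ∃ t, ActsAs t a b T) :
    RTT 1 T := by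
  suffices ∀ h k i j, defect T h k i j = 0 from fun i j h k => sub_eq_zero.1 (this i j h k)
  -- Acting on the vanishing defect with first entry `(h, h)` moves its column to `k`. All other
  -- terms still have first entry `(h, h)`.
  have h₁ : ∀ h k, P h → Q k → ∀ i j, defect T h k i j = 0 := by
    intro h k hh hk i j
    obtain ⟨t, ht⟩ := hE h k hh hk
    have := ht.defect h h i j
    have ne : h ≠ k := by rintro rfl; exact hPQ _ hh hk
    rw [h₀ _ _ _ _ hh hh, h₀ _ _ _ _ hh hh, h₀ _ _ _ _ hh hh, if_neg (c := h = k) ne] at this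
    simpa using this
  have h₂ : ∀ h k, Q h → P k → ∀ i j, defect T h k i j = 0 := by
    intro h k hh hk i j
    obtain ⟨t, ht⟩ := hF h k hh hk
    have := ht.defect k k i j
    have ne : h ≠ k := by rintro rfl; exact hPQ _ hk hh
    rw [h₀ _ _ _ _ hk hk, h₀ _ _ _ _ hk hk, h₀ _ _ _ _ hk hk, if_neg (c := h = k) ne] at this
    simpa using this.symm
  obtain ⟨l, hl'⟩ := hP
  -- Starting from `(l, k)` with `l` in `P`, the row is moved to `h`. If `h = k` there is an extra
  -- term with first entry `(l, l)`, which vanishes too.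
  have h₃ : ∀ h k, Q h → Q k → ∀ i j, defect T h k i j = 0 := by
    intro h k hh hk i j
    obtain ⟨t, ht⟩ := hF h l hh hl'
    have := ht.defect l k i j
    rw [h₁ _ _ hl' hk, h₁ _ _ hl' hk, h₁ _ _ hl' hk, h₀ _ _ _ _ hl' hl'] at this
    simpa using this.symm
  intro h k i j
  by_cases hh : P h ∨ Q h
  · by_cases hk : P k ∨ Q k
    · rcases hh with hh | hh <;> rcases hk with hk | hk
      · exact h₀ _ _ _ _ hh hk
      · exact h₁ _ _ hh hk _ _
      · exact h₂ _ _ hh hk _ _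
      · exact h₃ _ _ hh hk _ _
    · simp [defect, hr _ _ hk]
  · simp [defect, hl _ _ hh]

end Backward

/-! ### Commutators with coefficients of degree one -/

section Backward

variable {A : Type*} [Ring A] {I : Type*} [Fintype I] [DecidableEq I]

/-- The equation makes the row `u⁰` of the commutator vanish, so its row `u⁻¹` equals the row `u⁰`
of `w`. -/
theorem coeff_adC_left {f g : PowerSeries A} {w : BiSeries A}
    (h : kap * (iu f * iv g - iv g * iu f) = lam 1 * w) (s : ℕ) :
    coeff s (adC (coeff 1 f) g) = cf 0 s w := by
  have h1 := cf_eq_of_kap h 0 s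
  have h2 := ((kap_mul_eq_lam_mul_iff 1 _ _).1 h).1 (s + 1)
  rw [h2, sub_zero, map_sub, cf_iu_mul_iv, cf_iv_mul_iu] at h1
  rw [coeff_adC, ← h1]

theorem coeff_adC_right {f g : PowerSeries A} {w : BiSeries A}
    (h : kap * (iu f * iv g - iv g * iu f) = lam 1 * w) (s : ℕ) :
    coeff s (adC (coeff 1 g) f) = cf s 0 w := by
  have h1 := cf_eq_of_kap h s 0
  have h2 := ((kap_mul_eq_lam_mul_iff 1 _ _).1 h).2.1 (s + 1)
  rw [h2, zero_sub, map_sub, cf_iu_mul_iv, cf_iv_mul_iu] at h1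
  rw [coeff_adC, ← h1]; abel

/-- The degree-one coefficients span a copy of `gl`, acting on the entries of `T` by matrix units.
This holds because the constant term is an identity matrix. -/
theorem RTT.adC_one {T : Matrix I I (PowerSeries A)} (hT : RTT 1 T) {P : I → Prop}
    [DecidablePred P] (h0 : c0 T = proj A P) {a b : I} (ha : P a) (hb : P b) :
    ActsAs (coeff 1 (T a b)) a b T := by
  intro i j
  have e : ∀ i j, coeff 0 (T i j) = if i = j ∧ P i then 1 else 0 := fun i j => by
    rw [← c0_apply, h0, proj_apply]
  ext s
  rw [coeff_adC_left (hT a b i j)]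
  simp only [map_sub, cf_iu_mul_iv, cf_iv_mul_iu, e]
  by_cases h1 : i = b <;> by_cases h2 : a = j <;> simp_all

section Corner

variable {P Q : I → Prop} [DecidablePred P] [DecidablePred Q]
  {M M' G G' E F : Matrix I I (PowerSeries A)}

theorem Blocks.adC_M_E (t : Blocks P Q M M' G E F) (hT : RTT 1 (gaussProd M G E F))
    (hM : c0 M = proj A P) (hE : c0 E = 0) {i j : I} (hi : P i) (hj : P j) (h l : I) :
    adC (coeff 1 (M i j)) (E h l) = if h = j then E i l else 0 := by
  have e0 : ∀ i j, coeff 0 (E i j) = 0 := fun i j => by rw [← c0_apply, hE]; rfl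
  have m0 : ∀ i j, coeff 0 (M i j) = if i = j ∧ P i then 1 else 0 := fun i j => by
    rw [← c0_apply, hM, proj_apply]
  have := Blocks.M_E t hT i h l hj
  split_ifs at this ⊢ with hh
  · ext s
    rw [coeff_adC_left this, mul_sub, ← map_mul, Matrix.sub_apply, matU_apply, Matrix.mul_apply]
    simp only [matU_apply, matV_apply, map_sub, map_sum, cf_iu_mul_iv, m0, cf_iu]
    cases s with
    | zero => simp [coeff_mul, Matrix.mul_apply, hi, e0]
    | succ s => simp [hi]
  · exact adC_eq_zero fun r => sComm_iff.2 (sub_eq_zero.1 (kap_regular this)) 1 r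

theorem Blocks.adC_G_E (t : Blocks P Q M M' G E F) (g : CornerInverse (proj _ Q) G G')
    (hPQ : ∀ i, P i → ¬Q i) (hT : RTT 1 (gaussProd M G E F))
    (hG : c0 G = proj A Q) (hE : c0 E = 0) {i : I} (hi : Q i) (j h l : I) :
    adC (coeff 1 (G i j)) (E h l) = if i = l then -E h j else 0 := by
  have e0 : ∀ i j, coeff 0 (E i j) = 0 := fun i j => by rw [← c0_apply, hE]; rfl
  have m0 : ∀ i j, coeff 0 (G i j) = if i = j ∧ Q i then 1 else 0 := fun i j => by
    rw [← c0_apply, hG, proj_apply]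
  have := Blocks.G_E t g hPQ hT i j h l
  rw [mul_sub (iu (G i l)), ← map_mul] at this
  ext s
  rw [coeff_adC_left this, map_sub, cf_iu_mul_iv, m0, cf_iu]
  by_cases hs : s = 0
  · have := e0 h j
    subst hs; by_cases hil : i = l <;> simp_all [coeff_mul]
  · by_cases hil : i = l
    · subst hil; simp [hi, hs]
    · simp [hil, hs]

theorem Blocks.E_one_comm (t : Blocks P Q M M' G E F) (hT : RTT 1 (gaussProd M G E F))
    (hE : c0 E = 0) (i j h l : I) :
    coeff 1 (E i j) * coeff 1 (E h l) = coeff 1 (E h l) * coeff 1 (E i j) := by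
  have e0 : ∀ i j, coeff 0 (E i j) = 0 := fun i j => by rw [← c0_apply, hE]; rfl
  have := coeff_adC_left (Blocks.E_E t (by norm_num) hT i j h l) 1
  simp only [mul_sub, sub_mul, ← map_mul iu, ← map_mul iv, map_sub, cf_iu_mul_iv, cf_iv_mul_iu,
    e0, cf_iu, cf_iv, coeff_adC] at this
  rw [← sub_eq_zero, this]
  simp [coeff_mul, Finset.Nat.antidiagonal_succ, e0]

theorem Blocks.E_F_one (t : Blocks P Q M M' G E F) (hT : RTT 1 (gaussProd M G E F))
    (i j h l : I) : adC (coeff 1 (E i j)) (F h l) =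
      C (coeff 0 (M' i l) * coeff 0 (G h j)) - G h j * M' i l := by
  ext s
  rw [coeff_adC_left (Blocks.E_F t hT i j h l), ← map_mul, ← map_mul, map_sub, cf_iu, cf_iv,
    if_pos rfl, map_sub, coeff_C]
  congr 1
  split_ifs
  · simp [coeff_mul]
  · rfl

end Corner

end Backward

/-! ### Extension of a row of blocks beyond its neighbour -/

section Extension

variable {A : Type*} [Ring A] {I : Type*} [Fintype I] [DecidableEq I]

/-- The Jacobi identity, in the form used to carry known commutators from one index to another. -/
theorem adC_adC_coeff (x : A) (g f : PowerSeries A) (r : ℕ) :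
    adC x (adC (coeff r g) f) = adC (coeff r (adC x g)) f + adC (coeff r g) (adC x f) := by
  rw [coeff_adC, adC_lie, sub_add_cancel]

theorem SComm.adC_eq_zero {f g : PowerSeries A} (h : SComm f g) (r : ℕ) : adC (coeff r f) g = 0 :=
  ParabolicYangian.adC_eq_zero (h r)

theorem adC_coeff_eq_zero_symm {f g : PowerSeries A} (h : ∀ r, adC (coeff r f) g = 0) (r : ℕ) :
    adC (coeff r g) f = 0 := by
  ext s
  have := congrArg (coeff r) (h s)
  rw [coeff_adC, map_zero] at this ⊢
  rw [← neg_eq_zero, ← this, neg_sub]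

/-- The data for adding block `k` to a matrix `T₁` with the blocks beyond `k`, as far as the
part of the factorization above the diagonal is concerned. -/
structure RowData (β : I → ℕ) (k : ℕ) (p₀ : I) (D E : ℕ → Matrix I I (PowerSeries A))
    (d' T₁ T₂ E₁ F₁ : Matrix I I (PowerSeries A)) : Prop where
  half : HalfSystem β D E
  E_left : ∀ {a i j}, β i ≠ a → E a i j = 0
  E_right : ∀ {a i j}, β j ≠ a + 1 → E a i j = 0
  E_const : ∀ a i j, coeff 0 (E a i j) = 0
  D_const : ∀ a i j, coeff 0 (D a i j) = if i = j ∧ β i = a then 1 else 0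
  blocks : Blocks (fun i => β i = k + 1) (fun i => k + 1 < β i) (D (k + 1)) d' T₂ E₁ F₁
  eq : T₁ = gaussProd (D (k + 1)) T₂ E₁ F₁
  rtt : RTT 1 T₁
  rem : Remainder β (k + 1) T₁
  E_next : ∀ i j, β j = k + 2 → E₁ i j = E (k + 1) i j
  E_F : ∀ h l i j, SComm (E k h l) (F₁ i j)
  E_T : ∀ h l i j, SComm (E k h l) (T₂ i j)
  D_E : ∀ h l i j, SComm (D k h l) (E₁ i j)
  base : β p₀ = k + 1
  next : ∀ j, k + 1 < β j → ∃ x, β x = k + 2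
  two : ∀ x : A, x + x = 0 → x = 0

/-- The extension of the block `E k` to all columns beyond block `k`. -/
noncomputable def extendRow (β : I → ℕ) (k : ℕ) (p₀ : I) (E E₁ : Matrix I I (PowerSeries A)) :
    Matrix I I (PowerSeries A) :=
  Matrix.of fun h j => if β j = k + 1 then E h j else
    if k + 1 < β j then -adC (coeff 1 (E₁ p₀ j)) (E h p₀) else 0

section

variable {β : I → ℕ} {k : ℕ} {p₀ : I} {E E₁ : Matrix I I (PowerSeries A)}

theorem extendRow_of_eq {h j : I} (hj : β j = k + 1) : extendRow β k p₀ E E₁ h j = E h j := by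
  rw [extendRow, Matrix.of_apply, if_pos hj]

theorem extendRow_of_lt {h j : I} (hj : k + 1 < β j) :
    extendRow β k p₀ E E₁ h j = -adC (coeff 1 (E₁ p₀ j)) (E h p₀) := by
  rw [extendRow, Matrix.of_apply, if_neg (by omega), if_pos hj]

theorem extendRow_of_le {h j : I} (hj : β j ≤ k) : extendRow β k p₀ E E₁ h j = 0 := by
  rw [extendRow, Matrix.of_apply, if_neg (by omega), if_neg (by omega)]

end

namespace RowData

variable {β : I → ℕ} {k : ℕ} {p₀ : I} {D E : ℕ → Matrix I I (PowerSeries A)}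
  {d' T₁ T₂ E₁ F₁ : Matrix I I (PowerSeries A)} (R : RowData β k p₀ D E d' T₁ T₂ E₁ F₁)

theorem c0_all (R : RowData β k p₀ D E d' T₁ T₂ E₁ F₁) : c0 (D (k + 1)) = proj A (fun i => β i = k + 1) ∧ c0 E₁ = 0 ∧ c0 F₁ = 0 ∧
    c0 T₂ = proj A (fun i => k + 1 < β i) := by
  refine Blocks.c0_gauss R.blocks ?_
  rw [← R.eq, R.rem.const, proj_block_add]

theorem rtt' (R : RowData β k p₀ D E d' T₁ T₂ E₁ F₁) : RTT 1 (gaussProd (D (k + 1)) T₂ E₁ F₁) :=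
  R.eq ▸ R.rtt

theorem exists_inverse (R : RowData β k p₀ D E d' T₁ T₂ E₁ F₁) :
    ∃ G', CornerInverse (proj _ fun i => k + 1 < β i) T₂ G' :=
  exists_cornerInverse R.blocks.qG R.blocks.Gq R.c0_all.2.2.2

theorem D_E₁ (R : RowData β k p₀ D E d' T₁ T₂ E₁ F₁) {i j : I} (hi : β i = k + 1)
    (hj : β j = k + 1) (h l : I) :
    adC (coeff 1 (D (k + 1) i j)) (E₁ h l) = if h = j then E₁ i l else 0 :=
  Blocks.adC_M_E R.blocks R.rtt' R.c0_all.1 R.c0_all.2.1 hi hj h l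

theorem T_E₁ (R : RowData β k p₀ D E d' T₁ T₂ E₁ F₁) {i : I} (hi : k + 1 < β i) (j h l : I) :
    adC (coeff 1 (T₂ i j)) (E₁ h l) = if i = l then -E₁ h j else 0 := by
  obtain ⟨G', g⟩ := R.exists_inverse
  exact Blocks.adC_G_E R.blocks g (fun i hi => by omega) R.rtt' R.c0_all.2.2.2 R.c0_all.2.1 hi j h l

theorem T_E (R : RowData β k p₀ D E d' T₁ T₂ E₁ F₁) (i j h l : I) (r : ℕ) :
    adC (coeff r (T₂ i j)) (E k h l) = 0 := (R.E_T h l i j).symm.adC_eq_zero r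

theorem D_E_one (R : RowData β k p₀ D E d' T₁ T₂ E₁ F₁) {i : I} (hi : β i = k + 1) (j h l : I) :
    adC (coeff 1 (D (k + 1) i j)) (E k h l) = if i = l then -E k h j else 0 := by
  have := R.half.D_E_succ k i j h l
  rw [mul_sub (iu (D (k + 1) i l)), ← map_mul] at this
  have e0 := R.E_const k h j
  ext s
  rw [coeff_adC_left this, map_sub, cf_iu_mul_iv, R.D_const, cf_iu]
  by_cases hs : s = 0
  · subst hs; by_cases hil : i = l <;> simp_all [coeff_mul]
  · by_cases hil : i = l
    · subst hil; simp [hi, hs]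
    · simp [hil, hs]

/-- For columns in block `k + 2` this is one of the relations. The degree-one entry `(x, j)` of `T₂`
commutes with `E k` and carries column `x` of `E₁` to any later column `j`. -/
theorem E₁_E_ne (R : RowData β k p₀ D E d' T₁ T₂ E₁ F₁) {q j p : I} (hj : k + 1 < β j)
    (hpq : q ≠ p) (h : I) (r : ℕ) : adC (coeff r (E₁ q j)) (E k h p) = 0 := by
  have next : ∀ x, β x = k + 2 → adC (coeff r (E₁ q x)) (E k h p) = 0 := fun x hx => by
    rw [R.E_next _ _ hx]
    exact (R.half.E_E_succ_ne k h p q x hpq).symm.adC_eq_zero r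
  obtain ⟨x, hx⟩ := R.next j hj
  have := adC_adC_coeff (coeff 1 (T₂ x j)) (E₁ q x) (E k h p) r
  rw [next x hx, R.T_E, R.T_E₁ (by omega), if_pos rfl, map_neg, adC_neg] at this
  simpa using this

/-- The extension does not depend on the choice of `p₀` in block `k + 1`: the degree-one
coefficients of `D (k + 1)` exchange the candidates. -/
theorem E₁_E (R : RowData β k p₀ D E d' T₁ T₂ E₁ F₁) {q j p : I} (hq : β q = k + 1)
    (hj : k + 1 < β j) (h : I) : adC (coeff 1 (E₁ q j)) (E k h p) =
      if q = p then -extendRow β k p₀ (E k) E₁ h j else 0 := by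
  split_ifs with hpq
  · subst hpq
    rw [extendRow_of_lt hj, neg_neg]
    by_cases hq0 : q = p₀
    · rw [hq0]
    · have := adC_adC_coeff (coeff 1 (D (k + 1) q p₀)) (E₁ p₀ j) (E k h q) 1
      rw [R.E₁_E_ne hj (Ne.symm hq0), R.D_E_one hq, R.D_E₁ hq R.base, if_pos rfl, if_pos rfl,
        map_neg, map_zero] at this
      rw [eq_comm, ← sub_eq_zero, sub_eq_add_neg] at this
      rw [← sub_eq_zero, ← this]; abel
  · exact R.E₁_E_ne hj hpq h 1

theorem T_extend (R : RowData β k p₀ D E d' T₁ T₂ E₁ F₁) {i j : I} (hi : k + 1 < β i)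
    (hj : k + 1 < β j) (h l : I) : adC (coeff 1 (T₂ i j)) (extendRow β k p₀ (E k) E₁ h l) =
      if i = l then -extendRow β k p₀ (E k) E₁ h j else 0 := by
  rcases lt_trichotomy (k + 1) (β l) with hl | hl | hl
  · rw [extendRow_of_lt hl, map_neg, adC_adC_coeff, R.T_E, R.T_E₁ hi, map_zero, add_zero]
    split_ifs
    · rw [extendRow_of_lt hj, map_neg, adC_neg]
    · rw [map_zero, adC_zero, neg_zero]
  · rw [extendRow_of_eq hl.symm, R.T_E, if_neg (by rintro rfl; omega)]
  · rw [extendRow_of_le (by omega), map_zero, if_neg (by rintro rfl; omega)]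

/-- The essential case is that a double commutator with degree-one coefficients of `E₁` kills `E k`.
In block `k + 2` this is a Serre relation, and `T₂` spreads it to all later columns. -/
theorem E₁_extend (R : RowData β k p₀ D E d' T₁ T₂ E₁ F₁) {p b : I} (hp : β p = k + 1)
    (hb : k + 1 < β b) (h l : I) : adC (coeff 1 (E₁ p b)) (extendRow β k p₀ (E k) E₁ h l) =
      if p = l then -extendRow β k p₀ (E k) E₁ h b else 0 := by
  rcases lt_trichotomy (k + 1) (β l) with hl | hl | hl
  · have key : ∀ b l, k + 1 < β b → k + 1 < β l →
        adC (coeff 1 (E₁ p b)) (adC (coeff 1 (E₁ p l)) (E k h p)) = 0 := by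
      have symm : ∀ b l, adC (coeff 1 (E₁ p b)) (adC (coeff 1 (E₁ p l)) (E k h p)) =
          adC (coeff 1 (E₁ p l)) (adC (coeff 1 (E₁ p b)) (E k h p)) := fun b l => by
        rw [← sub_eq_zero, ← adC_lie, Blocks.E_one_comm R.blocks R.rtt' R.c0_all.2.1, sub_self,
          adC_zero]
      have act : ∀ x j b l, k + 1 < β x →
          adC (coeff 1 (T₂ x j)) (adC (coeff 1 (E₁ p b)) (adC (coeff 1 (E₁ p l)) (E k h p))) =
          -(if x = b then adC (coeff 1 (E₁ p j)) (adC (coeff 1 (E₁ p l)) (E k h p)) else 0)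
          - (if x = l then adC (coeff 1 (E₁ p b)) (adC (coeff 1 (E₁ p j)) (E k h p)) else 0) := by
        intro x j b l hx
        rw [adC_adC_coeff, adC_adC_coeff (coeff 1 (T₂ x j)) (E₁ p l), R.T_E, R.T_E₁ hx, R.T_E₁ hx]
        split_ifs <;> simp [adC_neg, adC_zero, sub_eq_add_neg]
      obtain ⟨x, hx⟩ := R.next l hl
      have two : ∀ f : PowerSeries A, f + f = 0 → f = 0 := fun f hf => by
        ext r
        exact R.two _ (by rw [← map_add, hf, map_zero])
      -- The Serre relation with two equal outer factors gives twice the double commutator.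
      have h₀ : adC (coeff 1 (E₁ p x)) (adC (coeff 1 (E₁ p x)) (E k h p)) = 0 := by
        rw [R.E_next _ _ hx]
        ext r
        have := R.half.serre (k + 1) k p x p x h p (Or.inl rfl) 1 1 r
        simp only [Ring.lie_def] at this
        rw [coeff_adC, coeff_adC, map_zero]
        exact R.two _ this
      -- Acting on `h₀` moves each of the two columns `x` to `j` in turn. The two terms agree, so
      -- again a factor two is cancelled.
      have h₁ : ∀ j, adC (coeff 1 (E₁ p x)) (adC (coeff 1 (E₁ p j)) (E k h p)) = 0 := fun j => by
        have := act x j x x (by omega)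
        rw [h₀, map_zero, if_pos rfl, if_pos rfl, symm j x] at this
        refine two _ ?_
        rw [← neg_eq_zero, this]; abel
      intro b l _ _
      have := act x l b x (by omega)
      rw [symm b x, h₁, map_zero, if_pos rfl] at this
      by_cases hxb : x = b
      · rw [← hxb]; exact h₁ l
      · rw [if_neg hxb] at this
        simpa using this.symm
    have e := R.E₁_E (p := p) hp hl h
    rw [if_pos rfl] at e
    rw [← neg_neg (extendRow β k p₀ (E k) E₁ h l), ← e, map_neg, key b l hb hl, neg_zero,
      if_neg (by rintro rfl; omega)]
  · rw [extendRow_of_eq hl.symm, R.E₁_E hp hb]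
  · rw [extendRow_of_le (by omega), map_zero, if_neg (by rintro rfl; omega)]

end RowData

end Extension

/-! ### The extended row acting on the remainder and on itself -/

section Extension

variable {A : Type*} [Ring A] {I : Type*} [Fintype I] [DecidableEq I]

theorem Blocks.gauss_apply_right {P Q : I → Prop} [DecidablePred P] [DecidablePred Q]
    {M M' G E F : Matrix I I (PowerSeries A)} (t : Blocks P Q M M' G E F) {i j : I} (hi : P i)
    (hj : Q j) : gaussProd M G E F i j = (M * E) i j := by
  rw [← congrFun (congrFun t.p_gauss_q i) j, mul_proj_apply, if_pos hj, proj_mul_apply, if_pos hi]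

theorem coeff_one_mul_apply {M N : Matrix I I (PowerSeries A)} {P : I → Prop} [DecidablePred P]
    (hM : c0 M = proj A P) (hN : c0 N = 0) {i : I} (hi : P i) (j : I) :
    coeff 1 ((M * N) i j) = coeff 1 (N i j) := by
  have hM' : ∀ i j, coeff 0 (M i j) = if i = j ∧ P i then 1 else 0 := fun i j => by
    rw [← c0_apply, hM, proj_apply]
  have hN' : ∀ i j, coeff 0 (N i j) = 0 := fun i j => by rw [← c0_apply, hN]; rfl
  rw [Matrix.mul_apply, map_sum, Finset.sum_eq_single i]
  · rw [coeff_mul, Finset.Nat.antidiagonal_succ]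
    simp [hM', hi, hN', -coeff_zero_eq_constantCoeff]
  · intro b _ hb
    rw [coeff_mul, Finset.Nat.antidiagonal_succ]
    simp [hM', hi, hN', hb.symm, -coeff_zero_eq_constantCoeff]
  · simp

namespace RowData

variable {β : I → ℕ} {k : ℕ} {p₀ : I} {D E : ℕ → Matrix I I (PowerSeries A)}
  {d' T₁ T₂ E₁ F₁ : Matrix I I (PowerSeries A)}

/-- In degree one the entries of `E₁` coincide with those of `T₁`, since the constant term of `D (k
+ 1)` is an identity; so they act by matrix units. -/
theorem E₁_T (R : RowData β k p₀ D E d' T₁ T₂ E₁ F₁) {p b : I} (hp : β p = k + 1)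
    (hb : k + 1 < β b) : ActsAs (coeff 1 (E₁ p b)) p b T₁ := by
  have h := RTT.adC_one R.rtt R.rem.const (a := p) (b := b) (by omega) (by omega)
  convert h using 1
  rw [R.eq, Blocks.gauss_apply_right R.blocks hp hb,
    coeff_one_mul_apply R.c0_all.1 R.c0_all.2.1 hp]

theorem extend_left (R : RowData β k p₀ D E d' T₁ T₂ E₁ F₁) {i j : I} (hi : β i ≠ k) :
    extendRow β k p₀ (E k) E₁ i j = 0 := by
  rw [extendRow, Matrix.of_apply, R.E_left hi, R.E_left hi, map_zero, neg_zero, ite_self, ite_self]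

theorem coeff_zero_extend (R : RowData β k p₀ D E d' T₁ T₂ E₁ F₁) (i j : I) :
    coeff 0 (extendRow β k p₀ (E k) E₁ i j) = 0 := by
  rw [extendRow, Matrix.of_apply]
  split_ifs
  · exact R.E_const k i j
  · rw [map_neg, coeff_adC, R.E_const]; simp
  · simp

theorem E_E₁_next (R : RowData β k p₀ D E d' T₁ T₂ E₁ F₁) {b y : I} (hb : β b = k + 1)
    (hy : β y = k + 2) (a : I) : adC (coeff 1 (E k a b)) (E₁ b y) =
      extendRow β k p₀ (E k) E₁ a y - (E k * E₁) a y := by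
  have hX := R.E₁_E (p := b) (j := y) hb (by omega) a
  rw [if_pos rfl] at hX
  rw [← neg_neg (extendRow β k p₀ (E k) E₁ a y), ← hX]
  have hs := R.half.E_E_succ k a b b y hb
  simp only [Ring.lie_def, ← R.E_next _ _ hy] at hs
  have e0 : ∀ i j, coeff 0 (E₁ i j) = 0 := fun i j => by rw [← c0_apply, R.c0_all.2.1]; rfl
  -- The relation `E_E_succ` moves one degree from `E₁` to `E k` at the cost of a quadratic term.
  -- Iteration leaves degree one in `E₁`, where the commutator is by definition a coefficient of the
  -- extended row, and the quadratic terms add up to the product `E k * E₁`.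
  have key : ∀ s n, coeff 1 (E k a b) * coeff (s + 1 + n) (E₁ b y)
      - coeff (s + 1 + n) (E₁ b y) * coeff 1 (E k a b) =
      coeff (s + 1) (E k a b) * coeff (n + 1) (E₁ b y)
      - coeff (n + 1) (E₁ b y) * coeff (s + 1) (E k a b)
      - ∑ t ∈ Finset.range s, ∑ q, coeff (t + 1) (E k a q) * coeff (s + n - t) (E₁ q y) := by
    intro s
    induction s with
    | zero => intro n; simp [add_comm]
    | succ s ih =>
      intro n
      have h1 := hs (s + 1) (n + 1) (by omega) (by omega)
      have h2 := ih (n + 1)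
      have h3 : ∑ t ∈ Finset.range s, ∑ q, coeff (t + 1) (E k a q) * coeff (s + (n + 1) - t) (E₁ q y) =
          ∑ t ∈ Finset.range s, ∑ q, coeff (t + 1) (E k a q) * coeff (s + 1 + n - t) (E₁ q y) := by
        simp only [show ∀ t, s + (n + 1) - t = s + 1 + n - t from fun t => by omega]
      rw [h3, show s + 1 + (n + 1) = s + 1 + 1 + n by ring] at h2
      rw [h2, Finset.sum_range_succ, show s + 1 + n - s = n + 1 by omega]
      rw [if_pos trivial] at h1
      generalize (∑ q, coeff (s + 1) (E k a q) * coeff (n + 1) (E₁ q y)) = S at *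
      generalize (∑ t ∈ Finset.range s, ∑ q,
        coeff (t + 1) (E k a q) * coeff (s + 1 + n - t) (E₁ q y)) = S' at *
      linear_combination (norm := noncomm_ring) h1
  ext s
  rw [coeff_adC, map_sub, map_neg, coeff_adC]
  cases s with
  | zero => simp [e0, R.E_const, Matrix.mul_apply, coeff_mul, -coeff_zero_eq_constantCoeff]
  | succ s =>
    have := key s 0
    rw [add_zero] at this
    have hsum : coeff (s + 1) ((E k * E₁) a y) =
        ∑ t ∈ Finset.range s, ∑ q, coeff (t + 1) (E k a q) * coeff (s + 0 - t) (E₁ q y) := by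
      rw [Matrix.mul_apply, map_sum, Finset.sum_comm]
      refine Finset.sum_congr rfl fun q _ => ?_
      rw [coeff_mul, Finset.Nat.sum_antidiagonal_eq_sum_range_succ_mk, Finset.sum_range_succ,
        Finset.sum_range_succ', R.E_const, Nat.sub_self, e0, mul_zero, add_zero, zero_mul, add_zero]
      refine Finset.sum_congr rfl fun t _ => ?_
      rw [show s + 1 - (t + 1) = s + 0 - t by omega]
    rw [this, neg_sub, zero_add, hsum]

/-- The formula for a column of block `k + 2` is carried to column `y` by a degree-one entry of
`T₂`, which commutes with `E k`. -/
theorem E_E₁ (R : RowData β k p₀ D E d' T₁ T₂ E₁ F₁) {b y : I} (hb : β b = k + 1)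
    (hy : k + 1 < β y) (a x : I) : adC (coeff 1 (E k a b)) (E₁ x y) =
      if x = b then extendRow β k p₀ (E k) E₁ a y - (E k * E₁) a y else 0 := by
  split_ifs with hxb
  · subst hxb
    obtain ⟨z, hz⟩ := R.next y hy
    have h1 := R.E_E₁_next hb hz a
    have h2 := congrArg (adC (coeff 1 (T₂ z y))) h1
    have hM : ∀ q, adC (coeff 1 (T₂ z y)) (E k a q * E₁ q z) = -(E k a q * E₁ q y) := fun q => by
      rw [adC_mul, R.T_E, R.T_E₁ (by omega), if_pos rfl]; simp
    rw [adC_adC_coeff, R.T_E, map_zero, adC_zero, zero_add, R.T_E₁ (by omega), if_pos rfl, map_sub,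
      R.T_extend (by omega) hy, if_pos rfl, Matrix.mul_apply, map_sum,
      Finset.sum_congr rfl fun q _ => hM q, map_neg, Finset.sum_neg_distrib] at h2
    rw [← neg_inj, h2, Matrix.mul_apply]; abel
  · exact adC_coeff_eq_zero_symm (fun r => R.E₁_E_ne hy hxb a r) 1

/-- The matrix with row `b` equal to row `a` of the extension. -/
theorem extend_T_base (R : RowData β k p₀ D E d' T₁ T₂ E₁ F₁) {b : I} (hb : β b = k + 1)
    (a i j : I) : adC (coeff 1 (E k a b)) (T₁ i j) = T₁ i b * extendRow β k p₀ (E k) E₁ a j := by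
  set X := extendRow β k p₀ (E k) E₁ with hX
  set K : Matrix I I (PowerSeries A) := Matrix.of fun l j => if l = b then X a j else 0 with hK
  have mulK : ∀ N : Matrix I I (PowerSeries A), ∀ i j, (N * K) i j = N i b * X a j := by
    intro N i j
    rw [Matrix.mul_apply, Finset.sum_eq_single b]
    · rw [hK, Matrix.of_apply, if_pos rfl]
    · intro l _ hl
      rw [hK, Matrix.of_apply, if_neg hl, mul_zero]
    · simp
  -- The argument of `Tower.dk_E` in the opposite direction: the known commutators with the factors
  -- of `T₁` assemble to right multiplication by a matrix with one nonzero row.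
  have := (R.blocks.log_derivation_iff (adM (coeff 1 (E k a b))) (adM_mul _) (K := K)
    (adM_proj _ _) (adM_proj _ _) ?_ ?_).2 ⟨?_, ?_, ?_, ?_⟩
  · rw [← R.eq] at this
    rw [← adM_apply, this, mulK]
  · refine proj_mul_eq_iff.2 fun i j hi => ?_
    rw [hK, Matrix.of_apply, if_neg (by rintro rfl; exact hi hb)]
  · rw [proj_block_add]
    refine mul_proj_eq_iff.2 fun i j hj => ?_
    rw [hK, Matrix.of_apply, hX, extendRow_of_le (by omega), ite_self]
  · ext i j s
    have h := R.half.D_E_succ k i j a b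
    rw [adM_apply, coeff_adC_right h, mul_proj_apply, mulK]
    have e0 := R.E_const k a j
    rw [mul_sub, ← map_mul, map_sub, cf_iu_mul_iv, e0, mul_zero, sub_zero, cf_iu, if_pos rfl]
    split_ifs with hj
    · rw [hX, extendRow_of_eq hj]
    · rw [R.E_right hj, mul_zero]
  · ext x y : 1
    rw [adM_apply, Matrix.sub_apply, mul_proj_apply]
    have h0 : (K * proj (PowerSeries A) (fun i => β i = k + 1) * E₁) x y =
        if x = b then (E k * E₁) a y else 0 := by
      rw [Matrix.mul_apply, Matrix.mul_apply]
      simp only [mul_proj_apply, hK, Matrix.of_apply]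
      split_ifs with hx
      · refine Finset.sum_congr rfl fun q _ => ?_
        split_ifs with hq
        · rw [hX, extendRow_of_eq hq]
        · rw [R.E_right hq]
      · simp
    rw [h0]
    by_cases hy : k + 1 < β y
    · rw [R.E_E₁ hb hy, if_pos hy, hK, Matrix.of_apply]
      split_ifs <;> simp [hX]
    · rw [if_neg hy, Blocks.col_eq_zero_of_proj R.blocks.Eq hy, map_zero,
        Blocks.col_eq_zero_of_proj (N := E k * E₁) (P := fun i => k + 1 < β i)
          (by rw [mul_assoc, R.blocks.Eq]) hy]
      simp
  · rw [adM_eq_zero_iff]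
    exact mComm_iff.2 fun i j r => R.E_F a b i j 1 r
  · rw [adM_eq_zero_iff]
    exact mComm_iff.2 fun i j r => R.E_T a b i j 1 r

theorem coeff_extend_eq (R : RowData β k p₀ D E d' T₁ T₂ E₁ F₁) {b p : I} (hb : k + 1 < β b)
    (hp : β p = k + 1) (a : I) (r : ℕ) : coeff r (extendRow β k p₀ (E k) E₁ a b) =
      -(coeff 1 (E₁ p b) * coeff r (E k a p) - coeff r (E k a p) * coeff 1 (E₁ p b)) := by
  have := R.E₁_E (p := p) hp hb a
  rw [if_pos rfl] at this
  rw [← coeff_adC, this, map_neg, neg_neg]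

/-- For `b` beyond block `k + 1` the acting element is itself a commutator of degree-one
coefficients of `E₁` and `E k`, whose actions on `T₁` are known. The formula then follows from the
Jacobi identity. -/
theorem extend_T (R : RowData β k p₀ D E d' T₁ T₂ E₁ F₁) {b : I} (hb : k < β b)
    (a i j : I) : adC (coeff 1 (extendRow β k p₀ (E k) E₁ a b)) (T₁ i j) =
      T₁ i b * extendRow β k p₀ (E k) E₁ a j := by
  by_cases hb' : β b = k + 1
  · rw [extendRow_of_eq hb']; exact R.extend_T_base hb' a i j
  · have hb : k + 1 < β b := by omega
    have hp := R.base
    have act := R.E₁_T hp hb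
    rw [R.coeff_extend_eq hb R.base, adC_neg, adC_lie, R.extend_T_base hp, act, adC_mul, act,
      R.E₁_extend hp hb, map_sub, apply_ite (adC (coeff 1 (E k a p₀))),
      apply_ite (adC (coeff 1 (E k a p₀))), R.extend_T_base hp, R.extend_T_base hp, map_zero,
      if_pos rfl]
    split_ifs <;> noncomm_ring

theorem E_E_one (R : RowData β k p₀ D E d' T₁ T₂ E₁ F₁) (a b i j : I) :
    adC (coeff 1 (E k a b)) (E k i j) = E k i b * E k a j := by
  ext s
  rw [coeff_adC_right (R.half.E_E_same k i j a b)]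
  simp only [mul_sub, sub_mul, ← map_mul iu, ← map_mul iv, map_sub, cf_iu_mul_iv, cf_iv_mul_iu,
    R.E_const, cf_iu, cf_iv, if_pos]
  cases s <;> simp [coeff_mul, R.E_const, -coeff_zero_eq_constantCoeff]

/-- For one column in block `k + 1` and the other in block `k + 2` this is a Serre relation in
degree one, up to a factor two. Degree-one coefficients of `T₂` and `E₁` then move the columns
further. -/
theorem extend_one_comm (R : RowData β k p₀ D E d' T₁ T₂ E₁ F₁) {b j : I} (hb : k < β b)
    (hj : k < β j) (a i : I) :
    coeff 1 (adC (coeff 1 (extendRow β k p₀ (E k) E₁ a b)) (extendRow β k p₀ (E k) E₁ i j)) =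
      0 := by
  set X := extendRow β k p₀ (E k) E₁ with hX
  have symm : ∀ x y : PowerSeries A, coeff 1 (adC (coeff 1 x) y) = 0 →
      coeff 1 (adC (coeff 1 y) x) = 0 := fun x y h => by
    rw [coeff_adC] at h ⊢
    rw [← neg_eq_zero, ← h, neg_sub]
  have zero : ∀ (x : A) (f : PowerSeries A), coeff 1 f = 0 → coeff 1 (adC x f) = 0 :=
    fun x f h => by rw [coeff_adC, h]; simp
  have next : ∀ {b j}, β b = k + 1 → β j = k + 2 → ∀ a i,
      coeff 1 (adC (coeff 1 (X a b)) (X i j)) = 0 := by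
    intro b j hb hj a i
    have := R.half.serre k (k + 1) a b i p₀ p₀ j (Or.inr rfl) 1 1 1
    have := R.two _ this
    rw [hX, extendRow_of_eq hb, coeff_adC, R.coeff_extend_eq (by omega) R.base, ← this,
      R.E_next _ _ hj]
    simp only [Ring.lie_def]
    noncomm_ring
  have base : ∀ {b j}, β b = k + 1 → k < β j → ∀ a i,
      coeff 1 (adC (coeff 1 (X a b)) (X i j)) = 0 := by
    intro b j hb hj a i
    by_cases hj' : β j = k + 1
    · rw [hX, extendRow_of_eq hb, extendRow_of_eq hj', R.E_E_one]
      rw [coeff_mul, Finset.Nat.antidiagonal_succ]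
      simp [R.E_const, -coeff_zero_eq_constantCoeff]
    · obtain ⟨x, hx⟩ := R.next j (by omega)
      have h1 := zero (coeff 1 (T₂ x j)) _ (next hb hx a i)
      rw [adC_adC_coeff, hX, R.T_extend (by omega) (by omega), R.T_extend (by omega) (by omega),
        if_pos rfl, if_neg (by rintro rfl; omega), map_zero, adC_zero, zero_add, map_neg,
        map_neg, neg_eq_zero] at h1
      exact h1
  by_cases hb' : β b = k + 1
  · exact base hb' hj a i
  · by_cases hj' : β j = k + 1
    · exact symm _ _ (base hj' hb i a)
    · have h1 := zero (coeff 1 (E₁ p₀ b)) _ (base R.base hj a i)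
      rw [adC_adC_coeff, hX, R.E₁_extend R.base (by omega), R.E₁_extend R.base (by omega),
        if_pos rfl, if_neg (by rintro rfl; exact hj' R.base), map_zero, add_zero, map_neg, adC_neg,
        map_neg, neg_eq_zero] at h1
      exact h1

/-- Two commuting degree-one elements of the row, in columns `b` and `c ≠ b`, act on `T₁` in either
order with the same result. Comparison gives an identity between multiples of the columns `c` and
`b` of `T₁`, and invertibility of `T₁` forces both multipliers to vanish. -/
theorem extend_extend (R : RowData β k p₀ D E d' T₁ T₂ E₁ F₁) {b : I} (hb : k < β b) (a i j : I) :
    adC (coeff 1 (extendRow β k p₀ (E k) E₁ a b)) (extendRow β k p₀ (E k) E₁ i j) =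
      extendRow β k p₀ (E k) E₁ i b * extendRow β k p₀ (E k) E₁ a j := by
  by_cases hc : ∃ c, k < β c ∧ c ≠ b
  · obtain ⟨c, hc, hcb⟩ := hc
    obtain ⟨T', ht⟩ := R.rem.exists_inverse
    set X := extendRow β k p₀ (E k) E₁ with hX
    have h1 : ∀ p, T₁ p c * (adC (coeff 1 (X a b)) (X i j) - X i b * X a j) =
        T₁ p b * (adC (coeff 1 (X i c)) (X a j) - X a c * X i j) := by
      intro p
      have h2 : adC (coeff 1 (X a b)) (adC (coeff 1 (X i c)) (T₁ p j)) =
          adC (coeff 1 (X i c)) (adC (coeff 1 (X a b)) (T₁ p j)) := by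
        rw [adC_adC_coeff, R.extend_one_comm hb hc, adC_zero, zero_add]
      rw [R.extend_T hc, R.extend_T hb, adC_mul, adC_mul, R.extend_T hc, R.extend_T hb] at h2
      linear_combination (norm := noncomm_ring) h2
    have h3 : ∀ l, (T' * T₁) c l = if c = l then 1 else 0 := fun l => by
      rw [ht.mul', proj_apply]
      simp only [show k + 1 ≤ β c by omega, and_true]
    have h4 : ∀ l (w : PowerSeries A), ∑ p, T' c p * (T₁ p l * w) = (if c = l then 1 else 0) * w :=
      fun l w => by
        rw [← h3, Matrix.mul_apply, Finset.sum_mul]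
        exact Finset.sum_congr rfl fun p _ => (mul_assoc _ _ _).symm
    have h5 := h4 c (adC (coeff 1 (X a b)) (X i j) - X i b * X a j)
    rw [Finset.sum_congr rfl fun p _ => congrArg (T' c p * ·) (h1 p), h4, if_neg hcb, if_pos rfl,
      zero_mul, one_mul] at h5
    exact sub_eq_zero.1 h5.symm
  -- If `b` is the only index beyond block `k` there is no second column. The row then has a single
  -- column, where the relation of `E k` with itself suffices.
  · push Not at hc
    have h1 : b = p₀ := (hc p₀ (by have := R.base; omega)).symm
    by_cases hj : k < β j
    · simp only [hc j hj, h1, extendRow_of_eq R.base, R.E_E_one]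
    · simp only [extendRow_of_le (show β j ≤ k by omega), map_zero, mul_zero]

/-- The entries of `E₁` commute with `D k`, so the commutator that defines the extension carries the
relation for column `p₀` to column `l`. -/
theorem D_extend_same (R : RowData β k p₀ D E d' T₁ T₂ E₁ F₁) {j : I} (hj : β j = k) (i h l : I) :
    kap * (iu (D k i j) * iv (extendRow β k p₀ (E k) E₁ h l)
        - iv (extendRow β k p₀ (E k) E₁ h l) * iu (D k i j)) =
      if h = j then lam 1 * (matU (D k) * (matV (extendRow β k p₀ (E k) E₁)
        - matU (extendRow β k p₀ (E k) E₁))) i l else 0 := by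
  have base : ∀ l, β l = k + 1 → kap * (iu (D k i j) * iv (E k h l) - iv (E k h l) * iu (D k i j)) =
      if h = j then lam 1 * ∑ q, iu (D k i q) * (iv (E k q l) - iu (E k q l)) else 0 := by
    intro l hl
    rw [R.half.D_E_same k i j h l hj]
    rfl
  have hM : (matU (D k) * (matV (extendRow β k p₀ (E k) E₁)
      - matU (extendRow β k p₀ (E k) E₁))) i l = ∑ q, iu (D k i q) *
        (iv (extendRow β k p₀ (E k) E₁ q l) - iu (extendRow β k p₀ (E k) E₁ q l)) := rfl
  rw [hM]
  rcases lt_trichotomy (k + 1) (β l) with hl | hl | hl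
  · have h1 := base p₀ R.base
    set x := iu (C (coeff 1 (E₁ p₀ l))) with hx
    have hu : ∀ f : PowerSeries A, iu (-adC (coeff 1 (E₁ p₀ l)) f) = iu f * x - x * iu f := by
      intro f; rw [adC_apply, neg_sub, map_sub, map_mul, map_mul]
    have hv : ∀ f : PowerSeries A, iv (-adC (coeff 1 (E₁ p₀ l)) f) = iv f * x - x * iv f := by
      intro f; rw [adC_apply, neg_sub, map_sub, map_mul, map_mul, iv_C]
    have hD : ∀ i q, iu (D k i q) * x = x * iu (D k i q) := by
      intro i q
      rw [hx, ← map_mul, ← map_mul]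
      congr 1
      ext r
      rw [coeff_mul_C, coeff_C_mul]
      exact R.D_E i q p₀ l r 1
    simp only [extendRow_of_lt hl, hu, hv]
    have h2 : iu (D k i j) * (iv (E k h p₀) * x - x * iv (E k h p₀))
        - (iv (E k h p₀) * x - x * iv (E k h p₀)) * iu (D k i j) =
        (iu (D k i j) * iv (E k h p₀) - iv (E k h p₀) * iu (D k i j)) * x
        - x * (iu (D k i j) * iv (E k h p₀) - iv (E k h p₀) * iu (D k i j)) := by
      linear_combination (norm := noncomm_ring) hD i j * (- iv (E k h p₀)) + iv (E k h p₀) * hD i j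
    rw [h2, mul_sub, ← mul_assoc, ← mul_assoc, kap_comm x, mul_assoc x, h1]
    split_ifs
    · rw [mul_assoc, ← mul_assoc x, ← lam_comm, mul_assoc, ← mul_sub, Finset.sum_mul,
        Finset.mul_sum, ← Finset.sum_sub_distrib]
      congr 1
      refine Finset.sum_congr rfl fun q _ => ?_
      linear_combination (norm := noncomm_ring) hD i q * (iv (E k q p₀) - iu (E k q p₀))
    · simp
  · simp only [extendRow_of_eq hl.symm]
    exact base l hl.symm
  · simp only [extendRow_of_le (show β l ≤ k by omega)]
    simp

end RowData

end Extension

/-! ### Interaction of the extended row and the extended column -/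

section Step

variable {A : Type*} [Ring A] {I : Type*} [Fintype I] [DecidableEq I]

theorem adC_op (x : A) (f : PowerSeries A) : adC (op x) (opS f) = -opS (adC x f) := by
  ext r
  rw [coeff_adC, map_neg, coeff_opS, coeff_opS, coeff_adC, ← op_mul, ← op_mul, ← op_sub, ← op_neg,
    neg_sub]

theorem ActsAs.of_op {t : A} {a b : I} {T : Matrix I I (PowerSeries A)}
    (h : ActsAs (op t) a b (opM T)) : ActsAs t b a T := by
  intro i j
  have := h j i
  simp only [opM_apply, adC_op] at this
  apply opS_injective
  rw [← neg_neg (opS (adC t (T i j))), this, neg_sub, map_sub, apply_ite opS, apply_ite opS, map_zero]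
  congr 1
  · simp only [eq_comm]
  · simp only [eq_comm]

theorem mComm_op {x : A} {M : Matrix I I (PowerSeries A)} : MComm (op x) (opM M) ↔ MComm x M := by
  simp only [mComm_iff, opM_apply, coeff_opS, ← op_mul, op_inj]
  exact ⟨fun h i j r => (h j i r).symm, fun h i j r => (h j i r).symm⟩

/-- One level of the factorization of a matrix with the blocks `D b`, `E b`, `F b` for `b ≥ l`. -/
structure Level (β : I → ℕ) (l : ℕ) (D D' E F : ℕ → Matrix I I (PowerSeries A))
    (T T' E' F' : Matrix I I (PowerSeries A)) : Prop where
  blocks : Blocks (fun i => β i = l) (fun i => l < β i) (D l) (D' l) T' E' F'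
  eq : T = gaussProd (D l) T' E' F'
  rem : Remainder β l T
  rtt : RTT 1 T
  E_next : ∀ i j, β j = l + 1 → E' i j = E l i j
  F_next : ∀ i j, β i = l + 1 → F' i j = F l i j
  comm_E : ∀ x : A, (∀ b, l ≤ b → MComm x (E b)) → MComm x E'
  comm_F : ∀ x : A, (∀ b, l ≤ b → MComm x (F b)) → MComm x F'
  comm_T : ∀ x : A, (∀ b, l < b → MComm x (D b) ∧ MComm x (E b) ∧ MComm x (F b)) → MComm x T'

variable {β : I → ℕ} {k : ℕ} {p₀ : I} {D D' E F : ℕ → Matrix I I (PowerSeries A)}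
  {T₁ T₂ E₁ F₁ : Matrix I I (PowerSeries A)}

theorem Level.comm (L : Level β k D D' E F T₁ T₂ E₁ F₁) (x : A)
    (h : ∀ b, k ≤ b → MComm x (D b) ∧ MComm x (E b) ∧ MComm x (F b)) : MComm x T₁ := by
  rw [L.eq]
  exact MComm.gaussProd (h k le_rfl).1 (L.comm_T x fun b hb => h b hb.le)
    (L.comm_E x fun b hb => (h b hb).2.1) (L.comm_F x fun b hb => (h b hb).2.2)

theorem Remainder.op {T : Matrix I I (PowerSeries A)} (h : Remainder β k T) :
    Remainder β k (opM T) where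
  left := by rw [← opM_proj, ← opM_mul, h.right]
  right := by rw [← opM_proj, ← opM_mul, h.left]
  const := by
    ext i j
    rw [c0_apply, opM_apply, coeff_opS, ← c0_apply, h.const, proj_apply, proj_apply]
    by_cases hij : i = j
    · subst hij; split_ifs <;> simp
    · simp [hij, Ne.symm hij]

theorem mComm_of_sComm {f : PowerSeries A} {M : Matrix I I (PowerSeries A)}
    (h : ∀ i j, SComm f (M i j)) (r : ℕ) : MComm (coeff r f) M :=
  mComm_iff.2 fun i j s => h i j r s

/-- The commutation clauses hold because whatever commutes with the generators of the later levels
commutes with the matrices built from them; `Level` carries this along for that purpose. -/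
theorem ParSystem.rowData (S : ParSystem β D D' E F)
    (L : Level β (k + 1) D D' E F T₁ T₂ E₁ F₁) (hp : β p₀ = k + 1)
    (hn : ∀ j, k + 1 < β j → ∃ x, β x = k + 2) (h2 : ∀ x : A, x + x = 0 → x = 0) :
    RowData β k p₀ D E (D' (k + 1)) T₁ T₂ E₁ F₁ where
  half := S.half
  E_left := S.E_left
  E_right := S.E_right
  E_const := S.E_const
  D_const := S.D_const
  blocks := L.blocks
  eq := L.eq
  rtt := L.rtt
  rem := L.rem
  E_next := L.E_next
  E_F h l i j r s := mComm_iff.1 (L.comm_F _ fun b hb =>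
    mComm_of_sComm (fun i j => S.E_F_ne k b h l i j (by omega)) r) i j s
  E_T h l i j r s := mComm_iff.1 (L.comm_T _ fun b hb =>
    ⟨mComm_of_sComm (fun i j => (S.half.D_E_ne b k i j h l (by omega) (by omega)).symm) r,
      mComm_of_sComm (fun i j => S.half.E_E_far k b h l i j (by omega)) r,
      mComm_of_sComm (fun i j => S.E_F_ne k b h l i j (by omega)) r⟩) i j s
  D_E h l i j r s := mComm_iff.1 (L.comm_E _ fun b hb =>
    mComm_of_sComm (fun i j => S.half.D_E_ne k b h l i j (by omega) (by omega)) r) i j s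
  base := hp
  next := hn
  two := h2

theorem ParSystem.D_F_ne (S : ParSystem β D D' E F) (a b : ℕ) (i j h k : I) (hab : a ≠ b)
    (hab' : a ≠ b + 1) : SComm (D a i j) (F b h k) :=
  sComm_opS.1 (S.half_op.D_E_ne a b j i k h hab hab')

theorem ParSystem.F_F_far (S : ParSystem β D D' E F) (a b : ℕ) (i j h k : I) (hab : a + 1 < b) :
    SComm (F a i j) (F b h k) :=
  sComm_opS.1 (S.half_op.E_E_far a b j i k h hab)

theorem ParSystem.rowData_op (S : ParSystem β D D' E F)
    (L : Level β (k + 1) D D' E F T₁ T₂ E₁ F₁) (hp : β p₀ = k + 1)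
    (hn : ∀ j, k + 1 < β j → ∃ x, β x = k + 2) (h2 : ∀ x : A, x + x = 0 → x = 0) :
    RowData β k p₀ (fun a => opM (D a)) (fun a => opM (F a)) (opM (D' (k + 1))) (opM T₁) (opM T₂)
      (opM F₁) (opM E₁) where
  half := S.half_op
  E_left hi := by rw [opM_apply, S.F_right hi, map_zero]
  E_right hi := by rw [opM_apply, S.F_left hi, map_zero]
  E_const a i j := by rw [opM_apply, coeff_opS, S.F_const, op_zero]
  D_const a i j := by
    rw [opM_apply, coeff_opS, S.D_const]
    by_cases hij : i = j
    · subst hij; split_ifs <;> simp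
    · simp [hij, Ne.symm hij]
  blocks := Blocks.op L.blocks
  eq := by rw [L.eq, opM_gaussProd]
  rtt := L.rtt.op
  rem := L.rem.op
  E_next i j hj := by rw [opM_apply, opM_apply, L.F_next _ _ hj]
  E_F h l i j := sComm_opS.2 fun r s => mComm_iff.1 (L.comm_E _ fun b hb =>
    mComm_of_sComm (fun i j => (S.E_F_ne b k i j l h (by omega)).symm) r) j i s
  E_T h l i j := sComm_opS.2 fun r s => mComm_iff.1 (L.comm_T _ fun b hb =>
    ⟨mComm_of_sComm (fun i j => (S.D_F_ne b k i j l h (by omega) (by omega)).symm) r,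
      mComm_of_sComm (fun i j => (S.E_F_ne b k i j l h (by omega)).symm) r,
      mComm_of_sComm (fun i j => S.F_F_far k b l h i j (by omega)) r⟩) j i s
  D_E h l i j := sComm_opS.2 fun r s => mComm_iff.1 (L.comm_F _ fun b hb =>
    mComm_of_sComm (fun i j => S.D_F_ne k b l h i j (by omega) (by omega)) r) j i s
  base := hp
  next := hn
  two x hx := by
    have := h2 (unop x) (by rw [← unop_add, hx, unop_zero])
    rwa [unop_eq_zero_iff] at this

/-- The extension of the block `F k` to all rows beyond block `k`. -/
noncomputable def extendCol (β : I → ℕ) (k : ℕ) (p₀ : I) (F F₁ : Matrix I I (PowerSeries A)) :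
    Matrix I I (PowerSeries A) :=
  Matrix.of fun i h => if β i = k + 1 then F i h else
    if k + 1 < β i then adC (coeff 1 (F₁ i p₀)) (F p₀ h) else 0

theorem opM_extendCol (F F₁ : Matrix I I (PowerSeries A)) :
    opM (extendCol β k p₀ F F₁) = extendRow β k p₀ (opM F) (opM F₁) := by
  ext i j : 1
  rw [opM_apply, extendCol, extendRow, Matrix.of_apply, Matrix.of_apply, opM_apply, opM_apply,
    opM_apply, coeff_opS, adC_op, neg_neg, apply_ite opS, apply_ite opS, map_zero]

section

variable {F₀ : Matrix I I (PowerSeries A)}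

theorem extendCol_of_eq {i j : I} (hi : β i = k + 1) : extendCol β k p₀ F₀ F₁ i j = F₀ i j := by
  rw [extendCol, Matrix.of_apply, if_pos hi]

theorem extendCol_of_lt {i j : I} (hi : k + 1 < β i) :
    extendCol β k p₀ F₀ F₁ i j = adC (coeff 1 (F₁ i p₀)) (F₀ p₀ j) := by
  rw [extendCol, Matrix.of_apply, if_neg (by omega), if_pos hi]

theorem extendCol_of_le {i j : I} (hi : β i ≤ k) : extendCol β k p₀ F₀ F₁ i j = 0 := by
  rw [extendCol, Matrix.of_apply, if_neg (by omega), if_neg (by omega)]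

end

/-- What the part of the factorization below the diagonal contributes to the addition of
block `k`. -/
structure CrossData (β : I → ℕ) (k : ℕ) (p₀ : I)
    (D₀ D₀' D₁ E₀ F₀ T₁ T₂ E₁ F₁ : Matrix I I (PowerSeries A)) : Prop where
  D_left : ∀ {i j}, β i ≠ k → D₀ i j = 0
  D_right : ∀ {i j}, β j ≠ k → D₀ i j = 0
  D_inv : CornerInverse (proj _ fun i => β i = k) D₀ D₀'
  F_right : ∀ {i j}, β j ≠ k → F₀ i j = 0
  E_F : ∀ {a b i}, β a = k → β b = k + 1 → β i = k + 1 → ∀ j, adC (coeff 1 (E₀ a b)) (F₀ i j) =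
    (if i = b ∧ a = j then 1 else 0) - T₁ i b * D₀' a j
  E₁_F : ∀ i j h l, SComm (E₁ i j) (F₀ h l)
  T_F : ∀ i j h l, SComm (T₂ i j) (F₀ h l)
  D_F₁ : ∀ i j h l, SComm (D₀ i j) (F₁ h l)
  F₁_F : ∀ {q j}, β q = k + 1 → k + 1 < β j → ∀ h,
    adC (coeff 1 (F₁ j q)) (F₀ q h) = extendCol β k p₀ F₀ F₁ j h
  D_F : ∀ {i}, β i = k + 1 → ∀ j h, adC (coeff 1 (D₁ j i)) (F₀ i h) = F₀ j h
  F₁_T : ∀ {p b}, β p = k + 1 → k + 1 < β b → ActsAs (coeff 1 (F₁ b p)) b p T₁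

variable {d' D₀' F₀ : Matrix I I (PowerSeries A)}

/-- The coefficients of `E₁` act on the extension of `F₀`. -/
theorem CrossData.E₁_extendCol (S : CrossData β k p₀ (D k) D₀' (D (k + 1)) (E k) F₀ T₁ T₂ E₁ F₁)
    (R : RowData β k p₀ D E d' T₁ T₂ E₁ F₁) {p b : I} (hp : β p = k + 1) (hb : k + 1 < β b)
    (i j : I) : adC (coeff 1 (E₁ p b)) (extendCol β k p₀ F₀ F₁ i j) =
      if i = b then extendCol β k p₀ F₀ F₁ p j else 0 := by
  have hEF : ∀ r i j, adC (coeff r (E₁ p b)) (F₀ i j) = 0 := fun r i j =>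
    (S.E₁_F p b i j).adC_eq_zero r
  have hTF : ∀ i' j' i j, adC (coeff 1 (T₂ i' j')) (F₀ i j) = 0 := fun i' j' i j =>
    (S.T_F i' j' i j).adC_eq_zero 1
  rcases lt_trichotomy (k + 1) (β i) with hi | hi | hi
  · rw [← S.F₁_F hp hi, adC_adC_coeff, hEF, map_zero, add_zero,
      Blocks.E_F_one R.blocks R.rtt' p b i p]
    have hD0 : ∀ i j, coeff 0 (D (k + 1) i j) = if i = j ∧ β i = k + 1 then 1 else 0 :=
      R.D_const (k + 1)
    have hT0 : ∀ i j, coeff 0 (T₂ i j) = if i = j ∧ k + 1 < β i then 1 else 0 := fun i j => by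
      rw [← c0_apply, R.c0_all.2.2.2, proj_apply]
    have hD'0 : c0 d' = proj A fun i => β i = k + 1 := by
      have h1 := congrArg c0 R.blocks.AA'
      have h2 := congrArg c0 R.blocks.pA'
      rw [map_mul, c0_proj, R.c0_all.1] at h1
      rw [map_mul, c0_proj] at h2
      rw [← h2, h1]
    have hDc : ∀ i j, coeff 0 (d' i j) = if i = j ∧ β i = k + 1 then 1 else 0 :=
      fun i j => by rw [← c0_apply, hD'0, proj_apply]
    have hD'1 : coeff 1 (d' p p) = -coeff 1 (D (k + 1) p p) := by
      have h1 := congrArg (coeff 1) (congrFun (congrFun R.blocks.AA' p) p)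
      rw [Matrix.mul_apply, map_sum, proj_apply, if_pos ⟨rfl, hp⟩, coeff_one, if_neg one_ne_zero] at h1
      rw [eq_neg_iff_add_eq_zero, add_comm, ← h1]
      simp only [coeff_mul, Finset.Nat.antidiagonal_succ]
      simp [hD0, hDc, hp, Finset.sum_add_distrib, ite_and, -coeff_zero_eq_constantCoeff,
        add_comm]
    -- The commutator of the degree-one entries `(p, b)` of `E₁` and `(i, p)` of `F₁`. Of its two
    -- terms, the coefficient of `T₂` commutes with `F₀`, and that of `D (k + 1)` acts on row `p` of
    -- `F₀` as the identity.
    have h3 : coeff 1 (C (coeff 0 (d' p p) * coeff 0 (T₂ i b)) - T₂ i b * d' p p) =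
        (if i = b then coeff 1 (D (k + 1) p p) else 0) - coeff 1 (T₂ i b) := by
      rw [map_sub, coeff_C, if_neg one_ne_zero, zero_sub, coeff_mul]
      simp only [Finset.Nat.antidiagonal_succ]
      by_cases hib : i = b
      · subst hib
        simp [hT0, hDc, hp, hi, hD'1, -coeff_zero_eq_constantCoeff]
        abel
      · simp [hT0, hDc, hp, hib, -coeff_zero_eq_constantCoeff]
    rw [h3, adC_sub, hTF, sub_zero]
    split_ifs
    · rw [S.D_F hp, extendCol_of_eq hp]
    · rw [adC_zero]
  · rw [extendCol_of_eq hi.symm, hEF, if_neg (by rintro rfl; omega)]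
  · rw [extendCol_of_le (by omega), map_zero, if_neg (by rintro rfl; omega)]

/-- For `b` and `i` in block `k + 1` this comes from the relation between `E k` and `F k`.
Commutators with `F₁` extend it to later rows `i`, and commutators with `E₁` to later columns `b`;
both commute with `D k` and hence with its inverse. -/
theorem CrossData.extend_extendCol
    (S : CrossData β k p₀ (D k) D₀' (D (k + 1)) (E k) F₀ T₁ T₂ E₁ F₁)
    (R : RowData β k p₀ D E d' T₁ T₂ E₁ F₁) {a b i : I} (ha : β a = k) (hb : k < β b) (hi : k < β i)
    (j : I) : adC (coeff 1 (extendRow β k p₀ (E k) E₁ a b)) (extendCol β k p₀ F₀ F₁ i j) =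
      (if i = b ∧ a = j then 1 else 0) - T₁ i b * D₀' a j := by
  have hp := R.base
  have hD'1 : ∀ (x : A), MComm x (D k) → ∀ a j, adC x (D₀' a j) = 0 := fun x hx a j =>
    adC_eq_zero (mComm_iff.1 (MComm.inverse S.D_inv hx) a j)
  have base' : ∀ b i, β b = k + 1 → k < β i →
      adC (coeff 1 (E k a b)) (extendCol β k p₀ F₀ F₁ i j) =
      (if i = b ∧ a = j then 1 else 0) - T₁ i b * D₀' a j := by
    intro b i hb hi
    by_cases hi' : β i = k + 1
    · rw [extendCol_of_eq hi', S.E_F ha hb hi']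
    · have hi : k + 1 < β i := by omega
      have hEF : adC (coeff 1 (F₁ i p₀)) (E k a b) = 0 :=
        (R.E_F a b i p₀).symm.adC_eq_zero 1
      have act : ActsAs (coeff 1 (F₁ i p₀)) i p₀ T₁ := S.F₁_T hp hi
      have h1 := adC_adC_coeff (coeff 1 (F₁ i p₀)) (E k a b) (F₀ p₀ j) 1
      have hD : adC (coeff 1 (F₁ i p₀)) (D₀' a j) = 0 := by
        refine hD'1 _ ?_ a j
        exact mComm_iff.2 fun h l r => (S.D_F₁ h l i p₀ r 1).symm
      rw [hEF, map_zero, adC_zero, zero_add, S.E_F ha hb hp, map_sub, adC_mul, act p₀ b,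
        if_pos rfl, if_neg (c := i = b) (by rintro rfl; omega), sub_zero, hD, mul_zero, add_zero] at h1
      rw [extendCol_of_lt hi, ← h1, if_neg (c := i = b ∧ a = j) (by rintro ⟨rfl, -⟩; omega)]
      congr 1
      split_ifs
      · exact adC_one _
      · exact map_zero _
  by_cases hb' : β b = k + 1
  · rw [extendRow_of_eq hb']; exact base' b i hb' hi
  · have hb : k + 1 < β b := by omega
    have act := R.E₁_T hp hb
    have hD : adC (coeff 1 (E₁ p₀ b)) (D₀' a j) = 0 :=
      hD'1 _ (mComm_iff.2 fun h l r => (R.D_E h l p₀ b r 1).symm) a j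
    have hone : ∀ P : Prop, [Decidable P] → adC (coeff 1 (E₁ p₀ b))
        (if P then (1 : PowerSeries A) else 0) = 0 := fun P _ => by
      split_ifs
      · exact adC_one _
      · exact map_zero _
    rw [R.coeff_extend_eq hb hp, adC_neg, adC_lie, base' p₀ i hp hi, S.E₁_extendCol R hp hb,
      map_sub, adC_mul, hD, act, if_pos rfl, hone, apply_ite (adC (coeff 1 (E k a p₀))), map_zero,
      base' p₀ p₀ hp (by omega)]
    by_cases h1 : i = b <;> by_cases h2 : a = j <;> simp [h1, h2] <;> noncomm_ring

end Step

/-! ### Matrix units acting on the new product -/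

section Step

variable {A : Type*} [Ring A] {I : Type*} [Fintype I] [DecidableEq I]

/-- The relations of the entries of the upper left block with all factors give those with the
entries of the product. -/
theorem Blocks.defect_corner {P Q : I → Prop} [DecidablePred P] [DecidablePred Q]
    {M M' G E F : Matrix I I (PowerSeries A)} (t : Blocks P Q M M' G E F) (hM : RTT 1 M)
    (hE : ∀ i j h k, P j → kap * (iu (M i j) * iv (E h k) - iv (E h k) * iu (M i j)) =
      if h = j then lam 1 * (matU M * (matV E - matU E)) i k else 0)
    (hF : ∀ i j h k, P i → kap * (iu (M i j) * iv (F h k) - iv (F h k) * iu (M i j)) =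
      if i = k then lam 1 * ((matU F - matV F) * matU M) h j else 0)
    (hG : ∀ i j h k, SComm (M i j) (G h k)) {h k : I} (hh : P h) (hk : P k) (i j : I) :
    defect (gaussProd M G E F) h k i j = 0 := by
  have key := (Blocks.corner_iff t 1 hh hk).2 ⟨hM.dk_eq h k, ?_, ?_, ?_⟩
  · have := congrFun (congrFun key i) j
    rw [dk_apply, Matrix.sub_apply, mul_single_mul_apply, mul_single_mul_apply] at this
    simp only [matU_apply, matV_apply] at this
    rw [← Blocks.gauss_apply t hh hk, ← lam_comm, ← lam_comm, mul_assoc, mul_assoc] at this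
    have h2 := congrArg swapVar this
    simp only [map_mul, map_sub, swapVar_kap, swapVar_lam, swapVar_iu, swapVar_iv] at h2
    rw [defect]
    linear_combination (norm := noncomm_ring) h2
  · ext i j : 1
    have h1 : swapVar ((matU M * (matV E - matU E)) h j) = (matV M * (matU E - matV E)) h j := by
      simp [Matrix.mul_apply, matU_apply, matV_apply, swapVar_iu, swapVar_iv]
    have := congrArg swapVar (hE h k i j hk)
    rw [apply_ite swapVar, map_mul, map_mul, h1, swapVar_kap, swapVar_lam, map_zero] at this
    simp only [map_sub, map_mul, swapVar_iu, swapVar_iv] at this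
    rw [dk_apply, mul_assoc, single_mul_apply', matU_apply, ← this]; noncomm_ring
  · ext i j : 1
    have h1 : swapVar (((matU F - matV F) * matU M) i k) = ((matV F - matU F) * matV M) i k := by
      simp [Matrix.mul_apply, matU_apply, matV_apply, swapVar_iu, swapVar_iv]
    have := congrArg swapVar (hF h k i j hh)
    rw [apply_ite swapVar, map_mul, map_mul, h1, swapVar_kap, swapVar_lam, map_zero] at this
    simp only [map_sub, map_mul, swapVar_iu, swapVar_iv] at this
    rw [dk_apply, mul_single_apply', ← lam_comm, matU_apply, ← this]; noncomm_ring
  · ext i j : 1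
    rw [dk_apply, matU_apply, sComm_iff.1 (hG h k i j).symm, sub_self, mul_zero]; rfl

variable {β : I → ℕ} {k : ℕ} {p₀ : I} {D D' E F : ℕ → Matrix I I (PowerSeries A)}
  {T₁ T₂ E₁ F₁ : Matrix I I (PowerSeries A)}

theorem RowData.extend_left_proj {D E : ℕ → Matrix I I (PowerSeries A)}
    {d' : Matrix I I (PowerSeries A)} (R : RowData β k p₀ D E d' T₁ T₂ E₁ F₁) :
    proj _ (fun i => β i = k) * extendRow β k p₀ (E k) E₁ = extendRow β k p₀ (E k) E₁ :=
  proj_mul_eq_iff.2 fun _ _ hi => R.extend_left hi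

theorem extendRow_right_proj (E₀ : Matrix I I (PowerSeries A)) :
    extendRow β k p₀ E₀ E₁ * proj _ (fun i => k < β i) = extendRow β k p₀ E₀ E₁ :=
  mul_proj_eq_iff.2 fun _ _ hj => extendRow_of_le (by omega)

variable {d' D₀' F₀ : Matrix I I (PowerSeries A)}

theorem CrossData.blocks (S : CrossData β k p₀ (D k) D₀' (D (k + 1)) (E k) F₀ T₁ T₂ E₁ F₁)
    (R : RowData β k p₀ D E d' T₁ T₂ E₁ F₁) :
    Blocks (fun i => β i = k) (fun i => k < β i) (D k) D₀' T₁
      (extendRow β k p₀ (E k) E₁) (extendCol β k p₀ F₀ F₁) where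
  pp := proj_idem
  qq := proj_idem
  pq := proj_disjoint fun i hi => by omega
  qp := proj_disjoint fun i hi => by omega
  pA := proj_mul_eq_iff.2 fun _ _ hi => S.D_left hi
  Ap := mul_proj_eq_iff.2 fun _ _ hi => S.D_right hi
  pA' := S.D_inv.left
  A'p := S.D_inv.right
  AA' := S.D_inv.mul
  A'A := S.D_inv.mul'
  pE := R.extend_left_proj
  Eq := extendRow_right_proj _
  qF := proj_mul_eq_iff.2 fun _ _ hi => extendCol_of_le (by omega)
  Fp := mul_proj_eq_iff.2 fun i j hj => by
    rw [extendCol, Matrix.of_apply, S.F_right hj, S.F_right hj, map_zero, ite_self, ite_self]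
  qG := R.rem.left
  Gq := R.rem.right

/-- The hypotheses of `TwoBlock.inner_action` for the four factors are `RowData.D_extend_same`,
`RowData.extend_extend`, `RowData.extend_T` and `CrossData.extend_extendCol`. -/
theorem CrossData.actsAs (S : CrossData β k p₀ (D k) D₀' (D (k + 1)) (E k) F₀ T₁ T₂ E₁ F₁)
    (R : RowData β k p₀ D E d' T₁ T₂ E₁ F₁) {a b : I} (ha : β a = k) (hb : k < β b) :
    ActsAs (coeff 1 (extendRow β k p₀ (E k) E₁ a b)) a b
      (gaussProd (D k) T₁ (extendRow β k p₀ (E k) E₁) (extendCol β k p₀ F₀ F₁)) := by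
  refine actsAs_of_adM ((S.blocks R).inner_action _ (adM_mul _) ?_ ?_ ?_ ?_ ?_ ?_)
  · exact proj_mul_eq_iff.2 fun i j hi => by
      rw [Matrix.single_apply, if_neg]; rintro ⟨rfl, -⟩; exact hi hb
  · exact mul_proj_eq_iff.2 fun i j hj => by
      rw [Matrix.single_apply, if_neg]; rintro ⟨-, rfl⟩; exact hj ha
  · ext i j s
    rw [adM_apply, Matrix.neg_apply, mul_single_apply', mul_one]
    by_cases hj : β j = k
    · have := R.D_extend_same hj i a b
      split_ifs at this ⊢ with h1
      · rw [coeff_adC_right this, mul_sub, ← map_mul, Matrix.sub_apply, map_sub, matU_apply, cf_iu,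
          if_pos rfl, Matrix.mul_apply, map_sum, map_neg]
        simp [matU_apply, matV_apply, cf_iu_mul_iv, R.coeff_zero_extend,
          -coeff_zero_eq_constantCoeff]
      · rw [coeff_adC_right (w := 0) (by rw [this, mul_zero])]; simp
    · rw [S.D_right hj, map_zero, if_neg (by rintro rfl; exact hj ha), neg_zero]
  · ext i j : 1
    rw [adM_apply, mul_single_mul_apply, mul_one]
    exact R.extend_extend hb a i j
  · ext i j : 1
    rw [adM_apply, mul_single_mul_apply, mul_one]
    exact R.extend_T hb a i j
  · ext i j : 1
    rw [adM_apply, Matrix.sub_apply, mul_single_mul_apply, mul_one, Matrix.single_apply]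
    by_cases hi : k < β i
    · rw [S.extend_extendCol R ha hb hi]
      simp only [eq_comm]
    · rw [extendCol_of_le (by omega), Blocks.row_eq_zero_of_proj R.rem.left (by omega), map_zero,
        if_neg (by rintro ⟨rfl, -⟩; exact hi hb)]
      simp

end Step

/-! ### Adding one block and reconstructing the tower -/

section Step

variable {A : Type*} [Ring A] {I : Type*} [Fintype I] [DecidableEq I]
  {β : I → ℕ} {k : ℕ} {p₀ : I} {D D' E F : ℕ → Matrix I I (PowerSeries A)}
  {T₁ T₂ E₁ F₁ : Matrix I I (PowerSeries A)}

theorem opM_extendRow (E E₁ : Matrix I I (PowerSeries A)) :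
    opM (extendRow β k p₀ E E₁) = extendCol β k p₀ (opM E) (opM E₁) := by
  ext i j : 1
  rw [opM_apply, extendCol, extendRow, Matrix.of_apply, Matrix.of_apply, opM_apply, opM_apply,
    opM_apply, coeff_opS, adC_op, apply_ite opS, apply_ite opS, map_zero, map_neg]

theorem CornerInverse.op {P : I → Prop} [DecidablePred P] {M M' : Matrix I I (PowerSeries A)}
    (h : CornerInverse (proj _ P) M M') : CornerInverse (proj _ P) (opM M) (opM M') where
  left := by rw [← opM_proj, ← opM_mul, h.right]
  right := by rw [← opM_proj, ← opM_mul, h.left]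
  mul := by rw [← opM_mul, h.mul', opM_proj]
  mul' := by rw [← opM_mul, h.mul, opM_proj]

theorem ParSystem.coeff_zero_D' (S : ParSystem β D D' E F) (a : ℕ) (i j : I) :
    coeff 0 (D' a i j) = if i = j ∧ β i = a then 1 else 0 := by
  have h0 : c0 (D a) = proj A fun i => β i = a := by
    ext i j; rw [c0_apply, S.D_const, proj_apply]
  have h1 := congrArg c0 (S.D_inv a).mul
  have h2 := congrArg c0 (S.D_inv a).left
  rw [map_mul, c0_proj, h0] at h1
  rw [map_mul, c0_proj] at h2
  rw [← c0_apply, ← h2, h1, proj_apply]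

theorem Level.T_apply (L : Level β k D D' E F T₁ T₂ E₁ F₁) {i j : I} (hi : β i = k)
    (hj : β j = k) : T₁ i j = D k i j := by
  rw [L.eq]; exact Blocks.gauss_apply L.blocks hi hj

/-- Apart from the relation between `E k` and `F k`, the facts about `F` are facts about the
extended row of the transposed system. -/
theorem ParSystem.crossData (S : ParSystem β D D' E F)
    (L : Level β (k + 1) D D' E F T₁ T₂ E₁ F₁)
    (R : RowData β k p₀ (fun a => opM (D a)) (fun a => opM (F a)) (opM (D' (k + 1))) (opM T₁)
      (opM T₂) (opM F₁) (opM E₁)) :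
    CrossData β k p₀ (D k) (D' k) (D (k + 1)) (E k) (F k) T₁ T₂ E₁ F₁ where
  D_left := S.D_left
  D_right := S.D_right
  D_inv := S.D_inv k
  F_right := S.F_right
  E_F {a b i} ha hb hi j := by
    ext s
    rw [coeff_adC_left (S.E_F_same k a b i j), ← map_mul, ← map_mul, map_sub, cf_iu, cf_iv,
      if_pos rfl, map_sub, L.T_apply hi hb]
    congr 1
    by_cases hs : s = 0
    · subst hs
      rw [if_pos rfl, coeff_mul, Finset.Nat.antidiagonal_zero, Finset.sum_singleton, S.D_const,
        S.coeff_zero_D']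
      by_cases h2 : a = j
      · rw [← h2]
        by_cases h1 : i = b <;> simp [h1, ha, hb]
      · by_cases h1 : i = b <;> simp [h1, h2]
    · rw [if_neg hs]
      split_ifs
      · rw [coeff_one, if_neg hs]
      · simp
  E₁_F i j h l := (sComm_opS.1 (R.E_F l h j i)).symm
  T_F i j h l := (sComm_opS.1 (R.E_T l h j i)).symm
  D_F₁ i j h l := sComm_opS.1 (R.D_E j i l h)
  F₁_F {q j} hq hj h := by
    have := R.E₁_E (p := q) hq hj h
    simp only [if_pos, opM_apply, coeff_opS, adC_op, ← opM_extendCol] at this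
    exact opS_injective (neg_injective this)
  D_F {i} hi j h := by
    have := R.D_E_one hi j h i
    simp only [if_pos, opM_apply, coeff_opS, adC_op] at this
    exact opS_injective (neg_injective this)
  F₁_T {p b} hp hb := by
    refine ActsAs.of_op ?_
    have := R.E₁_T hp hb
    rwa [opM_apply, coeff_opS] at this

theorem ActsAs.op {t : A} {a b : I} {T : Matrix I I (PowerSeries A)} (h : ActsAs t a b T) :
    ActsAs (op t) b a (opM T) := by
  intro i j
  rw [opM_apply, adC_op, h j i, map_sub, neg_sub, apply_ite opS, apply_ite opS, map_zero,
    opM_apply, opM_apply]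
  simp only [eq_comm]

theorem ParSystem.crossData_op (S : ParSystem β D D' E F)
    (L : Level β (k + 1) D D' E F T₁ T₂ E₁ F₁)
    (R : RowData β k p₀ D E (D' (k + 1)) T₁ T₂ E₁ F₁) :
    CrossData β k p₀ (opM (D k)) (opM (D' k)) (opM (D (k + 1))) (opM (F k)) (opM (E k)) (opM T₁)
      (opM T₂) (opM F₁) (opM E₁) where
  D_left hi := by rw [opM_apply, S.D_right hi, map_zero]
  D_right hi := by rw [opM_apply, S.D_left hi, map_zero]
  D_inv := (S.D_inv k).op
  F_right hi := by rw [opM_apply, S.E_left hi, map_zero]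
  E_F {a b i} ha hb hi j := by
    simp only [opM_apply, coeff_opS, adC_op]
    have : adC (coeff 1 (F k b a)) (E k j i) =
        D' k j a * T₁ b i - if i = b ∧ a = j then 1 else 0 := by
      ext s
      rw [coeff_adC_right (S.E_F_same k j i b a), ← map_mul, ← map_mul, map_sub, cf_iu, cf_iv,
        if_pos rfl, map_sub, L.T_apply hb hi]
      congr 1
      by_cases hs : s = 0
      · subst hs
        rw [if_pos rfl, coeff_mul, Finset.Nat.antidiagonal_zero, Finset.sum_singleton, S.D_const,
          S.coeff_zero_D']
        by_cases h2 : a = j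
        · rw [← h2]
          by_cases h1 : i = b
          · simp [h1, ha, hb]
          · simp [h1, Ne.symm h1]
        · by_cases h1 : i = b
          · simp [h1, h2, Ne.symm h2]
          · simp [h1, h2, Ne.symm h1]
      · rw [if_neg hs]
        split_ifs
        · rw [coeff_one, if_neg hs]
        · simp
    rw [this, map_sub, opS_mul, neg_sub, apply_ite opS, map_zero, opS_one]
  E₁_F i j h l := sComm_opS.2 (R.E_F l h j i).symm
  T_F i j h l := sComm_opS.2 (R.E_T l h j i).symm
  D_F₁ i j h l := sComm_opS.2 (R.D_E j i l h)
  F₁_F {q j} hq hj h := by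
    rw [← opM_extendRow]
    simp only [opM_apply, coeff_opS, adC_op]
    rw [R.E₁_E hq hj, if_pos rfl, map_neg, neg_neg]
  D_F {i} hi j h := by
    simp only [opM_apply, coeff_opS, adC_op]
    rw [R.D_E_one hi, if_pos rfl, map_neg, neg_neg]
  F₁_T {p b} hp hb := by
    rw [opM_apply, coeff_opS]
    exact (R.E₁_T hp hb).op

theorem D_F_of_op {M N : Matrix I I (PowerSeries A)} {i j h l : I}
    (this : kap * (iu (opM M j i) * iv (opM N l h) - iv (opM N l h) * iu (opM M j i)) =
      if l = i then lam 1 * (matU (opM M) * (matV (opM N) - matU (opM N))) j h else 0) :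
    kap * (iu (M i j) * iv (N h l) - iv (N h l) * iu (M i j)) =
      if i = l then lam 1 * ((matU N - matV N) * matU M) h j else 0 := by
  have h1 : (matU (opM M) * (matV (opM N) - matU (opM N))) j h =
      opB (((matV N - matU N) * matU M) h j) := by
    simp only [Matrix.mul_apply, Matrix.sub_apply, matU_apply, matV_apply, opM_apply, map_sum,
      opB_mul, opB_iu, opB_iv, map_sub]
  rw [h1, opM_apply, opM_apply] at this
  apply opB_injective
  have h2 : opB (kap * (iu (M i j) * iv (N h l) - iv (N h l) * iu (M i j))) =
      -(kap * (iu (opS (M i j)) * iv (opS (N h l)) - iv (opS (N h l)) * iu (opS (M i j)))) := by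
    rw [opB_mul, map_sub, opB_mul, opB_mul, opB_iu, opB_iv, opB_kap, kap_comm]; noncomm_ring
  rw [h2, this, apply_ite opB, map_zero, opB_mul, opB_lam, ← lam_comm,
    show (matU N - matV N) * matU M = -((matV N - matU N) * matU M) by noncomm_ring,
    Matrix.neg_apply, map_neg]
  by_cases hil : i = l
  · rw [if_pos hil, if_pos hil.symm]; noncomm_ring
  · rw [if_neg hil, if_neg (Ne.symm hil), neg_zero]

theorem MComm.adC {x y : A} {f : PowerSeries A} (hy : x * y = y * x)
    (hf : ∀ r, x * coeff r f = coeff r f * x) (r : ℕ) :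
    x * coeff r (adC y f) = coeff r (adC y f) * x := by
  rw [coeff_adC]
  have := hf r
  linear_combination (norm := noncomm_ring) hy * coeff r f + y * this - this * y - coeff r f * hy

theorem mComm_extendRow {x : A} {E₀ E₁ : Matrix I I (PowerSeries A)} (h : MComm x E₀)
    (h₁ : MComm x E₁) : MComm x (extendRow β k p₀ E₀ E₁) := by
  rw [mComm_iff] at *
  intro i j r
  rw [extendRow, Matrix.of_apply]
  split_ifs
  · exact h i j r
  · rw [map_neg, mul_neg, neg_mul, MComm.adC (h₁ _ _ _) (h _ _)]
  · simp

theorem mComm_extendCol {x : A} {F₀ F₁ : Matrix I I (PowerSeries A)} (h : MComm x F₀)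
    (h₁ : MComm x F₁) : MComm x (extendCol β k p₀ F₀ F₁) := by
  rw [← mComm_op] at *
  rw [opM_extendCol]
  exact mComm_extendRow h h₁

theorem ParSystem.c0_D (S : ParSystem β D D' E F) (a : ℕ) : c0 (D a) = proj A fun i => β i = a := by
  ext i j; rw [c0_apply, S.D_const, proj_apply]

/-- The inductive step of the reconstruction. RTT is verified by `rtt_of_actsAs`: the entries of `D
k` are treated directly, and the degree-one entries of the new row and, by transposition, of the new
column supply the matrix units. -/
theorem ParSystem.level_step (S : ParSystem β D D' E F)
    (L : Level β (k + 1) D D' E F T₁ T₂ E₁ F₁) (hβ : ∀ i l, l ≤ β i → ∃ p, β p = l)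
    (h2 : ∀ x : A, x + x = 0 → x = 0) :
    ∃ E₀ F₀, Level β k D D' E F (gaussProd (D k) T₁ E₀ F₀) T₁ E₀ F₀ := by
  by_cases hex : ∃ i, k < β i
  · obtain ⟨i₀, hi₀⟩ := hex
    obtain ⟨p₀, hp⟩ := hβ i₀ (k + 1) hi₀
    have R₀ := S.rowData L hp (fun j hj => hβ j (k + 2) hj) h2
    have R := S.rowData_op L hp (fun j hj => hβ j (k + 2) hj) h2
    have C₀ := S.crossData L R
    have C := S.crossData_op L R₀
    have t := C₀.blocks R₀
    have hc : c0 (gaussProd (D k) T₁ (extendRow β k p₀ (E k) E₁) (extendCol β k p₀ (F k) F₁)) =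
        proj A fun i => k ≤ β i := by
      have hE : c0 (extendRow β k p₀ (E k) E₁) = 0 := by
        ext i j; rw [c0_apply, R₀.coeff_zero_extend]; rfl
      have hF : c0 (extendCol β k p₀ (F k) F₁) = 0 := by
        ext i j
        have := R.coeff_zero_extend j i
        rw [← opM_extendCol, opM_apply, coeff_opS, op_eq_zero_iff] at this
        rw [c0_apply, this]; rfl
      rw [map_gaussProd, hE, hF, S.c0_D, L.rem.const, ← proj_block_add k]
      simp only [gaussProd, mul_zero, zero_mul, add_zero]
      rfl
    refine ⟨extendRow β k p₀ (E k) E₁, extendCol β k p₀ (F k) F₁, t, rfl, ⟨?_, ?_, hc⟩, ?_, ?_, ?_,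
      ?_, ?_, fun x hx => L.comm x hx⟩
    · rw [← proj_block_add]; exact t.gauss_supp_left
    · rw [← proj_block_add]; exact t.gauss_supp_right
    · refine rtt_of_actsAs (P := fun i => β i = k) (Q := fun i => k < β i) (fun i hi => by omega)
        (hβ p₀ k (by omega)) ?_ ?_ ?_ ?_ ?_
      · intro i j hi
        refine Blocks.row_eq_zero_of_proj (P := fun i => k ≤ β i) ?_ (by omega)
        rw [← proj_block_add]; exact t.gauss_supp_left
      · intro i j hj
        refine Blocks.col_eq_zero_of_proj (P := fun i => k ≤ β i) ?_ (by omega)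
        rw [← proj_block_add]; exact t.gauss_supp_right
      · intro i j h l hh hl
        refine Blocks.defect_corner t (S.D_D k) (fun i j h l hj => R₀.D_extend_same hj i h l)
          (fun i j h l hi => ?_) (fun i j h l r s => ?_) hh hl i j
        · have := R.D_extend_same hi j l h
          rw [← opM_extendCol] at this
          exact D_F_of_op this
        · exact mComm_iff.1 (L.comm _ fun b hb =>
            ⟨mComm_of_sComm (fun h l => S.D_D_ne k b i j h l (by omega)) r,
              mComm_of_sComm (fun h l => S.half.D_E_ne k b i j h l (by omega) (by omega)) r,
              mComm_of_sComm (fun h l => S.D_F_ne k b i j h l (by omega) (by omega)) r⟩) h l s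
      · exact fun a b ha hb => ⟨_, C₀.actsAs R₀ ha hb⟩
      · intro a b ha hb
        have := C.actsAs R hb ha
        rw [← opM_extendCol, ← opM_extendRow, ← opM_gaussProd, opM_apply, coeff_opS] at this
        exact ⟨_, this.of_op⟩
    · exact fun i j hj => extendRow_of_eq hj
    · exact fun i j hi => extendCol_of_eq hi
    · exact fun x hx => mComm_extendRow (hx k le_rfl) (L.comm_E x fun b hb => hx b (by omega))
    · exact fun x hx => mComm_extendCol (hx k le_rfl) (L.comm_F x fun b hb => hx b (by omega))
  -- No index lies beyond block `k`, so there is nothing to extend and the product is `D k` alone.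
  · have hT : T₁ = 0 := by
      ext i j : 1
      exact Blocks.row_eq_zero_of_proj L.rem.left fun hi => hex ⟨i, hi⟩
    have hg : gaussProd (D k) T₁ 0 0 = D k := by simp [gaussProd, hT]
    have hp : (proj (PowerSeries A) fun i => k ≤ β i) = proj _ fun i => β i = k := by
      congr 1; ext i; exact ⟨fun h => by by_contra h'; exact hex ⟨i, by omega⟩, fun h => by omega⟩
    have hp' : (proj A fun i => k ≤ β i) = proj _ fun i => β i = k := by
      congr 1; ext i; exact ⟨fun h => by by_contra h'; exact hex ⟨i, by omega⟩, fun h => by omega⟩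
    have pA : proj _ (fun i => β i = k) * D k = D k := proj_mul_eq_iff.2 fun _ _ hi => S.D_left hi
    have Ap : D k * proj _ (fun i => β i = k) = D k := mul_proj_eq_iff.2 fun _ _ hi => S.D_right hi
    refine ⟨0, 0, ⟨proj_idem, proj_idem, proj_disjoint fun i hi => by omega,
      proj_disjoint fun i hi => by omega, pA, Ap, (S.D_inv k).left, (S.D_inv k).right,
      (S.D_inv k).mul, (S.D_inv k).mul', by simp, by simp, by simp, by simp, by simp [hT],
      by simp [hT]⟩, rfl, ?_, ?_, ?_, ?_, ?_, ?_, fun x hx => L.comm x hx⟩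
    · rw [hg]
      exact ⟨by rw [hp, pA], by rw [hp, Ap], by rw [S.c0_D, hp']⟩
    · rw [hg]; exact S.D_D k
    · exact fun i j hj => absurd ⟨j, by omega⟩ hex
    · exact fun i j hj => absurd ⟨i, by omega⟩ hex
    · exact fun x _ => mComm_iff.2 fun i j r => by simp
    · exact fun x _ => mComm_iff.2 fun i j r => by simp

theorem ParSystem.level_top (S : ParSystem β D D' E F) (hk : ∀ i, β i < k) :
    Level β k D D' E F 0 0 0 0 := by
  have hp : ∀ (R : Type _) [Ring R] (P : I → Prop) [DecidablePred P], (∀ i, ¬P i) → proj R P = 0 := by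
    intro R _ P _ h
    ext i j; rw [proj_apply, if_neg (by simp [h])]; rfl
  have hD : D k = 0 := by
    ext i j : 1; exact S.D_left (hk i).ne
  have p0 := hp (PowerSeries A) (fun i => β i = k) fun i => (hk i).ne
  have q0 := hp (PowerSeries A) (fun i => k < β i) fun i => by have := hk i; omega
  have hD' : D' k = 0 := by rw [← (S.D_inv k).left, p0, zero_mul]
  refine ⟨?_, ?_, ⟨by simp, by simp, ?_⟩, ?_, ?_, ?_, ?_, ?_, ?_⟩
  · rw [hD, hD']
    unfold Blocks
    rw [p0, q0]
    constructor <;> simp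
  · simp [gaussProd, hD]
  · rw [hp _ _ fun i => by have := hk i; omega, map_zero]
  · intro i j h l; simp
  · exact fun i j hj => absurd (hk j) (by omega)
  · exact fun i j hj => absurd (hk i) (by omega)
  all_goals exact fun x _ => mComm_iff.2 fun i j r => by simp

/-- The relations of the parabolic presentation imply the `RTT` relation. -/
theorem ParSystem.exists_tower (S : ParSystem β D D' E F)
    (hβ : ∀ i l, l ≤ β i → ∃ p, β p = l) (h2 : ∀ x : A, x + x = 0 → x = 0) :
    ∃ T E' F', Tower β T D D' E' F' ∧ c0 (T 0) = 1 ∧ RTT 1 (T 0) ∧ nextBlock β E' = E ∧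
      lowBlock β F' = F := by
  obtain ⟨m, hm⟩ : ∃ m, ∀ i, β i < m :=
    ⟨Finset.univ.sup β + 1, fun i => Nat.lt_succ_of_le (Finset.le_sup (Finset.mem_univ i))⟩
  -- Induction on the number `d` of levels already built below the bound `m`, from the last block
  -- downwards.
  have key : ∀ d, ∃ T E' F' : ℕ → Matrix I I (PowerSeries A), ∀ l, m ≤ l + d →
      Level β l D D' E F (T l) (T (l + 1)) (E' l) (F' l) := by
    intro d
    induction d with
    | zero => exact ⟨fun _ => 0, fun _ => 0, fun _ => 0, fun l hl =>
        S.level_top fun i => (hm i).trans_le (by omega)⟩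
    | succ d ih =>
      obtain ⟨T, E', F', h⟩ := ih
      by_cases hd : m ≤ d
      · exact ⟨T, E', F', fun l _ => h l (by omega)⟩
      · set l₀ := m - (d + 1) with hl₀
        obtain ⟨E₀, F₀, h₀⟩ := S.level_step (h (l₀ + 1) (by omega)) hβ h2
        -- Only level `l₀` is overwritten. The levels above it refer to remainders with index
        -- greater than `l₀` and stay valid.
        refine ⟨Function.update T l₀ (gaussProd (D l₀) (T (l₀ + 1)) E₀ F₀), Function.update E' l₀ E₀, Function.update F' l₀ F₀,
          fun l hl => ?_⟩
        by_cases hll : l = l₀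
        · subst hll
          rw [Function.update_self, Function.update_self, Function.update_self,
            Function.update_of_ne (by omega)]
          exact h₀
        · rw [Function.update_of_ne hll, Function.update_of_ne hll, Function.update_of_ne hll,
            Function.update_of_ne (by omega)]
          exact h l (by omega)
  obtain ⟨T, E', F', h⟩ := key m
  have h := fun l => h l (by omega)
  refine ⟨T, E', F', ⟨fun l => (h l).blocks, fun l => (h l).eq⟩, ?_, (h 0).rtt, ?_, ?_⟩
  · rw [(h 0).rem.const]
    ext i j; rw [proj_apply, Matrix.one_apply]; simp
  · ext a i j : 2
    rw [nextBlock_apply]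
    split_ifs with hj
    · exact (h a).E_next i j hj
    · exact (S.E_right hj).symm
  · ext a i j : 2
    rw [lowBlock_apply]
    split_ifs with hj
    · exact (h a).F_next i j hj
    · exact (S.F_left hj).symm

end Step

/-! ### Coefficient forms of the relations -/

section Coefficients

variable {A : Type*} [Ring A]

/-- The equation is a recursion that determines all coefficients from the row `u⁰`. So a closed form
need only have the right borders and satisfy the recursion. -/
theorem kap_mul_eq_iff {a f : BiSeries A} {b : ℕ → ℕ → A} (h₁ : ∀ s, b 0 s = 0)
    (h₂ : ∀ r, b r 0 = 0) (h₃ : ∀ r s, b (r + 1) s - b r (s + 1) = cf r s f) :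
    kap * a = lam 1 * f ↔ ∀ r s, cf r s a = b r s := by
  rw [kap_mul_eq_lam_mul_iff]
  constructor
  · rintro ⟨h0, -, h⟩ r
    induction r with
    | zero => exact fun s => by rw [h0, h₁]
    | succ r ih =>
      intro s
      have e1 := h r s
      rw [one_smul, ih, ← h₃, sub_left_inj] at e1
      exact e1
  · intro h
    refine ⟨fun s => by rw [h, h₁], fun r => by rw [h, h₂], fun r s => by rw [h, h, h₃, one_smul]⟩

theorem kap_D_D_iff {a b p q : PowerSeries A} :
    kap * (iu a * iv b - iv b * iu a) = lam 1 * (iv p * iu q - iu p * iv q) ↔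
      ∀ r s, ⁅coeff r a, coeff s b⁆ = ∑ t ∈ Finset.range (min r s),
        (coeff (r + s - 1 - t) p * coeff t q - coeff t p * coeff (r + s - 1 - t) q) := by
  rw [kap_mul_eq_iff (b := fun r s => ∑ t ∈ Finset.range (min r s),
        (coeff (r + s - 1 - t) p * coeff t q - coeff t p * coeff (r + s - 1 - t) q))]
  · simp only [map_sub, cf_iu_mul_iv, cf_iv_mul_iu, Ring.lie_def]
  · simp
  · simp
  · intro r s
    simp only [map_sub, cf_iu_mul_iv, cf_iv_mul_iu]
    rw [show r + 1 + s - 1 = r + s by omega, show r + (s + 1) - 1 = r + s by omega]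
    rcases lt_trichotomy r s with h | h | h
    · rw [min_eq_left (by omega), min_eq_left (by omega), Finset.sum_range_succ,
        show r + s - r = s by omega]
      abel
    -- On the diagonal both sums have the same range and the new terms on the right cancel; this is
    -- why the range stops at the minimum.
    · subst h
      rw [min_eq_right (by omega), min_eq_left (by omega), sub_self, sub_self]
    · rw [min_eq_right (by omega), min_eq_right (by omega), Finset.sum_range_succ,
        show r + s - s = r by omega]
      abel

/-- One statement for three uses: `ι` is the index set of the matrix product when `D` and `E` lie in
the same block, `Unit` for the next diagonal block, and `Empty` when the commutator is zero. -/
theorem kap_D_E_iff {ι : Type*} [Fintype ι] {a b : PowerSeries A} {d e : ι → PowerSeries A}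
    (hb : coeff 0 b = 0) (he : ∀ p, coeff 0 (e p) = 0) :
    kap * (iu a * iv b - iv b * iu a) = lam 1 * ∑ p, iu (d p) * (iv (e p) - iu (e p)) ↔
      ∀ r s, 1 ≤ s → ⁅coeff r a, coeff s b⁆ =
        ∑ t ∈ Finset.range r, ∑ p, coeff t (d p) * coeff (r + s - 1 - t) (e p) := by
  -- At `s = 0` the commutator vanishes but the sum in general does not; the mismatch is accounted
  -- for by the part of the right-hand side that depends on `u` alone.
  rw [kap_mul_eq_iff (b := fun r s => if s = 0 then 0 else
    ∑ t ∈ Finset.range r, ∑ p, coeff t (d p) * coeff (r + s - 1 - t) (e p))]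
  · simp only [map_sub, cf_iu_mul_iv, cf_iv_mul_iu, Ring.lie_def]
    refine ⟨fun h r s hs => by rw [h, if_neg (by omega)], fun h r s => ?_⟩
    by_cases hs : s = 0
    · rw [if_pos hs, hs, hb]; simp
    · rw [if_neg hs, h r s (by omega)]
  · intro s; simp
  · intro r; simp
  · intro r s
    rw [if_neg (Nat.succ_ne_zero s), map_sum]
    by_cases hs : s = 0
    · subst hs
      rw [if_pos rfl, zero_sub, Finset.sum_comm, ← Finset.sum_neg_distrib]
      refine Finset.sum_congr rfl fun p _ => ?_
      rw [mul_sub, ← map_mul, map_sub, cf_iu_mul_iv, cf_iu, if_pos rfl, he, mul_zero, zero_sub,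
        coeff_mul, Finset.Nat.sum_antidiagonal_eq_sum_range_succ_mk, Finset.sum_range_succ,
        Nat.sub_self, he, mul_zero, add_zero]
      rfl
    · rw [if_neg hs, Finset.sum_range_succ, show r + 1 + s - 1 = r + s by omega,
        show r + (s + 1) - 1 = r + s by omega, add_sub_cancel_left, show r + s - r = s by omega]
      refine Finset.sum_congr rfl fun p _ => ?_
      rw [mul_sub, ← map_mul, map_sub, cf_iu_mul_iv, cf_iu, if_neg hs, sub_zero]

theorem kap_E_E_iff {a b p q : PowerSeries A} (ha : coeff 0 a = 0) (hb : coeff 0 b = 0)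
    (hp : coeff 0 p = 0) (hq : coeff 0 q = 0) :
    kap * (iu a * iv b - iv b * iu a) = lam 1 * ((iu p - iv p) * (iu q - iv q)) ↔
      ∀ r s, 1 ≤ r → 1 ≤ s → ⁅coeff r a, coeff s b⁆ =
        ∑ t ∈ Finset.Ico 1 s, coeff t p * coeff (r + s - 1 - t) q
          - ∑ t ∈ Finset.Ico 1 r, coeff t p * coeff (r + s - 1 - t) q := by
  have hc : ∀ m, coeff m (p * q) = ∑ t ∈ Finset.Ico 1 m, coeff t p * coeff (m - t) q := by
    intro m
    rw [coeff_mul, Finset.Nat.sum_antidiagonal_eq_sum_range_succ_mk, Finset.sum_range_succ,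
      Nat.sub_self, hq, mul_zero, add_zero]
    cases m with
    | zero => simp
    | succ m =>
      rw [Finset.range_eq_Ico, Finset.sum_eq_sum_Ico_succ_bot (by omega), hp, zero_mul, zero_add]
  have hf : ∀ r s, cf r s ((iu p - iv p) * (iu q - iv q)) =
      (if s = 0 then coeff r (p * q) else 0) - coeff r p * coeff s q - coeff s p * coeff r q
        + (if r = 0 then coeff s (p * q) else 0) := by
    intro r s
    rw [show (iu p - iv p) * (iu q - iv q) = iu (p * q) - iu p * iv q - iv p * iu q + iv (p * q) by
      rw [map_mul, map_mul]; noncomm_ring]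
    rw [map_add, map_sub, map_sub, cf_iu_mul_iv, cf_iv_mul_iu, cf_iu, cf_iv]
  rw [kap_mul_eq_iff (b := fun r s => if r = 0 ∨ s = 0 then 0 else
    ∑ t ∈ Finset.Ico 1 s, coeff t p * coeff (r + s - 1 - t) q
          - ∑ t ∈ Finset.Ico 1 r, coeff t p * coeff (r + s - 1 - t) q)]
  · simp only [map_sub, cf_iu_mul_iv, cf_iv_mul_iu, Ring.lie_def]
    refine ⟨fun h r s hr hs => by rw [h, if_neg (by omega)], fun h r s => ?_⟩
    split_ifs with hrs
    · rcases hrs with rfl | rfl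
      · rw [ha]; simp
      · rw [hb]; simp
    · exact h r s (by omega) (by omega)
  · intro s; simp
  · intro r; simp
  · intro r s
    rw [hf]
    rcases Nat.eq_zero_or_pos r with rfl | hr
    · rcases Nat.eq_zero_or_pos s with rfl | hs
      · simp [hp, hq, hc, -coeff_zero_eq_constantCoeff]
      · rw [if_neg (by omega), if_pos (Or.inl rfl), if_neg (by omega), if_pos rfl, hc, hp, hq]
        simp
    · rcases Nat.eq_zero_or_pos s with rfl | hs
      · rw [if_pos (Or.inr rfl), if_neg (by omega), if_pos rfl, if_neg (by omega), hc, hp, hq]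
        simp
      · rw [if_neg (by omega), if_neg (by omega), if_neg (by omega), if_neg (by omega),
          show r + 1 + s - 1 = r + s by omega, show r + (s + 1) - 1 = r + s by omega,
          Finset.sum_Ico_succ_top hr, Finset.sum_Ico_succ_top hs, show r + s - r = s by omega,
          show r + s - s = r by omega]
        abel

/-- Since `p` and `q` commute, the right-hand side is the difference of one series `p q` at `u` and
at `v`. Its divided difference depends only on `r + s`, and the sum is a coefficient of `p q`. -/
theorem kap_E_F_iff {a b p q : PowerSeries A} (ha : coeff 0 a = 0) (hb : coeff 0 b = 0)
    (hpq : p * q = q * p) :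
    kap * (iu a * iv b - iv b * iu a) = lam 1 * (iu p * iu q - iv q * iv p) ↔
      ∀ r s, 1 ≤ r → 1 ≤ s → ⁅coeff r a, coeff s b⁆ =
        -∑ t ∈ Finset.range (r + s), coeff t p * coeff (r + s - 1 - t) q := by
  have hc : ∀ m, coeff m (p * q) = ∑ t ∈ Finset.range (m + 1), coeff t p * coeff (m - t) q := by
    intro m
    rw [coeff_mul, Finset.Nat.sum_antidiagonal_eq_sum_range_succ_mk]
  have hf : ∀ r s, cf r s (iu p * iu q - iv q * iv p) =
      (if s = 0 then coeff r (p * q) else 0) - (if r = 0 then coeff s (p * q) else 0) := by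
    intro r s
    rw [← map_mul, ← map_mul, ← hpq, map_sub, cf_iu, cf_iv]
  rw [kap_mul_eq_iff (b := fun r s => if r = 0 ∨ s = 0 then 0 else -coeff (r + s - 1) (p * q))]
  · simp only [map_sub, cf_iu_mul_iv, cf_iv_mul_iu, Ring.lie_def]
    refine ⟨fun h r s hr hs => ?_, fun h r s => ?_⟩
    · rw [h, if_neg (by omega), hc, show r + s - 1 + 1 = r + s by omega]
    split_ifs with hrs
    · rcases hrs with rfl | rfl
      · rw [ha]; simp
      · rw [hb]; simp
    · rw [h r s (by omega) (by omega), hc, show r + s - 1 + 1 = r + s by omega]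
  · intro s; simp
  · intro r; simp
  · intro r s
    rw [hf]
    rcases Nat.eq_zero_or_pos r with rfl | hr
    · rcases Nat.eq_zero_or_pos s with rfl | hs
      · simp
      · rw [if_neg (by omega), if_pos (Or.inl rfl), if_neg (by omega), if_pos rfl,
          show 0 + 1 + s - 1 = s by omega]
        abel
    · rcases Nat.eq_zero_or_pos s with rfl | hs
      · rw [if_pos (Or.inr rfl), if_neg (by omega), if_pos rfl, if_neg (by omega),
          show r + (0 + 1) - 1 = r by omega]
        abel
      · rw [if_neg (by omega), if_neg (by omega), if_neg (by omega), if_neg (by omega),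
          show r + 1 + s - 1 = r + s by omega, show r + (s + 1) - 1 = r + s by omega]
        abel

end Coefficients

/-! ### Blocks of a composition -/

section Composition

variable {n : ℕ} (ν : Composition n)

/-- The block in which an index lies. -/
def blk (i : Fin n) : ℕ := ν.index i

theorem size_of_lt {a : ℕ} (h : a < ν.length) : size ν a = ν.blocksFun ⟨a, h⟩ := by
  simp [size, Composition.blocksFun, List.getD, List.getElem?_eq_getElem h]

theorem size_of_le {a : ℕ} (h : ν.length ≤ a) : size ν a = 0 := List.getD_eq_default _ _ h

theorem lt_length_of_fin {a : ℕ} (i : Fin (size ν a)) : a < ν.length := by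
  by_contra h
  have := i.2
  have := size_of_le ν (not_lt.1 h)
  omega

theorem pos_eq {a : ℕ} (h : a < ν.length) (i : Fin (size ν a)) :
    pos ν a i = ν.embedding ⟨a, h⟩ (Fin.cast (size_of_lt ν h) i) := by
  ext; simp [pos, Composition.embedding]

theorem blk_pos (a : ℕ) (i : Fin (size ν a)) : blk ν (pos ν a i) = a := by
  rw [blk, pos_eq ν (lt_length_of_fin ν i), Composition.index_embedding]

theorem pos_injective (a : ℕ) : Function.Injective (pos ν a) := fun i j h => by
  have := congrArg Fin.val h
  simp only [pos, Nat.add_left_cancel_iff] at this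
  exact Fin.ext this

theorem exists_pos {a : ℕ} {p : Fin n} (h : blk ν p = a) : ∃ i, pos ν a i = p := by
  have hl : a < ν.length := h ▸ (ν.index p).2
  have hi : (⟨a, hl⟩ : Fin ν.length) = ν.index p := Fin.ext h.symm
  refine ⟨Fin.cast ((size_of_lt ν hl).trans (by rw [hi])).symm (ν.invEmbedding p), ?_⟩
  subst h
  rw [pos_eq ν hl]
  exact ν.embedding_comp_inv p

theorem exists_blk_eq (i : Fin n) (l : ℕ) (h : l ≤ blk ν i) : ∃ p, blk ν p = l := by
  have hl : l < ν.length := lt_of_le_of_lt h (ν.index i).2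
  have : 0 < size ν l := by rw [size_of_lt ν hl]; exact ν.one_le_blocksFun _
  exact ⟨pos ν l ⟨0, this⟩, blk_pos ν l _⟩

/-- The number of an index inside its block. -/
noncomputable def inBlock {a : ℕ} {p : Fin n} (h : blk ν p = a) : Fin (size ν a) :=
  (exists_pos ν h).choose

theorem pos_inBlock {a : ℕ} {p : Fin n} (h : blk ν p = a) : pos ν a (inBlock ν h) = p :=
  (exists_pos ν h).choose_spec

theorem inBlock_pos {a : ℕ} (i : Fin (size ν a)) (h : blk ν (pos ν a i) = a) :
    inBlock ν h = i := pos_injective ν a (pos_inBlock ν h)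

theorem sum_pos {M : Type*} [AddCommMonoid M] {a : ℕ} (f : Fin n → M)
    (h : ∀ p, blk ν p ≠ a → f p = 0) : ∑ i, f (pos ν a i) = ∑ p, f p :=
  Fintype.sum_of_injective (pos ν a) (pos_injective ν a) _ _
    (fun p hp => h p fun hp' => hp (exists_pos ν hp')) fun _ => rfl

variable {B : Type*} [Ring B]

/-- The matrix of series with the given coefficients in block `(a, b)` and zeros elsewhere. -/
noncomputable def blockMat (a b : ℕ) (f : Fin (size ν a) → Fin (size ν b) → ℕ → B) :
    Matrix (Fin n) (Fin n) (PowerSeries B) :=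
  Matrix.of fun i j => if h : blk ν i = a ∧ blk ν j = b then
    PowerSeries.mk (f (inBlock ν h.1) (inBlock ν h.2)) else 0

variable {ν} {a b : ℕ} {f : Fin (size ν a) → Fin (size ν b) → ℕ → B}

theorem blockMat_pos (i : Fin (size ν a)) (j : Fin (size ν b)) :
    blockMat ν a b f (pos ν a i) (pos ν b j) = PowerSeries.mk (f i j) := by
  rw [blockMat, Matrix.of_apply, dif_pos ⟨blk_pos ν a i, blk_pos ν b j⟩, inBlock_pos, inBlock_pos]

theorem coeff_blockMat (i : Fin (size ν a)) (j : Fin (size ν b)) (r : ℕ) :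
    coeff r (blockMat ν a b f (pos ν a i) (pos ν b j)) = f i j r := by
  rw [blockMat_pos, coeff_mk]

theorem blockMat_left {i j : Fin n} (h : blk ν i ≠ a) : blockMat ν a b f i j = 0 := by
  rw [blockMat, Matrix.of_apply, dif_neg fun h' => h h'.1]

theorem blockMat_right {i j : Fin n} (h : blk ν j ≠ b) : blockMat ν a b f i j = 0 := by
  rw [blockMat, Matrix.of_apply, dif_neg fun h' => h h'.2]

theorem opM_blockMat : opM (blockMat ν a b f) = blockMat ν b a fun j i r => op (f i j r) := by
  ext i j r
  rw [opM_apply, coeff_opS, blockMat, blockMat, Matrix.of_apply, Matrix.of_apply]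
  by_cases h : blk ν i = b ∧ blk ν j = a
  · rw [dif_pos h, dif_pos ⟨h.2, h.1⟩, coeff_mk, coeff_mk]
  · rw [dif_neg h, dif_neg fun h' => h ⟨h'.2, h'.1⟩]; simp

theorem eq_blockMat {M : Matrix (Fin n) (Fin n) (PowerSeries B)}
    (hl : ∀ i j, blk ν i ≠ a → M i j = 0) (hr : ∀ i j, blk ν j ≠ b → M i j = 0)
    (h : ∀ i j r, coeff r (M (pos ν a i) (pos ν b j)) = f i j r) : M = blockMat ν a b f := by
  ext i j r
  by_cases hi : blk ν i = a
  · by_cases hj : blk ν j = b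
    · rw [← pos_inBlock ν hi, ← pos_inBlock ν hj, h, coeff_blockMat]
    · rw [hr _ _ hj, blockMat_right hj]
  · rw [hl _ _ hi, blockMat_left hi]

end Composition

/-! ### The relations of D and E: coefficients versus series -/

section HalfCoeff

open Finset

variable {n : ℕ} (ν : Composition n) {B : Type*} [Ring B]

/-- The relations of the generators `D` and `E` in terms of coefficients. -/
structure HalfCoeff (d : ∀ a, Fin (size ν a) → Fin (size ν a) → ℕ → B)
    (e : ∀ a, Fin (size ν a) → Fin (size ν (a + 1)) → ℕ → B) : Prop where
  D_E_same : ∀ a i j h k r s, 1 ≤ s → ⁅d a i j r, e a h k s⁆ =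
    if h = j then ∑ t ∈ range r, ∑ p, d a i p t * e a p k (r + s - 1 - t) else 0
  D_E_succ : ∀ b i j h k r s, 1 ≤ s → ⁅d (b + 1) i j r, e b h k s⁆ =
    -∑ t ∈ range r, d (b + 1) i k t * e b h j (r + s - 1 - t)
  D_E_ne : ∀ a b i j h k r s, a ≠ b → a ≠ b + 1 → 1 ≤ s → ⁅d a i j r, e b h k s⁆ = 0
  E_E_same : ∀ a i j h k r s, 1 ≤ r → 1 ≤ s → ⁅e a i j r, e a h k s⁆ =
    ∑ t ∈ Ico 1 s, e a i k t * e a h j (r + s - 1 - t)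
      - ∑ t ∈ Ico 1 r, e a i k t * e a h j (r + s - 1 - t)
  E_E_succ : ∀ a i j h k r s, 1 ≤ r → 1 ≤ s →
    ⁅e a i j r, e (a + 1) h k (s + 1)⁆ - ⁅e a i j (r + 1), e (a + 1) h k s⁆ =
      if h = j then -∑ q, e a i q r * e (a + 1) q k s else 0
  E_E_far : ∀ a b i j h k r s, a + 1 < b → 1 ≤ r → 1 ≤ s → ⁅e a i j r, e b h k s⁆ = 0
  E_E_succ_ne : ∀ a i j h k r s, h ≠ j → 1 ≤ r → 1 ≤ s → ⁅e a i j r, e (a + 1) h k s⁆ = 0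
  serre : ∀ a b i j h k f g, a = b + 1 ∨ b = a + 1 → ∀ r s t, 1 ≤ r → 1 ≤ s → 1 ≤ t →
    ⁅e a i j r, ⁅e a h k s, e b f g t⁆⁆ + ⁅e a i j s, ⁅e a h k r, e b f g t⁆⁆ = 0

variable {ν} {d : ∀ a, Fin (size ν a) → Fin (size ν a) → ℕ → B}
    {e : ∀ a, Fin (size ν a) → Fin (size ν (a + 1)) → ℕ → B}

theorem coeff_zero_blockMat {a b : ℕ} {f : Fin (size ν a) → Fin (size ν b) → ℕ → B}
    (h : ∀ i j, f i j 0 = 0) (i j : Fin n) : coeff 0 (blockMat ν a b f i j) = 0 := by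
  rw [blockMat, Matrix.of_apply]
  split_ifs
  · rw [coeff_mk, h]
  · simp

theorem sComm_blockMat {a b a' b' : ℕ} {f : Fin (size ν a) → Fin (size ν b) → ℕ → B}
    {g : Fin (size ν a') → Fin (size ν b') → ℕ → B}
    (h : ∀ i j k l r s, ⁅f i j r, g k l s⁆ = 0) (i j k l : Fin n) :
    SComm (blockMat ν a b f i j) (blockMat ν a' b' g k l) := by
  intro r s
  rw [blockMat, blockMat, Matrix.of_apply, Matrix.of_apply]
  split_ifs
  · rw [coeff_mk, coeff_mk, ← sub_eq_zero]; exact h _ _ _ _ r s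
  all_goals simp

theorem SComm.lie {f g : PowerSeries B} (h : SComm f g) (r s : ℕ) :
    ⁅coeff r f, coeff s g⁆ = 0 := by rw [Ring.lie_def, h, sub_self]

theorem lie_of_zero {f g : ℕ → B} (hf : f 0 = 0) (hg : g 0 = 0)
    (h : ∀ r s, 1 ≤ r → 1 ≤ s → ⁅f r, g s⁆ = 0) (r s : ℕ) : ⁅f r, g s⁆ = 0 := by
  rcases Nat.eq_zero_or_pos r with rfl | hr
  · simp [hf, Ring.lie_def]
  · rcases Nat.eq_zero_or_pos s with rfl | hs
    · simp [hg, Ring.lie_def]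
    · exact h r s hr hs

theorem lie_of_zero_right {f g : ℕ → B} (hg : g 0 = 0)
    (h : ∀ r s, 1 ≤ s → ⁅f r, g s⁆ = 0) (r s : ℕ) : ⁅f r, g s⁆ = 0 := by
  rcases Nat.eq_zero_or_pos s with rfl | hs
  · simp [hg, Ring.lie_def]
  · exact h r s hs

theorem D_E_same_iff (he : ∀ a i j, e a i j 0 = 0) (a : ℕ) (i j h : Fin (size ν a))
    (k : Fin (size ν (a + 1))) :
    (kap * (iu (blockMat ν a a (d a) (pos ν a i) (pos ν a j))
          * iv (blockMat ν a (a + 1) (e a) (pos ν a h) (pos ν (a + 1) k))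
        - iv (blockMat ν a (a + 1) (e a) (pos ν a h) (pos ν (a + 1) k))
          * iu (blockMat ν a a (d a) (pos ν a i) (pos ν a j))) =
      if pos ν a h = pos ν a j then lam 1 * (matU (blockMat ν a a (d a))
        * (matV (blockMat ν a (a + 1) (e a)) - matU (blockMat ν a (a + 1) (e a))))
          (pos ν a i) (pos ν (a + 1) k) else 0) ↔
    ∀ r s, 1 ≤ s → ⁅d a i j r, e a h k s⁆ =
      if h = j then ∑ t ∈ range r, ∑ p, d a i p t * e a p k (r + s - 1 - t) else 0 := by
  have he0 := fun i j => coeff_zero_blockMat (he a) i j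
  simp only [(pos_injective ν a).eq_iff]
  split_ifs with hhj
  · rw [Matrix.mul_apply, ← sum_pos ν (a := a)]
    · simp only [matU_apply, matV_apply, Matrix.sub_apply]
      rw [kap_D_E_iff (he0 _ _) fun p => he0 _ _]
      simp only [coeff_blockMat]
    · intro p hp
      rw [matU_apply, blockMat_right hp, map_zero, zero_mul]
  · have := kap_D_E_iff (ι := Empty) (d := fun _ => 0) (e := fun _ => 0)
      (a := blockMat ν a a (d a) (pos ν a i) (pos ν a j))
      (he0 (pos ν a h) (pos ν (a + 1) k)) fun p => p.elim
    simpa only [coeff_blockMat, univ_eq_empty, sum_empty, mul_zero, sum_const_zero] using this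

theorem D_E_succ_iff (he : ∀ a i j, e a i j 0 = 0) (a : ℕ) (i j k : Fin (size ν (a + 1)))
    (h : Fin (size ν a)) :
    (kap * (iu (blockMat ν (a + 1) (a + 1) (d (a + 1)) (pos ν (a + 1) i) (pos ν (a + 1) j))
          * iv (blockMat ν a (a + 1) (e a) (pos ν a h) (pos ν (a + 1) k))
        - iv (blockMat ν a (a + 1) (e a) (pos ν a h) (pos ν (a + 1) k))
          * iu (blockMat ν (a + 1) (a + 1) (d (a + 1)) (pos ν (a + 1) i) (pos ν (a + 1) j))) =
      lam 1 * (iu (blockMat ν (a + 1) (a + 1) (d (a + 1)) (pos ν (a + 1) i) (pos ν (a + 1) k))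
        * (iu (blockMat ν a (a + 1) (e a) (pos ν a h) (pos ν (a + 1) j))
          - iv (blockMat ν a (a + 1) (e a) (pos ν a h) (pos ν (a + 1) j))))) ↔
    ∀ r s, 1 ≤ s → ⁅d (a + 1) i j r, e a h k s⁆ =
      -∑ t ∈ range r, d (a + 1) i k t * e a h j (r + s - 1 - t) := by
  have he0 := fun i j => coeff_zero_blockMat (he a) i j
  have := kap_D_E_iff (ι := Unit)
    (d := fun _ => -blockMat ν (a + 1) (a + 1) (d (a + 1)) (pos ν (a + 1) i) (pos ν (a + 1) k))
    (e := fun _ => blockMat ν a (a + 1) (e a) (pos ν a h) (pos ν (a + 1) j))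
    (a := blockMat ν (a + 1) (a + 1) (d (a + 1)) (pos ν (a + 1) i) (pos ν (a + 1) j))
    (he0 (pos ν a h) (pos ν (a + 1) k)) fun p => he0 _ _
  simp only [coeff_blockMat, univ_unique, sum_singleton, map_neg, neg_mul, sum_neg_distrib]
    at this
  rw [← this, ← neg_sub (iv _) (iu _), mul_neg]

theorem E_E_same_iff (he : ∀ a i j, e a i j 0 = 0) (a : ℕ) (i h : Fin (size ν a))
    (j k : Fin (size ν (a + 1))) :
    (kap * (iu (blockMat ν a (a + 1) (e a) (pos ν a i) (pos ν (a + 1) j))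
          * iv (blockMat ν a (a + 1) (e a) (pos ν a h) (pos ν (a + 1) k))
        - iv (blockMat ν a (a + 1) (e a) (pos ν a h) (pos ν (a + 1) k))
          * iu (blockMat ν a (a + 1) (e a) (pos ν a i) (pos ν (a + 1) j))) =
      lam 1 * ((iu (blockMat ν a (a + 1) (e a) (pos ν a i) (pos ν (a + 1) k))
          - iv (blockMat ν a (a + 1) (e a) (pos ν a i) (pos ν (a + 1) k)))
        * (iu (blockMat ν a (a + 1) (e a) (pos ν a h) (pos ν (a + 1) j))
          - iv (blockMat ν a (a + 1) (e a) (pos ν a h) (pos ν (a + 1) j))))) ↔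
    ∀ r s, 1 ≤ r → 1 ≤ s → ⁅e a i j r, e a h k s⁆ =
      ∑ t ∈ Ico 1 s, e a i k t * e a h j (r + s - 1 - t)
        - ∑ t ∈ Ico 1 r, e a i k t * e a h j (r + s - 1 - t) := by
  have he0 := fun i j => coeff_zero_blockMat (he a) i j
  rw [kap_E_E_iff (he0 _ _) (he0 _ _) (he0 _ _) (he0 _ _)]
  simp only [coeff_blockMat]

/-- Inside the blocks the series equations are equivalent to the coefficient relations. For all
other indices both sides are zero by support, and the convention that coefficient `0` vanishes
covers the degrees excluded from the presentation. -/
theorem HalfCoeff.halfSystem (he : ∀ a i j, e a i j 0 = 0) (S : HalfCoeff ν d e) :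
    HalfSystem (blk ν) (fun a => blockMat ν a a (d a)) (fun a => blockMat ν a (a + 1) (e a)) where
  D_E_same a i j h k hj := by
    obtain ⟨j, rfl⟩ := exists_pos ν hj
    by_cases hi : blk ν i = a
    · obtain ⟨i, rfl⟩ := exists_pos ν hi
      by_cases hh : blk ν h = a
      · obtain ⟨h, rfl⟩ := exists_pos ν hh
        by_cases hk : blk ν k = a + 1
        · obtain ⟨k, rfl⟩ := exists_pos ν hk
          exact (D_E_same_iff he a i j h k).2 (S.D_E_same a i j h k)
        · simp [Matrix.mul_apply, matU_apply, matV_apply, blockMat_right hk]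
      · rw [blockMat_left hh, if_neg (by rintro rfl; exact hh hj)]; simp
    · simp [Matrix.mul_apply, matU_apply, blockMat_left hi]
  D_E_succ a i j h k := by
    by_cases hi : blk ν i = a + 1
    · obtain ⟨i, rfl⟩ := exists_pos ν hi
      by_cases hj : blk ν j = a + 1
      · obtain ⟨j, rfl⟩ := exists_pos ν hj
        by_cases hh : blk ν h = a
        · obtain ⟨h, rfl⟩ := exists_pos ν hh
          by_cases hk : blk ν k = a + 1
          · obtain ⟨k, rfl⟩ := exists_pos ν hk
            exact (D_E_succ_iff he a i j k h).2 (S.D_E_succ a i j h k)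
          · simp [blockMat_right hk]
        · simp [blockMat_left hh]
      · simp [blockMat_right hj]
    · simp [blockMat_left hi]
  D_E_ne a b i j h k hab hab' := sComm_blockMat (fun i j k l => lie_of_zero_right (he _ _ _)
    fun r s hs => S.D_E_ne a b i j k l r s hab hab' hs) i j h k
  E_E_same a i j h k := by
    by_cases hi : blk ν i = a
    · obtain ⟨i, rfl⟩ := exists_pos ν hi
      by_cases hj : blk ν j = a + 1
      · obtain ⟨j, rfl⟩ := exists_pos ν hj
        by_cases hh : blk ν h = a
        · obtain ⟨h, rfl⟩ := exists_pos ν hh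
          by_cases hk : blk ν k = a + 1
          · obtain ⟨k, rfl⟩ := exists_pos ν hk
            exact (E_E_same_iff he a i h j k).2 (S.E_E_same a i j h k)
          · simp [blockMat_right hk]
        · simp [blockMat_left hh]
      · simp [blockMat_right hj]
    · simp [blockMat_left hi]
  E_E_succ a i j h k hj r s hr hs := by
    obtain ⟨j, rfl⟩ := exists_pos ν hj
    by_cases hi : blk ν i = a
    · obtain ⟨i, rfl⟩ := exists_pos ν hi
      by_cases hh : blk ν h = a + 1
      · obtain ⟨h, rfl⟩ := exists_pos ν hh
        by_cases hk : blk ν k = a + 1 + 1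
        · obtain ⟨k, rfl⟩ := exists_pos ν hk
          rw [← sum_pos ν (a := a + 1)]
          · simp only [coeff_blockMat, (pos_injective ν (a + 1)).eq_iff]
            exact S.E_E_succ a i j h k r s hr hs
          · intro q hq
            rw [blockMat_right hq]; simp
        · simp [blockMat_right hk, Ring.lie_def]
      · rw [if_neg (by rintro rfl; exact hh hj)]
        simp [blockMat_left hh, Ring.lie_def]
    · simp [blockMat_left hi, Ring.lie_def]
  E_E_succ_ne a i j h k hhj r s := by
    by_cases hi : blk ν i = a
    · obtain ⟨i, rfl⟩ := exists_pos ν hi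
      by_cases hj : blk ν j = a + 1
      · obtain ⟨j, rfl⟩ := exists_pos ν hj
        by_cases hh : blk ν h = a + 1
        · obtain ⟨h, rfl⟩ := exists_pos ν hh
          by_cases hk : blk ν k = a + 1 + 1
          · obtain ⟨k, rfl⟩ := exists_pos ν hk
            rw [coeff_blockMat, coeff_blockMat, ← sub_eq_zero]
            exact lie_of_zero (he _ _ _) (he _ _ _) (fun r s hr hs =>
              S.E_E_succ_ne a i j h k r s (by rintro rfl; exact hhj rfl) hr hs) r s
          · simp [blockMat_right hk]
        · simp [blockMat_left hh]
      · simp [blockMat_right hj]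
    · simp [blockMat_left hi]
  E_E_far a b i j h k hab := sComm_blockMat (fun i j k l => lie_of_zero (he _ _ _) (he _ _ _)
    fun r s hr hs => S.E_E_far a b i j k l r s hab hr hs) i j h k
  serre a b i j h k f g hab r s t := by
    by_cases hi : blk ν i = a
    swap
    · simp [blockMat_left hi, Ring.lie_def]
    by_cases hj : blk ν j = a + 1
    swap
    · simp [blockMat_right hj, Ring.lie_def]
    by_cases hh : blk ν h = a
    swap
    · simp [blockMat_left hh, Ring.lie_def]
    by_cases hk : blk ν k = a + 1
    swap
    · simp [blockMat_right hk, Ring.lie_def]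
    by_cases hf : blk ν f = b
    swap
    · simp [blockMat_left hf, Ring.lie_def]
    by_cases hg : blk ν g = b + 1
    swap
    · simp [blockMat_right hg, Ring.lie_def]
    obtain ⟨i, rfl⟩ := exists_pos ν hi
    obtain ⟨j, rfl⟩ := exists_pos ν hj
    obtain ⟨h, rfl⟩ := exists_pos ν hh
    obtain ⟨k, rfl⟩ := exists_pos ν hk
    obtain ⟨f, rfl⟩ := exists_pos ν hf
    obtain ⟨g, rfl⟩ := exists_pos ν hg
    simp only [coeff_blockMat]
    rcases Nat.eq_zero_or_pos r with rfl | hr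
    · simp [he, Ring.lie_def]
    rcases Nat.eq_zero_or_pos s with rfl | hs
    · simp [he, Ring.lie_def]
    rcases Nat.eq_zero_or_pos t with rfl | ht
    · simp [he, Ring.lie_def]
    exact S.serre a b i j h k f g hab r s t hr hs ht

theorem HalfSystem.halfCoeff (he : ∀ a i j, e a i j 0 = 0)
    (S : HalfSystem (blk ν) (fun a => blockMat ν a a (d a))
      (fun a => blockMat ν a (a + 1) (e a))) : HalfCoeff ν d e where
  D_E_same a i j h k := (D_E_same_iff he a i j h k).1 (S.D_E_same a _ _ _ _ (blk_pos ν a j))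
  D_E_succ a i j h k := (D_E_succ_iff he a i j k h).1 (S.D_E_succ a _ _ _ _)
  D_E_ne a b i j h k r s hab hab' hs := by
    have := (S.D_E_ne a b (pos ν a i) (pos ν a j) (pos ν b h) (pos ν (b + 1) k) hab hab').lie r s
    rwa [coeff_blockMat, coeff_blockMat] at this
  E_E_same a i j h k := (E_E_same_iff he a i h j k).1 (S.E_E_same a _ _ _ _)
  E_E_succ a i j h k r s hr hs := by
    have := S.E_E_succ a (pos ν a i) (pos ν (a + 1) j) (pos ν (a + 1) h) (pos ν (a + 1 + 1) k)
      (blk_pos ν _ j) r s hr hs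
    rw [← sum_pos ν (a := a + 1)] at this
    · simpa only [coeff_blockMat, (pos_injective ν (a + 1)).eq_iff] using this
    · intro q hq
      rw [blockMat_right hq]; simp
  E_E_far a b i j h k r s hab hr hs := by
    have := (S.E_E_far a b (pos ν a i) (pos ν (a + 1) j) (pos ν b h) (pos ν (b + 1) k) hab).lie r s
    rwa [coeff_blockMat, coeff_blockMat] at this
  E_E_succ_ne a i j h k r s hhj hr hs := by
    have := (S.E_E_succ_ne a (pos ν a i) (pos ν (a + 1) j) (pos ν (a + 1) h) (pos ν (a + 1 + 1) k)
      ((pos_injective ν _).ne hhj)).lie r s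
    rwa [coeff_blockMat, coeff_blockMat] at this
  serre a b i j h k f g hab r s t hr hs ht := by
    have := S.serre a b (pos ν a i) (pos ν (a + 1) j) (pos ν a h) (pos ν (a + 1) k) (pos ν b f)
      (pos ν (b + 1) g) hab r s t
    simpa only [coeff_blockMat] using this

end HalfCoeff

/-! ### All parabolic relations: coefficients versus series -/

section ParCoeff

open Finset

variable {n : ℕ} (ν : Composition n) {B : Type*} [Ring B]

/-- The relations of the parabolic presentation for families of elements. -/
structure ParCoeff (d dt : ∀ a, Fin (size ν a) → Fin (size ν a) → ℕ → B)
    (e : ∀ a, Fin (size ν a) → Fin (size ν (a + 1)) → ℕ → B)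
    (f : ∀ a, Fin (size ν (a + 1)) → Fin (size ν a) → ℕ → B) : Prop where
  D_zero : ∀ a i j, d a i j 0 = if i = j then 1 else 0
  D_Dt : ∀ a i j r, ∑ t ∈ range (r + 1), ∑ p, d a i p t * dt a p j (r - t) =
    if r = 0 ∧ i = j then -1 else 0
  D_D_same : ∀ a i j h k r s, ⁅d a i j r, d a h k s⁆ = ∑ t ∈ range (min r s),
    (d a i k (r + s - 1 - t) * d a h j t - d a i k t * d a h j (r + s - 1 - t))
  D_D_ne : ∀ a b i j h k r s, a ≠ b → ⁅d a i j r, d b h k s⁆ = 0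
  E_F_same : ∀ a i j h k r s, 1 ≤ r → 1 ≤ s → ⁅e a i j r, f a h k s⁆ =
    ∑ t ∈ range (r + s), dt a i k t * d (a + 1) h j (r + s - 1 - t)
  E_F_ne : ∀ a b i j h k r s, a ≠ b → 1 ≤ r → 1 ≤ s → ⁅e a i j r, f b h k s⁆ = 0
  half : HalfCoeff ν d e
  half_op : HalfCoeff ν (fun a i j r => op (d a j i r)) (fun a i j r => op (f a j i r))

variable {ν} {d dt : ∀ a, Fin (size ν a) → Fin (size ν a) → ℕ → B}
    {e : ∀ a, Fin (size ν a) → Fin (size ν (a + 1)) → ℕ → B}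
    {f : ∀ a, Fin (size ν (a + 1)) → Fin (size ν a) → ℕ → B}

theorem D_D_same_iff (a : ℕ) (i j h k : Fin (size ν a)) :
    (kap * (iu (blockMat ν a a (d a) (pos ν a i) (pos ν a j))
          * iv (blockMat ν a a (d a) (pos ν a h) (pos ν a k))
        - iv (blockMat ν a a (d a) (pos ν a h) (pos ν a k))
          * iu (blockMat ν a a (d a) (pos ν a i) (pos ν a j))) =
      lam 1 * (iv (blockMat ν a a (d a) (pos ν a i) (pos ν a k))
          * iu (blockMat ν a a (d a) (pos ν a h) (pos ν a j))
        - iu (blockMat ν a a (d a) (pos ν a i) (pos ν a k))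
          * iv (blockMat ν a a (d a) (pos ν a h) (pos ν a j)))) ↔
    ∀ r s, ⁅d a i j r, d a h k s⁆ = ∑ t ∈ range (min r s),
      (d a i k (r + s - 1 - t) * d a h j t - d a i k t * d a h j (r + s - 1 - t)) := by
  rw [kap_D_D_iff]
  simp only [coeff_blockMat]

theorem E_F_same_iff (he : ∀ a i j, e a i j 0 = 0) (hf : ∀ a i j, f a i j 0 = 0) (a : ℕ)
    (i k : Fin (size ν a)) (j h : Fin (size ν (a + 1)))
    (hc : blockMat ν a a (dt a) (pos ν a i) (pos ν a k)
        * blockMat ν (a + 1) (a + 1) (d (a + 1)) (pos ν (a + 1) h) (pos ν (a + 1) j) =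
      blockMat ν (a + 1) (a + 1) (d (a + 1)) (pos ν (a + 1) h) (pos ν (a + 1) j)
        * blockMat ν a a (dt a) (pos ν a i) (pos ν a k)) :
    (kap * (iu (blockMat ν a (a + 1) (e a) (pos ν a i) (pos ν (a + 1) j))
          * iv (blockMat ν (a + 1) a (f a) (pos ν (a + 1) h) (pos ν a k))
        - iv (blockMat ν (a + 1) a (f a) (pos ν (a + 1) h) (pos ν a k))
          * iu (blockMat ν a (a + 1) (e a) (pos ν a i) (pos ν (a + 1) j))) =
      lam 1 * (iu ((-blockMat ν a a (dt a)) (pos ν a i) (pos ν a k))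
          * iu (blockMat ν (a + 1) (a + 1) (d (a + 1)) (pos ν (a + 1) h) (pos ν (a + 1) j))
        - iv (blockMat ν (a + 1) (a + 1) (d (a + 1)) (pos ν (a + 1) h) (pos ν (a + 1) j))
          * iv ((-blockMat ν a a (dt a)) (pos ν a i) (pos ν a k)))) ↔
    ∀ r s, 1 ≤ r → 1 ≤ s → ⁅e a i j r, f a h k s⁆ =
      ∑ t ∈ range (r + s), dt a i k t * d (a + 1) h j (r + s - 1 - t) := by
  rw [Matrix.neg_apply, kap_E_F_iff (coeff_zero_blockMat (he a) _ _)
    (coeff_zero_blockMat (hf a) _ _) (by rw [neg_mul, mul_neg, hc])]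
  simp only [coeff_blockMat, map_neg, neg_mul, sum_neg_distrib, neg_neg]

theorem blockMat_mul_pos {a b c : ℕ} {f : Fin (size ν a) → Fin (size ν b) → ℕ → B}
    {g : Fin (size ν b) → Fin (size ν c) → ℕ → B} (i : Fin (size ν a)) (j : Fin (size ν c)) (r : ℕ) :
    coeff r ((blockMat ν a b f * blockMat ν b c g) (pos ν a i) (pos ν c j)) =
      ∑ t ∈ range (r + 1), ∑ p, f i p t * g p j (r - t) := by
  rw [Matrix.mul_apply, ← sum_pos ν (a := b), map_sum, sum_comm]
  · refine sum_congr rfl fun p _ => ?_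
    rw [coeff_mul, Nat.sum_antidiagonal_eq_sum_range_succ_mk]
    simp only [coeff_blockMat]
  · intro p hp
    rw [blockMat_right hp, zero_mul]

theorem ParCoeff.parSystem (he : ∀ a i j, e a i j 0 = 0) (hf : ∀ a i j, f a i j 0 = 0)
    (S : ParCoeff ν d dt e f) : ParSystem (blk ν) (fun a => blockMat ν a a (d a))
      (fun a => -blockMat ν a a (dt a)) (fun a => blockMat ν a (a + 1) (e a))
      (fun a => blockMat ν (a + 1) a (f a)) := by
  have D_const : ∀ a i j, coeff 0 (blockMat ν a a (d a) i j) =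
      if i = j ∧ blk ν i = a then 1 else 0 := by
    intro a i j
    by_cases hi : blk ν i = a
    · obtain ⟨i, rfl⟩ := exists_pos ν hi
      by_cases hj : blk ν j = a
      · obtain ⟨j, rfl⟩ := exists_pos ν hj
        rw [coeff_blockMat, S.D_zero]
        simp only [(pos_injective ν a).eq_iff, hi, and_true]
      · rw [blockMat_right hj, if_neg (by rintro ⟨rfl, h⟩; exact hj h), map_zero]
    · rw [blockMat_left hi, if_neg fun h => hi h.2, map_zero]
  have D_inv : ∀ a, CornerInverse (proj _ fun i => blk ν i = a) (blockMat ν a a (d a))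
      (-blockMat ν a a (dt a)) := by
    intro a
    have hl : ∀ g : Fin (size ν a) → Fin (size ν a) → ℕ → B,
        proj _ (fun i => blk ν i = a) * blockMat ν a a g = blockMat ν a a g := fun g =>
      proj_mul_eq_iff.2 fun i j hi => blockMat_left hi
    have hr : ∀ g : Fin (size ν a) → Fin (size ν a) → ℕ → B,
        blockMat ν a a g * proj _ (fun i => blk ν i = a) = blockMat ν a a g := fun g =>
      mul_proj_eq_iff.2 fun i j hi => blockMat_right hi
    obtain ⟨M, hM⟩ := exists_cornerInverse (P := fun i => blk ν i = a) (hl (d a)) (hr (d a)) (by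
      ext i j; rw [c0_apply, D_const, proj_apply])
    have h1 : blockMat ν a a (d a) * -blockMat ν a a (dt a) = proj _ fun i => blk ν i = a := by
      rw [mul_neg, neg_eq_iff_eq_neg]
      ext i j r
      by_cases hi : blk ν i = a
      · obtain ⟨i, rfl⟩ := exists_pos ν hi
        by_cases hj : blk ν j = a
        · obtain ⟨j, rfl⟩ := exists_pos ν hj
          rw [blockMat_mul_pos, S.D_Dt, Matrix.neg_apply, proj_apply]
          simp only [(pos_injective ν a).eq_iff, hi, and_true]
          by_cases hij : i = j <;> by_cases hr : r = 0 <;> simp [hij, hr, coeff_one]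
        · rw [← hr (dt a), ← mul_assoc, mul_proj_apply, if_neg hj, Matrix.neg_apply, proj_apply,
            if_neg (by rintro ⟨rfl, h⟩; exact hj h), neg_zero]
      · rw [← hl (d a), mul_assoc, proj_mul_apply, if_neg hi, Matrix.neg_apply, proj_apply,
          if_neg fun h => hi h.2, neg_zero]
    -- The relations only say that `-D̃` is a right inverse of `D`. A two-sided inverse exists
    -- because of the constant term, and it must coincide with `-D̃`.
    have h2 : -blockMat ν a a (dt a) = M := by
      rw [← hM.right, ← h1, ← mul_assoc, hM.mul', mul_neg, hl]
    rw [h2]; exact hM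
  have D_D_ne : ∀ a b i j h k, a ≠ b → SComm (blockMat ν a a (d a) i j)
      (blockMat ν b b (d b) h k) := fun a b i j h k hab =>
    sComm_blockMat (fun i j k l r s => S.D_D_ne a b i j k l r s hab) i j h k
  refine ⟨blockMat_left, blockMat_right, blockMat_left, blockMat_right, blockMat_left,
    blockMat_right, D_const, fun a => coeff_zero_blockMat (he a),
    fun a => coeff_zero_blockMat (hf a), D_inv, ?_, D_D_ne, ?_, ?_, S.half.halfSystem he, ?_⟩
  · intro a
    refine rtt_of_swapped fun i j h k => ?_
    by_cases hi : blk ν i = a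
    · obtain ⟨i, rfl⟩ := exists_pos ν hi
      by_cases hj : blk ν j = a
      · obtain ⟨j, rfl⟩ := exists_pos ν hj
        by_cases hh : blk ν h = a
        · obtain ⟨h, rfl⟩ := exists_pos ν hh
          by_cases hk : blk ν k = a
          · obtain ⟨k, rfl⟩ := exists_pos ν hk
            exact (D_D_same_iff a i j h k).2 (S.D_D_same a i j h k)
          · simp [blockMat_right hk]
        · simp [blockMat_left hh]
      · simp [blockMat_right hj]
    · simp [blockMat_left hi]
  · intro a i j h k
    by_cases hi : blk ν i = a
    · obtain ⟨i, rfl⟩ := exists_pos ν hi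
      by_cases hj : blk ν j = a + 1
      · obtain ⟨j, rfl⟩ := exists_pos ν hj
        by_cases hh : blk ν h = a + 1
        · obtain ⟨h, rfl⟩ := exists_pos ν hh
          by_cases hk : blk ν k = a
          · obtain ⟨k, rfl⟩ := exists_pos ν hk
            refine (E_F_same_iff he hf a i k j h ?_).2 (S.E_F_same a i j h k)
            have := fun r => mComm_iff.1 (MComm.inverse (D_inv a) (mComm_iff.2 fun i' j' s =>
              (D_D_ne a (a + 1) i' j' (pos ν (a + 1) h) (pos ν (a + 1) j) (by omega) s r).symm))
              (pos ν a i) (pos ν a k)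
            simp only [Matrix.neg_apply, map_neg, mul_neg, neg_mul, neg_inj] at this
            ext m
            rw [coeff_mul, coeff_mul, ← Nat.sum_antidiagonal_swap]
            exact sum_congr rfl fun x _ => (this _ _).symm
          · simp [blockMat_right hk]
        · simp [blockMat_left hh]
      · simp [blockMat_right hj]
    · simp [blockMat_left hi]
  · exact fun a b i j h k hab => sComm_blockMat (fun i j k l => lie_of_zero (he _ _ _) (hf _ _ _)
      fun r s hr hs => S.E_F_ne a b i j k l r s hab hr hs) i j h k
  · have := S.half_op.halfSystem fun a i j => by rw [hf, op_zero]
    simpa only [opM_blockMat] using this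

theorem ParSystem.parCoeff (he : ∀ a i j, e a i j 0 = 0) (hf : ∀ a i j, f a i j 0 = 0)
    (S : ParSystem (blk ν) (fun a => blockMat ν a a (d a)) (fun a => -blockMat ν a a (dt a))
      (fun a => blockMat ν a (a + 1) (e a)) (fun a => blockMat ν (a + 1) a (f a))) :
    ParCoeff ν d dt e f where
  D_zero a i j := by
    have := S.D_const a (pos ν a i) (pos ν a j)
    simpa only [coeff_blockMat, (pos_injective ν a).eq_iff, blk_pos, and_true] using this
  D_Dt a i j r := by
    have := congrArg (fun M => coeff r (M (pos ν a i) (pos ν a j))) (S.D_inv a).mul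
    simp only [mul_neg, Matrix.neg_apply, map_neg, blockMat_mul_pos, proj_apply,
      (pos_injective ν a).eq_iff, blk_pos, and_true] at this
    rw [neg_eq_iff_eq_neg.1 this]
    by_cases hij : i = j <;> by_cases hr : r = 0 <;> simp [hij, hr, coeff_one]
  D_D_same a i j h k := (D_D_same_iff a i j h k).1 ((S.D_D a).swapped _ _ _ _)
  D_D_ne a b i j h k r s hab := by
    have := (S.D_D_ne a b (pos ν a i) (pos ν a j) (pos ν b h) (pos ν b k) hab).lie r s
    rwa [coeff_blockMat, coeff_blockMat] at this
  E_F_same a i j h k := by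
    refine (E_F_same_iff he hf a i k j h ?_).1 (S.E_F_same a _ _ _ _)
    have := fun r => mComm_iff.1 (MComm.inverse (S.D_inv a) (mComm_iff.2 fun i' j' s =>
      (S.D_D_ne a (a + 1) i' j' (pos ν (a + 1) h) (pos ν (a + 1) j) (by omega) s r).symm))
      (pos ν a i) (pos ν a k)
    simp only [Matrix.neg_apply, map_neg, mul_neg, neg_mul, neg_inj] at this
    ext m
    rw [coeff_mul, coeff_mul, ← Nat.sum_antidiagonal_swap]
    exact sum_congr rfl fun x _ => (this _ _).symm
  E_F_ne a b i j h k r s hab hr hs := by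
    have := (S.E_F_ne a b (pos ν a i) (pos ν (a + 1) j) (pos ν (b + 1) h) (pos ν b k) hab).lie r s
    rwa [coeff_blockMat, coeff_blockMat] at this
  half := S.half.halfCoeff he
  half_op := by
    have := S.half_op
    simp only [opM_blockMat] at this
    exact this.halfCoeff fun a i j => by rw [hf, op_zero]

end ParCoeff

/-! ### Elements of an algebra satisfying the parabolic relations -/

section Sat

/-- The elements `y g` satisfy the relations `rel`. -/
def Sat {G A : Type} [Ring A] [Algebra ℂ A] (rel : FreeAlgebra ℂ G → FreeAlgebra ℂ G → Prop)
    (y : G → A) : Prop := ∀ u v, rel u v → FreeAlgebra.lift ℂ y u = FreeAlgebra.lift ℂ y v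

variable {n : ℕ} {ν : Composition n} {A : Type} [Ring A] [Algebra ℂ A] (y : ParGen ν → A)

/-- The coefficients of `E` given by elements for the generators. -/
def genE (a : ℕ) (i : Fin (size ν a)) (j : Fin (size ν (a + 1))) : ℕ → A
  | 0 => 0
  | r + 1 => y (.E a i j r)

/-- The coefficients of `F` given by elements for the generators. -/
def genF (a : ℕ) (i : Fin (size ν (a + 1))) (j : Fin (size ν a)) : ℕ → A
  | 0 => 0
  | r + 1 => y (.F a i j r)

theorem lift_pD (a : ℕ) (i j : Fin (size ν a)) (r : ℕ) :
    FreeAlgebra.lift ℂ y (pD a i j r) = y (.D a i j r) := FreeAlgebra.lift_ι_apply _ _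

theorem lift_pDt (a : ℕ) (i j : Fin (size ν a)) (r : ℕ) :
    FreeAlgebra.lift ℂ y (pDt a i j r) = y (.Dt a i j r) := FreeAlgebra.lift_ι_apply _ _

theorem lift_pE (a : ℕ) (i : Fin (size ν a)) (j : Fin (size ν (a + 1))) (r : ℕ) :
    FreeAlgebra.lift ℂ y (pE a i j r) = genE y a i j r := by
  cases r
  · exact map_zero _
  · exact FreeAlgebra.lift_ι_apply _ _

theorem lift_pF (a : ℕ) (i : Fin (size ν (a + 1))) (j : Fin (size ν a)) (r : ℕ) :
    FreeAlgebra.lift ℂ y (pF a i j r) = genF y a i j r := by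
  cases r
  · exact map_zero _
  · exact FreeAlgebra.lift_ι_apply _ _

@[simp]
theorem map_lie_ring {R S : Type*} [Ring R] [Ring S] {F : Type*} [FunLike F R S] [RingHomClass F R S]
    (φ : F) (x y : R) : φ ⁅x, y⁆ = ⁅φ x, φ y⁆ := by
  simp [Ring.lie_def]

theorem lie_op {R : Type*} [Ring R] (x y : R) : ⁅op x, op y⁆ = -op ⁅x, y⁆ := by
  simp [Ring.lie_def]

theorem lie_op_op {R : Type*} [Ring R] (x y z : R) :
    ⁅op x, ⁅op y, op z⁆⁆ = op ⁅x, ⁅y, z⁆⁆ := by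
  rw [lie_op, Ring.lie_def, Ring.lie_def x, op_sub, op_mul, op_mul, mul_neg, neg_mul]
  abel

attribute [local simp] lift_pD lift_pDt lift_pE lift_pF

/-- The relations with `F` are those with `E` over the opposite ring, with row and column indices
exchanged. A simple commutator changes sign under this passage, and a double commutator does not. -/
theorem Sat.parCoeff {y : ParGen ν → A} (H : Sat (ParRel ν) y) :
    ParCoeff ν (fun a i j r => y (.D a i j r)) (fun a i j r => y (.Dt a i j r)) (genE y)
      (genF y) := by
  have H' : ∀ {u v}, ParRel ν u v → FreeAlgebra.lift ℂ y u = FreeAlgebra.lift ℂ y v :=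
    fun {u v} h => H u v h
  refine ⟨fun a i j => ?_, fun a i j r => ?_, fun a i j h k r s => ?_,
    fun a b i j h k r s hab => ?_, fun a i j h k r s hr hs => ?_,
    fun a b i j h k r s hab hr hs => ?_,
    ⟨fun a i j h k r s hs => ?_, fun b i j h k r s hs => ?_,
      fun a b i j h k r s hab hab' hs => ?_, fun a i j h k r s hr hs => ?_,
      fun a i j h k r s hr hs => ?_, fun a b i j h k r s hab hr hs => ?_,
      fun a i j h k r s hhj hr hs => ?_, fun a b i j h k f g hab r s t hr hs ht => ?_⟩,
    ⟨fun a i j h k r s hs => ?_, fun b i j h k r s hs => ?_,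
      fun a b i j h k r s hab hab' hs => ?_, fun a i j h k r s hr hs => ?_,
      fun a i j h k r s hr hs => ?_, fun a b i j h k r s hab hr hs => ?_,
      fun a i j h k r s hhj hr hs => ?_, fun a b i j h k f g hab r s t hr hs ht => ?_⟩⟩
  · simpa [apply_ite (FreeAlgebra.lift ℂ y)] using H' (ParRel.D_zero a i j)
  · simpa [apply_ite (FreeAlgebra.lift ℂ y)] using H' (ParRel.D_Dt a i j r)
  · simpa [apply_ite (FreeAlgebra.lift ℂ y)] using H' (ParRel.D_D_same a i j h k r s)
  · simpa [apply_ite (FreeAlgebra.lift ℂ y)] using H' (ParRel.D_D_ne a b hab i j h k r s)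
  · simpa [apply_ite (FreeAlgebra.lift ℂ y)] using H' (ParRel.E_F_same a i j h k r s hr hs)
  · simpa [apply_ite (FreeAlgebra.lift ℂ y)] using H' (ParRel.E_F_ne a b hab i j h k r s hr hs)
  · simpa [apply_ite (FreeAlgebra.lift ℂ y)] using H' (ParRel.D_E_same a i j h k r s hs)
  · simpa [apply_ite (FreeAlgebra.lift ℂ y)] using H' (ParRel.D_E_succ b i j h k r s hs)
  · simpa [apply_ite (FreeAlgebra.lift ℂ y)] using H' (ParRel.D_E_ne a b hab hab' i j h k r s hs)
  · simpa [apply_ite (FreeAlgebra.lift ℂ y)] using H' (ParRel.E_E_same a i h j k r s hr hs)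
  · simpa [apply_ite (FreeAlgebra.lift ℂ y)] using H' (ParRel.E_E_succ a i j h k r s hr hs)
  · simpa [apply_ite (FreeAlgebra.lift ℂ y)] using H' (ParRel.E_E_far a b hab i j h k r s hr hs)
  · simpa [apply_ite (FreeAlgebra.lift ℂ y)] using H' (ParRel.E_E_succ_ne a i j h hhj k r s hr hs)
  · simpa [apply_ite (FreeAlgebra.lift ℂ y)] using H' (ParRel.E_serre a b hab i h j k f g r s t hr hs ht)
  · have := H' (ParRel.D_F_same a j i k h r s hs)
    simp [apply_ite (FreeAlgebra.lift ℂ y)] at this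
    rw [lie_op, this, apply_ite op, apply_ite Neg.neg]
    simp only [Finset.op_sum, op_mul, op_sub, op_neg, op_zero, neg_neg, neg_zero, neg_sub, eq_comm]
  · have := H' (ParRel.D_F_succ b j i k h r s hs)
    simp [apply_ite (FreeAlgebra.lift ℂ y)] at this
    rw [lie_op, this]
    simp only [Finset.op_sum, op_mul, op_sub, op_neg, op_zero, neg_neg, neg_zero, neg_sub]
  · have := H' (ParRel.D_F_ne a b hab hab' j i k h r s hs)
    simp [apply_ite (FreeAlgebra.lift ℂ y)] at this
    rw [lie_op, this]
    simp only [Finset.op_sum, op_mul, op_sub, op_neg, op_zero, neg_neg, neg_zero, neg_sub]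
  · have := H' (ParRel.F_F_same a j k i h r s hr hs)
    simp [apply_ite (FreeAlgebra.lift ℂ y)] at this
    rw [lie_op, this]
    simp only [Finset.op_sum, op_mul, op_sub, op_neg, op_zero, neg_neg, neg_zero, neg_sub]
  · have := H' (ParRel.F_F_succ a j h i k r s hr hs)
    simp [apply_ite (FreeAlgebra.lift ℂ y)] at this
    rw [lie_op, lie_op, ← neg_sub, ← neg_sub', ← op_sub, neg_neg, this, apply_ite op]
    simp only [Finset.op_sum, op_mul, op_sub, op_neg, op_zero, neg_neg, neg_zero, neg_sub, eq_comm]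
  · have := H' (ParRel.F_F_far a b hab j i k h r s hr hs)
    simp [apply_ite (FreeAlgebra.lift ℂ y)] at this
    rw [lie_op, this]
    simp only [Finset.op_sum, op_mul, op_sub, op_neg, op_zero, neg_neg, neg_zero, neg_sub]
  · have := H' (ParRel.F_F_succ_ne a j h hhj.symm i k r s hr hs)
    simp [apply_ite (FreeAlgebra.lift ℂ y)] at this
    rw [lie_op, this]
    simp only [Finset.op_sum, op_mul, op_sub, op_neg, op_zero, neg_neg, neg_zero, neg_sub]
  · have := H' (ParRel.F_serre a b hab j k i h g f r s t hr hs ht)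
    simp [apply_ite (FreeAlgebra.lift ℂ y)] at this
    rw [lie_op_op, lie_op_op, ← op_add, this, op_zero]

theorem ParCoeff.sat {y : ParGen ν → A}
    (S : ParCoeff ν (fun a i j r => y (.D a i j r)) (fun a i j r => y (.Dt a i j r)) (genE y)
      (genF y)) : Sat (ParRel ν) y := by
  intro u v huv
  cases huv with
  | D_zero a i j =>
    simpa [apply_ite (FreeAlgebra.lift ℂ y)] using S.D_zero a i j
  | D_Dt a i j r =>
    simpa [apply_ite (FreeAlgebra.lift ℂ y)] using S.D_Dt a i j r
  | D_D_same a i j h k r s =>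
    simpa [apply_ite (FreeAlgebra.lift ℂ y)] using S.D_D_same a i j h k r s
  | D_D_ne a b hab i j h k r s =>
    simpa [apply_ite (FreeAlgebra.lift ℂ y)] using S.D_D_ne a b i j h k r s hab
  | E_F_same a i j h k r s hr hs =>
    simpa [apply_ite (FreeAlgebra.lift ℂ y)] using S.E_F_same a i j h k r s hr hs
  | E_F_ne a b hab i j h k r s hr hs =>
    simpa [apply_ite (FreeAlgebra.lift ℂ y)] using S.E_F_ne a b i j h k r s hab hr hs
  | D_E_same a i j h k r s hs =>
    simpa [apply_ite (FreeAlgebra.lift ℂ y)] using S.half.D_E_same a i j h k r s hs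
  | D_E_succ b i j h k r s hs =>
    simpa [apply_ite (FreeAlgebra.lift ℂ y)] using S.half.D_E_succ b i j h k r s hs
  | D_E_ne a b hab hab' i j h k r s hs =>
    simpa [apply_ite (FreeAlgebra.lift ℂ y)] using S.half.D_E_ne a b i j h k r s hab hab' hs
  | D_F_succ b i j h k r s hs =>
    have := S.half_op.D_E_succ b j i k h r s hs
    rw [lie_op] at this
    simp [apply_ite (FreeAlgebra.lift ℂ y)]
    apply op_injective
    rw [← neg_inj, this]
    simp only [Finset.op_sum, op_mul, op_sub, op_neg, op_zero, neg_neg, neg_zero, neg_sub]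
  | D_F_same a i j h k r s hs =>
    have := S.half_op.D_E_same a j i k h r s hs
    rw [lie_op] at this
    simp [apply_ite (FreeAlgebra.lift ℂ y)]
    apply op_injective
    rw [← neg_inj, this, apply_ite op, apply_ite Neg.neg]
    simp only [Finset.op_sum, op_mul, op_sub, op_neg, op_zero, neg_neg, neg_zero, neg_sub, eq_comm]
  | D_F_ne a b hab hab' i j h k r s hs =>
    have := S.half_op.D_E_ne a b j i k h r s hab hab' hs
    rw [lie_op] at this
    simp [apply_ite (FreeAlgebra.lift ℂ y)]
    apply op_injective
    rw [← neg_inj, this]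
    simp only [Finset.op_sum, op_mul, op_sub, op_neg, op_zero, neg_neg, neg_zero, neg_sub]
  | E_E_same a i h j k r s hr hs =>
    simpa [apply_ite (FreeAlgebra.lift ℂ y)] using S.half.E_E_same a i j h k r s hr hs
  | F_F_same a i h j k r s hr hs =>
    have := S.half_op.E_E_same a j i k h r s hr hs
    rw [lie_op] at this
    simp [apply_ite (FreeAlgebra.lift ℂ y)]
    apply op_injective
    rw [← neg_inj, this]
    simp only [Finset.op_sum, op_mul, op_sub, op_neg, op_zero, neg_neg, neg_zero, neg_sub]
  | E_E_succ a i j h k r s hr hs =>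
    simpa [apply_ite (FreeAlgebra.lift ℂ y)] using S.half.E_E_succ a i j h k r s hr hs
  | F_F_succ a i k j h r s hr hs =>
    have := S.half_op.E_E_succ a j i k h r s hr hs
    rw [lie_op, lie_op, ← neg_sub, ← neg_sub', ← op_sub, neg_neg] at this
    simp [apply_ite (FreeAlgebra.lift ℂ y)]
    apply op_injective
    rw [this, apply_ite op]
    simp only [Finset.op_sum, op_mul, op_sub, op_neg, op_zero, neg_neg, neg_zero, neg_sub, eq_comm]
  | E_E_far a b hab i j h k r s hr hs =>
    simpa [apply_ite (FreeAlgebra.lift ℂ y)] using S.half.E_E_far a b i j h k r s hab hr hs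
  | E_E_succ_ne a i j h hhj k r s hr hs =>
    simpa [apply_ite (FreeAlgebra.lift ℂ y)] using S.half.E_E_succ_ne a i j h k r s hhj hr hs
  | F_F_far a b hab i j h k r s hr hs =>
    have := S.half_op.E_E_far a b j i k h r s hab hr hs
    rw [lie_op] at this
    simp [apply_ite (FreeAlgebra.lift ℂ y)]
    apply op_injective
    rw [← neg_inj, this]
    simp only [Finset.op_sum, op_mul, op_sub, op_neg, op_zero, neg_neg, neg_zero, neg_sub]
  | F_F_succ_ne a i k hik j h r s hr hs =>
    have := S.half_op.E_E_succ_ne a j i k h r s hik.symm hr hs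
    rw [lie_op] at this
    simp [apply_ite (FreeAlgebra.lift ℂ y)]
    apply op_injective
    rw [← neg_inj, this]
    simp only [Finset.op_sum, op_mul, op_sub, op_neg, op_zero, neg_neg, neg_zero, neg_sub]
  | E_serre a b hab i h j k f g r s t hr hs ht =>
    simpa [apply_ite (FreeAlgebra.lift ℂ y)] using S.half.serre a b i j h k f g hab r s t hr hs ht
  | F_serre a b hab i h j k f g r s t hr hs ht =>
    have := S.half_op.serre a b j i k h g f hab r s t hr hs ht
    rw [lie_op_op, lie_op_op, ← op_add] at this
    simp [apply_ite (FreeAlgebra.lift ℂ y)]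
    apply op_injective
    rw [this, op_zero]

end Sat

/-! ### Block triangular factorizations -/

section Factorization

open Finset

variable {A : Type*} [Ring A] {I : Type*} [Fintype I] [DecidableEq I]

/-- A factorization of `T` into block lower unitriangular, invertible block diagonal and block upper
unitriangular matrices. -/
structure Factorization (β : I → ℕ) (T F D D' E : Matrix I I (PowerSeries A)) : Prop where
  F_above : ∀ i j, β i < β j → F i j = 0
  F_diag : ∀ i j, β i = β j → F i j = if i = j then 1 else 0
  D_off : ∀ i j, β i ≠ β j → D i j = 0
  E_below : ∀ i j, β j < β i → E i j = 0
  E_diag : ∀ i j, β i = β j → E i j = if i = j then 1 else 0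
  mul_inv : D * D' = 1
  inv_mul : D' * D = 1
  factor : T = F * D * E

variable {β : I → ℕ}

theorem sum_mul_sum_of_proj {s : Finset ℕ} {X Y : ℕ → Matrix I I (PowerSeries A)}
    (hX : ∀ k, X k * proj _ (fun i => β i = k) = X k)
    (hY : ∀ k, proj _ (fun i => β i = k) * Y k = Y k) :
    (∑ k ∈ s, X k) * ∑ k ∈ s, Y k = ∑ k ∈ s, X k * Y k := by
  rw [sum_mul]
  refine sum_congr rfl fun k hk => ?_
  rw [mul_sum]
  refine sum_eq_single_of_mem k hk fun l _ hl => ?_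
  rw [← hX, ← hY l, mul_assoc, ← mul_assoc (proj _ _), proj_disjoint fun i hi hi' => hl (by omega),
    zero_mul, mul_zero]

theorem sum_proj {N : ℕ} (hN : ∀ i, β i < N) :
    ∑ k ∈ range N, proj (PowerSeries A) (fun i => β i = k) = 1 := by
  ext i j : 1
  rw [Matrix.sum_apply, Matrix.one_apply]
  simp only [proj_apply]
  by_cases hij : i = j
  · simp [hij, hN]
  · simp [hij]

theorem proj_add_mul_proj {k : ℕ} {F : Matrix I I (PowerSeries A)}
    (h : F * proj _ (fun i => β i = k) = F) :
    (proj _ (fun i => β i = k) + F) * proj _ (fun i => β i = k) = proj _ (fun i => β i = k) + F := by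
  rw [add_mul, proj_idem, h]

theorem proj_mul_proj_add {k : ℕ} {F : Matrix I I (PowerSeries A)}
    (h : proj _ (fun i => β i = k) * F = F) :
    proj _ (fun i => β i = k) * (proj _ (fun i => β i = k) + F) = proj _ (fun i => β i = k) + F := by
  rw [mul_add, proj_idem, h]

variable {T D D' E F : ℕ → Matrix I I (PowerSeries A)}

theorem Tower.D_mul (t : Tower β T D D' E F) (k : ℕ) :
    gaussProd (D k) (T (k + 1)) (E k) (F k) =
      (proj _ (fun i => β i = k) + F k) * (D k * (proj _ (fun i => β i = k) + E k))
        + T (k + 1) := by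
  have := t.blocks k
  rw [mul_add (D k), this.Ap, add_mul, mul_add, mul_add, this.pA, ← mul_assoc, this.pA, gaussProd]
  noncomm_ring

/-- The block columns `p_k + F k`, the blocks `D k` and the block rows `p_k + E k` are added up;
cross terms vanish since the `p_k` are orthogonal. Unrolling the tower shows that the product is `T
0`, because the remainder after the last block is zero. -/
theorem Tower.factorization (t : Tower β T D D' E F) {N : ℕ} (hN : ∀ i, β i < N) :
    Factorization β (T 0) (∑ k ∈ range N, (proj _ (fun i => β i = k) + F k))
      (∑ k ∈ range N, D k) (∑ k ∈ range N, D' k)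
      (∑ k ∈ range N, (proj _ (fun i => β i = k) + E k)) := by
  have hF : ∀ k i j, ¬(β j = k ∧ k < β i) → F k i j = 0 := fun k i j h => by
    by_cases hj : β j = k
    · exact proj_mul_eq_iff.1 (t.blocks k).qF i j fun h' => h ⟨hj, h'⟩
    · exact mul_proj_eq_iff.1 (t.blocks k).Fp i j hj
  have hE : ∀ k i j, ¬(β i = k ∧ k < β j) → E k i j = 0 := fun k i j h => by
    by_cases hj : β i = k
    · exact mul_proj_eq_iff.1 (t.blocks k).Eq i j fun h' => h ⟨hj, h'⟩
    · exact proj_mul_eq_iff.1 (t.blocks k).pE i j hj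
  rw [sum_add_distrib, sum_add_distrib, sum_proj hN]
  refine ⟨fun i j h => ?_, fun i j h => ?_, fun i j h => ?_, fun i j h => ?_, fun i j h => ?_,
    ?_, ?_, ?_⟩
  · rw [Matrix.add_apply, Matrix.sum_apply, sum_eq_zero fun k _ => hF k i j (by omega),
      Matrix.one_apply_ne (by rintro rfl; omega), zero_add]
  · rw [Matrix.add_apply, Matrix.sum_apply, sum_eq_zero fun k _ => hF k i j (by omega),
      Matrix.one_apply, add_zero]
  · rw [Matrix.sum_apply]
    refine sum_eq_zero fun k _ => ?_
    by_cases hi : β i = k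
    · exact mul_proj_eq_iff.1 (t.blocks k).Ap i j (by omega)
    · exact proj_mul_eq_iff.1 (t.blocks k).pA i j hi
  · rw [Matrix.add_apply, Matrix.sum_apply, sum_eq_zero fun k _ => hE k i j (by omega),
      Matrix.one_apply_ne (by rintro rfl; omega), zero_add]
  · rw [Matrix.add_apply, Matrix.sum_apply, sum_eq_zero fun k _ => hE k i j (by omega),
      Matrix.one_apply, add_zero]
  · rw [sum_mul_sum_of_proj (β := β) (fun k => (t.blocks k).Ap) fun k => (t.blocks k).pA',
      sum_congr rfl fun k _ => (t.blocks k).AA', sum_proj hN]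
  · rw [sum_mul_sum_of_proj (β := β) (fun k => (t.blocks k).A'p) fun k => (t.blocks k).pA,
      sum_congr rfl fun k _ => (t.blocks k).A'A, sum_proj hN]
  · rw [← sum_proj hN (A := A), ← sum_add_distrib, ← sum_add_distrib, mul_assoc,
      sum_mul_sum_of_proj (β := β) (fun k => (t.blocks k).Ap)
        fun k => proj_mul_proj_add (t.blocks k).pE,
      sum_mul_sum_of_proj (β := β) (fun k => proj_add_mul_proj (t.blocks k).Fp)
        fun k => by rw [← mul_assoc, (t.blocks k).pA]]
    have key : ∀ m, T 0 = ∑ k ∈ range m, (proj _ (fun i => β i = k) + F k)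
        * (D k * (proj _ (fun i => β i = k) + E k)) + T m := by
      intro m
      induction m with
      | zero => simp
      | succ m ih => rw [ih, sum_range_succ, t.eq m, t.D_mul, add_assoc]
    have hN' : T N = 0 := by
      rcases N with _ | N
      · ext i; exact absurd (hN i) (by omega)
      · rw [← (t.blocks N).qG]
        ext i j : 1
        rw [proj_mul_apply, if_neg (by have := hN i; omega), Matrix.zero_apply]
    rw [key N, hN', add_zero]

theorem Factorization.tower {T₀ F D D' E : Matrix I I (PowerSeries A)}
    (h : Factorization β T₀ F D D' E) : ∃ T, T 0 = T₀ ∧ Tower β T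
      (fun k => proj _ (fun i => β i = k) * D * proj _ (fun i => β i = k))
      (fun k => proj _ (fun i => β i = k) * D' * proj _ (fun i => β i = k))
      (fun k => proj _ (fun i => β i = k) * E * proj _ (fun i => k < β i))
      (fun k => proj _ (fun i => k < β i) * F * proj _ (fun i => β i = k)) := by
  obtain ⟨N, hN⟩ : ∃ N, ∀ i, β i < N :=
    ⟨Finset.univ.sup β + 1, fun i => Nat.lt_succ_of_le (Finset.le_sup (Finset.mem_univ i))⟩
  have idem : ∀ k, proj (PowerSeries A) (fun i => β i = k) * proj _ (fun i => β i = k) =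
    proj _ (fun i => β i = k) := fun k => proj_idem
  have idem' : ∀ k, proj (PowerSeries A) (fun i => k < β i) * proj _ (fun i => k < β i) =
    proj _ (fun i => k < β i) := fun k => proj_idem
  have hE : ∀ k, proj _ (fun i => β i = k) * E =
      proj _ (fun i => β i = k) + proj _ (fun i => β i = k) * E * proj _ (fun i => k < β i) := by
    intro k
    ext i j : 1
    rw [Matrix.add_apply, mul_proj_apply, proj_mul_apply, proj_apply]
    by_cases hi : β i = k
    · rcases lt_trichotomy (β j) k with hj | hj | hj
      · have hij : i ≠ j := by rintro rfl; omega
        rw [if_pos hi, if_neg fun h => hij h.1, if_neg (by omega : ¬k < β j),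
          h.E_below i j (by omega), add_zero]
      · rw [if_pos hi, if_neg (by omega : ¬k < β j), h.E_diag i j (by omega), add_zero]
        simp [hi]
      · have hij : i ≠ j := by rintro rfl; omega
        rw [if_pos hi, if_pos hj, if_neg fun h => hij h.1, zero_add]
    · simp [hi]
  have hF : ∀ k, F * proj _ (fun i => β i = k) =
      proj _ (fun i => β i = k) + proj _ (fun i => k < β i) * F * proj _ (fun i => β i = k) := by
    intro k
    ext i j : 1
    rw [Matrix.add_apply, mul_proj_apply, mul_proj_apply, proj_mul_apply, proj_apply]
    by_cases hj : β j = k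
    · rcases lt_trichotomy (β i) k with hi | hi | hi
      · have hij : i ≠ j := by rintro rfl; omega
        rw [if_pos hj, if_pos hj, if_neg fun h => hij h.1, if_neg (by omega : ¬k < β i),
          h.F_above i j (by omega), add_zero]
      · rw [if_pos hj, if_pos hj, if_neg (by omega : ¬k < β i), h.F_diag i j (by omega), add_zero]
        simp [hi]
      · have hij : i ≠ j := by rintro rfl; omega
        rw [if_pos hj, if_pos hj, if_pos hi, if_neg fun h => hij h.1, zero_add]
    · rw [if_neg hj, if_neg hj, if_neg (by rintro ⟨rfl, h⟩; exact hj h), zero_add]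
  have hD : ∀ k, proj _ (fun i => β i = k) * D = D * proj _ (fun i => β i = k) := by
    intro k
    ext i j : 1
    rw [mul_proj_apply, proj_mul_apply]
    by_cases hij : β i = β j
    · simp only [hij]
    · rw [h.D_off i j hij, ite_self, ite_self]
  have hD' : ∀ k, proj _ (fun i => β i = k) * D' = D' * proj _ (fun i => β i = k) := by
    intro k
    rw [← one_mul (proj _ _ * D'), ← h.inv_mul, mul_assoc D', ← mul_assoc D, ← hD, mul_assoc,
      h.mul_inv, mul_one]
  have hDp : ∀ k, proj _ (fun i => β i = k) * D * proj _ (fun i => β i = k) =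
      D * proj _ (fun i => β i = k) := fun k => by rw [hD, mul_assoc, idem]
  have hD'p : ∀ k, proj _ (fun i => β i = k) * D' * proj _ (fun i => β i = k) =
      D' * proj _ (fun i => β i = k) := fun k => by rw [hD', mul_assoc, idem]
  -- `X k` is the contribution of block `k` to `F D E`. The remainder at level `k` is the sum of the
  -- contributions from `k` on.
  let X : ℕ → Matrix I I (PowerSeries A) := fun k => F * proj _ (fun i => β i = k) *
    (D * (proj _ (fun i => β i = k) * E))
  have hXl : ∀ k m, k < m → proj _ (fun i => k < β i) * X m = X m := by
    intro k m hkm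
    have : proj _ (fun i => k < β i) * (F * proj _ (fun i => β i = m)) =
        F * proj _ (fun i => β i = m) := by
      refine proj_mul_eq_iff.2 fun i j hi => ?_
      rw [mul_proj_apply]
      split_ifs with hj
      · exact h.F_above i j (by omega)
      · rfl
    rw [← mul_assoc, this]
  have hXr : ∀ k m, k < m → X m * proj _ (fun i => k < β i) = X m := by
    intro k m hkm
    have : proj _ (fun i => β i = m) * E * proj _ (fun i => k < β i) =
        proj _ (fun i => β i = m) * E := by
      refine mul_proj_eq_iff.2 fun i j hi => ?_
      rw [proj_mul_apply]
      split_ifs with hj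
      · exact h.E_below i j (by omega)
      · rfl
    rw [mul_assoc, mul_assoc D, this]
  refine ⟨fun k => ∑ m ∈ Ico k N, X m, ?_, fun k => ⟨proj_idem, proj_idem,
    proj_disjoint fun i hi => by omega, proj_disjoint fun i hi => by omega, ?_, ?_, ?_, ?_, ?_, ?_,
    ?_, ?_, ?_, ?_, ?_, ?_⟩, fun k => ?_⟩
  · rw [h.factor]
    beta_reduce
    rw [Nat.Ico_zero_eq_range]
    calc _ = (∑ k ∈ range N, F * proj _ (fun i => β i = k))
            * ∑ k ∈ range N, D * (proj _ (fun i => β i = k) * E) :=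
          (sum_mul_sum_of_proj (β := β) (fun k => by rw [mul_assoc, idem]) fun k => by
            rw [← mul_assoc, hD, mul_assoc, ← mul_assoc _ _ E, idem]).symm
      _ = _ := by rw [← mul_sum, ← mul_sum, ← sum_mul, sum_proj hN, mul_one, one_mul, mul_assoc]
  · rw [← mul_assoc, ← mul_assoc, idem]
  · rw [mul_assoc, idem]
  · rw [← mul_assoc, ← mul_assoc, idem]
  · rw [mul_assoc, idem]
  · rw [hDp, hD'p, mul_assoc, ← mul_assoc _ D', hD', mul_assoc, idem, ← mul_assoc, h.mul_inv,
      one_mul]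
  · rw [hDp, hD'p, mul_assoc, ← mul_assoc _ D, hD, mul_assoc, idem, ← mul_assoc, h.inv_mul,
      one_mul]
  · rw [← mul_assoc, ← mul_assoc, idem]
  · rw [mul_assoc, idem']
  · rw [← mul_assoc, ← mul_assoc, idem']
  · rw [mul_assoc, idem]
  · rw [mul_sum]; exact sum_congr rfl fun m hm => hXl k m (mem_Ico.1 hm).1
  · rw [sum_mul]; exact sum_congr rfl fun m hm => hXr k m (mem_Ico.1 hm).1
  · have hX : X k = (proj _ (fun i => β i = k) + proj _ (fun i => k < β i) * F
        * proj _ (fun i => β i = k)) * (proj _ (fun i => β i = k) * D * proj _ (fun i => β i = k))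
        * (proj _ (fun i => β i = k) + proj _ (fun i => β i = k) * E
        * proj _ (fun i => k < β i)) := by
      rw [← hE, ← hF]
      simp only [X, mul_assoc]
      rw [← mul_assoc (proj _ _) (proj _ _) (D * _), idem, ← mul_assoc (proj _ _) (proj _ _) E, idem,
        ← mul_assoc (proj _ _) D, hD, mul_assoc, ← mul_assoc (proj _ _) (proj _ _) E, idem]
    have hsum : ∑ m ∈ Ico k N, X m = X k + ∑ m ∈ Ico (k + 1) N, X m := by
      rcases lt_or_ge k N with hk | hk
      · exact sum_eq_sum_Ico_succ_bot hk _
      · have : proj (PowerSeries A) (fun i => β i = k) = 0 := by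
          ext i j : 1
          rw [proj_apply, if_neg (by have := hN i; omega), Matrix.zero_apply]
        rw [Ico_eq_empty (by omega), Ico_eq_empty (by omega)]
        simp [X, this]
    have h1 := idem k
    rw [hsum, hX, gaussProd]
    congr 1
    have h2 : proj _ (fun i => β i = k) *
      (proj _ (fun i => β i = k) * D * proj _ (fun i => β i = k)) =
      (proj _ (fun i => β i = k) * D * proj _ (fun i => β i = k)) := by
        rw [← mul_assoc, ← mul_assoc, idem]
    have h3 : (proj _ (fun i => β i = k) * D * proj _ (fun i => β i = k)) *
      proj _ (fun i => β i = k) =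
      (proj _ (fun i => β i = k) * D * proj _ (fun i => β i = k)) := by
        rw [mul_assoc, idem]
    generalize proj _ (fun i => β i = k) * D * proj _ (fun i => β i = k) = Dk at h2 h3 ⊢
    rw [add_mul, h2, mul_add, add_mul, h3, mul_assoc _ Dk (proj _ _), h3, add_mul]
    noncomm_ring

end Factorization

/-! ### Presentations by a universal property -/

section Presentation

variable {G A : Type} [Ring A] [Algebra ℂ A] {rel : FreeAlgebra ℂ G → FreeAlgebra ℂ G → Prop}

theorem lift_mk_eq : FreeAlgebra.lift ℂ (fun g => RingQuot.mkAlgHom ℂ rel (FreeAlgebra.ι ℂ g)) =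
    RingQuot.mkAlgHom ℂ rel := FreeAlgebra.hom_ext (funext fun _ => FreeAlgebra.lift_ι_apply _ _)

theorem sat_mk : Sat rel fun g => RingQuot.mkAlgHom ℂ rel (FreeAlgebra.ι ℂ g) := fun u v h => by
  rw [lift_mk_eq]
  exact RingQuot.mkAlgHom_rel ℂ h

/-- Elements that satisfy relations define a homomorphism from the algebra with these relations. -/
theorem Sat.exists_algHom {y : G → A} (h : Sat rel y) : ∃ ψ : RingQuot rel →ₐ[ℂ] A,
    ∀ u, ψ (RingQuot.mkAlgHom ℂ rel u) = FreeAlgebra.lift ℂ y u :=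
  ⟨RingQuot.liftAlgHom ℂ ⟨FreeAlgebra.lift ℂ y, fun {_ _} huv => h _ _ huv⟩, fun _ =>
    RingQuot.liftAlgHom_mkAlgHom_apply ..⟩

/-- The homomorphisms between `A` and the quotient, in both directions, match generators, so they
are mutually inverse. -/
theorem isPresentation_of_universal {x : G → A} (hx : Sat rel x)
    (hgen : Algebra.adjoin ℂ (Set.range x) = ⊤)
    (huniv : ∀ y : G → RingQuot rel, Sat rel y → ∃ ψ : A →ₐ[ℂ] RingQuot rel, ∀ g, ψ (x g) = y g) :
    IsPresentation x rel := by
  obtain ⟨φ, hφ⟩ := hx.exists_algHom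
  obtain ⟨ψ, hψ⟩ := huniv _ sat_mk
  have hφ' : ∀ g, φ (RingQuot.mkAlgHom ℂ rel (FreeAlgebra.ι ℂ g)) = x g := fun g => by
    rw [hφ, FreeAlgebra.lift_ι_apply]
  refine ⟨AlgEquiv.ofAlgHom φ ψ ?_ ?_, hφ'⟩
  · refine AlgHom.ext_of_adjoin_eq_top hgen ?_
    rintro _ ⟨g, rfl⟩
    rw [AlgHom.comp_apply, hψ, hφ', AlgHom.id_apply]
  · refine RingQuot.ringQuot_ext' ℂ _ _ (FreeAlgebra.hom_ext (funext fun g => ?_))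
    simp only [Function.comp_apply, AlgHom.comp_apply, AlgHom.id_apply, hφ', hψ]

theorem add_self_eq_zero_of_complex (x : A) (h : x + x = 0) : x = 0 := by
  have h2 : (2 : ℂ) • x = 0 := by rw [two_smul, h]
  have := congrArg (fun z => (2⁻¹ : ℂ) • z) h2
  simpa [smul_smul] using this

end Presentation

/-! ### The Yangian and homomorphisms from it -/

section Yangian

open Finset

variable {n : ℕ}

theorem leg₁_mul_leg₂_apply {A : Type} [Ring A] (M N : Matrix (Fin n) (Fin n) A)
    (i h j k : Fin n) : (leg₁ M * leg₂ N) (i, h) (j, k) = M i j * N h k := by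
  rw [Matrix.mul_apply, sum_eq_single (j, h)]
  · simp [leg₁, leg₂]
  · rintro ⟨a, b⟩ - hab
    by_cases ha : a = j
    · have : h ≠ b := by rintro rfl; exact hab (by rw [ha])
      simp [leg₁, this]
    · simp [leg₂, ha]
  · simp

theorem leg₂_mul_leg₁_apply {A : Type} [Ring A] (M N : Matrix (Fin n) (Fin n) A)
    (i h j k : Fin n) : (leg₂ N * leg₁ M) (i, h) (j, k) = N h k * M i j := by
  rw [Matrix.mul_apply, sum_eq_single (i, k)]
  · simp [leg₁, leg₂]
  · rintro ⟨a, b⟩ - hab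
    by_cases ha : i = a
    · have : b ≠ k := by rintro rfl; exact hab (by rw [ha])
      simp [leg₁, this]
    · simp [leg₂, ha]
  · simp

theorem swapMatrix_apply {A : Type} [Ring A] (x y : Fin n × Fin n) :
    swapMatrix n A x y = if y = x.swap then 1 else 0 := by
  obtain ⟨a, b⟩ := x
  rw [swapMatrix, Matrix.sum_apply, sum_eq_single a]
  · rw [Matrix.sum_apply, sum_eq_single b]
    · rw [Matrix.single_apply]
      simp [eq_comm]
    · intro j _ hj
      rw [Matrix.single_apply_of_row_ne]
      simp [hj]
    · simp
  · intro i _ hi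
    rw [Matrix.sum_apply]
    refine sum_eq_zero fun j _ => ?_
    rw [Matrix.single_apply_of_row_ne]
    simp [hi]
  · simp

theorem swapMatrix_mul_apply {A : Type} [Ring A] (M : Matrix (Fin n × Fin n) (Fin n × Fin n) A)
    (x y : Fin n × Fin n) : (swapMatrix n A * M) x y = M x.swap y := by
  simp [Matrix.mul_apply, swapMatrix_apply]

theorem mul_swapMatrix_apply {A : Type} [Ring A] (M : Matrix (Fin n × Fin n) (Fin n × Fin n) A)
    (x y : Fin n × Fin n) : (M * swapMatrix n A) x y = M x y.swap := by
  have : ∀ z : Fin n × Fin n, y = z.swap ↔ z = y.swap := fun z =>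
    ⟨fun h => by rw [h, Prod.swap_swap], fun h => by rw [h, Prod.swap_swap]⟩
  simp [Matrix.mul_apply, swapMatrix_apply, this]

variable {A : Type} [Ring A] [Algebra ℂ A]

/-- The matrix of series given by elements for the generators of the Yangian. -/
noncomputable def genT (y : YangianGen n → A) : Matrix (Fin n) (Fin n) (PowerSeries A) :=
  Matrix.of fun i j => PowerSeries.mk fun r => FreeAlgebra.lift ℂ y (freeT n r i j)

theorem coeff_genT (y : YangianGen n → A) (i j : Fin n) (r : ℕ) :
    coeff r (genT y i j) = FreeAlgebra.lift ℂ y (freeT n r i j) := by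
  rw [genT, Matrix.of_apply, coeff_mk]

theorem coeff_zero_genT (y : YangianGen n → A) (i j : Fin n) :
    coeff 0 (genT y i j) = if i = j then 1 else 0 := by
  rw [coeff_genT, freeT, Matrix.one_apply, apply_ite (FreeAlgebra.lift ℂ y), map_one, map_zero]

theorem coeff_succ_genT (y : YangianGen n → A) (i j : Fin n) (r : ℕ) :
    coeff (r + 1) (genT y i j) = y (.T i j r) := by
  rw [coeff_genT, freeT, Matrix.of_apply, FreeAlgebra.lift_ι_apply]

theorem c0_genT (y : YangianGen n → A) : c0 (genT y) = 1 := by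
  ext i j
  rw [c0_apply, coeff_zero_genT, Matrix.one_apply]

theorem genT_coeff {M : Matrix (Fin n) (Fin n) (PowerSeries A)} (h : c0 M = 1) :
    genT (fun g : YangianGen n => match g with | .T i j r => coeff (r + 1) (M i j)) = M := by
  ext i j r
  cases r with
  | zero => rw [coeff_zero_genT, ← c0_apply, h, Matrix.one_apply]
  | succ r => rw [coeff_succ_genT]

/-- The coefficient of `u^{-r} v^{-s}` in the original relation is that of `u^{-r-1} v^{-s-1}` after
multiplication by `u⁻¹ v⁻¹`. The border coefficients are commutators with constant terms and vanish
automatically. -/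
theorem sat_yangianRel_iff (y : YangianGen n → A) : Sat (YangianRel n) y ↔ RTT 1 (genT y) := by
  have hl : ∀ r s i j h k, (FreeAlgebra.lift ℂ y (rttLeft n r s (i, h) (j, k)) =
        FreeAlgebra.lift ℂ y (rttRight n r s (i, h) (j, k))) ↔
      cf (r + 1) s (iu (genT y i j) * iv (genT y h k) - iv (genT y h k) * iu (genT y i j))
        - cf r (s + 1) (iu (genT y i j) * iv (genT y h k) - iv (genT y h k) * iu (genT y i j)) =
      (1 : ℤ) • cf r s (iu (genT y h j) * iv (genT y i k) - iv (genT y h j) * iu (genT y i k)) := by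
    intro r s i j h k
    simp only [rttLeft, rttRight, Matrix.sub_apply, leg₁_mul_leg₂_apply, leg₂_mul_leg₁_apply,
      swapMatrix_mul_apply, mul_swapMatrix_apply, Prod.swap_prod_mk, map_sub, map_mul,
      cf_iu_mul_iv, cf_iv_mul_iu, coeff_genT, one_smul]
    constructor <;> intro h <;> linear_combination (norm := noncomm_ring) h
  constructor
  · intro H i j h k
    rw [kap_mul_eq_lam_mul_iff]
    refine ⟨fun s => ?_, fun r => ?_, fun r s => ?_⟩
    · rw [map_sub, cf_iu_mul_iv, cf_iv_mul_iu, coeff_zero_genT]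
      split_ifs <;> simp
    · rw [map_sub, cf_iu_mul_iv, cf_iv_mul_iu, coeff_zero_genT]
      split_ifs <;> simp
    · exact (hl r s i j h k).1 (H _ _ (YangianRel.rtt r s (i, h) (j, k)))
  · rintro H _ _ ⟨r, s, ⟨i, h⟩, ⟨j, k⟩⟩
    exact (hl r s i j h k).2 (((kap_mul_eq_lam_mul_iff _ _ _).1 (H i j h k)).2.2 r s)

theorem sat_rttRel_iff (y : YangianGen n → A) : Sat (RTTRel n) y ↔ RTT 1 (genT y) := by
  have hl : ∀ i j h k, (∀ r s, FreeAlgebra.lift ℂ y ⁅freeT n r i j, freeT n s h k⁆ =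
      FreeAlgebra.lift ℂ y (∑ t ∈ range (min r s), (freeT n (r + s - 1 - t) i k * freeT n t h j
        - freeT n t i k * freeT n (r + s - 1 - t) h j))) ↔
      kap * (iu (genT y i j) * iv (genT y h k) - iv (genT y h k) * iu (genT y i j)) =
        lam 1 * (iv (genT y i k) * iu (genT y h j) - iu (genT y i k) * iv (genT y h j)) := by
    intro i j h k
    rw [kap_D_D_iff]
    simp only [map_lie_ring, map_sum, map_sub, map_mul, coeff_genT]
  constructor
  · intro H
    exact rtt_of_swapped fun i j h k => (hl i j h k).1 fun r s =>
      H _ _ (RTTRel.comm i j h k r s)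
  · rintro H _ _ ⟨i, j, h, k, r, s⟩
    exact (hl i j h k).2 (H.swapped i j h k) r s

theorem elem_eq : (YangianGen.elem : YangianGen n → Yangian n) =
    fun g => RingQuot.mkAlgHom ℂ (YangianRel n) (FreeAlgebra.ι ℂ g) := by
  funext g; cases g; rfl

theorem genT_elem : genT (YangianGen.elem (n := n)) = Tseries n := by
  ext i j r
  rw [coeff_genT, elem_eq, lift_mk_eq, Tseries, Matrix.of_apply, coeff_mk, T]

theorem c0_Tseries : c0 (Tseries n) = 1 := by rw [← genT_elem, c0_genT]

theorem rtt_Tseries : RTT 1 (Tseries n) := by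
  rw [← genT_elem, ← sat_yangianRel_iff, elem_eq]; exact sat_mk

theorem adjoin_elem : Algebra.adjoin ℂ (Set.range (YangianGen.elem (n := n))) = ⊤ := by
  rw [elem_eq, Set.range_comp' (RingQuot.mkAlgHom ℂ (YangianRel n)) (FreeAlgebra.ι ℂ),
    ← AlgHom.map_adjoin, FreeAlgebra.adjoin_range_ι, Algebra.map_top, AlgHom.range_eq_top]
  exact RingQuot.mkAlgHom_surjective ℂ _

/-- Both sets of relations say that `genT y` satisfies RTT. -/
theorem isPresentation_rttRel :
    IsPresentation (YangianGen.elem (n := n)) (RTTRel n) := by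
  refine isPresentation_of_universal ?_ adjoin_elem fun y hy => ?_
  · rw [sat_rttRel_iff, genT_elem]; exact rtt_Tseries
  · rw [sat_rttRel_iff, ← sat_yangianRel_iff] at hy
    obtain ⟨ψ, hψ⟩ := hy.exists_algHom
    refine ⟨ψ, fun g => ?_⟩
    rw [elem_eq, hψ, FreeAlgebra.lift_ι_apply]

/-- A matrix with constant term one that satisfies the RTT relation is the image of `T(u)` under a
homomorphism. -/
theorem RTT.exists_algHom {M : Matrix (Fin n) (Fin n) (PowerSeries A)} (h0 : c0 M = 1)
    (h : RTT 1 M) : ∃ ψ : Yangian n →ₐ[ℂ] A,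
      (PowerSeries.map (ψ : Yangian n →+* A)).mapMatrix (Tseries n) = M := by
  rw [← genT_coeff h0, ← sat_yangianRel_iff] at h
  obtain ⟨ψ, hψ⟩ := h.exists_algHom
  refine ⟨ψ, ?_⟩
  ext i j r
  rw [RingHom.mapMatrix_apply, Matrix.map_apply, coeff_map, Tseries, Matrix.of_apply, coeff_mk, T]
  refine (hψ _).trans ?_
  rw [← coeff_genT, genT_coeff h0]

end Yangian

/-! ### Generation by the neighbouring blocks -/

section Generation

open Finset

variable {A : Type*} [Ring A] {I : Type*} [Fintype I] [DecidableEq I] {β : I → ℕ}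
  {T D D' E F : ℕ → Matrix I I (PowerSeries A)}

theorem Tower.map {B : Type*} [Ring B] (t : Tower β T D D' E F) (ψ : A →+* B) :
    Tower β (fun k => (PowerSeries.map ψ).mapMatrix (T k))
      (fun k => (PowerSeries.map ψ).mapMatrix (D k)) (fun k => (PowerSeries.map ψ).mapMatrix (D' k))
      (fun k => (PowerSeries.map ψ).mapMatrix (E k))
      (fun k => (PowerSeries.map ψ).mapMatrix (F k)) where
  blocks k := by
    have := TwoBlock.map (t.blocks k) (PowerSeries.map ψ).mapMatrix
    rwa [map_proj, map_proj] at this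
  eq k := by rw [t.eq k, map_gaussProd]

/-- An entry of `E a` in a distant column is a commutator of an entry in the neighbouring block with
a degree-one entry of `E (a + 1)` whose column is one block nearer to its row, so induction on the
distance applies. -/
theorem Tower.coeff_E_mem (t : Tower β T D D' E F) (h0 : c0 (T 0) = 1) (hT : RTT 1 (T 0))
    (hβ : ∀ i l, l ≤ β i → ∃ p, β p = l) {S : Subring A}
    (hS : ∀ a i j r, coeff r (nextBlock β E a i j) ∈ S) (a : ℕ) (i j : I) (r : ℕ) :
    coeff r (E a i j) ∈ S := by
  have key : ∀ m a i j r, β j = a + 1 + m → coeff r (E a i j) ∈ S := by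
    intro m
    induction m with
    | zero =>
      intro a i j r hj
      have := hS a i j r
      rwa [nextBlock_apply, if_pos (by omega)] at this
    | succ m ih =>
      intro a i j r hj
      obtain ⟨p, hp⟩ := hβ j (a + 1) (by omega)
      have := t.lie_E_one_left h0 hT a p j i p hp (by omega) r
      rw [if_pos rfl] at this
      rw [← this, Ring.lie_def]
      have h1 : coeff r (E a i p) ∈ S := by
        have := hS a i p r
        rwa [nextBlock_apply, if_pos hp] at this
      have h2 := ih (a + 1) p j 1 (by omega)
      exact S.sub_mem (S.mul_mem h1 h2) (S.mul_mem h2 h1)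
  by_cases hj : a < β j
  · exact key (β j - (a + 1)) a i j r (by omega)
  · rw [mul_proj_eq_iff.1 (t.blocks a).Eq i j hj, map_zero]
    exact S.zero_mem

theorem coeff_mul_mem {S : Subring A} {M N : Matrix I I (PowerSeries A)}
    (hM : ∀ i j r, coeff r (M i j) ∈ S) (hN : ∀ i j r, coeff r (N i j) ∈ S) (i j : I) (r : ℕ) :
    coeff r ((M * N) i j) ∈ S := by
  rw [Matrix.mul_apply, map_sum]
  refine S.sum_mem fun k _ => ?_
  rw [coeff_mul]
  exact S.sum_mem fun x _ => S.mul_mem (hM _ _ _) (hN _ _ _)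

theorem coeff_proj_mem (S : Subring A) (P : I → Prop) [DecidablePred P] (i j : I) (r : ℕ) :
    coeff r (proj (PowerSeries A) P i j) ∈ S := by
  rw [proj_apply]
  split_ifs
  · rw [coeff_one]
    split_ifs
    exacts [S.one_mem, S.zero_mem]
  · rw [map_zero]; exact S.zero_mem

theorem Tower.coeff_mem (t : Tower β T D D' E F) (h0 : c0 (T 0) = 1) (hT : RTT 1 (T 0))
    (hβ : ∀ i l, l ≤ β i → ∃ p, β p = l) {S : Subring A}
    (hD : ∀ a i j r, coeff r (D a i j) ∈ S)
    (hE : ∀ a i j r, coeff r (nextBlock β E a i j) ∈ S)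
    (hF : ∀ a i j r, coeff r (lowBlock β F a i j) ∈ S) (i j : I) (r : ℕ) :
    coeff r (T 0 i j) ∈ S := by
  have hE' := t.coeff_E_mem h0 hT hβ hE
  have hF' : ∀ a i j r, coeff r (F a i j) ∈ S := by
    intro a i j r
    have := t.op.coeff_E_mem (c0_opM h0) hT.op hβ (S := S.op) (fun a i j r => by
      rw [← opM_lowBlock, opM_apply, coeff_opS, Subring.mem_op, unop_op]; exact hF _ _ _ _) a j i r
    rwa [opM_apply, coeff_opS, Subring.mem_op, unop_op] at this
  obtain ⟨N, hN⟩ : ∃ N, ∀ i, β i < N :=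
    ⟨Finset.univ.sup β + 1, fun i => Nat.lt_succ_of_le (Finset.le_sup (Finset.mem_univ i))⟩
  rw [(t.factorization hN).factor]
  have hs : ∀ X : ℕ → Matrix I I (PowerSeries A), (∀ k i j r, coeff r (X k i j) ∈ S) →
      ∀ i j r, coeff r ((∑ k ∈ range N, X k) i j) ∈ S := fun X hX i j r => by
    rw [Matrix.sum_apply, map_sum]
    exact S.sum_mem fun k _ => hX k i j r
  refine coeff_mul_mem (coeff_mul_mem (hs _ fun k i j r => ?_) (hs _ hD)) (hs _ fun k i j r => ?_)
    i j r
  · rw [Matrix.add_apply, map_add]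
    exact S.add_mem (coeff_proj_mem S _ _ _ _) (hF' _ _ _ _)
  · rw [Matrix.add_apply, map_add]
    exact S.add_mem (coeff_proj_mem S _ _ _ _) (hE' _ _ _ _)

end Generation

/-! ### The parabolic presentation -/

section Parabolic

theorem mul_neg_eq_one_iff {R : Type*} [Ring R] (x y : R) : x * -y = 1 ↔ x * y = -1 := by
  rw [mul_neg, neg_eq_iff_eq_neg]

theorem neg_mul_eq_one_iff {R : Type*} [Ring R] (x y : R) : -x * y = 1 ↔ x * y = -1 := by
  rw [neg_mul, neg_eq_iff_eq_neg]

theorem mul_neg_mul {R : Type*} [Ring R] (x y z : R) : x * -y * z = -(x * y * z) := by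
  rw [mul_neg, neg_mul]

theorem eq_of_mul_eq_neg_one {R : Type*} [Ring R] {x y z : R} (h : y * x = -1) (h' : x * z = -1) :
    y = z := by
  rw [← neg_inj, ← mul_one (-y), neg_mul, ← mul_neg, ← h', ← mul_assoc, h, neg_one_mul]

variable {n : ℕ} {ν : Composition n}

theorem BlockGauss.factorization (G : BlockGauss ν) :
    Factorization (blk ν) (Tseries n) G.F G.D (-G.Dt) G.E where
  F_above i j h := G.F_above i j h
  F_diag i j h := G.F_diag i j (Fin.ext h)
  D_off i j h := G.D_off i j fun h' => h (congrArg Fin.val h')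
  E_below i j h := G.E_below i j h
  E_diag i j h := G.E_diag i j (Fin.ext h)
  mul_inv := (mul_neg_eq_one_iff _ _).2 G.D_mul_Dt
  inv_mul := (neg_mul_eq_one_iff _ _).2 G.Dt_mul_D
  factor := G.factor

/-- The block Gauss factorization given by a factorization of `T(u)`. -/
def Factorization.blockGauss {F D D' E : Matrix (Fin n) (Fin n) (PowerSeries (Yangian n))}
    (h : Factorization (blk ν) (Tseries n) F D D' E) : BlockGauss ν where
  F := F
  D := D
  Dt := -D'
  E := E
  F_above i j hij := h.F_above i j hij
  F_diag i j hij := h.F_diag i j (congrArg Fin.val hij)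
  D_off i j hij := h.D_off i j fun h' => hij (Fin.ext h')
  E_below i j hij := h.E_below i j hij
  E_diag i j hij := h.E_diag i j (congrArg Fin.val hij)
  D_mul_Dt := (mul_neg_eq_one_iff _ _).1 (by rw [neg_neg]; exact h.mul_inv)
  Dt_mul_D := (neg_mul_eq_one_iff _ _).1 (by rw [neg_neg]; exact h.inv_mul)
  factor := h.factor

theorem exists_blockGauss (ν : Composition n) : Nonempty (BlockGauss ν) := by
  obtain ⟨T, D, D', E, F, t, h⟩ := exists_tower (blk ν) (c0_Tseries (n := n))
  exact ⟨(h ▸ t.factorization (N := ν.length) fun i => (ν.index i).2).blockGauss⟩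

/-- Both factorizations give towers with the same first matrix, and towers are determined by it. All
entries of the factors not prescribed by the shape can be read off from the tower. -/
theorem BlockGauss.unique (G G' : BlockGauss ν) : G = G' := by
  obtain ⟨T, h, t⟩ := G.factorization.tower
  obtain ⟨T', h', t'⟩ := G'.factorization.tower
  obtain ⟨hD, -, -, hE, hF⟩ := t.unique t' (h.trans h'.symm)
  have e1 : G.D = G'.D := by
    ext i j : 1
    by_cases hij : blk ν i = blk ν j
    · have := congrFun (congrFun (congrFun hD (blk ν i)) i) j
      simpa only [mul_proj_apply, proj_mul_apply, hij, if_true] using this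
    · rw [G.factorization.D_off i j hij, G'.factorization.D_off i j hij]
  have e2 : G.E = G'.E := by
    ext i j : 1
    rcases lt_trichotomy (blk ν i) (blk ν j) with hij | hij | hij
    · have := congrFun (congrFun (congrFun hE (blk ν i)) i) j
      simpa only [mul_proj_apply, proj_mul_apply, hij, if_true] using this
    · rw [G.factorization.E_diag i j hij, G'.factorization.E_diag i j hij]
    · rw [G.factorization.E_below i j hij, G'.factorization.E_below i j hij]
  have e3 : G.F = G'.F := by
    ext i j : 1
    rcases lt_trichotomy (blk ν i) (blk ν j) with hij | hij | hij
    · rw [G.factorization.F_above i j hij, G'.factorization.F_above i j hij]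
    · rw [G.factorization.F_diag i j hij, G'.factorization.F_diag i j hij]
    · have := congrFun (congrFun (congrFun hF (blk ν j)) i) j
      simpa only [mul_proj_apply, proj_mul_apply, hij, if_true] using this
  have e4 : G.Dt = G'.Dt := by
    have h1 := G.Dt_mul_D
    rw [e1] at h1
    exact eq_of_mul_eq_neg_one h1 G'.D_mul_Dt
  cases G
  cases G'
  simp_all

/-- The factors of the successive two-block factorizations of `T(u)` in terms of the generators. -/
theorem BlockGauss.exists_tower (G : BlockGauss ν) : ∃ T E F, T 0 = Tseries n ∧
    Tower (blk ν) T (fun a => blockMat ν a a fun i j r => G.elem (.D a i j r))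
      (fun a => -blockMat ν a a fun i j r => G.elem (.Dt a i j r)) E F ∧
    nextBlock (blk ν) E = (fun a => blockMat ν a (a + 1) (genE G.elem a)) ∧
    lowBlock (blk ν) F = fun a => blockMat ν (a + 1) a (genF G.elem a) := by
  obtain ⟨T, h, t⟩ := G.factorization.tower
  have h0 : c0 (T 0) = 1 := by rw [h]; exact c0_Tseries
  have hT : RTT 1 (T 0) := by rw [h]; exact rtt_Tseries
  have S := t.parSystem h0 hT
  have hD : (fun a => proj _ (fun i => blk ν i = a) * G.D * proj _ fun i => blk ν i = a) =
      fun a => blockMat ν a a fun i j r => G.elem (.D a i j r) := by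
    funext a
    refine eq_blockMat (fun i j => S.D_left) (fun i j => S.D_right) fun i j r => ?_
    rw [mul_proj_apply, proj_mul_apply, if_pos (blk_pos ν a j), if_pos (blk_pos ν a i)]
    rfl
  have hD' : (fun a => proj _ (fun i => blk ν i = a) * -G.Dt * proj _ fun i => blk ν i = a) =
      fun a => -blockMat ν a a fun i j r => G.elem (.Dt a i j r) := by
    funext a
    refine (mul_neg_mul _ _ _).trans (congrArg Neg.neg ?_)
    refine eq_blockMat (fun i j hi => ?_) (fun i j hj => ?_) fun i j r => ?_
    · rw [mul_assoc, proj_mul_apply, if_neg hi]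
    · rw [mul_proj_apply, if_neg hj]
    · rw [mul_proj_apply, proj_mul_apply, if_pos (blk_pos ν a j), if_pos (blk_pos ν a i)]
      rfl
  rw [hD, hD'] at t
  refine ⟨T, _, _, h, t, funext fun a => ?_, funext fun a => ?_⟩
  · refine eq_blockMat (fun i j => S.E_left) (fun i j => S.E_right) fun i j r => ?_
    cases r with
    | zero => exact S.E_const _ _ _
    | succ r =>
      rw [nextBlock_apply, if_pos (blk_pos ν _ j), mul_proj_apply, proj_mul_apply,
        if_pos (by rw [blk_pos]; omega), if_pos (blk_pos ν a i)]
      rfl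
  · refine eq_blockMat (fun i j => S.F_left) (fun i j => S.F_right) fun i j r => ?_
    cases r with
    | zero => exact S.F_const _ _ _
    | succ r =>
      rw [lowBlock_apply, if_pos (blk_pos ν _ i), mul_proj_apply, proj_mul_apply,
        if_pos (blk_pos ν a j), if_pos (by rw [blk_pos]; omega)]
      rfl

variable {A : Type} [Ring A] [Algebra ℂ A]

theorem genE_zero (y : ParGen ν → A) (a : ℕ) (i : Fin (size ν a)) (j : Fin (size ν (a + 1))) :
    genE y a i j 0 = 0 := rfl

theorem genF_zero (y : ParGen ν → A) (a : ℕ) (i : Fin (size ν (a + 1))) (j : Fin (size ν a)) :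
    genF y a i j 0 = 0 := rfl

theorem BlockGauss.sat_elem (G : BlockGauss ν) : Sat (ParRel ν) G.elem := by
  obtain ⟨T, E, F, h, t, hE, hF⟩ := G.exists_tower
  have S := t.parSystem (by rw [h]; exact c0_Tseries) (by rw [h]; exact rtt_Tseries)
  rw [hE, hF] at S
  exact (S.parCoeff (genE_zero _) (genF_zero _)).sat

theorem coeff_blockMat_mem {B : Type*} [Ring B] {S : Subring B} {a b : ℕ}
    {f : Fin (size ν a) → Fin (size ν b) → ℕ → B} (hf : ∀ i j r, f i j r ∈ S) (i j : Fin n)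
    (r : ℕ) : coeff r (blockMat ν a b f i j) ∈ S := by
  rw [blockMat, Matrix.of_apply]
  split_ifs
  · rw [coeff_mk]; exact hf _ _ _
  · rw [map_zero]; exact S.zero_mem

theorem BlockGauss.adjoin_elem (G : BlockGauss ν) :
    Algebra.adjoin ℂ (Set.range G.elem) = ⊤ := by
  obtain ⟨T, E, F, h, t, hE, hF⟩ := G.exists_tower
  have hG : ∀ g, G.elem g ∈ (Algebra.adjoin ℂ (Set.range G.elem)).toSubring := fun g =>
    Algebra.subset_adjoin ⟨g, rfl⟩
  have key := t.coeff_mem (by rw [h]; exact c0_Tseries) (by rw [h]; exact rtt_Tseries)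
    (exists_blk_eq ν) (S := (Algebra.adjoin ℂ (Set.range G.elem)).toSubring)
    (fun a => coeff_blockMat_mem fun i j r => hG _)
    (fun a => by
      rw [hE]
      refine coeff_blockMat_mem fun i j r => ?_
      cases r
      exacts [Subring.zero_mem _, hG (.E _ _ _ _)])
    (fun a => by
      rw [hF]
      refine coeff_blockMat_mem fun i j r => ?_
      cases r
      exacts [Subring.zero_mem _, hG (.F _ _ _ _)])
  rw [eq_top_iff, ← ParabolicYangian.adjoin_elem, Algebra.adjoin_le_iff]
  rintro _ ⟨⟨i, j, r⟩, rfl⟩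
  have := key i j (r + 1)
  rw [h, ← genT_elem, coeff_succ_genT] at this
  exact this

theorem mapMatrix_nextBlock {I : Type*} [Fintype I] [DecidableEq I] {β : I → ℕ} {A B : Type*}
    [Ring A] [Ring B] (ψ : A →+* B) (E : ℕ → Matrix I I (PowerSeries A)) (a : ℕ) :
    nextBlock β (fun k => (PowerSeries.map ψ).mapMatrix (E k)) a =
      (PowerSeries.map ψ).mapMatrix (nextBlock β E a) := by
  rw [nextBlock, nextBlock, map_mul, map_proj]

theorem mapMatrix_lowBlock {I : Type*} [Fintype I] [DecidableEq I] {β : I → ℕ} {A B : Type*}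
    [Ring A] [Ring B] (ψ : A →+* B) (F : ℕ → Matrix I I (PowerSeries A)) (a : ℕ) :
    lowBlock β (fun k => (PowerSeries.map ψ).mapMatrix (F k)) a =
      (PowerSeries.map ψ).mapMatrix (lowBlock β F a) := by
  rw [lowBlock, lowBlock, map_mul, map_proj]

theorem eq_of_mapMatrix_blockMat {A B : Type*} [Ring A] [Ring B] {ψ : A →+* B} {a b : ℕ}
    {f : Fin (size ν a) → Fin (size ν b) → ℕ → A} {g : Fin (size ν a) → Fin (size ν b) → ℕ → B}
    (h : (PowerSeries.map ψ).mapMatrix (blockMat ν a b f) = blockMat ν a b g)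
    (i : Fin (size ν a)) (j : Fin (size ν b)) (r : ℕ) : ψ (f i j r) = g i j r := by
  have := congrArg (fun M => coeff r (M (pos ν a i) (pos ν b j))) h
  simpa only [RingHom.mapMatrix_apply, Matrix.map_apply, coeff_map, coeff_blockMat] using this

/-- The relations rebuild a matrix over `A` that satisfies RTT, which defines a homomorphism from
the Yangian. It maps the tower of `T(u)` to a tower of the rebuilt matrix, and uniqueness of towers
identifies the images of the Gauss entries with the given elements. -/
theorem BlockGauss.exists_algHom (G : BlockGauss ν) {y : ParGen ν → A} (hy : Sat (ParRel ν) y) :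
    ∃ ψ : Yangian n →ₐ[ℂ] A, ∀ g, ψ (G.elem g) = y g := by
  obtain ⟨T, E, F, h, t, hE, hF⟩ := G.exists_tower
  obtain ⟨T', E', F', t', h0, hT, hE', hF'⟩ :=
    (hy.parCoeff.parSystem (genE_zero y) (genF_zero y)).exists_tower (exists_blk_eq ν)
      add_self_eq_zero_of_complex
  obtain ⟨ψ, hψ⟩ := RTT.exists_algHom h0 hT
  -- The elements `D̃` need no separate treatment: the inverses are part of the tower and so are
  -- determined as well.
  obtain ⟨e1, e2, -, e3, e4⟩ := (t.map (ψ : Yangian n →+* A)).unique t'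
    (by rw [h, hψ])
  refine ⟨ψ, fun g => ?_⟩
  cases g with
  | D a i j r => exact eq_of_mapMatrix_blockMat (congrFun e1 a) i j r
  | Dt a i j r =>
    have := congrFun e2 a
    rw [map_neg, neg_inj] at this
    exact eq_of_mapMatrix_blockMat this i j r
  | E a i j r =>
    have := congrFun (hE' ▸ congrArg (nextBlock (blk ν)) e3) a
    rw [mapMatrix_nextBlock, hE] at this
    exact eq_of_mapMatrix_blockMat this i j (r + 1)
  | F a i j r =>
    have := congrFun (hF' ▸ congrArg (lowBlock (blk ν)) e4) a
    rw [mapMatrix_lowBlock, hF] at this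
    exact eq_of_mapMatrix_blockMat this i j (r + 1)

theorem BlockGauss.isPresentation (G : BlockGauss ν) : IsPresentation G.elem (ParRel ν) :=
  isPresentation_of_universal G.sat_elem G.adjoin_elem fun _ hy => G.exists_algHom hy

theorem BlockGauss.D_single {hn : 0 < n} (G : BlockGauss (Composition.single n hn)) :
    G.D = Tseries n := by
  have hs : ∀ i j, (Composition.single n hn).index i = (Composition.single n hn).index j :=
    fun i j => by
      have h1 := ((Composition.single n hn).index i).2
      have h2 := ((Composition.single n hn).index j).2
      have h3 := Composition.single_length hn
      ext; omega
  have hE : G.E = 1 := by ext i j : 1; rw [G.E_diag i j (hs i j), Matrix.one_apply]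
  have hF : G.F = 1 := by ext i j : 1; rw [G.F_diag i j (hs i j), Matrix.one_apply]
  rw [G.factor, hE, hF, one_mul, mul_one]

end Parabolic

/-! ### Blocks of size one -/

section Drinfeld

open Finset

variable {n : ℕ}

theorem size_ones {a : ℕ} (h : a < n) : size (Composition.ones n) a = 1 := by
  rw [size_of_lt _ (by rwa [Composition.ones_length]), Composition.ones_blocksFun]

theorem lt_of_fin_size_ones {a : ℕ} (i : Fin (size (Composition.ones n) a)) : a < n := by
  have := lt_length_of_fin _ i
  rwa [Composition.ones_length] at this

instance subsingleton_fin_size_ones (a : ℕ) :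
    Subsingleton (Fin (size (Composition.ones n) a)) := by
  refine ⟨fun i j => Fin.ext ?_⟩
  have h1 := i.2
  have h2 := j.2
  have h3 := size_ones (lt_of_fin_size_ones i)
  omega

/-- The index of the block `a` of size one. -/
def onesIndex {a : ℕ} (h : a < n) : Fin (size (Composition.ones n) a) :=
  ⟨0, by rw [size_ones h]; exact one_pos⟩

theorem pos_ones {a : ℕ} (i : Fin (size (Composition.ones n) a)) :
    pos (Composition.ones n) a i = ⟨a, lt_of_fin_size_ones i⟩ := by
  have h1 := i.2
  have h2 := size_ones (lt_of_fin_size_ones i)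
  have h3 := lt_of_fin_size_ones i
  ext
  simp only [pos, Composition.ones_sizeUpTo]
  omega

/-- The correspondence of the generators when all blocks have size one. -/
def toDrin : ParGen (Composition.ones n) → DrinGen n
  | .D a i _ r => .D a (lt_of_fin_size_ones i) r
  | .Dt a i _ r => .Dt a (lt_of_fin_size_ones i) r
  | .E a _ j r => .E a (lt_of_fin_size_ones j) r
  | .F a i _ r => .F a (lt_of_fin_size_ones i) r

theorem toDrin_surjective : Function.Surjective (toDrin (n := n)) := by
  rintro (⟨i, hi, r⟩ | ⟨i, hi, r⟩ | ⟨i, hi, r⟩ | ⟨i, hi, r⟩)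
  · exact ⟨.D i (onesIndex hi) (onesIndex hi) r, rfl⟩
  · exact ⟨.Dt i (onesIndex hi) (onesIndex hi) r, rfl⟩
  · exact ⟨.E i (onesIndex (Nat.lt_of_succ_lt hi)) (onesIndex hi) r, rfl⟩
  · exact ⟨.F i (onesIndex hi) (onesIndex (Nat.lt_of_succ_lt hi)) r, rfl⟩

theorem BlockGauss.drinElem_toDrin (G : BlockGauss (Composition.ones n))
    (g : ParGen (Composition.ones n)) : G.drinElem (toDrin g) = G.elem g := by
  cases g <;> simp only [toDrin, BlockGauss.drinElem, BlockGauss.elem, pos_ones]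

variable {A : Type} [Ring A] [Algebra ℂ A] (y : DrinGen n → A)

theorem lift_toDrin_pD (a : ℕ) (i j : Fin (size (Composition.ones n) a)) (r : ℕ) :
    FreeAlgebra.lift ℂ (y ∘ toDrin) (pD a i j r) =
      FreeAlgebra.lift ℂ y (dD a (lt_of_fin_size_ones i) r) := by
  rw [pD, dD, FreeAlgebra.lift_ι_apply, FreeAlgebra.lift_ι_apply]; rfl

theorem lift_toDrin_pDt (a : ℕ) (i j : Fin (size (Composition.ones n) a)) (r : ℕ) :
    FreeAlgebra.lift ℂ (y ∘ toDrin) (pDt a i j r) =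
      FreeAlgebra.lift ℂ y (dDt a (lt_of_fin_size_ones i) r) := by
  rw [pDt, dDt, FreeAlgebra.lift_ι_apply, FreeAlgebra.lift_ι_apply]; rfl

theorem lift_toDrin_pE (a : ℕ) (i : Fin (size (Composition.ones n) a))
    (j : Fin (size (Composition.ones n) (a + 1))) (r : ℕ) :
    FreeAlgebra.lift ℂ (y ∘ toDrin) (pE a i j r) =
      FreeAlgebra.lift ℂ y (dE a (lt_of_fin_size_ones j) r) := by
  cases r with
  | zero => rw [pE, dE, map_zero, map_zero]
  | succ r => rw [pE, dE, FreeAlgebra.lift_ι_apply, FreeAlgebra.lift_ι_apply]; rfl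

theorem lift_toDrin_pF (a : ℕ) (i : Fin (size (Composition.ones n) (a + 1)))
    (j : Fin (size (Composition.ones n) a)) (r : ℕ) :
    FreeAlgebra.lift ℂ (y ∘ toDrin) (pF a i j r) =
      FreeAlgebra.lift ℂ y (dF a (lt_of_fin_size_ones i) r) := by
  cases r with
  | zero => rw [pF, dF, map_zero, map_zero]
  | succ r => rw [pF, dF, FreeAlgebra.lift_ι_apply, FreeAlgebra.lift_ι_apply]; rfl

/-- Elements with the commutators of the entry of a matrix of size one commute. -/
theorem lie_eq_zero_of_rtt {B : Type*} [Ring B] {d : ℕ → B}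
    (h : ∀ r s, ⁅d r, d s⁆ = ∑ t ∈ range (min r s),
      (d (r + s - 1 - t) * d t - d t * d (r + s - 1 - t))) (r s : ℕ) : ⁅d r, d s⁆ = 0 := by
  -- For a single entry each summand is itself a commutator, with one index `t` smaller than both
  -- `r` and `s`, so strong induction on the minimum applies.
  have key : ∀ m r s, min r s ≤ m → ⁅d r, d s⁆ = 0 := by
    intro m
    induction m using Nat.strong_induction_on with
    | _ m ih =>
      intro r s hrs
      rw [h]
      refine sum_eq_zero fun t ht => ?_
      have := mem_range.1 ht
      exact ih t (by omega) _ _ (min_le_right _ _)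
  exact key _ r s le_rfl

theorem sum_fin_size_ones {B : Type*} [AddCommMonoid B] {a : ℕ}
    (f : Fin (size (Composition.ones n) a) → B) (h : a < n) : ∑ p, f p = f (onesIndex h) :=
  Fintype.sum_subsingleton f (onesIndex h)

variable {y}

attribute [local simp] lift_toDrin_pD lift_toDrin_pDt lift_toDrin_pE lift_toDrin_pF

theorem sat_toDrin_of_sat (H : Sat (DrinRel n) y) :
    Sat (ParRel (Composition.ones n)) (y ∘ toDrin) := by
  have H' : ∀ {u v}, DrinRel n u v → FreeAlgebra.lift ℂ y u = FreeAlgebra.lift ℂ y v :=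
    fun {u v} h => H u v h
  intro u v huv
  cases huv with
  | D_zero a i j =>
    have hi := lt_of_fin_size_ones i
    have := H' (DrinRel.D_zero a hi)
    rw [if_pos (Subsingleton.elim _ _)]
    simpa using this
  | D_Dt a i j r =>
    have hi := lt_of_fin_size_ones i
    have := H' (DrinRel.D_Dt a hi r)
    simp only [sum_fin_size_ones _ hi, Subsingleton.elim i j, and_true]
    simpa [apply_ite (FreeAlgebra.lift ℂ y), apply_ite (FreeAlgebra.lift ℂ (y ∘ toDrin))] using this
  | D_D_same a i j h k r s =>
    have hi := lt_of_fin_size_ones i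
    have := fun r s => H' (DrinRel.D_D a a hi hi r s)
    simp only [map_lie_ring, map_sum, map_mul, map_sub, map_zero, lift_toDrin_pD] at this ⊢
    rw [this]
    exact (sum_eq_zero fun t _ => this _ _).symm
  | D_D_ne a b hab i j h k r s =>
    have := H' (DrinRel.D_D a b (lt_of_fin_size_ones i) (lt_of_fin_size_ones h) r s)
    simpa using this
  | E_F_same a i j h k r s hr hs =>
    have := H' (DrinRel.E_F a a (lt_of_fin_size_ones j) (lt_of_fin_size_ones j) r s hr hs)
    rw [if_pos rfl] at this
    simpa using this
  | E_F_ne a b hab i j h k r s hr hs =>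
    have := H' (DrinRel.E_F a b (lt_of_fin_size_ones j) (lt_of_fin_size_ones h) r s hr hs)
    rw [if_neg hab] at this
    simpa using this
  | D_E_same a i j h k r s hs =>
    have hi := lt_of_fin_size_ones i
    have := H' (DrinRel.D_E a a hi (lt_of_fin_size_ones k) r s hs)
    rw [if_pos rfl, if_neg (by omega), sub_zero, one_mul] at this
    rw [if_pos (Subsingleton.elim _ _)]
    simp only [sum_fin_size_ones _ hi]
    simpa using this
  | D_E_succ b i j h k r s hs =>
    have hi := lt_of_fin_size_ones i
    have := H' (DrinRel.D_E (b + 1) b hi hi r s hs)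
    rw [if_neg (by omega), if_pos rfl, zero_sub, neg_one_mul] at this
    simpa using this
  | D_E_ne a b hab hab' i j h k r s hs =>
    have := H' (DrinRel.D_E a b (lt_of_fin_size_ones i) (lt_of_fin_size_ones k) r s hs)
    rw [if_neg hab, if_neg hab', sub_zero, zero_mul] at this
    simpa using this
  | D_F_succ b i j h k r s hs =>
    have hi := lt_of_fin_size_ones i
    have := H' (DrinRel.D_F (b + 1) b hi hi r s hs)
    rw [if_pos rfl, if_neg (by omega), sub_zero, one_mul] at this
    simpa using this
  | D_F_same a i j h k r s hs =>
    have hi := lt_of_fin_size_ones i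
    have := H' (DrinRel.D_F a a hi (lt_of_fin_size_ones h) r s hs)
    rw [if_neg (by omega), if_pos rfl, zero_sub, neg_one_mul] at this
    rw [if_pos (Subsingleton.elim _ _)]
    simp only [sum_fin_size_ones _ hi]
    simpa using this
  | D_F_ne a b hab hab' i j h k r s hs =>
    have := H' (DrinRel.D_F a b (lt_of_fin_size_ones i) (lt_of_fin_size_ones h) r s hs)
    rw [if_neg hab', if_neg hab, sub_zero, zero_mul] at this
    simpa using this
  | E_E_same a i h j k r s hr hs =>
    have := H' (DrinRel.E_E_same a (lt_of_fin_size_ones j) r s hr hs)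
    simpa using this
  | F_F_same a i h j k r s hr hs =>
    have := H' (DrinRel.F_F_same a (lt_of_fin_size_ones i) r s hr hs)
    simpa using this
  | E_E_succ a i j h k r s hr hs =>
    have hj := lt_of_fin_size_ones j
    have := H' (DrinRel.E_E_succ a hj (lt_of_fin_size_ones k) r s hr hs)
    rw [if_pos (Subsingleton.elim _ _)]
    simp only [sum_fin_size_ones _ hj]
    simpa using this
  | F_F_succ a i k j h r s hr hs =>
    have hi := lt_of_fin_size_ones i
    have := H' (DrinRel.F_F_succ a hi (lt_of_fin_size_ones h) r s hr hs)
    rw [if_pos (Subsingleton.elim _ _)]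
    simp only [sum_fin_size_ones _ hi]
    simpa using this
  | E_E_far a b hab i j h k r s hr hs =>
    have := H' (DrinRel.E_E_far a b (.inl hab) (lt_of_fin_size_ones j) (lt_of_fin_size_ones k)
      r s hr hs)
    simpa using this
  | E_E_succ_ne a i j h hhj => exact absurd (Subsingleton.elim _ _) hhj
  | F_F_far a b hab i j h k r s hr hs =>
    have := H' (DrinRel.F_F_far a b (.inl hab) (lt_of_fin_size_ones i) (lt_of_fin_size_ones h)
      r s hr hs)
    simpa using this
  | F_F_succ_ne a i k hik => exact absurd (Subsingleton.elim _ _) hik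
  | E_serre a b hab i h j k f g r s t hr hs ht =>
    have := H' (DrinRel.E_serre a b hab (lt_of_fin_size_ones j) (lt_of_fin_size_ones g)
      r s t hr hs ht)
    simpa using this
  | F_serre a b hab i h j k f g r s t hr hs ht =>
    have := H' (DrinRel.F_serre a b hab (lt_of_fin_size_ones i) (lt_of_fin_size_ones f)
      r s t hr hs ht)
    simpa using this

/-- Most relations are translated one by one. Two need more: the coefficients of one `D i` commute
by `lie_eq_zero_of_rtt`, and the far relations with the larger index first follow by antisymmetry.
-/
theorem sat_of_sat_toDrin (H : Sat (ParRel (Composition.ones n)) (y ∘ toDrin)) :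
    Sat (DrinRel n) y := by
  have H' : ∀ {u v}, ParRel (Composition.ones n) u v →
      FreeAlgebra.lift ℂ (y ∘ toDrin) u = FreeAlgebra.lift ℂ (y ∘ toDrin) v :=
    fun {u v} h => H u v h
  intro u v huv
  cases huv with
  | D_zero i hi =>
    have := H' (ParRel.D_zero i (onesIndex hi) (onesIndex hi))
    rw [if_pos rfl] at this
    simpa using this
  | D_Dt i hi r =>
    have := H' (ParRel.D_Dt i (onesIndex hi) (onesIndex hi) r)
    simp only [sum_fin_size_ones _ hi, and_true] at this
    simpa [apply_ite (FreeAlgebra.lift ℂ y), apply_ite (FreeAlgebra.lift ℂ (y ∘ toDrin))] using this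
  | D_D i j hi hj r s =>
    by_cases hij : i = j
    · subst hij
      have := fun r s => H' (ParRel.D_D_same i (onesIndex hi) (onesIndex hi) (onesIndex hi)
        (onesIndex hi) r s)
      simp only [map_lie_ring, map_sum, map_mul, map_sub, map_zero, lift_toDrin_pD] at this ⊢
      exact lie_eq_zero_of_rtt (d := fun r => FreeAlgebra.lift ℂ y (dD i hi r)) this r s
    · have := H' (ParRel.D_D_ne i j hij (onesIndex hi) (onesIndex hi) (onesIndex hj)
        (onesIndex hj) r s)
      simpa using this
  | E_F i j hi hj r s hr hs =>
    have hi' := Nat.lt_of_succ_lt hi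
    have hj' := Nat.lt_of_succ_lt hj
    split_ifs with hij
    · subst hij
      have := H' (ParRel.E_F_same i (onesIndex hi') (onesIndex hi) (onesIndex hi) (onesIndex hi')
        r s hr hs)
      simpa using this
    · have := H' (ParRel.E_F_ne i j hij (onesIndex hi') (onesIndex hi) (onesIndex hj)
        (onesIndex hj') r s hr hs)
      simpa using this
  | D_E i j hi hj r s hs =>
    have hj' := Nat.lt_of_succ_lt hj
    by_cases hij : i = j
    · subst hij
      have := H' (ParRel.D_E_same i (onesIndex hi) (onesIndex hi) (onesIndex hi) (onesIndex hj)
        r s hs)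
      rw [if_pos rfl] at this
      rw [if_pos rfl, if_neg (by omega), sub_zero, one_mul]
      simp only [sum_fin_size_ones _ hi] at this
      simpa using this
    by_cases hij' : i = j + 1
    · subst hij'
      have := H' (ParRel.D_E_succ j (onesIndex hi) (onesIndex hi) (onesIndex hj') (onesIndex hi)
        r s hs)
      rw [if_neg hij, if_pos rfl, zero_sub, neg_one_mul]
      simpa using this
    · have := H' (ParRel.D_E_ne i j hij hij' (onesIndex hi) (onesIndex hi) (onesIndex hj')
        (onesIndex hj) r s hs)
      rw [if_neg hij, if_neg hij', sub_zero, zero_mul]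
      simpa using this
  | D_F i j hi hj r s hs =>
    have hj' := Nat.lt_of_succ_lt hj
    by_cases hij : i = j
    · subst hij
      have := H' (ParRel.D_F_same i (onesIndex hi) (onesIndex hi) (onesIndex hj) (onesIndex hi)
        r s hs)
      rw [if_pos rfl] at this
      rw [if_neg (by omega), if_pos rfl, zero_sub, neg_one_mul]
      simp only [sum_fin_size_ones _ hi] at this
      simpa using this
    by_cases hij' : i = j + 1
    · subst hij'
      have := H' (ParRel.D_F_succ j (onesIndex hi) (onesIndex hi) (onesIndex hi) (onesIndex hj')
        r s hs)
      rw [if_pos rfl, if_neg hij, sub_zero, one_mul]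
      simpa using this
    · have := H' (ParRel.D_F_ne i j hij hij' (onesIndex hi) (onesIndex hi) (onesIndex hj)
        (onesIndex hj') r s hs)
      rw [if_neg hij', if_neg hij, sub_zero, zero_mul]
      simpa using this
  | E_E_same i hi r s hr hs =>
    have hi' := Nat.lt_of_succ_lt hi
    have := H' (ParRel.E_E_same i (onesIndex hi') (onesIndex hi') (onesIndex hi) (onesIndex hi)
      r s hr hs)
    simpa using this
  | F_F_same i hi r s hr hs =>
    have hi' := Nat.lt_of_succ_lt hi
    have := H' (ParRel.F_F_same i (onesIndex hi) (onesIndex hi) (onesIndex hi') (onesIndex hi')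
      r s hr hs)
    simpa using this
  | E_E_succ i hi hi' r s hr hs =>
    have := H' (ParRel.E_E_succ i (onesIndex (Nat.lt_of_succ_lt hi)) (onesIndex hi) (onesIndex hi)
      (onesIndex hi') r s hr hs)
    rw [if_pos rfl] at this
    simp only [sum_fin_size_ones _ hi] at this
    simpa using this
  | F_F_succ i hi hi' r s hr hs =>
    have := H' (ParRel.F_F_succ i (onesIndex hi) (onesIndex hi) (onesIndex (Nat.lt_of_succ_lt hi))
      (onesIndex hi') r s hr hs)
    rw [if_pos rfl] at this
    simp only [sum_fin_size_ones _ hi] at this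
    simpa using this
  | E_E_far i j hij hi hj r s hr hs =>
    have hi' := Nat.lt_of_succ_lt hi
    have hj' := Nat.lt_of_succ_lt hj
    rcases hij with hij | hij
    · have := H' (ParRel.E_E_far i j hij (onesIndex hi') (onesIndex hi) (onesIndex hj')
        (onesIndex hj) r s hr hs)
      simpa using this
    · have := H' (ParRel.E_E_far j i hij (onesIndex hj') (onesIndex hj) (onesIndex hi')
        (onesIndex hi) s r hs hr)
      simp at this ⊢
      rw [Ring.lie_def] at this ⊢
      rw [← neg_sub, this, neg_zero]
  | F_F_far i j hij hi hj r s hr hs =>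
    have hi' := Nat.lt_of_succ_lt hi
    have hj' := Nat.lt_of_succ_lt hj
    rcases hij with hij | hij
    · have := H' (ParRel.F_F_far i j hij (onesIndex hi) (onesIndex hi') (onesIndex hj)
        (onesIndex hj') r s hr hs)
      simpa using this
    · have := H' (ParRel.F_F_far j i hij (onesIndex hj) (onesIndex hj') (onesIndex hi)
        (onesIndex hi') s r hs hr)
      simp at this ⊢
      rw [Ring.lie_def] at this ⊢
      rw [← neg_sub, this, neg_zero]
  | E_serre i j hij hi hj r s t hr hs ht =>
    have hi' := Nat.lt_of_succ_lt hi
    have hj' := Nat.lt_of_succ_lt hj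
    have := H' (ParRel.E_serre i j hij (onesIndex hi') (onesIndex hi') (onesIndex hi)
      (onesIndex hi) (onesIndex hj') (onesIndex hj) r s t hr hs ht)
    simpa using this
  | F_serre i j hij hi hj r s t hr hs ht =>
    have hi' := Nat.lt_of_succ_lt hi
    have hj' := Nat.lt_of_succ_lt hj
    have := H' (ParRel.F_serre i j hij (onesIndex hi) (onesIndex hi) (onesIndex hi')
      (onesIndex hi') (onesIndex hj) (onesIndex hj') r s t hr hs ht)
    simpa using this

theorem BlockGauss.isPresentation_drin (G : BlockGauss (Composition.ones n)) :
    IsPresentation G.drinElem (DrinRel n) := by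
  have hG : G.drinElem ∘ toDrin = G.elem := funext G.drinElem_toDrin
  refine isPresentation_of_universal ?_ ?_ fun y hy => ?_
  · apply sat_of_sat_toDrin
    rw [hG]
    exact G.sat_elem
  · rw [← toDrin_surjective.range_comp, hG]
    exact G.adjoin_elem
  · obtain ⟨ψ, hψ⟩ := G.exists_algHom (sat_toDrin_of_sat hy)
    refine ⟨ψ, fun g => ?_⟩
    obtain ⟨g, rfl⟩ := toDrin_surjective g
    rw [G.drinElem_toDrin, hψ, Function.comp_apply]

end Drinfeld

end ParabolicYangian

theorem theoremA (n : ℕ) :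
    (∀ ν : Composition n, ∃ G : ParabolicYangian.BlockGauss ν,
      (∀ G' : ParabolicYangian.BlockGauss ν, G' = G) ∧
      ParabolicYangian.IsPresentation G.elem (ParabolicYangian.ParRel ν)) ∧
    (∀ hn : 0 < n,
      (∀ G : ParabolicYangian.BlockGauss (Composition.single n hn),
        G.D = ParabolicYangian.Tseries n) ∧
      ParabolicYangian.IsPresentation (ParabolicYangian.YangianGen.elem (n := n))
        (ParabolicYangian.RTTRel n)) ∧
    (∀ G : ParabolicYangian.BlockGauss (Composition.ones n),
      ParabolicYangian.IsPresentation G.drinElem (ParabolicYangian.DrinRel n)) := by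
  refine ⟨fun ν => ?_, fun hn => ⟨fun G => G.D_single, ParabolicYangian.isPresentation_rttRel⟩,
    fun G => G.isPresentation_drin⟩
  obtain ⟨G⟩ := ParabolicYangian.exists_blockGauss ν
  exact ⟨G, fun G' => G'.unique G, G.isPresentation⟩
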